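/- **Setting.** A string over an ordered alphabet $\Sigma$ is a finite word followed by an end-of-string character that is smaller than every letter and counts towards the length. Let $\mathcal C=\{S_1,\dots,S_m\}$ be an indexed collection of strings (repetitions allowed) of total length $N=\sum_d|S_d|$, and let $R$ be a reference string of length $n$. The end-of-string character $\#$ of $R$ is smaller than those of the $S_d$; inside the algorithm the latter are ordered by document, $\#<\$_1<\dots<\$_m<\Sigma$, which realizes the tie-breaking below. The generalized suffix array (GSA) of $\mathcal C$ is the list of all pairs $(d,j)$, $1\le d\le m$, $1\le j\le|S_d|$, each once, in lexicographic order of the suffixes $S_d[j..]$, equal suffixes being ordered by $d$. **Notation.** After augmenting $R$ as in Phase 1, let $SA$, $ISA$, $LCP$ be its suffix array, inverse suffix array and LCP array. For a position $i$ of a string $S$ of $\mathcal C$ let $U$ be the longest prefix of $S[i..]$ that occurs in $R$, $\ell_i=|U|$, and $c_i$ the character following it (the mismatch character). The insert point $ip(i)$ is $1$ if $U$ is empty; otherwise the largest $k$ such that $U$ is a prefix of $R[SA[k]..]$ and $R[SA[k]..]<Uc_i$, if there is one, and the smallest $k$ such that $U$ is a prefix of $R[SA[k]..]$, if not. Let $q_i=SA[ip(i)]$,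 let $x_i\in\{\mathrm S,\mathrm L\}$ say whether $Uc_i$ is smaller or greater than $R[q_i..]$, and put $ems(i)=(q_i,\ell_i,x_i,c_i)$. Position $i$ is an insert-head if it is the first position of its string or $q_i\ne q_{i-1}+1$. Suffixes with the same insert point are compared by $(\ell,x,c)$ as follows: $\mathrm S$ before $\mathrm L$; among $\mathrm S$ the smaller $\ell$ first, among $\mathrm L$ the larger $\ell$ first; then by $c$. A suffix $S[i..]$ is of type S if $S[i..]<S[i+1..]$, of type L if $S[i..]>S[i+1..]$; a suffix consisting of an end-of-string character only has type S. An $S^*$-suffix is a type-S suffix preceded in its string by a type-L suffix, or a suffix consisting of an end-of-string character only. **Algorithm 1** (input $\mathcal C,R$). 1. Rename the characters by rank. For every letter $c$ of $\mathcal C$ not occurring in $R$ append $c^{k}$ to $R$ (before $\#$), $k$ being the length of the longest run of $c$ in $\mathcal C$. Compute $SA$ and $ISA$ (prefix doubling with bucket sort), the permuted LCP array, $LCP$, and a range-minimum structure on $LCP$ that answers, for a threshold $v$, previous/next-smaller-value queries (nearest entry $<v$). 2. Compute the enhanced compressed matching statistics from left to right, storing $(i,ems(i))$ at the insert-heads $i$.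 The suffix-array interval of the current matching factor is updated by right extensions (binary search) and left contractions (by $ISA[SA[\cdot]+1]$ and previous/next-smaller-value queries on $LCP$ with threshold the length of the contracted factor). 3. Find the $S^*$-suffixes by a backward scan, recover their $ems$ from the insert-head to their left, and bucket them by insert point. 4. Bucket the insert-heads by insert point, sort each bucket by $(\ell,x,c)$, replace each insert-head $j$ by the rank of its metacharacter $S_d[j..j+\ell_j]$, and compute the suffix array of the string formed by these ranks in text order. This gives the rank of each insert-head suffix. 5. Sort each bucket of Phase 3 by comparison (merge sort) with respect to $(\ell,x,c)$, ties being broken by the rank of the first insert-head to the right of the start of the suffix. 6. Put the sorted $S^*$-suffixes at the right ends of their first-character buckets, induce the L-suffixes by a left-to-right scan and the S-suffixes by a right-to-left scan, and output the pairs $(d,j)$. The machine is a unit-cost random access machine: each array read, array write, addition, (truncated) subtraction, halving and comparison of words, and each loop iteration, takes one step; there is no multiplication. The alphabet is $\Sigma=\mathbb N$, of which finitely many letters occur in any input. **Proposition.** (a) For every collection $\mathcal C$ and every reference $R$, Algorithm 1 outputs the generalized suffix array of $\mathcal C$. (b) If the length of the reference is at most linear in the total length of the collection, the worst-case running time is $O(N\log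 N)$: for every $K\in\mathbb N$ there is a constant $c$ such that, for all $\mathcal C$ and $R$ with $N\ge2$ and $n\le KN$, Algorithm 1 takes at most $c\,N\log N$ steps. The constant depends on $K$ only, in particular not on the alphabet, the number of strings, or their similarity to $R$. -/

import Mathlib

namespace SuffixSorting

/-! ## Strings, collections, and the generalized suffix array

Letters are natural numbers with their usual order. A string is given by its letters; the
end-of-string character, smaller than every letter, is appended by `terminated`. -/

/-- The string with letters `s`, followed by its end-of-string character `⊥`. -/
def terminated (s : List ℕ) : List (WithBot ℕ) :=
  s.map (fun a => (a : WithBot ℕ)) ++ [⊥]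

/-- Total length of a collection, end-of-string characters included. -/
def totalLength (C : List (List ℕ)) : ℕ :=
  (C.map (fun s => (terminated s).length)).sum

/-- The `d`-th string of the collection (`d` starts at `1`). -/
def doc (C : List (List ℕ)) (d : ℕ) : List (WithBot ℕ) :=
  terminated (C.getD (d - 1) [])

/-- The `j`-th suffix of the `d`-th string (`d` and `j` start at `1`). -/
def suffix (C : List (List ℕ)) (p : ℕ × ℕ) : List (WithBot ℕ) :=
  (doc C p.1).drop (p.2 - 1)

/-- `p = (d, j)` is the index of a suffix of the collection. -/
def IsSuffixIndex (C : List (List ℕ)) (p : ℕ × ℕ) : Prop :=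
  1 ≤ p.1 ∧ p.1 ≤ C.length ∧ 1 ≤ p.2 ∧ p.2 ≤ (doc C p.1).length

/-- `G` is the generalized suffix array of `C`: it lists the indices of all suffixes, each of them
once, in lexicographic order of the suffixes, equal suffixes being ordered by document index. -/
structure IsGSA (C : List (List ℕ)) (G : List (ℕ × ℕ)) : Prop where
  mem_iff : ∀ p, p ∈ G ↔ IsSuffixIndex C p
  sorted : G.Pairwise (fun p q =>
    suffix C p < suffix C q ∨ (suffix C p = suffix C q ∧ p.1 < q.1))

/-! ## The machine: a unit-cost random access machine

Programs work on machine words, which are held in finitely many registers (the local variables of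
a program) and in a fixed finite family of arrays. The only operations on words are the
primitives below, and each of them takes one unit of time. Each iteration of a loop takes one more
unit in addition to the cost of its body. There is no multiplication. Numerals are immediate
operands; results of comparisons (`Bool`, `Ordering`) only steer the control flow. -/

/-- Machine words. -/
structure Word where
  val : ℕ

instance (n : ℕ) : OfNat Word n := ⟨⟨n⟩⟩

/-- Names of the arrays. -/
inductive Arr
  -- input: the collection, the reference, and their lengths
  | inColl | inRef | inSize
  -- text of the collection, with document number and position in the document
  | txt | docNo | docPos
  -- alphabet renaming
  | raw | rawOrd | rawRank
  -- reference, and data for its augmentation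
  | ref | seen | runLen
  -- index structures of the reference
  | saR | isaR | phi | plcp | lcp | rmq
  -- insert-heads: position and entries of the enhanced matching statistics
  | hPos | hQ | hLen | hX | hC
  -- insert-heads: insert point, list, buckets, metacharacters, suffix array and ranks
  | hIp | hList | hSorted | hEnd | metaStr | saM | hRank
  -- suffix types
  | typ
  -- S*-suffixes: position, enhanced matching statistics, rank of next insert-head, list, buckets
  | sPos | sIp | sLen | sX | sC | sNext | sList | sSorted | sEnd
  -- inducing
  | bStart | bPtr | gsa
  -- scratch space
  | tmp | ord | cnt
  -- output
  | outDoc | outPos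
  deriving DecidableEq

/-- A machine state: the contents of the arrays and the time used so far. -/
structure Machine where
  mem : Arr → ℕ → Word
  time : ℕ

/-- Programs with result in `α`. -/
abbrev RAM (α : Type) : Type := StateM Machine α

/-- Spend one unit of time. -/
def tick : RAM Unit := modify fun M => { M with time := M.time + 1 }

def add (x y : Word) : RAM Word := do tick; pure ⟨x.val + y.val⟩

/-- Subtraction, truncated at `0`. -/
def sub (x y : Word) : RAM Word := do tick; pure ⟨x.val - y.val⟩

/-- Shift to the right by one bit. -/
def half (x : Word) : RAM Word := do tick; pure ⟨x.val / 2⟩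

def lt (x y : Word) : RAM Bool := do tick; pure (decide (x.val < y.val))

def le (x y : Word) : RAM Bool := do tick; pure (decide (x.val ≤ y.val))

def eq (x y : Word) : RAM Bool := do tick; pure (decide (x.val = y.val))

def read (a : Arr) (i : Word) : RAM Word := do tick; return (← get).mem a i.val

def write (a : Arr) (i v : Word) : RAM Unit := do
  tick
  modify fun M => { M with mem := Function.update M.mem a (Function.update (M.mem a) i.val v) }

def forAux {σ : Type} (body : Word → σ → RAM σ) : ℕ → σ → RAM σ
  | 0, s => do tick; pure s
  | k + 1, s => do
    let s ← forAux body k s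
    tick
    body ⟨k⟩ s

/-- `for i = 0, …, k - 1 do s := body i s`. -/
def forLoop {σ : Type} (k : Word) (s : σ) (body : Word → σ → RAM σ) : RAM σ :=
  forAux body k.val s

def whileAux {σ : Type} (test : σ → RAM Bool) (body : σ → RAM σ) : ℕ → σ → RAM σ
  | 0, s => do tick; pure s
  | k + 1, s => do
    tick
    if (← test s) then
      let s ← body s
      whileAux test body k s
    else
      pure s

/-- `while test s do s := body s`, left after at most `k` iterations. -/
def whileLoop {σ : Type} (k : Word) (s : σ) (test : σ → RAM Bool) (body : σ → RAM σ) : RAM σ :=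
  whileAux test body k.val s

/-- `for i = 0, …, k - 1 do body i`. -/
def forEach (k : Word) (body : Word → RAM Unit) : RAM Unit :=
  forLoop k () fun i _ => body i

/-- `for i = k - 1, …, 0 do body i`. -/
def forDown (k : Word) (body : Word → RAM Unit) : RAM Unit :=
  forEach k fun t => do body (← sub (← sub k t) 1)

/-! ## General subroutines -/

/-- The first `j` in `[lo, hi)` at which `pred` fails, and `hi` if there is none; `pred` is
assumed to be monotone (first true, then false). Binary search. -/
def binarySearch (pred : Word → RAM Bool) (lo hi : Word) : RAM Word := do
  let r ← whileLoop (← sub hi lo) (lo, hi) (fun s => lt s.1 s.2) fun s => do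
    let mid ← half (← add s.1 s.2)
    if (← pred mid) then
      return (← add mid 1, s.2)
    else
      return (s.1, mid)
  return r.1

/-- Merge the sorted runs `a[l, m)` and `a[m, r)` into `tmp[l, r)`. -/
def mergeRuns (leq : Word → Word → RAM Bool) (a : Arr) (l m r : Word) : RAM Unit := do
  let _ ← forLoop (← sub r l) (l, m) fun t s => do
    let k ← add l t
    let left ←
      if (← lt s.1 m) then
        if (← lt s.2 r) then leq (← read a s.1) (← read a s.2) else pure true
      else pure false
    if left then
      write .tmp k (← read a s.1)
      return (← add s.1 1, s.2)
    else
      write .tmp k (← read a s.2)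
      return (s.1, ← add s.2 1)

def minWord (x y : Word) : RAM Word := do
  if (← le x y) then pure x else pure y

/-- Bottom-up merge sort of the segment `a[lo, hi)` with respect to `leq`. -/
def mergeSort (leq : Word → Word → RAM Bool) (a : Arr) (lo hi : Word) : RAM Unit := do
  let len ← sub hi lo
  let _ ← whileLoop len (1 : Word) (fun w => lt w len) fun w => do
    let _ ← whileLoop len lo (fun i => lt i hi) fun i => do
      let m ← minWord (← add i w) hi
      let r ← minWord (← add m w) hi
      mergeRuns leq a i m r
      return r
    forEach len fun t => do
      let k ← add lo t
      write a k (← read .tmp k)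
    add w w

/-- Stable bucket sort of `src[0, len)` into `dst[0, len)` by the keys `key x < numKeys`.
In the end `ends[c]` is the right end (exclusive) of bucket `c` in `dst`. -/
def bucketSort (key : Word → RAM Word) (src dst ends : Arr) (len numKeys : Word) : RAM Unit := do
  forEach (← add numKeys 1) fun c => write ends c 0
  forEach len fun i => do
    let c ← add (← key (← read src i)) 1
    write ends c (← add (← read ends c) 1)
  forEach numKeys fun c => do
    let c' ← add c 1
    write ends c' (← add (← read ends c') (← read ends c))
  forEach len fun i => do
    let x ← read src i
    let c ← key x
    let p ← read ends c
    write dst p x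
    write ends c (← add p 1)

/-- Sort each bucket of `a` with respect to `leq`; `ends` holds the right ends of the buckets. -/
def sortBuckets (leq : Word → Word → RAM Bool) (a ends : Arr) (numKeys : Word) : RAM Unit := do
  let _ ← forLoop numKeys (0 : Word) fun c lo => do
    let hi ← read ends c
    mergeSort leq a lo hi
    return hi

/-- Renaming by rank: `order[0, len)` is sorted, equal elements (as decided by `same`) being
consecutive; `out[x]` becomes the number of classes before that of `x`. Returns the number of
classes. -/
def assignRanks (same : Word → Word → RAM Bool) (order out : Arr) (len : Word) : RAM Word :=
  forLoop len (0 : Word) fun j r => do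
    let x ← read order j
    let old ←
      if (← eq j 0) then pure false else same (← read order (← sub j 1)) x
    let r' ← if old then pure r else add r 1
    write out x (← sub r' 1)
    return r'

/-- The rank of the second half in one step of prefix doubling, `0` beyond the end. -/
def secondKey (rank : Arr) (len k i : Word) : RAM Word := do
  let j ← add i k
  if (← lt j len) then add (← read rank j) 1 else pure 0

/-- Suffix array `sa` and inverse suffix array `rank` of the string `t[0, len)` with characters
below `numKeys`, by prefix doubling with bucket sort. -/
def suffixSort (t sa rank : Arr) (len numKeys : Word) : RAM Unit := do
  forEach len fun i => write .ord i i
  bucketSort (read t) .ord sa .cnt len numKeys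
  let _ ← assignRanks (fun x y => do eq (← read t x) (← read t y)) sa rank len
  let _ ← whileLoop len (1 : Word) (fun k => lt k len) fun k => do
    let base ← sub len k
    forEach k fun i => do write .ord i (← add base i)
    let _ ← forLoop len k fun j p => do
      let i ← read sa j
      if (← le k i) then
        write .ord p (← sub i k)
        add p 1
      else
        pure p
    bucketSort (read rank) .ord sa .cnt len len
    let _ ← assignRanks (fun x y => do
      if (← eq (← read rank x) (← read rank y)) then
        eq (← secondKey rank len k x) (← secondKey rank len k y)
      else pure false) sa .tmp len
    forEach len fun i => do write rank i (← read .tmp i)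
    add k k

/-! ## Phase 1: preparing the text, augmenting the reference, index structures of the reference -/

/-- Copies the input into `ref` and `txt`. The end-of-string character of the reference becomes
`0`, that of the `d`-th string of the collection becomes `d`, and the letters are renamed by rank
to the numbers following `m`, the number of strings. So the end-of-string character of the
reference is the smallest one, those of the collection come next, in document order (so that
equal suffixes are ordered by document index), and then the letters.
Returns `m` and the size of the new alphabet. -/
def prepare (N n : Word) : RAM (Word × Word) := do
  let m ← forLoop N (0 : Word) fun i m => do
    if (← eq (← read .inColl i) 0) then add m 1 else pure m
  forEach n fun i => do
    let c ← read .inRef i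
    if (← eq c 0) then write .raw i 0 else write .raw i (← add c m)
  let _ ← forLoop N ((1, 1) : Word × Word) fun i s => do
    let c ← read .inColl i
    let k ← add n i
    write .docNo i s.1
    write .docPos i s.2
    if (← eq c 0) then
      write .raw k s.1
      return (← add s.1 1, 1)
    else
      write .raw k (← add c m)
      return (s.1, ← add s.2 1)
  let total ← add n N
  forEach total fun i => write .rawOrd i i
  mergeSort (fun x y => do le (← read .raw x) (← read .raw y)) .rawOrd 0 total
  let numKeys ←
    assignRanks (fun x y => do eq (← read .raw x) (← read .raw y)) .rawOrd .rawRank total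
  forEach n fun i => do write .ref i (← read .rawRank i)
  forEach N fun i => do write .txt i (← read .rawRank (← add n i))
  return (m, numKeys)

/-- Augmentation: for every letter `c` of the collection that does not occur in the reference,
append to the reference (before its end-of-string character) the word `c ^ k`, where `k` is the
length of the longest run of `c` in the collection. Returns the new length of the reference. -/
def augment (N n m : Word) : RAM Word := do
  forEach n fun i => do write .seen (← read .ref i) 1
  let _ ← forLoop N ((0, 0) : Word × Word) fun i s => do
    let c ← read .txt i
    let run ← if (← eq c s.1) then add s.2 1 else pure 1
    if (← lt (← read .runLen c) run) then write .runLen c run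
    return (c, run)
  let last ← forLoop N (← sub n 1) fun i p => do
    let c ← read .txt i
    if (← lt m c) then
      if (← eq (← read .seen c) 0) then
        write .seen c 1
        forLoop (← read .runLen c) p fun _ p => do
          write .ref p c
          add p 1
      else pure p
    else pure p
  write .ref last 0
  add last 1

/-- `plcp[i]` is the length of the longest common prefix of the `i`-th suffix of the reference and
its predecessor in the suffix array, and `lcp[j] = plcp[saR[j]]`. -/
def computeLCP (nR : Word) : RAM Unit := do
  let last ← sub nR 1
  forEach last fun i => do
    write .phi (← read .saR (← add i 1)) (← read .saR i)
  let _ ← forLoop last (0 : Word) fun i l => do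
    let j ← read .phi i
    let l ← whileLoop nR l
      (fun l => do eq (← read .ref (← add i l)) (← read .ref (← add j l)))
      (fun l => add l 1)
    write .plcp i l
    sub l 1
  write .plcp last 0
  forEach nR fun j => do write .lcp j (← read .plcp (← read .saR j))

/-- Range minimum structure: row `k`, which starts at `k * nR`, holds at index `i` the minimum of
`lcp[i, min (i + 2 ^ k) nR)`; the rows are computed until `2 ^ k ≥ nR`. Returns the start of the
last row and its power of two. -/
def buildRMQ (nR : Word) : RAM (Word × Word) := do
  forEach nR fun i => do write .rmq i (← read .lcp i)
  whileLoop nR ((0, 1) : Word × Word) (fun s => lt s.2 nR) fun s => do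
    let next ← add s.1 nR
    forEach nR fun i => do
      let j ← add i s.2
      let x ← read .rmq (← add s.1 i)
      let y ← if (← lt j nR) then read .rmq (← add s.1 j) else pure x
      write .rmq (← add next i) (← minWord x y)
    return (next, ← add s.2 s.2)

/-- Previous smaller value: the largest `x' ≤ x` with `lcp[x'] < v` (for `v ≥ 1`). -/
def prevSmaller (nR : Word) (top : Word × Word) (v x : Word) : RAM Word := do
  let r ← whileLoop nR (top, x) (fun s => lt 0 s.1.2) fun s => do
    let (base, w) := s.1
    let x' ←
      if (← le w s.2) then
        let y ← sub s.2 w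
        if (← le v (← read .rmq (← add base (← add y 1)))) then pure y else pure s.2
      else pure s.2
    return ((← sub base nR, ← half w), x')
  return r.2

/-- Next smaller value: the smallest `y' ≥ y` with `lcp[y'] < v`, and `nR` if there is none. -/
def nextSmaller (nR : Word) (top : Word × Word) (v y : Word) : RAM Word := do
  let r ← whileLoop nR (top, y) (fun s => lt 0 s.1.2) fun s => do
    let (base, w) := s.1
    let y' ←
      if (← lt s.2 nR) then
        if (← le v (← read .rmq (← add base s.2))) then minWord (← add s.2 w) nR else pure s.2
      else pure s.2
    return ((← sub base nR, ← half w), y')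
  return r.2

/-- The sizes that later phases need. -/
structure Sizes where
  /-- total length of the collection -/
  N : Word
  /-- number of strings -/
  m : Word
  /-- size of the alphabet; all characters are smaller -/
  numKeys : Word
  /-- length of the augmented reference -/
  nR : Word
  /-- last row of the range minimum structure -/
  top : Word × Word

def phase1 : RAM Sizes := do
  let N ← read .inSize 0
  let n ← read .inSize 1
  let (m, numKeys) ← prepare N n
  let nR ← augment N n m
  suffixSort .ref .saR .isaR nR numKeys
  computeLCP nR
  let top ← buildRMQ nR
  return { N, m, numKeys, nR, top }

/-! ## Phase 2: the enhanced compressed matching statistics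

An interval `[lo, hi)` of the suffix array of the reference together with a length `len` stands
for the word `Y` of length `len` that is a prefix of exactly the suffixes in the interval. -/

/-- Right extension: from the interval of `Y` to that of `Y c`. If `Y c` does not occur, the
interval is empty, and its left end is the place where `Y c` would be inserted. -/
def rightExtension (lo hi len c : Word) : RAM (Word × Word) := do
  let a ← binarySearch
    (fun j => do lt (← read .ref (← add (← read .saR j) len)) c) lo hi
  let b ← binarySearch
    (fun j => do le (← read .ref (← add (← read .saR j) len)) c) a hi
  return (a, b)

/-- Left contraction: from the non-empty interval of `c Y`, where `Y` has length `v`, to that of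
`Y`. -/
def leftContraction (z : Sizes) (lo hi v : Word) : RAM (Word × Word) := do
  if (← eq v 0) then
    return (0, z.nR)
  else
    let s ← read .isaR (← add (← read .saR lo) 1)
    let e ← read .isaR (← add (← read .saR (← sub hi 1)) 1)
    return (← prevSmaller z.nR z.top v s, ← nextSmaller z.nR z.top v (← add e 1))

/-- The state of the search for a matching factor. -/
structure Search where
  lo : Word
  hi : Word
  len : Word
  /-- where the matching factor followed by the mismatch character would be inserted -/
  ins : Word
  go : Bool

/-- Extend the current match of the suffix at position `i` as far as possible. -/
def extendMatch (z : Sizes) (i lo hi len : Word) : RAM Search := do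
  whileLoop (← add z.N 1) { lo, hi, len, ins := lo, go := true : Search }
    (fun s => pure s.go) fun s => do
      let c ← read .txt (← add i s.len)
      let (a, b) ← rightExtension s.lo s.hi s.len c
      if (← lt a b) then
        return { lo := a, hi := b, len := ← add s.len 1, ins := a, go := true }
      else
        return { s with ins := a, go := false }

/-- The insert point of a suffix, and whether the suffix is smaller (`0`) or greater (`1`) than
the suffix of the reference at the insert point. -/
def insertPoint (s : Search) : RAM (Word × Word) := do
  if (← eq s.len 0) then
    return (0, 1)
  else if (← lt s.lo s.ins) then
    return (← sub s.ins 1, 1)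
  else
    return (s.lo, 0)

/-- The loop state: interval and length of the last matching factor, the position in the reference
given by the last insert point, and the number of insert-heads so far. -/
structure Scan where
  lo : Word
  hi : Word
  len : Word
  q : Word
  heads : Word

/-- Computes the enhanced matching statistics `(q, len, x, c)` from left to right and stores them
at the insert-heads, i.e. where `q` is not the successor of the previous `q`. Returns the number
of insert-heads. -/
def phase2 (z : Sizes) : RAM Word := do
  let r ← forLoop z.N { lo := 0, hi := z.nR, len := 0, q := z.nR, heads := 0 : Scan }
    fun i s => do
      let v ← sub s.len 1
      let (lo, hi) ← leftContraction z s.lo s.hi v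
      let f ← extendMatch z i lo hi v
      let (ip, x) ← insertPoint f
      let q ← read .saR ip
      let h := s.heads
      let isTail ← eq q (← add s.q 1)
      let heads ←
        if isTail then pure h
        else
          write .hPos h i
          write .hQ h q
          write .hLen h f.len
          write .hX h x
          write .hC h (← read .txt (← add i f.len))
          add h 1
      return { lo := f.lo, hi := f.hi, len := f.len, q, heads }
  return r.heads

/-! ## Phase 3: bucketing the S*-suffixes -/

/-- Suffix types (`0` for S, `1` for L), by a backward scan. -/
def computeTypes (N : Word) : RAM Unit :=
  forDown N fun i => do
    let j ← add i 1
    if (← lt j N) then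
      let a ← read .txt i
      let b ← read .txt j
      if (← lt a b) then write .typ i 0
      else if (← lt b a) then write .typ i 1
      else write .typ i (← read .typ j)
    else
      write .typ i 0

/-- S*-suffixes: S-suffixes preceded by an L-suffix, and the suffixes that consist of an
end-of-string character only. -/
def isSStar (m i : Word) : RAM Bool := do
  if (← le (← read .txt i) m) then pure true
  else if (← eq (← read .typ i) 1) then pure false
  else if (← eq i 0) then pure false
  else eq (← read .typ (← sub i 1)) 1

/-- Lists the S*-suffixes with their enhanced matching statistics, recovered from those of the
insert-head to the left, and buckets them by insert point. Returns their number. -/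
def phase3 (z : Sizes) (heads : Word) : RAM Word := do
  computeTypes z.N
  let r ← forLoop z.N ((0, 0) : Word × Word) fun i s => do
    -- `s.1` is the current insert-head, `s.2` the number of S*-suffixes so far
    let h' ← add s.1 1
    let h ←
      if (← lt h' heads) then
        if (← eq (← read .hPos h') i) then pure h' else pure s.1
      else pure s.1
    if (← isSStar z.m i) then
      let k ← sub i (← read .hPos h)
      let t := s.2
      write .sPos t i
      write .sIp t (← read .isaR (← add (← read .hQ h) k))
      write .sLen t (← sub (← read .hLen h) k)
      write .sX t (← read .hX h)
      write .sC t (← read .hC h)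
      return (h, ← add t 1)
    else
      return (h, s.2)
  let num := r.2
  forEach num fun t => write .sList t t
  bucketSort (read .sIp) .sList .sSorted .sEnd num z.nR
  return num

/-! ## Phase 4: sorting the insert-heads -/

/-- Comparison of two suffixes with the same insert point by length, type and mismatch character
of their enhanced matching statistics. -/
def compareEms (len x c : Arr) (i j : Word) : RAM Ordering := do
  let li ← read len i
  let lj ← read len j
  let xi ← read x i
  let xj ← read x j
  if (← lt li lj) then
    if (← eq xi 0) then pure .lt else pure .gt
  else if (← lt lj li) then
    if (← eq xj 0) then pure .gt else pure .lt
  else if (← lt xi xj) then pure .lt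
  else if (← lt xj xi) then pure .gt
  else
    let ci ← read c i
    let cj ← read c j
    if (← lt ci cj) then pure .lt
    else if (← lt cj ci) then pure .gt
    else pure .eq

/-- Buckets the insert-heads by insert point, sorts each bucket by enhanced matching statistics,
renames the insert-heads by the rank of their metacharacter (matching factor followed by mismatch
character), and sorts the suffixes of the string of metacharacters in text order. In the end,
`hRank` holds the rank of each insert-head among all insert-heads. -/
def phase4 (z : Sizes) (heads : Word) : RAM Unit := do
  forEach heads fun h => do
    write .hList h h
    write .hIp h (← read .isaR (← read .hQ h))
  bucketSort (read .hIp) .hList .hSorted .hEnd heads z.nR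
  sortBuckets (fun i j => do return (← compareEms .hLen .hX .hC i j) != .gt) .hSorted .hEnd z.nR
  let numMeta ← assignRanks (fun i j => do
    if (← eq (← read .hIp i) (← read .hIp j)) then
      return (← compareEms .hLen .hX .hC i j) == .eq
    else pure false) .hSorted .metaStr heads
  suffixSort .metaStr .saM .hRank heads numMeta

/-! ## Phase 5: sorting the S*-suffixes -/

/-- The first insert-head after position `p` (the number of insert-heads if there is none). -/
def nextHead (heads p : Word) : RAM Word :=
  binarySearch (fun h => do le (← read .hPos h) p) 0 heads

/-- Sorts every bucket of S*-suffixes by enhanced matching statistics, ties being broken by the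
rank of the first insert-head after the start of the suffix. (Suffixes whose enhanced matching
statistics agree have this insert-head at the same distance, at most the length of the matching
factor.) -/
def phase5 (z : Sizes) (heads num : Word) : RAM Unit := do
  forEach num fun t => do
    let h ← nextHead heads (← read .sPos t)
    write .sNext t (← read .hRank h)
  sortBuckets (fun i j => do
    match (← compareEms .sLen .sX .sC i j) with
    | .lt => pure true
    | .gt => pure false
    | .eq => le (← read .sNext i) (← read .sNext j)) .sSorted .sEnd z.nR

/-! ## Phase 6: inducing the generalized suffix array

In `gsa`, the text position `p` is stored as `p + 1`, and `0` stands for an empty slot. -/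

/-- Bucket boundaries by first character: bucket `c` is `[bStart[c], bStart[c + 1])`. -/
def charBuckets (z : Sizes) : RAM Unit := do
  forEach (← add z.numKeys 1) fun c => write .bStart c 0
  forEach z.N fun i => do
    let c ← add (← read .txt i) 1
    write .bStart c (← add (← read .bStart c) 1)
  forEach z.numKeys fun c => do
    let c' ← add c 1
    write .bStart c' (← add (← read .bStart c') (← read .bStart c))

/-- Let the bucket pointers point to the right ends of the buckets. -/
def pointToEnds (z : Sizes) : RAM Unit :=
  forEach z.numKeys fun c => do write .bPtr c (← read .bStart (← add c 1))

/-- Insert the suffix at `p` at the right end of the free part of its bucket. -/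
def putRight (p : Word) : RAM Unit := do
  let c ← read .txt p
  let k ← sub (← read .bPtr c) 1
  write .bPtr c k
  write .gsa k (← add p 1)

/-- Insert the suffix at `p` at the left end of the free part of its bucket. -/
def putLeft (p : Word) : RAM Unit := do
  let c ← read .txt p
  let k ← read .bPtr c
  write .gsa k (← add p 1)
  write .bPtr c (← add k 1)

def phase6 (z : Sizes) (num : Word) : RAM Unit := do
  charBuckets z
  forEach z.N fun k => write .gsa k 0
  -- the sorted S*-suffixes go to the right ends of their buckets
  pointToEnds z
  forDown num fun t => do putRight (← read .sPos (← read .sSorted t))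
  -- left-to-right scan: induce the L-suffixes
  forEach z.numKeys fun c => do write .bPtr c (← read .bStart c)
  forEach z.N fun k => do
    let v ← read .gsa k
    if (← le 2 v) then
      let p ← sub v 2
      if (← eq (← read .typ p) 1) then putLeft p
  -- right-to-left scan: induce the S-suffixes; end-of-string characters are already in place
  pointToEnds z
  forDown z.N fun k => do
    let v ← read .gsa k
    if (← le 2 v) then
      let p ← sub v 2
      if (← eq (← read .typ p) 0) then
        if (← lt z.m (← read .txt p)) then putRight p
  forEach z.N fun k => do
    let p ← sub (← read .gsa k) 1
    write .outDoc k (← read .docNo p)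
    write .outPos k (← read .docPos p)

/-! ## Algorithm 1 and its input and output -/

/-- The algorithm: one program for all inputs. -/
def algorithm1 : RAM Unit := do
  let z ← phase1
  let heads ← phase2 z
  let num ← phase3 z heads
  phase4 z heads
  phase5 z heads num
  phase6 z num

/-- Representation of a string in memory: `0` is the end-of-string character, `a + 1` the
letter `a`. -/
def encode (s : List ℕ) : List ℕ := s.map (· + 1) ++ [0]

/-- The array that starts with the entries of `l` and continues with zeros. -/
def arrayOf (l : List ℕ) (i : ℕ) : Word := ⟨l.getD i 0⟩

/-- The initial state: the collection (one string after the other), the reference, the length of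
both; everything else is zero. -/
def initial (C : List (List ℕ)) (R : List ℕ) : Machine where
  mem
    | .inColl => arrayOf (C.map encode).flatten
    | .inRef => arrayOf (encode R)
    | .inSize => arrayOf [totalLength C, (terminated R).length]
    | _ => arrayOf []
  time := 0

/-- The state after running the algorithm on the collection `C` and the reference `R`. -/
def finalState (C : List (List ℕ)) (R : List ℕ) : Machine :=
  (algorithm1.run (initial C R)).2

/-- The output: the first `N` entries of the two output arrays, `N` the total length. -/
def output (C : List (List ℕ)) (R : List ℕ) : List (ℕ × ℕ) :=
  (List.range (totalLength C)).map fun k =>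
    (((finalState C R).mem .outDoc k).val, ((finalState C R).mem .outPos k).val)

/-- The number of elementary steps. -/
def runningTime (C : List (List ℕ)) (R : List ℕ) : ℕ :=
  (finalState C R).time

end SuffixSorting

namespace SuffixSorting

/-! ## Weakest preconditions -/

/-! Order of the suffixes. After the renaming the collection is one sequence `T` of numbers in which
the terminators are pairwise distinct and smaller than the letters; the reference `R` ends with its
only `0`, and every letter of `T` occurs in `R` (`TextRef`, `RefIndex`). Suffixes are compared as
infinite sequences (`Seq`), so ends of strings need no special treatment and distinct positions have
distinct suffixes (`TextRef.suf_inj`). Only at the very end does `Renamed.suffix_lt` translate this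
order back into the lexicographic order of strings, ties being broken by document.

The statistics `Ems` place a suffix of `T` among the suffixes of `R`. A smaller insert point means a
smaller suffix (`Ems.lt_of_isa_lt`); at equal insert points the key `(x, ±l, c)` decides
(`Ems.lt_of_key_lt`); if the keys agree too, the suffixes share `l + 1` characters
(`Ems.agree_of_key_eq`). Conversely, the matching factor with its mismatch character determines the
statistics (`Ems.unique`). Consider two different positions with equal statistics. The shared
characters contain no terminator, since terminators do not repeat. Therefore an insert-head follows
within `l` places (`Within.next_le`), and at the same distance for both positions
(`Within.next_eq`). So the tie is decided at the next insert-heads. Iterating this shows that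
insert-heads are ordered like the suffixes of the string of metacharacters
(`Heads.lt_of_padded_lt`), and one more application sorts the `S*`-suffixes (`wp_phase5`). Induced
sorting then rests on two facts: within a bucket the L-suffixes precede the S-suffixes
(`TextRef.lt_of_type`), and two suffixes with equal first characters compare like their successors
(`suf_lt_succ_iff`). So each scan meets successors in the right order and fills each bucket in the
right order (`wp_induceL`, `wp_induceS`).

Running time. Every routine has a specification in terms of `wp` that bounds the clock together with
the result. The augmented reference and the alphabet have size at most `n + N`, because an appended
run is no longer than the number of occurrences of its letter in the collection. Sorting takes a
logarithmic number of linear rounds. The LCP array and the matching statistics are amortized: the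
current length drops by at most one per position, so the number of extensions is linear. `time_le`
adds everything up, and `algorithmTime_le` passes from bit lengths to the logarithm. -/

/-- Memory contents as natural numbers. -/
abbrev Mem := Arr → ℕ → ℕ

/-- The machine with memory `μ` and clock `τ`. -/
def Machine.of (μ : Mem) (τ : ℕ) : Machine := ⟨fun a i => ⟨μ a i⟩, τ⟩

/-- The memory contents of a machine. -/
def Machine.view (M : Machine) : Mem := fun a i => (M.mem a i).val

@[simp] theorem Machine.of_view (M : Machine) : Machine.of M.view M.time = M := rfl
/-- Running `c` from memory `μ` at time `τ` ends with a result, memory and time that satisfy `Q`. -/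
def wp {α : Type} (c : RAM α) (μ : Mem) (τ : ℕ) (Q : α → Mem → ℕ → Prop) : Prop :=
  Q (c.run (Machine.of μ τ)).1 (c.run (Machine.of μ τ)).2.view (c.run (Machine.of μ τ)).2.time

/-- Memory update. -/
def upd (μ : Mem) (a : Arr) (i v : ℕ) : Mem :=
  fun b j => if b = a ∧ j = i then v else μ b j

@[simp] theorem upd_same (μ : Mem) (a : Arr) (i v : ℕ) : upd μ a i v a i = v := by
  simp [upd]

theorem upd_self (μ : Mem) (a : Arr) (i v j : ℕ) :
    upd μ a i v a j = if j = i then v else μ a j := by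
  simp [upd]

theorem upd_ne (μ : Mem) {a b : Arr} (i v : ℕ) (h : b ≠ a) : upd μ a i v b = μ b := by
  funext j; simp [upd, h]

section rules
variable {α β : Type} (μ : Mem) (τ : ℕ)

theorem wp_mono {c : RAM α} {μ : Mem} {τ : ℕ} {P Q : α → Mem → ℕ → Prop} (h : wp c μ τ P)
    (hPQ : ∀ a μ' τ', P a μ' τ' → Q a μ' τ') : wp c μ τ Q := hPQ _ _ _ h

/-- Definitional, because `Machine.of_view` allows the second program to start from the memory and
clock left by the first one instead of from the machine itself. -/
theorem wp_bind (x : RAM α) (f : α → RAM β) (Q : β → Mem → ℕ → Prop) :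
    wp (x >>= f) μ τ Q ↔ wp x μ τ fun a μ' τ' => wp (f a) μ' τ' Q := Iff.rfl

theorem wp_pure (a : α) (Q : α → Mem → ℕ → Prop) :
    wp (pure a : RAM α) μ τ Q ↔ Q a μ τ := Iff.rfl

theorem wp_ite (p : Prop) [Decidable p] (x y : RAM α) (Q : α → Mem → ℕ → Prop) :
    wp (if p then x else y) μ τ Q ↔ if p then wp x μ τ Q else wp y μ τ Q := by
  split_ifs <;> rfl

theorem wp_tick (Q : Unit → Mem → ℕ → Prop) : wp tick μ τ Q ↔ Q () μ (τ + 1) := Iff.rfl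

theorem wp_add (x y : Word) (Q : Word → Mem → ℕ → Prop) :
    wp (add x y) μ τ Q ↔ Q ⟨x.val + y.val⟩ μ (τ + 1) := Iff.rfl

theorem wp_sub (x y : Word) (Q : Word → Mem → ℕ → Prop) :
    wp (sub x y) μ τ Q ↔ Q ⟨x.val - y.val⟩ μ (τ + 1) := Iff.rfl

theorem wp_half (x : Word) (Q : Word → Mem → ℕ → Prop) :
    wp (half x) μ τ Q ↔ Q ⟨x.val / 2⟩ μ (τ + 1) := Iff.rfl

theorem wp_lt (x y : Word) (Q : Bool → Mem → ℕ → Prop) :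
    wp (lt x y) μ τ Q ↔ Q (decide (x.val < y.val)) μ (τ + 1) := Iff.rfl

theorem wp_le (x y : Word) (Q : Bool → Mem → ℕ → Prop) :
    wp (le x y) μ τ Q ↔ Q (decide (x.val ≤ y.val)) μ (τ + 1) := Iff.rfl

theorem wp_eq (x y : Word) (Q : Bool → Mem → ℕ → Prop) :
    wp (eq x y) μ τ Q ↔ Q (decide (x.val = y.val)) μ (τ + 1) := Iff.rfl

theorem wp_read (a : Arr) (i : Word) (Q : Word → Mem → ℕ → Prop) :
    wp (read a i) μ τ Q ↔ Q ⟨μ a i.val⟩ μ (τ + 1) := Iff.rfl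

theorem wp_write (a : Arr) (i v : Word) (Q : Unit → Mem → ℕ → Prop) :
    wp (write a i v) μ τ Q ↔ Q () (upd μ a i.val v.val) (τ + 1) := by
  have : upd μ a i.val v.val = ((write a i v).run (Machine.of μ τ)).2.view := by
    funext b j
    simp only [upd, Machine.view]
    change _ = (Function.update (Machine.of μ τ).mem a
      (Function.update ((Machine.of μ τ).mem a) i.val v) b j).val
    by_cases hb : b = a
    · subst hb
      by_cases hj : j = i.val
      · subst hj; simp
      · simp [hj, Machine.of]
    · simp [hb, Machine.of]
  rw [this]; rfl

end rules

/-- Bundled so that a single `simp only [wp_rules]` executes straight-line code symbolically; calls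
and loops are then treated by their own specifications. -/
theorem wp_rules :
    (∀ {α β : Type} (μ : Mem) (τ : ℕ) (x : RAM α) (f : α → RAM β) (Q : β → Mem → ℕ → Prop),
      wp (x >>= f) μ τ Q ↔ wp x μ τ fun a μ' τ' => wp (f a) μ' τ' Q) ∧
    (∀ {α : Type} (μ : Mem) (τ : ℕ) (a : α) (Q : α → Mem → ℕ → Prop),
      wp (pure a : RAM α) μ τ Q ↔ Q a μ τ) ∧
    (∀ {α : Type} (μ : Mem) (τ : ℕ) (p : Prop) [Decidable p] (x y : RAM α)
      (Q : α → Mem → ℕ → Prop),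
      wp (if p then x else y) μ τ Q ↔ if p then wp x μ τ Q else wp y μ τ Q) ∧
    (∀ (μ : Mem) (τ : ℕ) (x y : Word) (Q : Word → Mem → ℕ → Prop),
      wp (add x y) μ τ Q ↔ Q ⟨x.val + y.val⟩ μ (τ + 1)) ∧
    (∀ (μ : Mem) (τ : ℕ) (x y : Word) (Q : Word → Mem → ℕ → Prop),
      wp (sub x y) μ τ Q ↔ Q ⟨x.val - y.val⟩ μ (τ + 1)) ∧
    (∀ (μ : Mem) (τ : ℕ) (x : Word) (Q : Word → Mem → ℕ → Prop),
      wp (half x) μ τ Q ↔ Q ⟨x.val / 2⟩ μ (τ + 1)) ∧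
    (∀ (μ : Mem) (τ : ℕ) (x y : Word) (Q : Bool → Mem → ℕ → Prop),
      wp (lt x y) μ τ Q ↔ Q (decide (x.val < y.val)) μ (τ + 1)) ∧
    (∀ (μ : Mem) (τ : ℕ) (x y : Word) (Q : Bool → Mem → ℕ → Prop),
      wp (le x y) μ τ Q ↔ Q (decide (x.val ≤ y.val)) μ (τ + 1)) ∧
    (∀ (μ : Mem) (τ : ℕ) (x y : Word) (Q : Bool → Mem → ℕ → Prop),
      wp (eq x y) μ τ Q ↔ Q (decide (x.val = y.val)) μ (τ + 1)) ∧
    (∀ (μ : Mem) (τ : ℕ) (a : Arr) (i : Word) (Q : Word → Mem → ℕ → Prop),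
      wp (read a i) μ τ Q ↔ Q ⟨μ a i.val⟩ μ (τ + 1)) ∧
    (∀ (μ : Mem) (τ : ℕ) (a : Arr) (i v : Word) (Q : Unit → Mem → ℕ → Prop),
      wp (write a i v) μ τ Q ↔ Q () (upd μ a i.val v.val) (τ + 1)) :=
  ⟨wp_bind, wp_pure, wp_ite, wp_add, wp_sub, wp_half, wp_lt, wp_le, wp_eq, wp_read, wp_write⟩

@[simp] theorem Word.val_ofNat (n : ℕ) : (OfNat.ofNat n : Word).val = n := rfl
@[simp] theorem Word.val_mk (n : ℕ) : (Word.mk n).val = n := rfl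
@[simp] theorem Word.val_zero : (0 : Word).val = 0 := rfl
@[simp] theorem Word.val_one : (1 : Word).val = 1 := rfl

/-- `c` computes the value `v` within time `B`, leaving the memory as it is. -/
def Computes {α : Type} (c : RAM α) (μ : Mem) (v : α) (B : ℕ) : Prop :=
  ∀ τ, wp c μ τ fun a μ' τ' => a = v ∧ μ' = μ ∧ τ' ≤ τ + B

/-- The memories agree except on the arrays in `S`. -/
def Frame (S : List Arr) (μ μ' : Mem) : Prop := ∀ b, b ∉ S → μ' b = μ b

theorem Frame.refl (S : List Arr) (μ : Mem) : Frame S μ μ := fun _ _ => rfl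

theorem Frame.trans {S : List Arr} {μ μ' μ'' : Mem} (h : Frame S μ μ') (h' : Frame S μ' μ'') :
    Frame S μ μ'' := fun b hb => (h' b hb).trans (h b hb)

theorem Frame.mono {S S' : List Arr} {μ μ' : Mem} (h : Frame S μ μ') (hS : S ⊆ S') :
    Frame S' μ μ' := fun b hb => h b fun hb' => hb (hS hb')

theorem Frame.upd {S : List Arr} {μ μ' : Mem} (h : Frame S μ μ') {a : Arr} (ha : a ∈ S)
    (i v : ℕ) : Frame S μ (upd μ' a i v) := fun b hb => by
  rw [upd_ne _ _ _ (fun hba => hb (by rwa [hba]))]; exact h b hb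

/-! ### Loops -/

theorem wp_forAux {σ : Type} {body : Word → σ → RAM σ} {μ : Mem} {τ : ℕ} {s : σ}
    (I : ℕ → σ → Mem → ℕ → Prop) (n : ℕ) (h0 : I 0 s μ (τ + 1))
    (hstep : ∀ k s μ τ, k < n → I k s μ τ → wp (body ⟨k⟩ s) μ (τ + 1) (I (k + 1))) :
    wp (forAux body n s) μ τ (I n) := by
  induction n with
  | zero => exact h0
  | succ n ih =>
    have := ih fun k s μ τ hk => hstep k s μ τ (by omega)
    exact hstep n _ _ _ (by omega) this

/-- Loop rule with an invariant that may refer to the clock. -/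
theorem wp_forLoop {σ : Type} {body : Word → σ → RAM σ} {μ : Mem} {τ : ℕ} {s : σ} {n : Word}
    (I : ℕ → σ → Mem → ℕ → Prop) (h0 : I 0 s μ (τ + 1))
    (hstep : ∀ k s μ τ, k < n.val → I k s μ τ → wp (body ⟨k⟩ s) μ (τ + 1) (I (k + 1))) :
    wp (forLoop n s body) μ τ (I n.val) := wp_forAux I n.val h0 hstep

/-- Loop rule for bodies with a uniform time bound. -/
theorem wp_forLoop_of_cost {σ : Type} {body : Word → σ → RAM σ} {μ : Mem} {τ : ℕ} {s : σ}
    {n : Word} (I : ℕ → σ → Mem → Prop) (B : ℕ) (h0 : I 0 s μ)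
    (hstep : ∀ k s μ τ, k < n.val → I k s μ →
      wp (body ⟨k⟩ s) μ τ fun s' μ' τ' => I (k + 1) s' μ' ∧ τ' ≤ τ + B) :
    wp (forLoop n s body) μ τ fun s' μ' τ' => I n.val s' μ' ∧ τ' ≤ τ + (n.val * (B + 1) + 1) := by
  refine wp_mono (wp_forLoop (fun k s μ' τ' => I k s μ' ∧ τ' ≤ τ + (k * (B + 1) + 1))
    ⟨h0, by omega⟩ ?_) fun _ _ _ h => h
  rintro k s μ' τ' hk ⟨hI, ht⟩
  refine wp_mono (hstep k s μ' _ hk hI) ?_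
  rintro _ _ _ ⟨h1, h2⟩
  refine ⟨h1, ?_⟩
  rw [Nat.succ_mul]
  omega

theorem wp_forEach {body : Word → RAM Unit} {μ : Mem} {τ : ℕ} {n : Word}
    (I : ℕ → Mem → Prop) (B : ℕ) (h0 : I 0 μ)
    (hstep : ∀ k μ τ, k < n.val → I k μ →
      wp (body ⟨k⟩) μ τ fun _ μ' τ' => I (k + 1) μ' ∧ τ' ≤ τ + B) :
    wp (forEach n body) μ τ fun _ μ' τ' => I n.val μ' ∧ τ' ≤ τ + (n.val * (B + 1) + 1) :=
  wp_forLoop_of_cost (fun k _ => I k) B h0 fun k _ μ τ => hstep k μ τ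

/-- Downward loop; `I k` holds when the indices from `k` on have been processed. -/
theorem wp_forDown {body : Word → RAM Unit} {μ : Mem} {τ : ℕ} {n : Word}
    (I : ℕ → Mem → Prop) (B : ℕ) (h0 : I n.val μ)
    (hstep : ∀ k μ τ, k < n.val → I (k + 1) μ →
      wp (body ⟨k⟩) μ τ fun _ μ' τ' => I k μ' ∧ τ' ≤ τ + B) :
    wp (forDown n body) μ τ fun _ μ' τ' => I 0 μ' ∧ τ' ≤ τ + (n.val * (B + 3) + 1) := by
  refine wp_mono (wp_forEach (fun k => I (n.val - k)) (B + 2) h0 ?_) ?_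
  · intro k μ τ hk hI
    simp only [wp_bind, wp_sub, Word.val_one]
    have e : n.val - k = n.val - k - 1 + 1 := by omega
    refine wp_mono (hstep (n.val - k - 1) μ _ (by omega) (e ▸ hI)) ?_
    rintro _ _ _ ⟨h1, h2⟩
    exact ⟨by rwa [show n.val - (k + 1) = n.val - k - 1 by omega], by omega⟩
  · rintro _ _ _ ⟨h1, h2⟩
    exact ⟨by simpa using h1, h2⟩

theorem wp_whileAux {σ : Type} {test : σ → RAM Bool} {body : σ → RAM σ} {μ : Mem} {τ : ℕ}
    {s : σ} {Q : σ → Mem → ℕ → Prop} (I : σ → Mem → ℕ → Prop) (meas : σ → ℕ) (k : ℕ)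
    (h0 : I s μ τ) (hk : meas s ≤ k)
    (hstep : ∀ s μ τ, I s μ τ → wp (test s) μ (τ + 1) fun b μ' τ' =>
      if b = true then wp (body s) μ' τ' fun s' μ'' τ'' => meas s' < meas s ∧ I s' μ'' τ''
      else Q s μ' τ')
    (hend : ∀ s μ τ, I s μ τ → meas s = 0 → Q s μ (τ + 1)) :
    wp (whileAux test body k s) μ τ Q := by
  induction k generalizing s μ τ with
  -- The fuel bounds the measure, so it can only run out when the measure is `0`; in that state the
  -- postcondition has to hold without the test being evaluated.
  | zero => exact hend s μ τ h0 (by omega)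
  | succ k ih =>
    simp only [whileAux, wp_bind, wp_tick]
    refine wp_mono (hstep s μ τ h0) ?_
    intro b μ' τ' h
    rw [wp_ite]
    split_ifs at h ⊢ with hb
    · rw [wp_bind]
      refine wp_mono h ?_
      rintro s' μ'' τ'' ⟨h1, h2⟩
      exact ih h2 (by omega)
    · exact h

/-- Rule for while loops: the measure decreases, and bounds the number of iterations. -/
theorem wp_whileLoop {σ : Type} {test : σ → RAM Bool} {body : σ → RAM σ} {μ : Mem} {τ : ℕ}
    {s : σ} {k : Word} {Q : σ → Mem → ℕ → Prop} (I : σ → Mem → ℕ → Prop) (meas : σ → ℕ)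
    (h0 : I s μ τ) (hk : meas s ≤ k.val)
    (hstep : ∀ s μ τ, I s μ τ → wp (test s) μ (τ + 1) fun b μ' τ' =>
      if b = true then wp (body s) μ' τ' fun s' μ'' τ'' => meas s' < meas s ∧ I s' μ'' τ''
      else Q s μ' τ')
    (hend : ∀ s μ τ, I s μ τ → meas s = 0 → Q s μ (τ + 1)) :
    wp (whileLoop k s test body) μ τ Q := wp_whileAux I meas k.val h0 hk hstep hend

/-! ### Binary search -/

/-- The potential for all loops that halve or double: a round is paid for by a lost bit, so no
logarithm appears before the final estimate. -/
theorem size_lt_size {x n : ℕ} (hn : 0 < n) (hx : x ≤ n / 2) : Nat.size x < Nat.size n := by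
  rcases Nat.eq_zero_or_pos x with rfl | hx0
  · simpa using Nat.size_pos.2 hn
  · obtain ⟨m, hm⟩ : ∃ m, Nat.size x = m + 1 :=
      ⟨Nat.size x - 1, by have := Nat.size_pos.2 hx0; omega⟩
    rw [hm, Nat.lt_size, pow_succ]
    have : 2 ^ m ≤ x := Nat.lt_size.1 (by omega)
    omega

/-- Time of a binary search in an interval of length `n` if the predicate takes time `B`. -/
def searchTime (B n : ℕ) : ℕ := Nat.size n * (B + 6) + 6

theorem searchTime_mono (B : ℕ) {n n' : ℕ} (h : n ≤ n') : searchTime B n ≤ searchTime B n' :=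
  Nat.add_le_add_right (Nat.mul_le_mul_right _ (Nat.size_le_size h)) _

theorem wp_binarySearch {pred : Word → RAM Bool} {p : ℕ → Prop} [DecidablePred p] {B lo hi : ℕ}
    {μ : Mem} {τ : ℕ}
    (hpred : ∀ j, lo ≤ j → j < hi → Computes (pred ⟨j⟩) μ (decide (p j)) B)
    (hmono : ∀ i j, lo ≤ i → i ≤ j → j < hi → p j → p i) (hle : lo ≤ hi) :
    wp (binarySearch pred ⟨lo⟩ ⟨hi⟩) μ τ fun r μ' τ' =>
      (μ' = μ ∧ lo ≤ r.val ∧ r.val ≤ hi ∧ ∀ j, lo ≤ j → j < hi → (p j ↔ j < r.val)) ∧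
        τ' ≤ τ + searchTime B (hi - lo) := by
  simp only [binarySearch, wp_bind, wp_sub, wp_pure]
  -- `p` holds left of `s.1` and fails from `s.2` on. A round costs at most `B + 6`, charged to a
  -- lost bit of the length of the remaining interval.
  refine wp_whileLoop (fun s μ' τ' => μ' = μ ∧ lo ≤ s.1.val ∧ s.1.val ≤ s.2.val ∧ s.2.val ≤ hi ∧
      (∀ j, lo ≤ j → j < s.1.val → p j) ∧ (∀ j, s.2.val ≤ j → j < hi → ¬ p j) ∧
      τ' + Nat.size (s.2.val - s.1.val) * (B + 6) ≤ τ + 1 + Nat.size (hi - lo) * (B + 6))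
    (fun s => s.2.val - s.1.val) ?_ ?_ ?_ ?_
  · exact ⟨rfl, le_rfl, hle, le_rfl, fun j _ _ => by simp at *; omega, fun j _ _ => by simp at *; omega,
      le_rfl⟩
  · simp
  · rintro ⟨⟨a⟩, ⟨b⟩⟩ μ' τ' ⟨rfl, h1, h2, h3, h4, h5, ht⟩
    simp only at h1 h2 h3 h4 h5 ht
    simp only [wp_rules, decide_eq_true_eq]
    split_ifs with hab
    · refine wp_mono (hpred ((a + b) / 2) (by omega) (by omega) _) ?_
      rintro _ _ τ'' ⟨rfl, rfl, ht'⟩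
      have hs : ∀ x, x ≤ (b - a) / 2 → Nat.size x * (B + 6) + (B + 6) ≤
          Nat.size (b - a) * (B + 6) := fun x hx => by
        rw [← Nat.succ_mul]
        refine Nat.mul_le_mul_right _ ?_
        exact size_lt_size (by omega) hx
      simp only [decide_eq_true_eq, Word.val_one]
      split_ifs with hp
      · refine ⟨by omega, by trivial, by omega, by omega, h3, fun j hj hj' =>
          hmono j _ hj (by omega) (by omega) hp, h5, ?_⟩
        have := hs (b - ((a + b) / 2 + 1)) (by omega)
        omega
      · refine ⟨by omega, by trivial, by omega, by omega, by omega, h4, fun j hj hj' hpj =>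
          hp (hmono _ j (by omega) hj hj' hpj), ?_⟩
        have := hs ((a + b) / 2 - a) (by omega)
        omega
    · refine ⟨⟨by trivial, h1, by omega, fun j hj hj' => ⟨fun hp => ?_, fun h => h4 j hj h⟩⟩, ?_⟩
      · by_contra hc
        exact h5 j (by omega) hj' hp
      · unfold searchTime; omega
  · rintro ⟨⟨a⟩, ⟨b⟩⟩ μ' τ' ⟨rfl, h1, h2, h3, h4, h5, ht⟩ h0
    simp only at h1 h2 h3 h4 h5 ht h0 ⊢
    refine ⟨⟨by trivial, h1, by omega, fun j hj hj' => ⟨fun hp => ?_, fun h => h4 j hj h⟩⟩, ?_⟩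
    · by_contra hc
      exact h5 j (by omega) hj' hp
    · unfold searchTime; omega

/-! ## Segments of arrays -/

/-- The entries of `f` with indices in `[l, r)`. -/
def seg (f : ℕ → ℕ) (l r : ℕ) : List ℕ := (List.range' l (r - l)).map f

theorem seg_of_le (f : ℕ → ℕ) {l r : ℕ} (h : r ≤ l) : seg f l r = [] := by
  simp [seg, Nat.sub_eq_zero_of_le h]

theorem seg_append (f : ℕ → ℕ) {l m r : ℕ} (h : l ≤ m) (h' : m ≤ r) :
    seg f l m ++ seg f m r = seg f l r := by
  have e : r - l = (m - l) + (r - m) := by omega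
  rw [seg, seg, seg, ← List.map_append, e, ← List.range'_append_1, show l + (m - l) = m by omega]

theorem seg_succ (f : ℕ → ℕ) (l : ℕ) : seg f l (l + 1) = [f l] := by simp [seg]

theorem seg_cons (f : ℕ → ℕ) {l r : ℕ} (h : l < r) : seg f l r = f l :: seg f (l + 1) r := by
  rw [← seg_append f (Nat.le_succ l) h, seg_succ]; rfl

theorem seg_congr {f g : ℕ → ℕ} {l r : ℕ} (h : ∀ i, l ≤ i → i < r → f i = g i) :
    seg f l r = seg g l r := by
  refine List.map_congr_left fun i hi => ?_
  rw [List.mem_range'_1] at hi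
  exact h i hi.1 (by omega)

theorem mem_seg {f : ℕ → ℕ} {l r x : ℕ} : x ∈ seg f l r ↔ ∃ i, l ≤ i ∧ i < r ∧ f i = x := by
  simp only [seg, List.mem_map, List.mem_range'_1]
  exact ⟨fun ⟨i, h, e⟩ => ⟨i, h.1, by omega, e⟩, fun ⟨i, h, h', e⟩ => ⟨i, ⟨h, by omega⟩, e⟩⟩

theorem pairwise_seg {f : ℕ → ℕ} {l r : ℕ} {R : ℕ → ℕ → Prop} :
    (seg f l r).Pairwise R ↔ ∀ i j, l ≤ i → i < j → j < r → R (f i) (f j) := by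
  simp only [seg, List.pairwise_iff_getElem, List.getElem_map, List.getElem_range', List.length_map,
    List.length_range', one_mul]
  refine ⟨fun h i j hi hij hj => ?_, fun h i j hi hj hij => h _ _ (by omega) (by omega) (by omega)⟩
  have := h (i - l) (j - l) (by omega) (by omega) (by omega)
  rwa [show l + (i - l) = i by omega, show l + (j - l) = j by omega] at this

/-! ## Merge sort -/

section mergeSort
variable {β : Type} [LinearOrder β]

theorem merge_sorted {κ : ℕ → β} {xs ys : List ℕ} (hx : xs.Pairwise fun x y => κ x ≤ κ y)
    (hy : ys.Pairwise fun x y => κ x ≤ κ y) :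
    (List.merge xs ys fun x y => decide (κ x ≤ κ y)).Pairwise fun x y => κ x ≤ κ y := by
  have := List.pairwise_merge (le := fun x y => decide (κ x ≤ κ y))
    (fun a b c h h' => by simp only [decide_eq_true_eq] at *; exact h.trans h')
    (fun a b => by simpa using le_total _ _) xs ys (by simpa using hx) (by simpa using hy)
  simpa using this

/-- `leq` decides the order of the keys `κ` of the elements with `D`, whatever the contents of
the arrays in `S`. -/
def Decides (leq : Word → Word → RAM Bool) (S : List Arr) (μ : Mem) (D : ℕ → Prop) (κ : ℕ → β)
    (B : ℕ) : Prop :=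
  ∀ μ', Frame S μ μ' → ∀ x y, D x → D y →
    Computes (leq ⟨x⟩ ⟨y⟩) μ' (decide (κ x ≤ κ y)) B

theorem Decides.of_frame {leq : Word → Word → RAM Bool} {S S' : List Arr} {μ μ' : Mem}
    {D : ℕ → Prop} {κ : ℕ → β} {B : ℕ} (h : Decides leq S μ D κ B) (hμ : Frame S μ μ')
    (hS : S' ⊆ S) : Decides leq S' μ' D κ B :=
  fun μ'' h'' => h μ'' (hμ.trans (h''.mono hS))

theorem wp_mergeRuns {leq : Word → Word → RAM Bool} {a : Arr} {l m r : ℕ} {μ : Mem} {τ : ℕ}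
    {D : ℕ → Prop} {κ : ℕ → β} {B : ℕ} (ha : a ≠ .tmp) (hleq : Decides leq [.tmp] μ D κ B)
    (hlm : l ≤ m) (hmr : m ≤ r) (hD : ∀ i, l ≤ i → i < r → D (μ a i))
    (h1 : ∀ i j, l ≤ i → i < j → j < m → κ (μ a i) ≤ κ (μ a j))
    (h2 : ∀ i j, m ≤ i → i < j → j < r → κ (μ a i) ≤ κ (μ a j)) :
    wp (mergeRuns leq a ⟨l⟩ ⟨m⟩ ⟨r⟩) μ τ fun _ μ' τ' =>
      (Frame [.tmp] μ μ' ∧ (∀ i, i < l ∨ r ≤ i → μ' .tmp i = μ .tmp i) ∧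
        (seg (μ' .tmp) l r).Perm (seg (μ a) l r) ∧
        ∀ i j, l ≤ i → i < j → j < r → κ (μ' .tmp i) ≤ κ (μ' .tmp j)) ∧
      τ' ≤ τ + ((r - l) * (B + 11) + 2) := by
  set mg := fun xs ys : List ℕ => List.merge xs ys fun x y => decide (κ x ≤ κ y) with hmg
  simp only [mergeRuns, wp_rules]
  -- What has been written, followed by `List.merge` of the two remainders, is always `List.merge`
  -- of the complete runs; sortedness and the permutation property are then inherited from the list
  -- function.
  refine wp_mono (wp_forLoop_of_cost (fun t s μ' => Frame [.tmp] μ μ' ∧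
    (∀ i, i < l ∨ r ≤ i → μ' .tmp i = μ .tmp i) ∧ l ≤ s.1.val ∧ s.1.val ≤ m ∧ m ≤ s.2.val ∧
    s.2.val ≤ r ∧ s.1.val - l + (s.2.val - m) = t ∧
    seg (μ' .tmp) l (l + t) ++ mg (seg (μ a) s.1.val m) (seg (μ a) s.2.val r) =
      mg (seg (μ a) l m) (seg (μ a) m r)) (B + 10) ?_ ?_) ?_
  · refine ⟨Frame.refl _ _, fun _ _ => rfl, le_rfl, hlm, le_rfl, hmr, by simp, ?_⟩
    rw [Nat.add_zero, seg_of_le _ le_rfl]; rfl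
  · rintro k ⟨⟨p⟩, ⟨q⟩⟩ μ' τ' hk ⟨hF, hout, hp, hp', hq, hq', hpq, hs⟩
    simp only at hk hp hp' hq hq' hpq hs
    have hread : μ' a = μ a := hF a (by simpa using ha)
    have hadd : ∀ v, seg (upd μ' .tmp (l + k) v .tmp) l (l + k + 1) =
        seg (μ' .tmp) l (l + k) ++ [v] := fun v => by
      rw [← seg_append _ (Nat.le_add_right l k) (Nat.le_succ _), seg_succ, upd_same]
      congr 1
      exact seg_congr fun i _ hi => by rw [upd_self, if_neg (by omega)]
    have hL : p < m → ∀ τ'', (q < r → κ (μ a p) ≤ κ (μ a q)) → τ'' ≤ τ' + 10 + B →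
        (Frame [.tmp] μ (upd μ' .tmp (l + k) (μ' a p)) ∧
        (∀ i, i < l ∨ r ≤ i → upd μ' .tmp (l + k) (μ' a p) .tmp i = μ .tmp i) ∧ l ≤ p + 1 ∧
        p + 1 ≤ m ∧ m ≤ q ∧ q ≤ r ∧ p + 1 - l + (q - m) = k + 1 ∧
        seg (upd μ' .tmp (l + k) (μ' a p) .tmp) l (l + (k + 1)) ++
          mg (seg (μ a) (p + 1) m) (seg (μ a) q r) = mg (seg (μ a) l m) (seg (μ a) m r)) ∧
        τ'' ≤ τ' + (B + 10) := by
      intro hpm τ'' hle ht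
      refine ⟨⟨hF.upd (by simp) _ _, fun i hi => ?_, by omega, hpm, hq, hq', by omega, ?_⟩,
        by omega⟩
      · rw [upd_self, if_neg (by omega)]; exact hout i hi
      · rw [← hs, ← Nat.add_assoc, hadd, hread, List.append_assoc, seg_cons (μ a) hpm]
        congr 1
        rcases Nat.lt_or_ge q r with hqr | hqr
        · rw [seg_cons (μ a) hqr, hmg]
          simp [hle hqr]
        · rw [seg_of_le _ hqr, hmg]; simp
    have hR : q < r → ∀ τ'', (p < m → ¬ κ (μ a p) ≤ κ (μ a q)) → τ'' ≤ τ' + 10 + B →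
        (Frame [.tmp] μ (upd μ' .tmp (l + k) (μ' a q)) ∧
        (∀ i, i < l ∨ r ≤ i → upd μ' .tmp (l + k) (μ' a q) .tmp i = μ .tmp i) ∧ l ≤ p ∧
        p ≤ m ∧ m ≤ q + 1 ∧ q + 1 ≤ r ∧ p - l + (q + 1 - m) = k + 1 ∧
        seg (upd μ' .tmp (l + k) (μ' a q) .tmp) l (l + (k + 1)) ++
          mg (seg (μ a) p m) (seg (μ a) (q + 1) r) = mg (seg (μ a) l m) (seg (μ a) m r)) ∧
        τ'' ≤ τ' + (B + 10) := by
      intro hqr τ'' hle ht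
      refine ⟨⟨hF.upd (by simp) _ _, fun i hi => ?_, by omega, hp', by omega, hqr, by omega, ?_⟩,
        by omega⟩
      · rw [upd_self, if_neg (by omega)]; exact hout i hi
      · rw [← hs, ← Nat.add_assoc, hadd, hread, List.append_assoc, seg_cons (μ a) hqr]
        congr 1
        rcases Nat.lt_or_ge p m with hpm | hpm
        · rw [seg_cons (μ a) hpm, hmg]
          simp [hle hpm]
        · rw [seg_of_le _ hpm, hmg]; simp
    simp only [wp_rules, decide_eq_true_eq, Word.val_one]
    split_ifs with hpm hqr
    · have hc := hleq μ' hF (μ a p) (μ a q) (hD _ hp (by omega)) (hD _ (by omega) hqr)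
      rw [hread]
      refine wp_mono (hc _) ?_
      rintro _ _ τ'' ⟨rfl, rfl, ht'⟩
      simp only [decide_eq_true_eq, hread] at hL hR ⊢
      split_ifs with hle
      · exact hL hpm _ (fun _ => hle) (by omega)
      · exact hR hqr _ (fun _ => hle) (by omega)
    · exact hL hpm _ (fun h => absurd h hqr) (by omega)
    · exact False.elim ‹False›
    · exact hR (by omega) _ (fun h => absurd h hpm) (by omega)
  · rintro ⟨⟨p⟩, ⟨q⟩⟩ μ' τ' ⟨⟨hF, hout, hp, hp', hq, hq', hpq, hs⟩, ht⟩
    simp only at hp hp' hq hq' hpq hs ht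
    have hs' : seg (μ' .tmp) l r = mg (seg (μ a) l m) (seg (μ a) m r) := by
      rw [← hs, seg_of_le (μ a) (show m ≤ p by omega), seg_of_le (μ a) (show r ≤ q by omega), hmg,
        show l + (r - l) = r by omega]
      simp
    refine ⟨⟨hF, hout, ?_, ?_⟩, ?_⟩
    · rw [hs', ← seg_append (μ a) hlm hmr]
      exact List.merge_perm_append _
    · rw [← pairwise_seg (R := fun x y => κ x ≤ κ y), hs']
      exact merge_sorted (pairwise_seg.2 h1) (pairwise_seg.2 h2)
    · have e : B + 10 + 1 = B + 11 := rfl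
      rw [e] at ht; omega

/-- Time of a merge sort of `n` elements if a comparison takes time `B`. -/
def mergeTime (B n : ℕ) : ℕ := Nat.size n * (n * (B + 60)) + 5

theorem wp_mergeSort {leq : Word → Word → RAM Bool} {a : Arr} {lo hi : ℕ} {μ : Mem} {τ : ℕ}
    {D : ℕ → Prop} {κ : ℕ → β} {B : ℕ} (ha : a ≠ .tmp) (hleq : Decides leq [a, .tmp] μ D κ B)
    (hlh : lo ≤ hi) (hD : ∀ i, lo ≤ i → i < hi → D (μ a i)) :
    wp (mergeSort leq a ⟨lo⟩ ⟨hi⟩) μ τ fun _ μ' τ' =>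
      (Frame [a, .tmp] μ μ' ∧ (∀ i, i < lo ∨ hi ≤ i → μ' a i = μ a i) ∧
        (seg (μ' a) lo hi).Perm (seg (μ a) lo hi) ∧
        ∀ i j, lo ≤ i → i < j → j < hi → κ (μ' a i) ≤ κ (μ' a j)) ∧
      τ' ≤ τ + mergeTime B (hi - lo) := by
  set len := hi - lo with hlen
  simp only [mergeSort, wp_rules]
  -- All blocks of width `w`, counted from `lo`, are sorted. The number of rounds left is bounded by
  -- the bit length of `(len - 1) / w`, which loses a bit when `w` doubles and vanishes once `w ≥
  -- len`.
  refine wp_whileLoop (fun w μ' τ' => (Frame [a, .tmp] μ μ' ∧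
      (∀ i, i < lo ∨ hi ≤ i → μ' a i = μ a i) ∧ (seg (μ' a) lo hi).Perm (seg (μ a) lo hi) ∧
      ∀ c i j, lo + c * w.val ≤ i → i < j → j < lo + (c + 1) * w.val → j < hi →
        κ (μ' a i) ≤ κ (μ' a j)) ∧ 1 ≤ w.val ∧
      τ' + Nat.size ((len - 1) / w.val) * (len * (B + 60)) ≤
        τ + 1 + Nat.size (len - 1) * (len * (B + 60)))
    (fun w => len - w.val) ?_ ?_ ?_ ?_
  · refine ⟨⟨Frame.refl _ _, fun _ _ => rfl, .refl _, fun c i j h1 h2 h3 => ?_⟩, by simp, by simp⟩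
    simp only [Word.val_one, mul_one] at h1 h3
    omega
  · simp [← hlen]
  · rintro ⟨w⟩ μ₁ τ₁ ⟨⟨hF, hout, hperm, hsort⟩, hw, ht⟩
    simp only at hsort hw ht
    simp only [wp_rules, decide_eq_true_eq]
    have hfin : ¬ w < len → Nat.size (len - 1) * (len * (B + 60)) ≤
        Nat.size len * (len * (B + 60)) := fun _ =>
      Nat.mul_le_mul_right _ (Nat.size_le_size (by omega))
    split_ifs with hwl
    · refine wp_mono (wp_whileLoop (σ := Word) (τ := τ₁ + 1 + 1) (μ := μ₁) (s := ⟨lo⟩) (k := ⟨len⟩)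
        (Q := fun _ μ₂ τ₂ => (Frame [.tmp] μ₁ μ₂ ∧ (seg (μ₂ .tmp) lo hi).Perm (seg (μ₁ a) lo hi) ∧
          ∀ c i j, lo + c * (2 * w) ≤ i → i < j → j < lo + (c + 1) * (2 * w) → j < hi →
            κ (μ₂ .tmp i) ≤ κ (μ₂ .tmp j)) ∧ τ₂ ≤ τ₁ + 5 + len * (B + 50))
        (fun (i : Word) μ₂ τ₂ => (lo ≤ i.val ∧ i.val ≤ hi ∧ (i.val < hi → ∃ c, i.val = lo + c * (2 * w)) ∧
          Frame [.tmp] μ₁ μ₂ ∧ (seg (μ₂ .tmp) lo i.val).Perm (seg (μ₁ a) lo i.val) ∧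
          ∀ c x y, lo + c * (2 * w) ≤ x → x < y → y < lo + (c + 1) * (2 * w) → y < i.val →
            κ (μ₂ .tmp x) ≤ κ (μ₂ .tmp y)) ∧ τ₂ ≤ τ₁ + 2 + (i.val - lo) * (B + 50))
        (fun (i : Word) => hi - i.val) ?_ ?_ ?_ ?_) ?_
      · refine ⟨⟨le_rfl, hlh, fun _ => ⟨0, by simp⟩, Frame.refl _ _, ?_, ?_⟩, by simp⟩
        · simp [seg_of_le]
        · intro c x y _ _ _ h; simp only at h; omega
      · exact le_rfl
      · rintro ⟨i⟩ μ₂ τ₂ ⟨⟨hi1, hi2, hc, hF₂, hp₂, hs₂⟩, ht₂⟩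
        simp only at hi1 hi2 hc hp₂ hs₂ ht₂
        simp only [wp_rules, decide_eq_true_eq, minWord]
        have ha₂ : μ₂ a = μ₁ a := hF₂ a (by simpa using ha)
        have key : ∀ m r τ₃, i < hi → m = min (i + w) hi → r = min (m + w) hi → τ₃ ≤ τ₂ + 10 →
            wp (mergeRuns leq a ⟨i⟩ ⟨m⟩ ⟨r⟩) μ₂ τ₃ fun _ μ₃ τ₄ => hi - r < hi - i ∧
            (lo ≤ r ∧ r ≤ hi ∧ (r < hi → ∃ c, r = lo + c * (2 * w)) ∧
            Frame [.tmp] μ₁ μ₃ ∧ (seg (μ₃ .tmp) lo r).Perm (seg (μ₁ a) lo r) ∧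
            ∀ c x y, lo + c * (2 * w) ≤ x → x < y → y < lo + (c + 1) * (2 * w) → y < r →
              κ (μ₃ .tmp x) ≤ κ (μ₃ .tmp y)) ∧ τ₄ ≤ τ₁ + 2 + (r - lo) * (B + 50) := by
          intro m r τ₃ hih hm hr ht₃
          obtain ⟨c, hc⟩ := hc hih
          -- Blocks `2c` and `2c + 1` of width `w` form block `c` of width `2w`; these identities
          -- spare `omega` the products.
          have e1 : lo + (2 * c) * w = i := by rw [hc]; ring
          have e2 : lo + (2 * c + 1) * w = i + w := by rw [hc]; ring
          have e3 : lo + (2 * c + 1 + 1) * w = i + w + w := by rw [hc]; ring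
          have e4 : lo + (c + 1) * (2 * w) = i + w + w := by rw [hc]; ring
          refine wp_mono (wp_mergeRuns ha
            (hleq.of_frame (S' := [.tmp]) (hF.trans (hF₂.mono (by simp))) (by simp))
            (m := m) (by omega) (by omega) ?_ ?_ ?_) ?_
          · intro x hx hx'
            rw [ha₂]
            have : μ₁ a x ∈ seg (μ a) lo hi :=
              hperm.subset (mem_seg.2 ⟨x, by omega, by omega, rfl⟩)
            obtain ⟨y, hy, hy', e⟩ := mem_seg.1 this
            exact e ▸ hD y hy hy'
          · intro x y hx hxy hy
            rw [ha₂]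
            exact hsort (2 * c) x y (by omega) hxy (by omega) (by omega)
          · intro x y hx hxy hy
            rw [ha₂]
            exact hsort (2 * c + 1) x y (by omega) hxy (by omega) (by omega)
          · rintro _ μ₃ τ₄ ⟨⟨hF₃, hout₃, hp₃, hs₃⟩, ht₄⟩
            refine ⟨by omega, ⟨by omega, by omega, fun hrh => ⟨c + 1, by omega⟩,
              hF₂.trans hF₃, ?_, ?_⟩, ?_⟩
            · rw [← seg_append (μ₃ .tmp) hi1 (show i ≤ r by omega),
                ← seg_append (μ₁ a) hi1 (show i ≤ r by omega),
                seg_congr (f := μ₃ .tmp) (g := μ₂ .tmp) fun x _ hx => hout₃ x (Or.inl hx), ← ha₂]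
              exact (ha₂ ▸ hp₂).append hp₃
            · intro c' x y hx hxy hy hyr
              rcases lt_trichotomy c' c with h | h | h
              · have h' : (c' + 1) * (2 * w) ≤ c * (2 * w) := Nat.mul_le_mul_right _ h
                rw [hout₃ x (Or.inl (by omega)), hout₃ y (Or.inl (by omega))]
                exact hs₂ c' x y hx hxy hy (by omega)
              · subst h
                exact hs₃ x y (by omega) hxy hyr
              · have h' : (c + 1) * (2 * w) ≤ c' * (2 * w) := Nat.mul_le_mul_right _ h
                omega
            · have e5 : (r - lo) * (B + 50) = (i - lo) * (B + 50) + (r - i) * (B + 50) := by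
                rw [← Nat.add_mul]; congr 1; omega
              have e6 : (r - i) * (B + 50) = (r - i) * (B + 11) + (r - i) * 39 := by
                rw [← Nat.mul_add]
              omega
        split_ifs with h1 h2 h3 h3
        · refine key _ _ _ h1 (by omega) (by omega) (by omega)
        · refine key _ _ _ h1 (by omega) (by omega) (by omega)
        · refine key _ _ _ h1 (by omega) (by omega) (by omega)
        · refine key _ _ _ h1 (by omega) (by omega) (by omega)
        · have : i = hi := by omega
          subst this
          refine ⟨⟨hF₂, hp₂, hs₂⟩, ?_⟩
          have : len * (B + 50) = (i - lo) * (B + 50) := by rw [hlen]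
          omega
      · rintro ⟨i⟩ μ₂ τ₂ ⟨⟨hi1, hi2, hc, hF₂, hp₂, hs₂⟩, ht₂⟩ h0
        simp only at hi1 hi2 hc hp₂ hs₂ ht₂ h0 ⊢
        have : i = hi := by omega
        subst this
        refine ⟨⟨hF₂, hp₂, hs₂⟩, ?_⟩
        have : len * (B + 50) = (i - lo) * (B + 50) := by rw [hlen]
        omega
      · rintro _ μ₂ τ₂ ⟨⟨hF₂, hp₂, hs₂⟩, ht₂⟩
        refine wp_mono (wp_forEach (fun t μ₃ => Frame [a] μ₂ μ₃ ∧
          (∀ i, i < lo ∨ lo + t ≤ i → μ₃ a i = μ₂ a i) ∧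
          ∀ i, lo ≤ i → i < lo + t → μ₃ a i = μ₂ .tmp i) 3 ?_ ?_) ?_
        · exact ⟨Frame.refl _ _, fun _ _ => rfl, fun i h h' => by omega⟩
        · rintro t μ₃ τ₃ htl ⟨hF₃, ho₃, hc₃⟩
          simp only [wp_rules]
          refine ⟨⟨hF₃.upd (by simp) _ _, fun i hi => ?_, fun i h1 h2 => ?_⟩, by omega⟩
          · rw [upd_self, if_neg (by omega)]
            exact ho₃ i (by omega)
          · rw [upd_self]
            split_ifs with h
            · rw [hF₃ .tmp (by simpa using ha.symm), h]
            · exact hc₃ i h1 (by omega)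
        · rintro _ μ₃ τ₃ ⟨⟨hF₃, ho₃, hc₃⟩, ht₃⟩
          simp only at ho₃ hc₃ ht₃ ⊢
          have hc₃' : ∀ i, lo ≤ i → i < hi → μ₃ a i = μ₂ .tmp i :=
            fun i h h' => hc₃ i h (by omega)
          refine ⟨by omega, ⟨?_, ?_, ?_, ?_⟩, by omega, ?_⟩
          · exact hF.trans ((hF₂.mono (by simp)).trans (hF₃.mono (by simp)))
          · intro i hi
            rw [ho₃ i (by omega), hF₂ a (by simpa using ha), hout i hi]
          · rw [seg_congr hc₃']
            exact hp₂.trans hperm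
          · intro c i j h1 h2 h3 h4
            have e : lo + c * (2 * w) ≤ i := by rw [Nat.two_mul]; exact h1
            have hlo : lo ≤ i := le_trans (Nat.le_add_right _ _) e
            rw [hc₃' i hlo (by omega), hc₃' j (by omega) h4]
            exact hs₂ c i j e h2 (by rw [Nat.two_mul]; exact h3) h4
          · have hs : Nat.size ((len - 1) / (w + w)) + 1 ≤ Nat.size ((len - 1) / w) := by
              rw [← Nat.mul_two, ← Nat.div_div_eq_div_mul]
              exact size_lt_size (Nat.div_pos (by omega) (by omega)) le_rfl
            have := Nat.mul_le_mul_right (len * (B + 60)) hs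
            rw [Nat.add_mul] at this
            have e7 : len * (B + 60) = len * (B + 50) + len * 10 := by rw [← Nat.mul_add]
            have e8 : len * (3 + 1) = len * 4 := rfl
            omega
    · refine ⟨⟨hF, hout, hperm, fun i j h1 h2 h3 => hsort 0 i j (by omega) h2 (by omega) h3⟩, ?_⟩
      have := hfin hwl
      unfold mergeTime
      omega
  · rintro ⟨w⟩ μ₁ τ₁ ⟨⟨hF, hout, hperm, hsort⟩, hw, ht⟩ h0
    simp only at hsort hw ht h0 ⊢
    refine ⟨⟨hF, hout, hperm, fun i j h1 h2 h3 => hsort 0 i j (by omega) h2 (by omega) h3⟩, ?_⟩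
    have : Nat.size (len - 1) * (len * (B + 60)) ≤ Nat.size len * (len * (B + 60)) :=
      Nat.mul_le_mul_right _ (Nat.size_le_size (by omega))
    unfold mergeTime
    omega

end mergeSort

/-! ### Permutations stored in arrays -/

/-- The first `n` entries of `f` are a permutation of `0, …, n - 1`. -/
structure IsPerm (f : ℕ → ℕ) (n : ℕ) : Prop where
  lt : ∀ i, i < n → f i < n
  inj : ∀ i j, i < n → j < n → f i = f j → i = j

theorem IsPerm.surj {f : ℕ → ℕ} {n : ℕ} (h : IsPerm f n) {k : ℕ} (hk : k < n) :
    ∃ i, i < n ∧ f i = k := by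
  have hinj : Function.Injective fun i : Fin n => (⟨f i, h.lt i i.2⟩ : Fin n) := fun i j hij =>
    Fin.ext (h.inj i j i.2 j.2 (by simpa using hij))
  obtain ⟨i, hi⟩ := (Finite.injective_iff_surjective.1 hinj) ⟨k, hk⟩
  exact ⟨i, i.2, by simpa using hi⟩

theorem IsPerm.id (n : ℕ) : IsPerm (fun i => i) n := ⟨fun _ h => h, fun _ _ _ _ h => h⟩

theorem IsPerm.congr {f g : ℕ → ℕ} {n : ℕ} (h : IsPerm f n) (hfg : ∀ i, i < n → g i = f i) :
    IsPerm g n :=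
  ⟨fun i hi => hfg i hi ▸ h.lt i hi, fun i j hi hj e => h.inj i j hi hj (by
    rwa [hfg i hi, hfg j hj] at e)⟩

/-- Merge sort only promises a permutation of lists; the absence of duplicates is what carries
injectivity over. -/
theorem IsPerm.of_seg {f g : ℕ → ℕ} {n : ℕ} (h : IsPerm f n)
    (hp : (seg g 0 n).Perm (seg f 0 n)) : IsPerm g n := by
  have hn : (seg f 0 n).Nodup := by
    rw [List.Nodup, pairwise_seg]
    exact fun i j _ hij hj e => hij.ne (h.inj i j (by omega) hj e)
  have hn' := hp.nodup_iff.2 hn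
  rw [List.Nodup, pairwise_seg] at hn'
  refine ⟨fun i hi => ?_, fun i j hi hj e => ?_⟩
  · obtain ⟨j, _, hj, e⟩ := mem_seg.1 (hp.subset (mem_seg.2 ⟨i, Nat.zero_le i, hi, rfl⟩))
    exact e ▸ h.lt j hj
  · rcases lt_trichotomy i j with hij | hij | hij
    · exact absurd e (hn' i j (Nat.zero_le _) hij hj)
    · exact hij
    · exact absurd e.symm (hn' j i (Nat.zero_le _) hij hi)

/-! ## Bucket sort -/

/-- The entries `a[0, len)` have keys `kf < numKeys` in increasing order, and `ends` holds the
right ends of the buckets. -/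
structure Bucketed (a ends : ℕ → ℕ) (len numKeys : ℕ) (kf : ℕ → ℕ) : Prop where
  key_lt : ∀ j, j < len → kf (a j) < numKeys
  ends_le : ∀ c, c < numKeys → ends c ≤ len
  lt_ends : ∀ c j, c < numKeys → j < len → (j < ends c ↔ kf (a j) ≤ c)

theorem count_lt_succ (k : ℕ → ℕ) (c n : ℕ) :
    Nat.count (fun j => k j < c) n + Nat.count (fun j => k j = c) n =
      Nat.count (fun j => k j < c + 1) n := by
  induction n with
  | zero => simp
  | succ n ih =>
    simp only [Nat.count_succ, ← ih]
    split_ifs <;> omega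

theorem count_lt_mono (k : ℕ → ℕ) {c c' : ℕ} (h : c ≤ c') (n : ℕ) :
    Nat.count (fun j => k j < c) n ≤ Nat.count (fun j => k j < c') n :=
  Nat.count_mono_left fun _ _ hk => lt_of_lt_of_le hk h

/-- The position of the `j`-th element after a stable bucket sort of `n` elements with keys `k`. -/
def bucketPos (k : ℕ → ℕ) (n j : ℕ) : ℕ :=
  Nat.count (fun i => k i < k j) n + Nat.count (fun i => k i = k j) j

theorem bucketPos_lt_count (k : ℕ → ℕ) {n j : ℕ} (hj : j < n) :
    bucketPos k n j < Nat.count (fun i => k i < k j + 1) n := by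
  rw [← count_lt_succ, bucketPos]
  exact Nat.add_lt_add_left (Nat.count_strict_mono (p := fun i => k i = k j) rfl hj) _

theorem bucketPos_lt (k : ℕ → ℕ) {n j : ℕ} (hj : j < n) : bucketPos k n j < n :=
  (bucketPos_lt_count k hj).trans_le (Nat.count_le _)

theorem bucketPos_lt_bucketPos (k : ℕ → ℕ) {n i j : ℕ} (hi : i < n)
    (h : k i < k j ∨ k i = k j ∧ i < j) : bucketPos k n i < bucketPos k n j := by
  rcases h with h | ⟨h, hij⟩
  · exact (bucketPos_lt_count k hi).trans_le
      ((count_lt_mono k h n).trans (Nat.le_add_right _ _))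
  · rw [bucketPos, bucketPos, h]
    exact Nat.add_lt_add_left (Nat.count_strict_mono (p := fun i => k i = k j) h hij) _

/-- Positions follow the lexicographic order of (key, index). This one equivalence contains
sortedness, stability and, by trichotomy, bijectivity. -/
theorem bucketPos_lt_bucketPos_iff (k : ℕ → ℕ) {n i j : ℕ} (hi : i < n) (hj : j < n) :
    bucketPos k n i < bucketPos k n j ↔ k i < k j ∨ k i = k j ∧ i < j := by
  refine ⟨fun h => ?_, bucketPos_lt_bucketPos k hi⟩
  by_contra hc
  have : i = j ∨ (k j < k i ∨ k j = k i ∧ j < i) := by omega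
  rcases this with rfl | h'
  · exact lt_irrefl _ h
  · exact lt_asymm h (bucketPos_lt_bucketPos k hj h')

theorem isPerm_bucketPos (k : ℕ → ℕ) (n : ℕ) : IsPerm (bucketPos k n) n := by
  refine ⟨fun i hi => bucketPos_lt k hi, fun i j hi hj e => ?_⟩
  have h1 := bucketPos_lt_bucketPos_iff k hi hj
  have h2 := bucketPos_lt_bucketPos_iff k hj hi
  omega

/-- The target of an element is determined by the source alone: the number of smaller keys plus the
number of equal keys before it. The key has to be computed correctly while `dst` and `ends` are
being overwritten, hence the frame in `hkey`. -/
theorem wp_bucketSort {key : Word → RAM Word} {src dst ends : Arr} {len numKeys : ℕ} {μ : Mem}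
    {τ : ℕ} {kf : ℕ → ℕ} {B : ℕ} (h1 : src ≠ dst) (h2 : src ≠ ends) (h3 : dst ≠ ends)
    (hkey : ∀ μ', Frame [dst, ends] μ μ' → ∀ i, i < len →
      Computes (key ⟨μ src i⟩) μ' ⟨kf (μ src i)⟩ B)
    (hlt : ∀ i, i < len → kf (μ src i) < numKeys) :
    wp (bucketSort key src dst ends ⟨len⟩ ⟨numKeys⟩) μ τ fun _ μ' τ' =>
      (Frame [dst, ends] μ μ' ∧
        (∀ j, j < len → μ' dst (bucketPos (fun i => kf (μ src i)) len j) = μ src j) ∧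
        Bucketed (μ' dst) (μ' ends) len numKeys kf) ∧
      τ' ≤ τ + (len * (2 * B + 20) + numKeys * 10 + 10) := by
  set k := fun i => kf (μ src i) with hk
  simp only [bucketSort, wp_rules, Word.val_one]
  refine wp_mono (wp_forEach (fun c μ' => Frame [dst, ends] μ μ' ∧ ∀ c', c' < c → μ' ends c' = 0)
    1 ⟨Frame.refl _ _, fun _ h => absurd h (Nat.not_lt_zero _)⟩ ?_) ?_
  · rintro c μ' τ' _ ⟨hF, hz⟩
    simp only [wp_rules, Word.val_zero]
    refine ⟨⟨hF.upd (by simp) _ _, fun c' hc' => ?_⟩, le_rfl⟩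
    rw [upd_self]
    split_ifs with h
    · rfl
    · exact hz c' (by omega)
  rintro _ μ₁ τ₁ ⟨⟨hF₁, hz₁⟩, ht₁⟩
  simp only at hz₁ ht₁
  -- The counts are shifted by one, so that the summation that follows turns `ends c` into the
  -- number of keys below `c`, the left end of bucket `c`.
  refine wp_mono (wp_forEach (fun i μ' => Frame [dst, ends] μ μ' ∧ μ' ends 0 = 0 ∧
    ∀ c, c < numKeys → μ' ends (c + 1) = Nat.count (fun j => k j = c) i) (B + 5) ?_ ?_) ?_
  · exact ⟨hF₁, hz₁ 0 (by omega), fun c hc => by simp [hz₁ (c + 1) (by omega)]⟩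
  · rintro i μ' τ' hi ⟨hF, h0, hc⟩
    simp only [wp_rules]
    have hs : μ' src = μ src := hF src (by simp [h1, h2])
    rw [hs]
    refine wp_mono (hkey μ' hF i hi _) ?_
    rintro _ _ τ'' ⟨rfl, rfl, ht''⟩
    simp only [Word.val_one]
    refine ⟨⟨hF.upd (by simp) _ _, ?_, fun c hcn => ?_⟩, by omega⟩
    · rw [upd_self, if_neg (by omega), h0]
    · rw [upd_self, Nat.count_succ, hc _ (hlt i hi)]
      by_cases hci : k i = c
      · have : c + 1 = kf (μ src i) + 1 := by rw [← hci]
        rw [if_pos this, if_pos hci, ← hci]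
      · have : ¬ c + 1 = kf (μ src i) + 1 := fun h => hci (by simp only [hk]; omega)
        rw [if_neg this, if_neg hci, hc c hcn, Nat.add_zero]
  rintro _ μ₂ τ₂ ⟨⟨hF₂, h0₂, hc₂⟩, ht₂⟩
  simp only at hc₂ ht₂
  refine wp_mono (wp_forEach (fun c μ' => Frame [dst, ends] μ μ' ∧
    (∀ c', c' ≤ c → μ' ends c' = Nat.count (fun j => k j < c') len) ∧
    ∀ c', c ≤ c' → c' < numKeys → μ' ends (c' + 1) = Nat.count (fun j => k j = c') len) 5 ?_ ?_) ?_
  · refine ⟨hF₂, fun c' hc' => ?_, fun c' _ h => hc₂ c' h⟩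
    obtain rfl : c' = 0 := by omega
    rw [h0₂, eq_comm]; simp
  · rintro c μ' τ' hcn ⟨hF, hle, hge⟩
    simp only [wp_rules, Word.val_one]
    simp only at hcn
    refine ⟨⟨hF.upd (by simp) _ _, fun c' hc' => ?_, fun c' hc' hcn' => ?_⟩, by omega⟩
    · rw [upd_self]
      split_ifs with h
      · rw [h, hge c le_rfl hcn, hle c le_rfl, ← count_lt_succ]; omega
      · exact hle c' (by omega)
    · rw [upd_self, if_neg (by omega)]
      exact hge c' (by omega) hcn'
  rintro _ μ₃ τ₃ ⟨⟨hF₃, hle₃, -⟩, ht₃⟩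
  simp only at hle₃ ht₃
  -- Now `ends c` is the left end plus the elements of bucket `c` distributed so far; for the next
  -- element this is exactly `bucketPos`, and after the last element it is the right end.
  refine wp_mono (wp_forEach (fun i μ' => Frame [dst, ends] μ μ' ∧
    (∀ c, c < numKeys → μ' ends c = Nat.count (fun j => k j < c) len +
      Nat.count (fun j => k j = c) i) ∧
    ∀ j, j < i → μ' dst (bucketPos k len j) = μ src j) (B + 6) ?_ ?_) ?_
  · exact ⟨hF₃, fun c hc => by simp [hle₃ c hc.le], fun j hj => absurd hj (Nat.not_lt_zero _)⟩
  · rintro i μ' τ' hi ⟨hF, hc, hd⟩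
    simp only [wp_rules]
    have hs : μ' src = μ src := hF src (by simp [h1, h2])
    rw [hs]
    refine wp_mono (hkey μ' hF i hi _) ?_
    rintro _ _ τ'' ⟨rfl, rfl, ht''⟩
    simp only [Word.val_one]
    refine ⟨⟨(hF.upd (by simp) _ _).upd (by simp) _ _, fun c hcn => ?_, fun j hj => ?_⟩, by omega⟩
    · rw [upd_self, upd_ne _ _ _ h3.symm, Nat.count_succ, hc _ (hlt i hi)]
      by_cases hci : k i = c
      · have : c = kf (μ src i) := by rw [← hci]
        rw [if_pos this, if_pos hci, ← this, Nat.add_assoc]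
      · have : ¬ c = kf (μ src i) := fun h => hci h.symm
        rw [if_neg this, if_neg hci, hc c hcn, Nat.add_zero]
    · rw [upd_ne _ _ _ h3, upd_self, hc _ (hlt i hi)]
      change (if _ = bucketPos k len i then _ else _) = _
      split_ifs with h
      · rw [(isPerm_bucketPos k len).inj j i (by simp at hi; omega) hi h]
      · refine hd j (lt_of_le_of_ne (Nat.lt_succ_iff.1 hj) ?_)
        rintro rfl; exact h rfl
  rintro _ μ₄ τ₄ ⟨⟨hF₄, hc₄, hd₄⟩, ht₄⟩
  simp only at hc₄ hd₄ ht₄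
  refine ⟨⟨hF₄, hd₄, ?_, fun c hcn => ?_, fun c j hcn hj => ?_⟩, ?_⟩
  · intro j hj
    obtain ⟨i, hi, rfl⟩ := (isPerm_bucketPos k len).surj hj
    rw [hd₄ i hi]
    exact hlt i hi
  · rw [hc₄ c hcn, count_lt_succ]; exact Nat.count_le _
  · obtain ⟨i, hi, rfl⟩ := (isPerm_bucketPos k len).surj hj
    rw [hd₄ i hi, hc₄ c hcn, count_lt_succ]
    refine ⟨fun h => ?_, fun h => ?_⟩
    · by_contra hc
      refine absurd (h.trans_le (count_lt_mono k (Nat.succ_le_of_lt (not_le.1 hc)) len)) ?_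
      exact not_lt.2 (Nat.le_add_right _ _)
    · exact (bucketPos_lt_count k hi).trans_le (count_lt_mono k (Nat.succ_le_succ h) len)
  · have e1 : len * (2 * B + 20) = len * (B + 5 + 1) + len * (B + 6 + 1) + len * 7 := by ring
    omega

/-- A bucket sort of a permutation yields a permutation. -/
theorem isPerm_of_bucketPos {f g k : ℕ → ℕ} {len : ℕ} (hf : IsPerm f len)
    (h : ∀ j, j < len → g (bucketPos k len j) = f j) : IsPerm g len := by
  have hp := isPerm_bucketPos k len
  refine ⟨fun i hi => ?_, fun i j hi hj e => ?_⟩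
  · obtain ⟨i, hi', rfl⟩ := hp.surj hi
    rw [h i hi']; exact hf.lt i hi'
  · obtain ⟨i, hi', rfl⟩ := hp.surj hi
    obtain ⟨j, hj', rfl⟩ := hp.surj hj
    rw [h i hi', h j hj'] at e
    rw [hf.inj i j hi' hj' e]

/-- A bucket sort is stable. -/
theorem sorted_of_bucketPos {f g kf : ℕ → ℕ} {len : ℕ}
    (h : ∀ j, j < len → g (bucketPos (fun i => kf (f i)) len j) = f j) {R : ℕ → ℕ → Prop}
    (hR : ∀ i j, i < j → j < len → R (f i) (f j)) {a b : ℕ} (hab : a < b) (hb : b < len) :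
    kf (g a) < kf (g b) ∨ kf (g a) = kf (g b) ∧ R (g a) (g b) := by
  have hp := isPerm_bucketPos (fun i => kf (f i)) len
  obtain ⟨i, hi, rfl⟩ := hp.surj (hab.trans hb)
  obtain ⟨j, hj, rfl⟩ := hp.surj hb
  rw [h i hi, h j hj]
  rcases (bucketPos_lt_bucketPos_iff _ hi hj).1 hab with h' | ⟨h', hij⟩
  · exact Or.inl h'
  · exact Or.inr ⟨h', hR i j hij hj⟩

/-! ## Sorting the buckets -/

section sortBuckets
variable {β : Type} [LinearOrder β]

/-- Sorted by the key `kf`, ties being broken by `κ`. -/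
def LexSorted (a : ℕ → ℕ) (len : ℕ) (kf : ℕ → ℕ) (κ : ℕ → β) : Prop :=
  ∀ i j, i < j → j < len → kf (a i) < kf (a j) ∨ kf (a i) = kf (a j) ∧ κ (a i) ≤ κ (a j)

theorem wp_sortBuckets {leq : Word → Word → RAM Bool} {a ends : Arr} {len numKeys : ℕ} {μ : Mem}
    {τ : ℕ} {D : ℕ → Prop} {kf : ℕ → ℕ} {κ : ℕ → β} {B : ℕ} (ha : a ≠ .tmp) (he : ends ≠ .tmp)
    (hae : ends ≠ a) (hleq : Decides leq [a, .tmp] μ D κ B) (hD : ∀ i, i < len → D (μ a i))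
    (hb : Bucketed (μ a) (μ ends) len numKeys kf) :
    wp (sortBuckets leq a ends ⟨numKeys⟩) μ τ fun _ μ' τ' =>
      (Frame [a, .tmp] μ μ' ∧ (seg (μ' a) 0 len).Perm (seg (μ a) 0 len) ∧
        LexSorted (μ' a) len kf κ) ∧
      τ' ≤ τ + (Nat.size len * (len * (B + 60)) + numKeys * 7 + 1) := by
  simp only [sortBuckets, wp_rules]
  -- The time is charged to the entries passed rather than to the buckets: each entry pays one bit
  -- length of `len`, each bucket only a constant.
  refine wp_mono (wp_forLoop (fun c lo μ' τ' => (Frame [a, .tmp] μ μ' ∧ lo.val ≤ len ∧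
      (∀ j, j < len → (j < lo.val ↔ kf (μ a j) < c)) ∧ (∀ i, lo.val ≤ i → μ' a i = μ a i) ∧
      (seg (μ' a) 0 lo.val).Perm (seg (μ a) 0 lo.val) ∧ LexSorted (μ' a) lo.val kf κ) ∧
      τ' ≤ τ + (Nat.size len * (lo.val * (B + 60)) + c * 7 + 1)) ?_ ?_) ?_
  · refine ⟨⟨Frame.refl _ _, Nat.zero_le _, fun j _ => by simp, fun _ _ => rfl, .refl _,
      fun i j _ h => absurd h (Nat.not_lt_zero _)⟩, by simp⟩
  · rintro c ⟨lo⟩ μ' τ' hc ⟨⟨hF, hlo, hlt, hsame, hperm, hsort⟩, ht⟩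
    simp only [wp_rules]
    simp only at hc hlo hlt hsame hperm hsort ht
    rw [hF ends (by simp [hae, he])]
    set hi := μ ends c with hhi
    have hih : hi ≤ len := hb.ends_le c hc
    have hiff : ∀ j, j < len → (j < hi ↔ kf (μ a j) ≤ c) := fun j hj => hb.lt_ends c j hc hj
    have hlh : lo ≤ hi := by
      by_contra hcon
      have := (hlt hi (by omega)).1 (by omega)
      have := (hiff hi (by omega)).2 this.le
      omega
    refine wp_mono (wp_mergeSort ha (hleq.of_frame hF (List.Subset.refl _)) hlh
      fun i h h' => ?_) ?_
    · rw [hsame i h]; exact hD i (by omega)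
    rintro _ μ'' τ'' ⟨⟨hF', hout', hperm', hsort'⟩, ht'⟩
    have hsegEq : seg (μ' a) lo hi = seg (μ a) lo hi := seg_congr fun i h _ => hsame i h
    rw [hsegEq] at hperm'
    have hold : ∀ i, i < lo → kf (μ' a i) < c := fun i hi => by
      obtain ⟨j, _, hj, e⟩ := mem_seg.1 (hperm.subset (mem_seg.2 ⟨i, Nat.zero_le i, hi, rfl⟩))
      rw [← e]
      exact (hlt j (by omega)).1 hj
    have hnew : ∀ i, lo ≤ i → i < hi → kf (μ'' a i) = c := fun i hi hi' => by
      obtain ⟨j, hj, hj', e⟩ := mem_seg.1 (hperm'.subset (mem_seg.2 ⟨i, hi, hi', rfl⟩))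
      rw [← e]
      have h1 := (hiff j (by omega)).1 hj'
      have h2 := (hlt j (by omega)).not.1 (by omega)
      omega
    refine ⟨⟨hF.trans hF', hih, fun j hj => ?_, fun i h => ?_, ?_, fun i j hij hj => ?_⟩, ?_⟩
    · rw [hiff j hj, Nat.lt_succ_iff]
    · rw [hout' i (Or.inr h), hsame i (by omega)]
    · rw [← seg_append _ (Nat.zero_le lo) hlh, ← seg_append _ (Nat.zero_le lo) hlh,
        seg_congr (f := μ'' a) (g := μ' a) fun i _ h => hout' i (Or.inl h)]
      exact hperm.append hperm'
    · rcases Nat.lt_or_ge j lo with h | h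
      · rw [hout' i (Or.inl (by omega)), hout' j (Or.inl h)]
        exact hsort i j hij h
      · rw [hnew j h hj]
        rcases Nat.lt_or_ge i lo with h' | h'
        · rw [hout' i (Or.inl h')]
          exact Or.inl (hold i h')
        · rw [hnew i h' (by omega)]
          exact Or.inr ⟨rfl, hsort' i j h' hij hj⟩
    · unfold mergeTime at ht'
      have h1 : Nat.size (hi - lo) * ((hi - lo) * (B + 60)) ≤
          Nat.size len * ((hi - lo) * (B + 60)) :=
        Nat.mul_le_mul_right _ (Nat.size_le_size (by omega))
      have h2 : Nat.size len * (hi * (B + 60)) = Nat.size len * (lo * (B + 60)) +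
          Nat.size len * ((hi - lo) * (B + 60)) := by
        rw [← Nat.mul_add, ← Nat.add_mul]
        congr 2; omega
      change τ'' ≤ τ + (Nat.size len * (hi * (B + 60)) + (c + 1) * 7 + 1)
      omega
  · rintro ⟨lo⟩ μ' τ' ⟨⟨hF, hlo, hlt, hsame, hperm, hsort⟩, ht⟩
    simp only at hlo hlt hsame hperm hsort ht
    have : lo = len := by
      by_contra hne
      have hl : lo < len := by omega
      have := (hlt lo hl).2 (hb.key_lt lo hl)
      omega
    subst this
    exact ⟨⟨hF, hperm, hsort⟩, by omega⟩

end sortBuckets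

/-! ## Renaming by rank -/

section assignRanks
variable {β : Type} [LinearOrder β]

/-- `out` holds the number of key classes before that of each element of `order`; `r` is the
number of classes. -/
structure Ranked (order out : ℕ → ℕ) (len r : ℕ) (κ : ℕ → β) : Prop where
  zero : 0 < len → out (order 0) = 0
  succ : ∀ j, j + 1 < len → out (order (j + 1)) =
    out (order j) + if κ (order j) = κ (order (j + 1)) then 0 else 1
  num : r = if len = 0 then 0 else out (order (len - 1)) + 1

/-- As the entries of `order` are distinct, a rank once written is never overwritten; comparing with
the preceding entry is enough because equal keys are consecutive. -/
theorem wp_assignRanks {same : Word → Word → RAM Bool} {order out : Arr} {len : ℕ} {μ : Mem}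
    {τ : ℕ} {κ : ℕ → β} {B : ℕ} (ho : order ≠ out)
    (hsame : ∀ μ', Frame [out] μ μ' → ∀ i j, i < len → j < len →
      Computes (same ⟨μ order i⟩ ⟨μ order j⟩) μ' (decide (κ (μ order i) = κ (μ order j))) B)
    (hinj : ∀ i j, i < len → j < len → μ order i = μ order j → i = j) :
    wp (assignRanks same order out ⟨len⟩) μ τ fun r μ' τ' =>
      (Frame [out] μ μ' ∧ Ranked (μ order) (μ' out) len r.val κ ∧
        ∀ x, (∀ i, i < len → μ order i ≠ x) → μ' out x = μ out x) ∧
      τ' ≤ τ + (len * (B + 8) + 1) := by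
  refine wp_mono (wp_forLoop_of_cost (fun j r μ' => Frame [out] μ μ' ∧
    Ranked (μ order) (μ' out) j r.val κ ∧
      ∀ x, (∀ i, i < j → μ order i ≠ x) → μ' out x = μ out x) (B + 7) ?_ ?_) ?_
  · exact ⟨Frame.refl _ _, ⟨fun h => absurd h (lt_irrefl _), fun j h => by omega, rfl⟩,
      fun _ _ => rfl⟩
  · rintro j ⟨r⟩ μ' τ' hj ⟨hF, ⟨hz, hs, hr⟩, hx⟩
    simp only at hj hr
    simp only [wp_rules, Word.val_zero, Word.val_one, decide_eq_true_eq]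
    have hord : μ' order = μ order := hF order (by simpa using ho)
    rw [hord]
    have key : ∀ τ'' r', τ'' ≤ τ' + 7 + B → (0 < j → r' = r + if κ (μ order (j - 1)) =
          κ (μ order j) then 0 else 1) → (j = 0 → r' = r + 1) →
        (Frame [out] μ (upd μ' out (μ order j) (r' - 1)) ∧
          Ranked (μ order) (upd μ' out (μ order j) (r' - 1) out) (j + 1) r' κ ∧
          ∀ x, (∀ i, i < j + 1 → μ order i ≠ x) →
            upd μ' out (μ order j) (r' - 1) out x = μ out x) ∧ τ'' ≤ τ' + (B + 7) := by
      intro τ'' r' ht hr1 hr2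
      have hold : ∀ i, i < j → upd μ' out (μ order j) (r' - 1) out (μ order i) =
          μ' out (μ order i) := fun i hi => by
        rw [upd_self, if_neg fun e => hi.ne (hinj i j (by omega) hj e)]
      refine ⟨⟨hF.upd (by simp) _ _, ⟨fun _ => ?_, fun i hi => ?_, ?_⟩, fun x hxx => ?_⟩, by omega⟩
      · rcases Nat.eq_zero_or_pos j with rfl | h
        · rw [upd_same, hr2 rfl, hr]; rfl
        · rw [hold 0 h]; exact hz h
      · rcases Nat.lt_or_ge (i + 1) j with h | h
        · rw [hold _ h, hold i (by omega)]; exact hs i h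
        · obtain rfl : i + 1 = j := by omega
          rw [upd_same, hold i (by omega), hr1 (by omega), hr, if_neg (by omega)]
          simp only [Nat.add_sub_cancel]
          split_ifs <;> rfl
      · rw [if_neg (by omega), Nat.add_sub_cancel, upd_same]
        rcases Nat.eq_zero_or_pos j with rfl | h
        · have := hr2 rfl; omega
        · have := hr1 h; rw [if_neg (by omega)] at hr; omega
      · rw [upd_self, if_neg (hxx j (by omega)).symm]
        exact hx x fun i hi => hxx i (by omega)
    split_ifs with h0
    · exact absurd ‹False› not_false
    · exact key _ _ (by omega) (fun h => by omega) fun _ => rfl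
    · refine wp_mono (hsame μ' hF (j - 1) j (by omega) hj _) ?_
      rintro _ _ τ'' ⟨rfl, rfl, ht'⟩
      simp only [decide_eq_true_eq]
      split_ifs with hκ
      · exact key _ _ (by omega) (fun _ => by simp [hκ]) fun h => absurd h h0
      · exact key _ _ (by omega) (fun _ => by simp [hκ]) fun h => absurd h h0
  · rintro r μ' τ' ⟨h, ht⟩
    exact ⟨h, by simpa using ht⟩

namespace Ranked
variable {order out : ℕ → ℕ} {len r : ℕ} {κ : ℕ → β}

theorem le_of_le (h : Ranked order out len r κ) {i j : ℕ} (hij : i ≤ j) (hj : j < len) :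
    out (order i) ≤ out (order j) := by
  induction j, hij using Nat.le_induction with
  | base => exact le_rfl
  | succ j hij ih => exact (ih (by omega)).trans (by rw [h.succ j hj]; exact Nat.le_add_right _ _)

theorem le_index (h : Ranked order out len r κ) {j : ℕ} (hj : j < len) : out (order j) ≤ j := by
  induction j with
  | zero => exact (h.zero hj).le
  | succ j ih =>
    have := ih (by omega)
    rw [h.succ j hj]
    split_ifs <;> omega

theorem lt_num (h : Ranked order out len r κ) {j : ℕ} (hj : j < len) : out (order j) < r := by
  rw [h.num, if_neg (by omega)]
  exact Nat.lt_succ_of_le (h.le_of_le (by omega) (by omega))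

theorem num_le (h : Ranked order out len r κ) : r ≤ len := by
  rw [h.num]
  split_ifs with h0
  · omega
  · have := h.le_index (j := len - 1) (by omega)
    omega

theorem eq_iff (h : Ranked order out len r κ)
    (hs : ∀ i j, i < j → j < len → κ (order i) ≤ κ (order j)) {i j : ℕ} (hij : i ≤ j)
    (hj : j < len) : out (order i) = out (order j) ↔ κ (order i) = κ (order j) := by
  induction j, hij using Nat.le_induction with
  | base => simp
  | succ j hij ih =>
    have hj' : j < len := by omega
    have h1 := h.le_of_le hij hj'
    have h2 := h.succ j hj
    by_cases hκ : κ (order j) = κ (order (j + 1))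
    · rw [h2, if_pos hκ, Nat.add_zero, ih hj', hκ]
    · rw [if_neg hκ] at h2
      refine ⟨fun e => by omega, fun e => absurd ?_ hκ⟩
      have h3 : κ (order i) ≤ κ (order j) := by
        rcases Nat.lt_or_ge i j with h | h
        · exact hs i j h hj'
        · rw [show i = j by omega]
      exact le_antisymm (hs j (j + 1) (by omega) hj) (e ▸ h3)

theorem lt_iff (h : Ranked order out len r κ)
    (hs : ∀ i j, i < j → j < len → κ (order i) ≤ κ (order j)) {i j : ℕ} (hi : i < len)
    (hj : j < len) : out (order i) < out (order j) ↔ κ (order i) < κ (order j) := by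
  rcases Nat.lt_or_ge i j with hij | hij
  · have := h.le_of_le hij.le hj
    have h2 := h.eq_iff hs hij.le hj
    rw [lt_iff_le_and_ne, lt_iff_le_and_ne, Ne, Ne, h2]
    exact ⟨fun h => ⟨hs i j hij hj, h.2⟩, fun h => ⟨this, h.2⟩⟩
  · have h1 := h.le_of_le hij hi
    refine ⟨fun h => absurd h (not_lt.2 h1), fun h' => absurd h' (not_lt.2 ?_)⟩
    rcases hij.lt_or_eq with h | h
    · exact hs j i h hi
    · rw [h]

/-- With strictly increasing keys every class is a singleton; this is how the final ranks of prefix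
doubling become the inverse suffix array. -/
theorem eq_index (h : Ranked order out len r κ)
    (hs : ∀ i j, i < j → j < len → κ (order i) < κ (order j)) {j : ℕ} (hj : j < len) :
    out (order j) = j := by
  induction j with
  | zero => exact h.zero hj
  | succ j ih => rw [h.succ j hj, ih (by omega), if_neg (hs j (j + 1) (by omega) hj).ne]

end Ranked
end assignRanks

/-! ## Lexicographic order of suffixes -/

/-- Infinite sequences, ordered lexicographically. -/
def Seq : Type := ℕ → ℕ

/-- Linear because two different sequences have a first difference. What is put beyond the end of a
string is chosen separately for each string so that it never distorts a comparison. -/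
noncomputable instance : LinearOrder Seq := inferInstanceAs (LinearOrder (Lex (ℕ → ℕ)))

/-- The `i`-th suffix of the sequence `f`. -/
def suf (f : ℕ → ℕ) (i : ℕ) : Seq := fun k => f (i + k)

/-- The suffixes `f[i..]` and `g[j..]` agree in the first `l` places. -/
def Agree (f : ℕ → ℕ) (i : ℕ) (g : ℕ → ℕ) (j l : ℕ) : Prop := ∀ k, k < l → f (i + k) = g (j + k)

section order
variable {f g h : ℕ → ℕ} {i j k l l' : ℕ}

theorem Agree.refl (f : ℕ → ℕ) (i l : ℕ) : Agree f i f i l := fun _ _ => rfl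

theorem Agree.zero : Agree f i g j 0 := fun _ h => absurd h (Nat.not_lt_zero _)

theorem Agree.symm (h : Agree f i g j l) : Agree g j f i l := fun k hk => (h k hk).symm

theorem Agree.trans (h₁ : Agree f i g j l) (h₂ : Agree g j h k l) : Agree f i h k l :=
  fun m hm => (h₁ m hm).trans (h₂ m hm)

theorem Agree.mono (h : Agree f i g j l) (hl : l' ≤ l) : Agree f i g j l' :=
  fun k hk => h k (hk.trans_le hl)

theorem Agree.succ (h : Agree f i g j l) (hl : f (i + l) = g (j + l)) : Agree f i g j (l + 1) :=
  fun k hk => (Nat.lt_succ_iff_lt_or_eq.1 hk).elim (h k) fun e => e ▸ hl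

theorem agree_succ_iff : Agree f i g j (l + 1) ↔ Agree f i g j l ∧ f (i + l) = g (j + l) :=
  ⟨fun h => ⟨h.mono (Nat.le_succ l), h l (Nat.lt_succ_self l)⟩, fun h => h.1.succ h.2⟩

theorem Agree.shift (h : Agree f i g j (k + l)) : Agree f (i + k) g (j + k) l := fun m hm => by
  rw [Nat.add_assoc, Nat.add_assoc]; exact h _ (by omega)

theorem Agree.append (h : Agree f i g j k) (h' : Agree f (i + k) g (j + k) l) :
    Agree f i g j (k + l) := fun m hm => by
  rcases Nat.lt_or_ge m k with hk | hk
  · exact h m hk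
  · have := h' (m - k) (by omega)
    rwa [show i + k + (m - k) = i + m by omega, show j + k + (m - k) = j + m by omega] at this

theorem suf_lt_iff : suf f i < suf g j ↔ ∃ l, Agree f i g j l ∧ f (i + l) < g (j + l) := Iff.rfl

theorem suf_eq_iff : suf f i = suf g j ↔ ∀ l, Agree f i g j l :=
  ⟨fun e _ k _ => congrFun (show (fun k => f (i + k)) = fun k => g (j + k) from e) k,
    fun h => funext fun k => h (k + 1) k (Nat.lt_succ_self k)⟩

theorem Agree.lt (h : Agree f i g j l) (hl : f (i + l) < g (j + l)) : suf f i < suf g j :=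
  suf_lt_iff.2 ⟨l, h, hl⟩

/-- A common prefix can be cancelled. Most comparisons below are moved in this way to a place where
the order is already known. -/
theorem Agree.lt_iff (h : Agree f i g j l) :
    suf f i < suf g j ↔ suf f (i + l) < suf g (j + l) := by
  simp only [suf_lt_iff]
  constructor
  · rintro ⟨m, hm, hlt⟩
    have hlm : l ≤ m := by
      by_contra hc
      exact hlt.ne (h m (by omega))
    obtain ⟨d, rfl⟩ := Nat.exists_eq_add_of_le hlm
    exact ⟨d, hm.shift, by rwa [Nat.add_assoc, Nat.add_assoc]⟩
  · rintro ⟨d, hd, hlt⟩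
    exact ⟨l + d, h.append hd, by rwa [← Nat.add_assoc, ← Nat.add_assoc]⟩

theorem Agree.char_le (h : Agree f i g j l) (hle : suf f i ≤ suf g j) :
    f (i + l) ≤ g (j + l) := by
  by_contra hc
  exact absurd hle (not_le.2 (h.symm.lt (not_le.1 hc)))

theorem Agree.lt_of_le_of_ne (h : Agree f i g j l) (hle : suf f i ≤ suf g j)
    (hne : f (i + l) ≠ g (j + l)) : f (i + l) < g (j + l) :=
  _root_.lt_of_le_of_ne (h.char_le hle) hne

/-- Suffixes between two suffixes with a common prefix share this prefix. -/
theorem Agree.between (h₁ : suf f i ≤ suf g j) (h₂ : suf g j ≤ suf h k) (ha : Agree f i h k l) :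
    Agree f i g j l := by
  induction l with
  | zero => exact Agree.zero
  | succ l ih =>
    have h3 := ih (ha.mono (Nat.le_succ l))
    refine h3.succ (le_antisymm (h3.char_le h₁) ?_)
    rw [ha l (Nat.lt_succ_self l)]
    exact (h3.symm.trans (ha.mono (Nat.le_succ l))).char_le h₂

end order

/-! ## Suffix sorting by prefix doubling -/

/-- The string `t[0, len)`, followed by a smallest character. -/
def padded (t : ℕ → ℕ) (len : ℕ) (k : ℕ) : ℕ := if k < len then t k + 1 else 0

/-- The first `k` characters of the `x`-th suffix of `t[0, len)`. -/
def trunc (t : ℕ → ℕ) (len k x : ℕ) : Seq :=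
  suf (fun j => if j < x + k then padded t len j else 0) x

theorem trunc_lt_iff {t : ℕ → ℕ} {len k x y : ℕ} : trunc t len k x < trunc t len k y ↔
    ∃ l, l < k ∧ Agree (padded t len) x (padded t len) y l ∧
      padded t len (x + l) < padded t len (y + l) := by
  rw [trunc, trunc, suf_lt_iff]
  constructor
  · rintro ⟨l, hl, hlt⟩
    have hk : l < k := by
      by_contra hc
      rw [if_neg (by omega), if_neg (by omega)] at hlt
      omega
    rw [if_pos (by omega), if_pos (by omega)] at hlt
    refine ⟨l, hk, fun m hm => ?_, hlt⟩
    have := hl m hm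
    beta_reduce at this
    rwa [if_pos (by omega), if_pos (by omega)] at this
  · rintro ⟨l, hk, hl, hlt⟩
    refine ⟨l, fun m hm => ?_, ?_⟩
    · beta_reduce
      rw [if_pos (by omega), if_pos (by omega)]; exact hl m hm
    · rw [if_pos (by omega), if_pos (by omega)]; exact hlt

theorem trunc_eq_iff {t : ℕ → ℕ} {len k x y : ℕ} : trunc t len k x = trunc t len k y ↔
    Agree (padded t len) x (padded t len) y k := by
  rw [trunc, trunc, suf_eq_iff]
  constructor
  · intro h m hm
    have := h k m hm
    beta_reduce at this
    rwa [if_pos (by omega), if_pos (by omega)] at this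
  · intro h l m hm
    beta_reduce
    rcases Nat.lt_or_ge m k with hk | hk
    · rw [if_pos (by omega), if_pos (by omega)]; exact h m hk
    · rw [if_neg (by omega), if_neg (by omega)]

theorem trunc_add_eq_iff {t : ℕ → ℕ} {len k x y : ℕ} :
    trunc t len (k + k) x = trunc t len (k + k) y ↔
      trunc t len k x = trunc t len k y ∧ trunc t len k (x + k) = trunc t len k (y + k) := by
  simp only [trunc_eq_iff]
  exact ⟨fun h => ⟨h.mono (Nat.le_add_left _ _), h.shift⟩, fun h => h.1.append h.2⟩

/-- A prefix of length `2k` is a pair of prefixes of length `k`, compared lexicographically: the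
basis of prefix doubling. -/
theorem trunc_add_lt {t : ℕ → ℕ} {len k x y : ℕ}
    (h : trunc t len k x < trunc t len k y ∨
      trunc t len k x = trunc t len k y ∧ trunc t len k (x + k) < trunc t len k (y + k)) :
    trunc t len (k + k) x < trunc t len (k + k) y := by
  rw [trunc_lt_iff]
  rcases h with h | ⟨h, h'⟩
  · obtain ⟨l, hk, h⟩ := trunc_lt_iff.1 h
    exact ⟨l, by omega, h⟩
  · obtain ⟨l, hk, h2, h3⟩ := trunc_lt_iff.1 h'
    exact ⟨k + l, by omega, (trunc_eq_iff.1 h).append h2, by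
      rwa [← Nat.add_assoc, ← Nat.add_assoc]⟩

theorem trunc_add_le {t : ℕ → ℕ} {len k x y : ℕ}
    (h : trunc t len k x < trunc t len k y ∨
      trunc t len k x = trunc t len k y ∧ trunc t len k (x + k) ≤ trunc t len k (y + k)) :
    trunc t len (k + k) x ≤ trunc t len (k + k) y := by
  rcases h with h | ⟨h, h'⟩
  · exact (trunc_add_lt (Or.inl h)).le
  · rcases h'.lt_or_eq with h2 | h2
    · exact (trunc_add_lt (Or.inr ⟨h, h2⟩)).le
    · exact (trunc_add_eq_iff.2 ⟨h, h2⟩).le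

theorem trunc_lt_of_ge {t : ℕ → ℕ} {len k x y : ℕ} (hk : 0 < k) (hx : len ≤ x) (hy : y < len) :
    trunc t len k x < trunc t len k y :=
  trunc_lt_iff.2 ⟨0, hk, Agree.zero, by
    rw [padded, padded, if_neg (by omega), if_pos (by omega)]; omega⟩

theorem trunc_eq_of_ge {t : ℕ → ℕ} {len k x y : ℕ} (hx : len ≤ x) (hy : len ≤ y) :
    trunc t len k x = trunc t len k y :=
  trunc_eq_iff.2 fun m _ => by rw [padded, padded, if_neg (by omega), if_neg (by omega)]

theorem padded_lt_or_lt {t : ℕ → ℕ} {len x y : ℕ} (hxy : x < y) (hy : y < len) :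
    padded t len (x + (len - y)) ≠ padded t len (y + (len - y)) := by
  rw [padded, padded, if_pos (by omega), if_neg (by omega)]; omega

/-- The padding of the later suffix starts at an offset where the earlier one still has a character,
and padding differs from every character. -/
theorem trunc_injOn {t : ℕ → ℕ} {len k x y : ℕ} (hk : len ≤ k) (hx : x < len) (hy : y < len)
    (h : trunc t len k x = trunc t len k y) : x = y := by
  rw [trunc_eq_iff] at h
  rcases lt_trichotomy x y with hxy | hxy | hxy
  · rcases Nat.eq_zero_or_pos x with rfl | h0
    · exact absurd (h (len - y) (by omega)) (padded_lt_or_lt hxy hy)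
    · exact absurd (h (len - y) (by omega)) (padded_lt_or_lt hxy hy)
  · exact hxy
  · exact absurd (h (len - x) (by omega)).symm (padded_lt_or_lt hxy hx)

theorem suf_padded_lt {t : ℕ → ℕ} {len k x y : ℕ} (h : trunc t len k x < trunc t len k y) :
    suf (padded t len) x < suf (padded t len) y := by
  obtain ⟨l, _, h1, h2⟩ := trunc_lt_iff.1 h
  exact h1.lt h2

/-- `sa` is the suffix array and `isa` the inverse suffix array of `t[0, len)`. -/
structure IsSuffixArray (t sa isa : ℕ → ℕ) (len : ℕ) : Prop where
  perm : IsPerm sa len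
  sorted : ∀ i j, i < j → j < len → suf (padded t len) (sa i) < suf (padded t len) (sa j)
  isa_sa : ∀ j, j < len → isa (sa j) = j

/-- The key of the second half in a step of prefix doubling. -/
def halfKey (rank : ℕ → ℕ) (len k x : ℕ) : ℕ := if x + k < len then rank (x + k) + 1 else 0

theorem computes_secondKey (rank : Arr) (len k x : ℕ) (μ : Mem) :
    Computes (secondKey rank ⟨len⟩ ⟨k⟩ ⟨x⟩) μ ⟨halfKey (μ rank) len k x⟩ 4 := by
  intro τ
  simp only [secondKey, wp_rules, decide_eq_true_eq, Word.val_one, halfKey]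
  split_ifs
  · exact ⟨by trivial, by trivial, le_rfl⟩
  · exact ⟨by trivial, by trivial, by omega⟩

theorem exists_count_eq {p : ℕ → Prop} [DecidablePred p] {n c : ℕ} (h : c < Nat.count p n) :
    ∃ i, i < n ∧ p i ∧ Nat.count p i = c := by
  induction n with
  | zero => simp at h
  | succ n ih =>
    rw [Nat.count_succ] at h
    rcases Nat.lt_or_ge c (Nat.count p n) with h' | h'
    · obtain ⟨i, hi, h2⟩ := ih h'
      exact ⟨i, by omega, h2⟩
    · split_ifs at h with hp
      · exact ⟨n, Nat.lt_succ_self n, hp, by omega⟩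
      · omega

theorem count_comp_of_isPerm {f : ℕ → ℕ} {n : ℕ} (hf : IsPerm f n) (p : ℕ → Prop)
    [DecidablePred p] : Nat.count (fun i => p (f i)) n = Nat.count p n := by
  rw [Nat.count_eq_card_filter_range, Nat.count_eq_card_filter_range]
  refine Finset.card_bij (fun i _ => f i) ?_ ?_ ?_
  · intro i hi
    simp only [Finset.mem_filter, Finset.mem_range] at hi ⊢
    exact ⟨hf.lt i hi.1, hi.2⟩
  · intro i hi j hj e
    simp only [Finset.mem_filter, Finset.mem_range] at hi hj
    exact hf.inj i j hi.1 hj.1 e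
  · intro k hk
    simp only [Finset.mem_filter, Finset.mem_range] at hk
    obtain ⟨i, hi, rfl⟩ := hf.surj hk.1
    exact ⟨i, by simp [hi, hk.2], rfl⟩

theorem count_ge (k n : ℕ) : Nat.count (fun x => k ≤ x) n = n - k := by
  induction n with
  | zero => simp
  | succ n ih =>
    rw [Nat.count_succ, ih]
    split_ifs <;> omega

/-- The order of the positions by their second halves in a step of prefix doubling. -/
theorem isPerm_shift {sa ord : ℕ → ℕ} {len k : ℕ} (hsa : IsPerm sa len) (hk : k < len)
    (h1 : ∀ q, q < k → ord q = len - k + q)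
    (h2 : ∀ i, i < len → k ≤ sa i → ord (k + Nat.count (fun i => k ≤ sa i) i) = sa i - k) :
    IsPerm ord len ∧ ∀ a b, a < b → b < len → len ≤ ord a + k ∨
      ∃ i j, i < j ∧ j < len ∧ ord a + k = sa i ∧ ord b + k = sa j := by
  -- Exactly `len - k` positions have the form `i + k` inside the string; shifted back in suffix
  -- array order, they fill the places after the `k` positions whose second half is empty.
  have hcount : Nat.count (fun i => k ≤ sa i) len = len - k := by
    rw [count_comp_of_isPerm hsa (fun x => k ≤ x), count_ge]
  have hex : ∀ q, k ≤ q → q < len → ∃ i, i < len ∧ k ≤ sa i ∧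
      k + Nat.count (fun i => k ≤ sa i) i = q ∧ ord q + k = sa i := by
    intro q hq hq'
    obtain ⟨i, hi, hp, e⟩ := exists_count_eq (p := fun i => k ≤ sa i) (n := len) (c := q - k)
      (by omega)
    have e' : k + Nat.count (fun i => k ≤ sa i) i = q := by omega
    refine ⟨i, hi, hp, e', ?_⟩
    have := h2 i hi hp
    rw [e'] at this
    omega
  have hlt : ∀ i, i < len → ord i < len := by
    intro i hi
    rcases Nat.lt_or_ge i k with h | h
    · rw [h1 i h]; omega
    · obtain ⟨x, hx, -, -, e⟩ := hex i h hi
      have := hsa.lt x hx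
      omega
  refine ⟨⟨hlt, fun i j hi hj e => ?_⟩, fun a b hab hb => ?_⟩
  · rcases Nat.lt_or_ge i k with h | h <;> rcases Nat.lt_or_ge j k with h' | h'
    · rw [h1 i h, h1 j h'] at e; omega
    · obtain ⟨y, hy, -, -, ey⟩ := hex j h' hj
      have := hsa.lt y hy
      rw [← e, h1 i h] at ey
      omega
    · obtain ⟨y, hy, -, -, ey⟩ := hex i h hi
      have := hsa.lt y hy
      rw [e, h1 j h'] at ey
      omega
    · obtain ⟨x, hx, -, ex', ex⟩ := hex i h hi
      obtain ⟨y, hy, -, ey', ey⟩ := hex j h' hj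
      have := hsa.inj x y hx hy (by omega)
      subst this
      omega
  · rcases Nat.lt_or_ge a k with h | h
    · rw [h1 a h]; left; omega
    · right
      obtain ⟨x, hx, -, ex', ex⟩ := hex a h (by omega)
      obtain ⟨y, hy, -, ey', ey⟩ := hex b (by omega) hb
      refine ⟨x, y, ?_, hy, ex, ey⟩
      by_contra hc
      have := Nat.count_monotone (fun i => k ≤ sa i) (not_lt.1 hc)
      omega

theorem Ranked.congr {β : Type} [LinearOrder β] {order out out' : ℕ → ℕ} {len r : ℕ} {κ : ℕ → β}
    (h : Ranked order out len r κ) (ho : ∀ j, j < len → out' (order j) = out (order j)) :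
    Ranked order out' len r κ := by
  refine ⟨fun h0 => by rw [ho 0 h0, h.zero h0], fun j hj => ?_, ?_⟩
  · rw [ho _ hj, ho j (by omega), h.succ j hj]
  · rw [h.num]
    split_ifs with h0
    · rfl
    · rw [ho _ (by omega)]

/-- The state of the suffix array and of the ranks before the step of prefix doubling with
offset `k`. -/
structure SortedTo (t sa rank : ℕ → ℕ) (len k : ℕ) : Prop where
  perm : IsPerm sa len
  sorted : ∀ i j, i < j → j < len → trunc t len k (sa i) ≤ trunc t len k (sa j)
  ranked : ∃ r, Ranked sa rank len r (trunc t len k)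

namespace SortedTo
variable {t sa rank : ℕ → ℕ} {len k : ℕ}

theorem rank_lt_iff (h : SortedTo t sa rank len k) {x y : ℕ} (hx : x < len) (hy : y < len) :
    rank x < rank y ↔ trunc t len k x < trunc t len k y := by
  obtain ⟨r, hr⟩ := h.ranked
  obtain ⟨i, hi, rfl⟩ := h.perm.surj hx
  obtain ⟨j, hj, rfl⟩ := h.perm.surj hy
  exact hr.lt_iff h.sorted hi hj

theorem rank_eq_iff (h : SortedTo t sa rank len k) {x y : ℕ} (hx : x < len) (hy : y < len) :
    rank x = rank y ↔ trunc t len k x = trunc t len k y := by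
  have h1 := h.rank_lt_iff hx hy
  have h2 := h.rank_lt_iff hy hx
  rw [le_antisymm_iff, le_antisymm_iff, ← not_lt, ← not_lt, ← not_lt, ← not_lt, h1, h2]

theorem rank_lt (h : SortedTo t sa rank len k) {x : ℕ} (hx : x < len) : rank x < len := by
  obtain ⟨r, hr⟩ := h.ranked
  obtain ⟨i, hi, rfl⟩ := h.perm.surj hx
  exact (hr.lt_num hi).trans_le hr.num_le

/-- The key `0` is reserved for second halves that consist of padding only; the others are shifted
by one to stay clear of it. -/
theorem halfKey_eq_iff (h : SortedTo t sa rank len k) (hk : 0 < k) (x y : ℕ) :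
    halfKey rank len k x = halfKey rank len k y ↔
      trunc t len k (x + k) = trunc t len k (y + k) := by
  rw [halfKey, halfKey]
  split_ifs with hx hy hy
  · rw [← h.rank_eq_iff hx hy]; omega
  · exact ⟨fun e => e.elim,
      fun e => absurd e.symm (trunc_lt_of_ge hk (not_lt.1 hy) hx).ne⟩
  · exact ⟨fun e => e.elim,
      fun e => absurd e (trunc_lt_of_ge hk (not_lt.1 hx) hy).ne⟩
  · exact ⟨fun _ => trunc_eq_of_ge (by omega) (by omega), fun _ => rfl⟩

theorem isSuffixArray (h : SortedTo t sa rank len k) (hk : len ≤ k) :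
    IsSuffixArray t sa rank len := by
  have hs : ∀ i j, i < j → j < len → trunc t len k (sa i) < trunc t len k (sa j) :=
    fun i j hij hj => lt_of_le_of_ne (h.sorted i j hij hj) fun e => hij.ne
      (h.perm.inj i j (by omega) hj
        (trunc_injOn hk (h.perm.lt i (by omega)) (h.perm.lt j hj) e))
  obtain ⟨r, hr⟩ := h.ranked
  exact ⟨h.perm, fun i j hij hj => suf_padded_lt (hs i j hij hj), fun j hj => hr.eq_index hs hj⟩

end SortedTo

/-- Radix sort on pairs. The order by second halves is the old suffix array shifted by `k`, with the
empty second halves in front; a stable bucket sort by the rank of the first half then yields the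
order by both. -/
theorem SortedTo.double {t sa rank ord sa' rank' : ℕ → ℕ} {len k : ℕ}
    (h : SortedTo t sa rank len k) (hk : 0 < k) (hkl : k < len)
    (h1 : ∀ q, q < k → ord q = len - k + q)
    (h2 : ∀ i, i < len → k ≤ sa i → ord (k + Nat.count (fun i => k ≤ sa i) i) = sa i - k)
    (h3 : ∀ j, j < len → sa' (bucketPos (fun i => rank (ord i)) len j) = ord j)
    (h4 : ∃ r, Ranked sa' rank' len r (trunc t len (k + k))) :
    SortedTo t sa' rank' len (k + k) := by
  obtain ⟨hord, hs⟩ := isPerm_shift h.perm hkl h1 h2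
  have hperm := isPerm_of_bucketPos hord h3
  refine ⟨hperm, fun i j hij hj => ?_, h4⟩
  have := sorted_of_bucketPos (R := fun x y => trunc t len k (x + k) ≤ trunc t len k (y + k)) h3
    (fun a b hab hb => ?_) hij hj
  · rw [h.rank_lt_iff (hperm.lt i (by omega)) (hperm.lt j hj),
      h.rank_eq_iff (hperm.lt i (by omega)) (hperm.lt j hj)] at this
    exact trunc_add_le this
  · rcases hs a b hab hb with h' | ⟨x, y, hxy, hy, e1, e2⟩
    · rcases Nat.lt_or_ge (ord b + k) len with h5 | h5
      · exact (trunc_lt_of_ge hk h' h5).le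
      · exact (trunc_eq_of_ge h' h5).le
    · rw [e1, e2]; exact h.sorted x y hxy hy

theorem trunc_one_le_iff {t : ℕ → ℕ} {len x y : ℕ} (hx : x < len) (hy : y < len) :
    trunc t len 1 x ≤ trunc t len 1 y ↔ t x ≤ t y := by
  rw [← not_lt, trunc_lt_iff, ← not_lt, not_iff_not]
  constructor
  · rintro ⟨l, hl, -, h⟩
    obtain rfl : l = 0 := by omega
    simp only [padded, Nat.add_zero, if_pos hx, if_pos hy] at h
    omega
  · intro h
    refine ⟨0, Nat.one_pos, Agree.zero, ?_⟩
    simp only [padded, Nat.add_zero, if_pos hx, if_pos hy]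
    omega

theorem trunc_one_eq_iff {t : ℕ → ℕ} {len x y : ℕ} (hx : x < len) (hy : y < len) :
    trunc t len 1 x = trunc t len 1 y ↔ t x = t y := by
  rw [le_antisymm_iff, le_antisymm_iff, trunc_one_le_iff hx hy, trunc_one_le_iff hy hx]

/-- Time of sorting the suffixes of a string of length `len`. -/
def suffixTime (len numKeys : ℕ) : ℕ :=
  Nat.size len * (len * 150) + len * 60 + numKeys * 10 + 60

/-- Order by the second halves, given the order by the first halves. -/
theorem wp_shift (sa : Arr) (hsa : sa ≠ .ord) (len k : ℕ) (hkl : k < len) (μ : Mem) (τ : ℕ)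
    {Q : Mem → ℕ → Prop} (hQ : ∀ μ' τ', Frame [.ord] μ μ' → (∀ q, q < k → μ' .ord q = len - k + q) →
      (∀ i, i < len → k ≤ μ sa i →
        μ' .ord (k + Nat.count (fun i => k ≤ μ sa i) i) = μ sa i - k) →
      τ' ≤ τ + (len * 10 + 5) → Q μ' τ') :
    wp (sub ⟨len⟩ ⟨k⟩) μ τ fun base μ τ =>
      wp (forEach ⟨k⟩ fun i => do write .ord i (← add base i)) μ τ fun _ μ τ =>
        wp (forLoop ⟨len⟩ (⟨k⟩ : Word) fun j p => do
          let i ← read sa j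
          if (← le ⟨k⟩ i) then
            write .ord p (← sub i ⟨k⟩)
            add p 1
          else
            pure p) μ τ fun _ μ τ => Q μ τ := by
  simp only [wp_sub]
  refine wp_mono (wp_forEach (fun i μ' => Frame [.ord] μ μ' ∧
    ∀ q, q < i → μ' .ord q = len - k + q) 2 ?_ ?_) ?_
  · exact ⟨Frame.refl _ _, fun q h => absurd h (Nat.not_lt_zero _)⟩
  · rintro i μ' τ' hi ⟨hF, h⟩
    simp only [wp_rules]
    refine ⟨⟨hF.upd (by simp) _ _, fun q hq => ?_⟩, by omega⟩
    rw [upd_self]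
    split_ifs with e
    · rw [e]
    · exact h q (by omega)
  rintro _ μ₁ τ₁ ⟨⟨hF₁, h₁⟩, ht₁⟩
  refine wp_mono (wp_forLoop_of_cost (fun j p μ' => Frame [.ord] μ μ' ∧
    p.val = k + Nat.count (fun i => k ≤ μ sa i) j ∧ (∀ q, q < k → μ' .ord q = len - k + q) ∧
    ∀ i, i < j → k ≤ μ sa i →
      μ' .ord (k + Nat.count (fun i => k ≤ μ sa i) i) = μ sa i - k) 5 ?_ ?_) ?_
  · exact ⟨hF₁, by simp, h₁, fun i h => absurd h (Nat.not_lt_zero _)⟩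
  · rintro j ⟨p⟩ μ' τ' hj ⟨hF, hp, h, h'⟩
    simp only at hp
    simp only [wp_rules, decide_eq_true_eq, Word.val_one]
    rw [hF sa (by simpa using hsa)]
    split_ifs with hk
    · refine ⟨⟨hF.upd (by simp) _ _, ?_, fun q hq => ?_, fun i hi hki => ?_⟩, by omega⟩
      · rw [Nat.count_succ, if_pos hk]; omega
      · rw [upd_self, if_neg (by omega)]; exact h q hq
      · rw [upd_self]
        rcases Nat.lt_or_ge i j with hij | hij
        · have := Nat.count_strict_mono (p := fun i => k ≤ μ sa i) hki hij
          rw [if_neg (by omega)]; exact h' i hij hki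
        · obtain rfl : i = j := by omega
          rw [if_pos hp.symm]
    · refine ⟨⟨hF, ?_, h, fun i hi hki => ?_⟩, by omega⟩
      · rw [Nat.count_succ, if_neg hk]; exact hp
      · refine h' i (lt_of_le_of_ne (Nat.lt_succ_iff.1 hi) ?_) hki
        rintro rfl; exact hk hki
  rintro _ μ₂ τ₂ ⟨⟨hF₂, -, h₂, h₂'⟩, ht₂⟩
  simp only at ht₁ ht₂ h₂'
  exact hQ _ _ hF₂ h₂ h₂' (by omega)

/-- `SortedTo` with offset `k` passes to `2k` at linear cost, and `k ≥ len` separates all suffixes.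
The potential is the bit length of `(len - 1) / k`. -/
theorem wp_suffixSort {t sa rank : Arr} (h1 : t ∉ [sa, rank, .ord, .cnt, .tmp])
    (h2 : sa ∉ [rank, .ord, .cnt, .tmp]) (h3 : rank ∉ [Arr.ord, .cnt, .tmp]) {len numKeys : ℕ}
    {μ : Mem} {τ : ℕ} (hlt : ∀ i, i < len → μ t i < numKeys) :
    wp (suffixSort t sa rank ⟨len⟩ ⟨numKeys⟩) μ τ fun _ μ' τ' =>
      (Frame [sa, rank, .ord, .cnt, .tmp] μ μ' ∧
        IsSuffixArray (μ t) (μ' sa) (μ' rank) len ∧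
        ∀ x, len ≤ x → μ' rank x = μ rank x) ∧
      τ' ≤ τ + suffixTime len numKeys := by
  simp only [List.mem_cons, List.not_mem_nil, or_false, not_or] at h1 h2 h3
  obtain ⟨t1, t2, t3, t4, t5⟩ := h1
  obtain ⟨s1, s2, s3, s4⟩ := h2
  have s1' := Ne.symm s1
  have s2' := Ne.symm s2
  obtain ⟨r1, r2, r3⟩ := h3
  have r3' := Ne.symm r3
  simp only [suffixSort, wp_bind]
  refine wp_mono (wp_forEach (fun i μ' => Frame [.ord] μ μ' ∧ ∀ q, q < i → μ' .ord q = q) 1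
    ⟨Frame.refl _ _, fun q h => absurd h (Nat.not_lt_zero _)⟩ ?_) ?_
  · rintro i μ' τ' hi ⟨hF, h⟩
    simp only [wp_rules]
    refine ⟨⟨hF.upd (by simp) _ _, fun q hq => ?_⟩, by omega⟩
    rw [upd_self]
    split_ifs with e
    · exact e.symm
    · exact h q (by omega)
  rintro _ μ₁ τ₁ ⟨⟨hF₁, ho₁⟩, ht₁⟩
  simp only at ho₁ ht₁
  have hord : IsPerm (μ₁ .ord) len := (IsPerm.id len).congr ho₁
  have et₁ : μ₁ t = μ t := hF₁ t (by simpa using t3)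
  refine wp_mono (wp_bucketSort (kf := μ t) (B := 1) s2' (by simp) s3 ?_ ?_) ?_
  · intro μ' hF i hi τ
    simp only [wp_rules]
    exact ⟨by rw [hF t (by simp [t1, t4]), et₁], by trivial, le_rfl⟩
  · intro i hi
    exact hlt _ (hord.lt i hi)
  rintro _ μ₂ τ₂ ⟨⟨hF₂, hd₂, -⟩, ht₂⟩
  have et₂ : μ₂ t = μ t := (hF₂ t (by simp [t1, t4])).trans et₁
  have hsa₂ := isPerm_of_bucketPos hord hd₂
  have hsort₂ : ∀ i j, i < j → j < len → trunc (μ t) len 1 (μ₂ sa i) ≤ trunc (μ t) len 1 (μ₂ sa j) :=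
    fun i j hij hj => by
      rw [trunc_one_le_iff (hsa₂.lt i (by omega)) (hsa₂.lt j hj)]
      rcases sorted_of_bucketPos (R := fun _ _ => True) hd₂ (fun _ _ _ _ => trivial) hij hj
        with h | h
      · exact h.le
      · exact h.1.le
  refine wp_mono (wp_assignRanks (κ := trunc (μ t) len 1) (B := 3) s1 ?_ hsa₂.inj) ?_
  · intro μ' hF i j hi hj τ
    simp only [wp_rules]
    refine ⟨?_, by trivial, le_rfl⟩
    rw [hF t (by simp [t2]), et₂]
    exact decide_eq_decide.2 (trunc_one_eq_iff (hsa₂.lt i hi) (hsa₂.lt j hj)).symm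
  rintro r₃ μ₃ τ₃ ⟨⟨hF₃, hr₃, hx₃⟩, ht₃⟩
  have esa₃ : μ₃ sa = μ₂ sa := hF₃ sa (by simp [s1])
  have hs₃ : SortedTo (μ t) (μ₃ sa) (μ₃ rank) len 1 := by
    rw [esa₃]; exact ⟨hsa₂, hsort₂, _, hr₃⟩
  have hF₃' : Frame [sa, rank, .ord, .cnt, .tmp] μ μ₃ :=
    (hF₁.mono (by simp)).trans ((hF₂.mono (by simp)).trans (hF₃.mono (by simp)))
  have hout₃ : ∀ x, len ≤ x → μ₃ rank x = μ rank x := fun x hx => by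
    rw [hx₃ x fun i hi e => by have := hsa₂.lt i hi; omega, hF₂ rank (by simp [s1', r2]),
      hF₁ rank (by simp [r1])]
  simp only [wp_pure]
  refine wp_whileLoop (fun k μ' τ' => (Frame [sa, rank, .ord, .cnt, .tmp] μ μ' ∧
      SortedTo (μ t) (μ' sa) (μ' rank) len k.val ∧ ∀ x, len ≤ x → μ' rank x = μ rank x) ∧
      1 ≤ k.val ∧ τ' + Nat.size ((len - 1) / k.val) * (len * 150) ≤
        τ₃ + Nat.size (len - 1) * (len * 150))
    (fun k => len - k.val) ?_ ?_ ?_ ?_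
  · exact ⟨⟨hF₃', hs₃, hout₃⟩, le_rfl, by simp⟩
  · simp
  · rintro ⟨k⟩ μ' τ' ⟨⟨hF, hs, hout⟩, hk, ht⟩
    simp only at hs hk ht
    simp only [wp_lt, wp_bind, decide_eq_true_eq]
    have hfin : Nat.size (len - 1) * (len * 150) ≤ Nat.size len * (len * 150) :=
      Nat.mul_le_mul_right _ (Nat.size_le_size (by omega))
    split_ifs with hkl
    · refine wp_shift sa s2 len k hkl μ' _ fun μ₄ τ₄ hF₄ ha₄ hb₄ ht₄ => ?_
      obtain ⟨hord₄, -⟩ := isPerm_shift hs.perm hkl ha₄ hb₄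
      have er₄ : μ₄ rank = μ' rank := hF₄ rank (by simp [r1])
      refine wp_mono (wp_bucketSort (kf := μ' rank) (B := 1) s2' (by simp) s3 ?_ ?_) ?_
      · intro μ'' hF'' i hi τ
        simp only [wp_rules]
        exact ⟨by rw [hF'' rank (by simp [s1', r2]), er₄], by trivial, le_rfl⟩
      · intro i hi
        exact hs.rank_lt (hord₄.lt i hi)
      rintro _ μ₅ τ₅ ⟨⟨hF₅, hd₅, -⟩, ht₅⟩
      have er₅ : μ₅ rank = μ' rank := (hF₅ rank (by simp [s1', r2])).trans er₄
      have hsa₅ := isPerm_of_bucketPos hord₄ hd₅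
      refine wp_mono (wp_assignRanks (κ := trunc (μ t) len (k + k)) (B := 12) s4 ?_ hsa₅.inj) ?_
      · intro μ'' hF'' i j hi hj τ
        have er₆ : μ'' rank = μ' rank := (hF'' rank (by simp [r3])).trans er₅
        have e1 := hs.rank_eq_iff (hsa₅.lt i hi) (hsa₅.lt j hj)
        have e2 := hs.halfKey_eq_iff hk (μ₅ sa i) (μ₅ sa j)
        simp only [wp_rules, decide_eq_true_eq, trunc_add_eq_iff, ← e1, ← e2, er₆]
        split_ifs with hc
        · refine wp_mono (computes_secondKey rank len k _ _ _) ?_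
          rintro _ _ τa ⟨rfl, rfl, hta⟩
          refine wp_mono (computes_secondKey rank len k _ _ _) ?_
          rintro _ _ τb ⟨rfl, rfl, htb⟩
          exact ⟨by simp [hc, er₆], by trivial, by omega⟩
        · exact ⟨by simp [hc], by trivial, by omega⟩
      rintro r₆ μ₆ τ₆ ⟨⟨hF₆, hr₆, -⟩, ht₆⟩
      -- The new ranks were collected in `.tmp`, since the old ones were still needed for
      -- comparisons while they were being assigned.
      refine wp_mono (wp_forEach (fun i μ'' => Frame [rank] μ₆ μ'' ∧
        (∀ q, q < i → μ'' rank q = μ₆ .tmp q) ∧ ∀ q, i ≤ q → μ'' rank q = μ₆ rank q) 2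
        ⟨Frame.refl _ _, fun q h => absurd h (Nat.not_lt_zero _), fun _ _ => rfl⟩ ?_) ?_
      · rintro i μ'' τ'' hi ⟨hF'', h, h'⟩
        simp only [wp_rules]
        refine ⟨⟨hF''.upd (by simp) _ _, fun q hq => ?_, fun q hq => ?_⟩, by omega⟩
        · rw [upd_self, hF'' .tmp (by simpa using r3')]
          split_ifs with e
          · rw [e]
          · exact h q (by omega)
        · rw [upd_self, if_neg (by omega)]
          exact h' q (by omega)
      rintro _ μ₇ τ₇ ⟨⟨hF₇, h₇, h₇'⟩, ht₇⟩
      simp only at h₇ h₇' ht₇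
      simp only [wp_rules]
      have esa₇ : μ₇ sa = μ₅ sa := (hF₇ sa (by simp [s1])).trans (hF₆ sa (by simp [s4]))
      refine ⟨by omega, ⟨?_, ?_, ?_⟩, by omega, ?_⟩
      · exact hF.trans ((hF₄.mono (by simp)).trans ((hF₅.mono (by simp)).trans
          ((hF₆.mono (by simp)).trans (hF₇.mono (by simp)))))
      · rw [esa₇]
        exact hs.double hk hkl ha₄ hb₄ hd₅ ⟨_, hr₆.congr fun j hj => h₇ _ (hsa₅.lt j hj)⟩
      · intro x hx
        rw [h₇' x hx, hF₆ rank (by simp [r3]), er₅, hout x hx]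
      · have hs : Nat.size ((len - 1) / (k + k)) + 1 ≤ Nat.size ((len - 1) / k) := by
          rw [← Nat.mul_two, ← Nat.div_div_eq_div_mul]
          exact size_lt_size (Nat.div_pos (by omega) (by omega)) le_rfl
        have := Nat.mul_le_mul_right (len * 150) hs
        rw [Nat.add_mul] at this
        omega
    · have := hs.isSuffixArray (by omega)
      exact ⟨⟨hF, this, hout⟩, by unfold suffixTime; omega⟩
  · rintro ⟨k⟩ μ' τ' ⟨⟨hF, hs, hout⟩, hk, ht⟩ h0
    simp only at hs hk ht h0
    have hfin : Nat.size (len - 1) * (len * 150) ≤ Nat.size len * (len * 150) :=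
      Nat.mul_le_mul_right _ (Nat.size_le_size (by omega))
    exact ⟨⟨hF, hs.isSuffixArray (by omega), hout⟩, by unfold suffixTime; omega⟩

/-! ## Phase 1: preparing the text -/

/-- The number of characters before position `i` since the last `0` before it. -/
def sinceZero (E : ℕ → ℕ) : ℕ → ℕ
  | 0 => 0
  | i + 1 => if E i = 0 then 0 else sinceZero E i + 1

/-- The number of zeros before position `i`. -/
abbrev zerosBefore (E : ℕ → ℕ) (i : ℕ) : ℕ := Nat.count (fun k => E k = 0) i

/-- The initial values occur, hence agree with their ranks. -/
theorem Ranked.eq_of_initial {order out raw : ℕ → ℕ} {len r m : ℕ}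
    (h : Ranked order out len r raw) (hs : ∀ i j, i < j → j < len → raw (order i) ≤ raw (order j))
    (hm : ∀ d, d ≤ m → ∃ j, j < len ∧ raw (order j) = d) {j : ℕ} (hj : j < len)
    (hle : raw (order j) ≤ m) : out (order j) = raw (order j) := by
  induction j with
  | zero =>
    obtain ⟨i, hi, e⟩ := hm 0 (Nat.zero_le m)
    rw [h.zero hj]
    rcases Nat.eq_zero_or_pos i with rfl | hi0
    · exact e.symm
    · have := hs 0 i hi0 hi; omega
  | succ j ih =>
    have hsj := hs j (j + 1) (by omega) hj
    rw [h.succ j hj, ih (by omega) (by omega)]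
    split_ifs with e
    · omega
    · obtain ⟨i, hi, e'⟩ := hm (raw (order (j + 1)) - 1) (by omega)
      rcases Nat.lt_or_ge i (j + 1) with hij | hij
      · rcases Nat.lt_or_ge i j with hij' | hij'
        · have := hs i j hij' (by omega); omega
        · obtain rfl : i = j := by omega
          omega
      · rcases hij.lt_or_eq with hij' | rfl
        · have := hs (j + 1) i hij' hi; omega
        · omega

/-- Time of `prepare`. -/
def prepareTime (N n : ℕ) : ℕ := mergeTime 3 (n + N) + (n + N) * 60 + 60

/-- In the raw alphabet `0` is the end of the reference, `d` the end of the `d`-th string, and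
letters lie above `m`. All of `0, …, m` occur, so ranking leaves them unchanged
(`Ranked.eq_of_initial`) and only compresses the letters. -/
theorem wp_prepare {N n : ℕ} {E F : ℕ → ℕ} {μ : Mem} {τ : ℕ} (hE : ∀ i, i < N → μ .inColl i = E i)
    (hF : ∀ i, i < n → μ .inRef i = F i) (hn : 0 < n) (hlast : F (n - 1) = 0)
    (hF0 : ∀ i, i < n - 1 → F i ≠ 0) :
    wp (prepare ⟨N⟩ ⟨n⟩) μ τ fun r μ' τ' =>
      (Frame [.docNo, .docPos, .raw, .rawOrd, .rawRank, .ref, .txt, .tmp] μ μ' ∧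
        r.1.val = zerosBefore E N ∧
        (∀ i, i < N → μ' .docNo i = zerosBefore E i + 1 ∧ μ' .docPos i = sinceZero E i + 1) ∧
        (∀ i, i < N → E i = 0 → μ' .txt i = zerosBefore E i + 1) ∧
        (∀ i, i < N → E i ≠ 0 → zerosBefore E N < μ' .txt i) ∧
        (∀ i, i < N → μ' .txt i < r.2.val) ∧
        (∀ i j, i < N → j < N → E i ≠ 0 → E j ≠ 0 → (μ' .txt i < μ' .txt j ↔ E i < E j)) ∧
        μ' .ref (n - 1) = 0 ∧ (∀ i, i < n - 1 → zerosBefore E N < μ' .ref i ∧ μ' .ref i < r.2.val) ∧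
        zerosBefore E N < r.2.val ∧ r.2.val ≤ n + N) ∧
      τ' ≤ τ + prepareTime N n := by
  set m := zerosBefore E N with hm
  simp only [prepare, wp_bind]
  -- counting the strings
  refine wp_mono (wp_forLoop_of_cost (fun i s μ' => μ' = μ ∧ s.val = zerosBefore E i) 3
    ⟨rfl, by simp⟩ ?_) ?_
  · rintro i ⟨s⟩ _ τ' hi ⟨rfl, hs⟩
    simp only at hi hs
    simp only [wp_rules, decide_eq_true_eq, Word.val_zero, Word.val_one, hE i hi]
    split_ifs with h
    · exact ⟨⟨by trivial, by rw [zerosBefore, Nat.count_succ, if_pos h, hs]⟩, by omega⟩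
    · exact ⟨⟨by trivial, by rw [zerosBefore, Nat.count_succ, if_neg h, hs, Nat.add_zero]⟩, by omega⟩
  rintro ⟨m'⟩ μ₁ τ₁ ⟨⟨hμ₁, hm'⟩, ht₁⟩
  rw [hμ₁]
  simp only at hm' ht₁
  rw [← hm] at hm'
  subst hm'
  -- raw characters of the reference
  refine wp_mono (wp_forEach (fun i μ' => Frame [.raw] μ μ' ∧ ∀ k, k < i → μ' .raw k =
    if F k = 0 then 0 else F k + m) 4 ⟨Frame.refl _ _, fun k h => absurd h (Nat.not_lt_zero _)⟩
    ?_) ?_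
  · rintro i μ' τ' hi ⟨hFr, hk⟩
    simp only [wp_rules, decide_eq_true_eq, Word.val_zero, hFr .inRef (by simp), hF i hi]
    split_ifs with h
    · refine ⟨⟨hFr.upd (by simp) _ _, fun k hki => ?_⟩, by omega⟩
      rw [upd_self]
      by_cases e : k = i
      · rw [if_pos e, e, if_pos h]
      · rw [if_neg e]; exact hk k (by omega)
    · refine ⟨⟨hFr.upd (by simp) _ _, fun k hki => ?_⟩, by omega⟩
      rw [upd_self]
      by_cases e : k = i
      · rw [if_pos e, e, if_neg h]
      · rw [if_neg e]; exact hk k (by omega)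
  rintro _ μ₂ τ₂ ⟨⟨hF₂, hr₂⟩, ht₂⟩
  simp only at hr₂ ht₂
  -- raw characters of the collection
  refine wp_mono (wp_forLoop_of_cost (fun i s μ' => Frame [.raw, .docNo, .docPos] μ μ' ∧
    s.1.val = zerosBefore E i + 1 ∧ s.2.val = sinceZero E i + 1 ∧
    (∀ k, k < n → μ' .raw k = if F k = 0 then 0 else F k + m) ∧
    (∀ k, k < i → μ' .raw (n + k) = if E k = 0 then zerosBefore E k + 1 else E k + m) ∧
    (∀ k, k < i → μ' .docNo k = zerosBefore E k + 1 ∧ μ' .docPos k = sinceZero E k + 1)) 8 ?_ ?_) ?_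
  · exact ⟨hF₂.mono (by simp), rfl, rfl, hr₂, fun k h => absurd h (Nat.not_lt_zero _),
      fun k h => absurd h (Nat.not_lt_zero _)⟩
  · rintro i ⟨⟨s⟩, ⟨p⟩⟩ μ' τ' hi ⟨hFr, hs, hp, h1, h2, h3⟩
    simp only at hi hs hp
    simp only [wp_rules, decide_eq_true_eq, Word.val_zero, Word.val_one, hFr .inColl (by simp),
      hE i hi]
    have key : ∀ v, v = (if E i = 0 then zerosBefore E i + 1 else E i + m) →
        ∀ μ'', μ'' = upd (upd (upd μ' .docNo i s) .docPos i p) .raw (n + i) v →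
        Frame [.raw, .docNo, .docPos] μ μ'' ∧
        (∀ k, k < n → μ'' .raw k = if F k = 0 then 0 else F k + m) ∧
        (∀ k, k < i + 1 → μ'' .raw (n + k) = if E k = 0 then zerosBefore E k + 1 else E k + m) ∧
        (∀ k, k < i + 1 → μ'' .docNo k = zerosBefore E k + 1 ∧
          μ'' .docPos k = sinceZero E k + 1) := by
      rintro v hv _ rfl
      refine ⟨((hFr.upd (by simp) _ _).upd (by simp) _ _).upd (by simp) _ _, fun k hk => ?_,
        fun k hk => ?_, fun k hk => ?_⟩
      · rw [upd_self, if_neg (by omega)]; simpa [upd_ne] using h1 k hk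
      · rw [upd_self]
        by_cases e : k = i
        · rw [if_pos (by omega), hv, e]
        · rw [if_neg (by omega)]; simpa [upd_ne] using h2 k (by omega)
      · by_cases e : k = i
        · subst e; simp [upd, hs, hp]
        · simpa [upd, e] using h3 k (by omega)
    split_ifs with h
    · obtain ⟨k1, k2, k3, k4⟩ := key s (by rw [if_pos h, hs]) _ rfl
      refine ⟨⟨k1, ?_, ?_, k2, k3, k4⟩, by omega⟩
      · rw [zerosBefore, Nat.count_succ, if_pos h]; simp only [hs]
      · rw [sinceZero, if_pos h]
    · obtain ⟨k1, k2, k3, k4⟩ := key _ (by rw [if_neg h]) _ rfl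
      refine ⟨⟨k1, ?_, ?_, k2, k3, k4⟩, by omega⟩
      · rw [zerosBefore, Nat.count_succ, if_neg h]; simp only [hs]
      · rw [sinceZero, if_neg h, ← hp]
  rintro _ μ₃ τ₃ ⟨⟨hF₃, -, -, hrF, hrE, hdoc⟩, ht₃⟩
  simp only at hrE hdoc ht₃
  rw [wp_add]
  simp only
  -- sorting the characters
  refine wp_mono (wp_forEach (fun i μ' => Frame [.rawOrd] μ₃ μ' ∧ ∀ k, k < i → μ' .rawOrd k = k) 1
    ⟨Frame.refl _ _, fun k h => absurd h (Nat.not_lt_zero _)⟩ ?_) ?_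
  · rintro i μ' τ' hi ⟨hFr, hk⟩
    simp only [wp_rules]
    refine ⟨⟨hFr.upd (by simp) _ _, fun k hki => ?_⟩, by omega⟩
    rw [upd_self]
    split_ifs with e
    · exact e.symm
    · exact hk k (by omega)
  rintro _ μ₄ τ₄ ⟨⟨hF₄, ho₄⟩, ht₄⟩
  simp only at ho₄ ht₄
  refine wp_mono (wp_mergeSort (lo := 0) (κ := μ₃ .raw) (D := fun _ => True) (B := 3) (by simp)
    ?_ (Nat.zero_le _) fun _ _ _ => trivial) ?_
  · intro μ' hFr x y _ _ τ
    simp only [wp_rules]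
    exact ⟨by rw [hFr .raw (by simp), hF₄ .raw (by simp)], by trivial, le_rfl⟩
  rintro _ μ₅ τ₅ ⟨⟨hF₅, -, hp₅, hs₅⟩, ht₅⟩
  have hperm : IsPerm (μ₅ .rawOrd) (n + N) := ((IsPerm.id _).congr ho₄).of_seg hp₅
  have hsort : ∀ i j, i < j → j < n + N → μ₃ .raw (μ₅ .rawOrd i) ≤ μ₃ .raw (μ₅ .rawOrd j) :=
    fun i j => hs₅ i j (Nat.zero_le i)
  have hraw₅ : μ₅ .raw = μ₃ .raw := (hF₅ .raw (by simp)).trans (hF₄ .raw (by simp))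
  refine wp_mono (wp_assignRanks (κ := μ₃ .raw) (B := 3) (by simp) ?_ hperm.inj) ?_
  · intro μ' hFr x y _ _ τ
    simp only [wp_rules]
    exact ⟨by rw [hFr .raw (by simp), hraw₅], by trivial, le_rfl⟩
  rintro ⟨K⟩ μ₆ τ₆ ⟨⟨hF₆, hrk, -⟩, ht₆⟩
  simp only at hrk ht₆
  -- properties of the ranks
  have hinit : ∀ d, d ≤ m → ∃ j, j < n + N ∧ μ₃ .raw (μ₅ .rawOrd j) = d := by
    intro d hd
    have : ∃ x, x < n + N ∧ μ₃ .raw x = d := by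
      rcases Nat.eq_zero_or_pos d with rfl | h0
      · exact ⟨n - 1, by omega, by rw [hrF _ (by omega), if_pos hlast]⟩
      · obtain ⟨i, hi, h1, h2⟩ := exists_count_eq (p := fun k => E k = 0) (n := N) (c := d - 1)
          (by rw [hm] at hd; exact lt_of_lt_of_le (by omega) hd)
        refine ⟨n + i, by omega, ?_⟩
        rw [hrE i hi, if_pos h1, zerosBefore, h2]; omega
    obtain ⟨x, hx, e⟩ := this
    obtain ⟨j, hj, rfl⟩ := hperm.surj hx
    exact ⟨j, hj, e⟩
  have hrk0 : ∀ x, x < n + N → μ₃ .raw x ≤ m → μ₆ .rawRank x = μ₃ .raw x := fun x hx hle => by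
    obtain ⟨j, hj, rfl⟩ := hperm.surj hx
    exact hrk.eq_of_initial hsort hinit hj hle
  have hrklt : ∀ x y, x < n + N → y < n + N →
      (μ₆ .rawRank x < μ₆ .rawRank y ↔ μ₃ .raw x < μ₃ .raw y) := fun x y hx hy => by
    obtain ⟨i, hi, rfl⟩ := hperm.surj hx
    obtain ⟨j, hj, rfl⟩ := hperm.surj hy
    exact hrk.lt_iff hsort hi hj
  have hrkK : ∀ x, x < n + N → μ₆ .rawRank x < K := fun x hx => by
    obtain ⟨j, hj, rfl⟩ := hperm.surj hx
    exact hrk.lt_num hj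
  obtain ⟨jm, hjm, ejm⟩ := hinit m le_rfl
  have hxm := hperm.lt jm hjm
  have hrkm := hrk0 _ hxm ejm.le
  rw [ejm] at hrkm
  have hgt : ∀ x, x < n + N → m < μ₃ .raw x → m < μ₆ .rawRank x := fun x hx h => by
    rw [← hrkm, hrklt _ _ hxm hx, ejm]; exact h
  -- copying
  refine wp_mono (wp_forEach (fun i μ' => Frame [.ref] μ₆ μ' ∧
    ∀ k, k < i → μ' .ref k = μ₆ .rawRank k) 2
    ⟨Frame.refl _ _, fun k h => absurd h (Nat.not_lt_zero _)⟩ ?_) ?_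
  · rintro i μ' τ' hi ⟨hFr, hk⟩
    simp only [wp_rules]
    refine ⟨⟨hFr.upd (by simp) _ _, fun k hki => ?_⟩, by omega⟩
    rw [upd_self, hFr .rawRank (by simp)]
    split_ifs with e
    · rw [e]
    · exact hk k (by omega)
  rintro _ μ₇ τ₇ ⟨⟨hF₇, ho₇⟩, ht₇⟩
  simp only at ho₇ ht₇
  refine wp_mono (wp_forEach (fun i μ' => Frame [.txt] μ₇ μ' ∧
    ∀ k, k < i → μ' .txt k = μ₆ .rawRank (n + k)) 3
    ⟨Frame.refl _ _, fun k h => absurd h (Nat.not_lt_zero _)⟩ ?_) ?_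
  · rintro i μ' τ' hi ⟨hFr, hk⟩
    simp only [wp_rules]
    refine ⟨⟨hFr.upd (by simp) _ _, fun k hki => ?_⟩, by omega⟩
    rw [upd_self, hFr .rawRank (by simp), hF₇ .rawRank (by simp)]
    split_ifs with e
    · rw [e]
    · exact hk k (by omega)
  rintro _ μ₈ τ₈ ⟨⟨hF₈, ho₈⟩, ht₈⟩
  simp only at ho₈ ht₈
  simp only [wp_pure]
  have href : ∀ i, i < n → μ₈ .ref i = μ₆ .rawRank i := fun i hi => by
    rw [hF₈ .ref (by simp), ho₇ i hi]
  have hgtE : ∀ i, i < N → E i ≠ 0 → μ₃ .raw (n + i) = E i + m := fun i hi h => by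
    rw [hrE i hi, if_neg h]
  refine ⟨⟨?_, by trivial, fun i hi => ?_, fun i hi h => ?_, fun i hi h => ?_, fun i hi => ?_,
    fun i j hi hj h h' => ?_, ?_, fun i hi => ⟨?_, ?_⟩, ?_, ?_⟩, ?_⟩
  · exact (hF₃.mono (by simp)).trans ((hF₄.mono (by simp)).trans ((hF₅.mono (by simp)).trans
      ((hF₆.mono (by simp)).trans ((hF₇.mono (by simp)).trans (hF₈.mono (by simp))))))
  · rw [hF₈ .docNo (by simp), hF₇ .docNo (by simp), hF₆ .docNo (by simp), hF₅ .docNo (by simp),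
      hF₄ .docNo (by simp), hF₈ .docPos (by simp), hF₇ .docPos (by simp), hF₆ .docPos (by simp),
      hF₅ .docPos (by simp), hF₄ .docPos (by simp)]
    exact hdoc i hi
  · have e : μ₃ .raw (n + i) = zerosBefore E i + 1 := by rw [hrE i hi, if_pos h]
    have : zerosBefore E i < m := Nat.count_strict_mono (p := fun k => E k = 0) h hi
    rw [ho₈ i hi, hrk0 _ (by omega) (by omega), e]
  · rw [ho₈ i hi]
    exact hgt _ (by omega) (by rw [hgtE i hi h]; omega)
  · rw [ho₈ i hi]; exact hrkK _ (by omega)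
  · rw [ho₈ i hi, ho₈ j hj, hrklt _ _ (by omega) (by omega), hgtE i hi h, hgtE j hj h']; omega
  · have e : μ₃ .raw (n - 1) = 0 := by rw [hrF _ (by omega), if_pos hlast]
    rw [href _ (by omega), hrk0 _ (by omega) (by omega), e]
  · rw [href i (by omega)]
    refine hgt _ (by omega) ?_
    have := hF0 i hi
    rw [hrF i (by omega), if_neg this]; omega
  · rw [href i (by omega)]; exact hrkK i (by omega)
  · rw [← hrkm]; exact hrkK _ hxm
  · exact hrk.num_le
  · rw [Nat.sub_zero] at ht₅
    unfold prepareTime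
    omega

/-! ## Phase 1: augmenting the reference -/

/-- Lets a newly appended run be charged to the text positions that carry its letter. -/
theorem count_add_le_count {p q r : ℕ → Prop} [DecidablePred p] [DecidablePred q] [DecidablePred r]
    (h1 : ∀ i, p i → r i) (h2 : ∀ i, q i → r i) (h3 : ∀ i, p i → ¬ q i) (n : ℕ) :
    Nat.count p n + Nat.count q n ≤ Nat.count r n := by
  induction n with
  | zero => simp
  | succ n ih =>
    have := h1 n; have := h2 n; have := h3 n
    simp only [Nat.count_succ]
    split_ifs <;> first | omega | (exfalso; tauto)

/-- Time of `augment`. -/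
def augmentTime (N n : ℕ) : ℕ := (n + N) * 40 + 40

/-- Of the lengths of the runs two facts are kept: they are at least `1`, so each letter occurs in
the result, and at most the number of occurrences of the letter, so the total growth is at most `N`.
-/
theorem wp_augment {N n m K : ℕ} {T : ℕ → ℕ} {μ : Mem} {τ : ℕ} (hT : ∀ i, i < N → μ .txt i = T i)
    (hTK : ∀ i, i < N → T i < K) (hn : 0 < n)
    (hlast : μ .ref (n - 1) = 0)
    (hR : ∀ i, i < n - 1 → m < μ .ref i ∧ μ .ref i < K) (hseen : ∀ c, μ .seen c = 0)
    (hrun : ∀ c, μ .runLen c = 0) :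
    wp (augment ⟨N⟩ ⟨n⟩ ⟨m⟩) μ τ fun r μ' τ' =>
      (Frame [.seen, .runLen, .ref] μ μ' ∧ n ≤ r.val ∧ r.val ≤ n + N ∧
        μ' .ref (r.val - 1) = 0 ∧ (∀ i, i < r.val - 1 → m < μ' .ref i ∧ μ' .ref i < K) ∧
        ∀ i, i < N → m < T i → ∃ j, j < r.val ∧ μ' .ref j = T i) ∧
      τ' ≤ τ + augmentTime N n := by
  simp only [augment, wp_bind]
  refine wp_mono (wp_forEach (fun i μ' => Frame [.seen] μ μ' ∧
    ∀ c, μ' .seen c ≠ 0 → ∃ k, k < n ∧ μ .ref k = c) 2 ⟨Frame.refl _ _, fun c h => absurd (hseen c) h⟩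
    ?_) ?_
  · rintro i μ' τ' hi ⟨hF, hc⟩
    simp only [wp_rules, Word.val_one, hF .ref (by simp)]
    refine ⟨⟨hF.upd (by simp) _ _, fun c h => ?_⟩, by omega⟩
    rw [upd_self] at h
    split_ifs at h with e
    · exact ⟨i, hi, e.symm⟩
    · exact hc c h
  rintro _ μ₁ τ₁ ⟨⟨hF₁, hs₁⟩, ht₁⟩
  simp only at hs₁ ht₁
  refine wp_mono (wp_forLoop_of_cost (fun i s μ' => Frame [.runLen] μ₁ μ' ∧
    s.2.val ≤ Nat.count (fun j => T j = s.1.val) i ∧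
    (∀ c, μ' .runLen c ≤ Nat.count (fun j => T j = c) i) ∧
    ∀ j, j < i → 1 ≤ μ' .runLen (T j)) 6 ?_ ?_) ?_
  · refine ⟨Frame.refl _ _, by simp, fun c => ?_, fun j h => absurd h (Nat.not_lt_zero _)⟩
    rw [hF₁ .runLen (by simp), hrun c]; exact Nat.zero_le _
  · rintro i ⟨⟨s⟩, ⟨r⟩⟩ μ' τ' hi ⟨hF, h1, h2, h3⟩
    simp only at hi h1
    have eT : μ' .txt i = T i := by rw [hF .txt (by simp), hF₁ .txt (by simp), hT i hi]
    simp only [wp_rules, Word.val_one, decide_eq_true_eq, eT]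
    have key : ∀ r', 1 ≤ r' → r' ≤ Nat.count (fun j => T j = T i) i + 1 →
        (μ' .runLen (T i) < r' →
          Frame [.runLen] μ₁ (upd μ' .runLen (T i) r') ∧
          r' ≤ Nat.count (fun j => T j = T i) (i + 1) ∧
          (∀ c, upd μ' .runLen (T i) r' .runLen c ≤ Nat.count (fun j => T j = c) (i + 1)) ∧
          ∀ j, j < i + 1 → 1 ≤ upd μ' .runLen (T i) r' .runLen (T j)) ∧
        (¬ μ' .runLen (T i) < r' → Frame [.runLen] μ₁ μ' ∧
          r' ≤ Nat.count (fun j => T j = T i) (i + 1) ∧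
          (∀ c, μ' .runLen c ≤ Nat.count (fun j => T j = c) (i + 1)) ∧
          ∀ j, j < i + 1 → 1 ≤ μ' .runLen (T j)) := by
      intro r' hr1 hr2
      have hr3 : r' ≤ Nat.count (fun j => T j = T i) (i + 1) := by
        rw [Nat.count_succ, if_pos rfl]; exact hr2
      have hmono : ∀ c, μ' .runLen c ≤ Nat.count (fun j => T j = c) (i + 1) := fun c =>
        (h2 c).trans (Nat.count_monotone _ (Nat.le_succ i))
      refine ⟨fun _ => ⟨hF.upd (by simp) _ _, hr3, fun c => ?_, fun j hj => ?_⟩,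
        fun h => ⟨hF, hr3, hmono, fun j hj => ?_⟩⟩
      · rw [upd_self]
        split_ifs with e
        · rw [e]; exact hr3
        · exact hmono c
      · rw [upd_self]
        split_ifs with e
        · exact hr1
        · refine h3 j (lt_of_le_of_ne (Nat.lt_succ_iff.1 hj) ?_)
          rintro rfl; exact e rfl
      · rcases Nat.lt_or_ge j i with hj' | hj'
        · exact h3 j hj'
        · obtain rfl : j = i := by omega
          omega
    split_ifs with he hlt hlt
    · exact ⟨(key _ (by omega) (by rw [he]; omega)).1 hlt, by omega⟩
    · exact ⟨(key _ (by omega) (by rw [he]; omega)).2 hlt, by omega⟩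
    · exact ⟨(key 1 le_rfl (by omega)).1 hlt, by omega⟩
    · exact ⟨(key 1 le_rfl (by omega)).2 hlt, by omega⟩
  rintro _ μ₂ τ₂ ⟨⟨hF₂, -, hle₂, hge₂⟩, ht₂⟩
  simp only at hle₂ hge₂ ht₂
  simp only [wp_sub, Word.val_one]
  have href₂ : μ₂ .ref = μ .ref := (hF₂ .ref (by simp)).trans (hF₁ .ref (by simp))
  -- What has been appended is bounded by the number of text positions whose letter is marked as
  -- seen; the inner loop is paid for by the growth of `p`.
  refine wp_mono (wp_forLoop (fun i p μ' τ' => (Frame [.seen, .ref] μ₂ μ' ∧ n - 1 ≤ p.val ∧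
    p.val ≤ n - 1 + Nat.count (fun j => μ' .seen (T j) ≠ 0) N ∧
    (∀ k, k < p.val → m < μ' .ref k ∧ μ' .ref k < K) ∧
    (∀ c, m < c → μ' .seen c ≠ 0 → ∃ k, k < p.val ∧ μ' .ref k = c) ∧
    ∀ j, j < i → m < T j → μ' .seen (T j) ≠ 0) ∧
    τ' ≤ τ₂ + 2 + i * 10 + (p.val - (n - 1)) * 5) ?_ ?_) ?_
  · refine ⟨⟨Frame.refl _ _, le_rfl, Nat.le_add_right _ _, fun k hk => ?_, fun c hc h => ?_,
      fun j h => absurd h (Nat.not_lt_zero _)⟩, by omega⟩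
    · rw [href₂]; exact hR k hk
    · rw [hF₂ .seen (by simp)] at h
      obtain ⟨k, hk, e⟩ := hs₁ c h
      -- The old end of the reference, at `n - 1`, will be overwritten; it cannot be the witness,
      -- because its character `0` is not above `m`.
      refine ⟨k, lt_of_le_of_ne (show k ≤ n - 1 by omega) ?_, by rw [href₂, e]⟩
      rintro rfl
      rw [hlast] at e; omega
  · rintro i ⟨p⟩ μ' τ' hi ⟨⟨hF, hp1, hp2, hr, hsn, hall⟩, ht⟩
    simp only at hi hp1 hp2 hr hsn ht
    have eT : μ' .txt i = T i := by
      rw [hF .txt (by simp), hF₂ .txt (by simp), hF₁ .txt (by simp), hT i hi]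
    simp only [wp_rules, Word.val_zero, Word.val_one, decide_eq_true_eq, eT]
    split_ifs with hm h0
    · have hrl : μ' .runLen (T i) = μ₂ .runLen (T i) := by rw [hF .runLen (by simp)]
      rw [upd_ne _ _ _ (by simp), hrl]
      have hrl1 := hge₂ i hi
      have hrlN := hle₂ (T i)
      set q := μ₂ .runLen (T i) with hq
      refine wp_mono (wp_forLoop_of_cost (fun t p' μ'' => Frame [.ref] (upd μ' .seen (T i) 1) μ'' ∧
        p'.val = p + t ∧ (∀ k, k < p → μ'' .ref k = μ' .ref k) ∧
        ∀ k, p ≤ k → k < p + t → μ'' .ref k = T i) 2 ?_ ?_) ?_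
      · exact ⟨Frame.refl _ _, rfl, fun k _ => by rw [upd_ne _ _ _ (by simp)],
          fun k h h' => by omega⟩
      · rintro t ⟨p'⟩ μ'' τ'' ht' ⟨hF', hp', h1, h2⟩
        simp only at hp'
        simp only [wp_rules, Word.val_one]
        refine ⟨⟨hF'.upd (by simp) _ _, by omega, fun k hk => ?_, fun k hk hk' => ?_⟩, by omega⟩
        · rw [upd_self, if_neg (by omega)]; exact h1 k hk
        · rw [upd_self]
          split_ifs with e
          · rfl
          · exact h2 k hk (by omega)
      · rintro ⟨p'⟩ μ'' τ'' ⟨⟨hF', hp', h1, h2⟩, ht'⟩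
        simp only at hp' h2 ht' ⊢
        have hseen' : μ'' .seen = upd μ' .seen (T i) 1 .seen := hF' .seen (by simp)
        refine ⟨⟨?_, by omega, ?_, fun k hk => ?_, fun c hc h => ?_, fun j hj hmj => ?_⟩, ?_⟩
        · exact (hF.upd (by simp) _ _).trans (hF'.mono (by simp))
        · have := count_add_le_count (p := fun j => μ' .seen (T j) ≠ 0)
            (q := fun j => T j = T i) (r := fun j => μ'' .seen (T j) ≠ 0)
            (fun j hj => by rw [hseen', upd_self]; split_ifs <;> simp_all)
            (fun j hj => by rw [hseen', upd_self, if_pos hj]; simp)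
            (fun j hj e => hj (e ▸ h0)) N
          omega
        · rcases Nat.lt_or_ge k p with hk' | hk'
          · rw [h1 k hk']; exact hr k hk'
          · rw [h2 k hk' (by omega)]; exact ⟨hm, hTK i hi⟩
        · rw [hseen', upd_self] at h
          split_ifs at h with e
          · exact ⟨p, by omega, by rw [h2 p le_rfl (by omega), e]⟩
          · obtain ⟨k, hk, e'⟩ := hsn c hc h
            exact ⟨k, by omega, by rw [h1 k hk, e']⟩
        · rw [hseen', upd_self]
          split_ifs with e
          · simp
          · refine hall j (lt_of_le_of_ne (Nat.lt_succ_iff.1 hj) ?_) hmj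
            rintro rfl; exact e rfl
        · have : q * (2 + 1) + 2 * q = 5 * q := by omega
          have e2 : (p' - (n - 1)) * 5 = (p - (n - 1)) * 5 + q * 5 := by
            rw [← Nat.add_mul]; congr 1; omega
          omega
    · refine ⟨⟨hF, hp1, hp2, hr, hsn, fun j hj hmj => ?_⟩, by omega⟩
      rcases Nat.lt_or_ge j i with hj' | hj'
      · exact hall j hj' hmj
      · obtain rfl : j = i := by omega
        exact h0
    · refine ⟨⟨hF, hp1, hp2, hr, hsn, fun j hj hmj => ?_⟩, by omega⟩
      rcases Nat.lt_or_ge j i with hj' | hj'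
      · exact hall j hj' hmj
      · obtain rfl : j = i := by omega
        exact absurd hmj hm
  rintro ⟨p⟩ μ₃ τ₃ ⟨⟨hF₃, hp1, hp2, hr, hsn, hall⟩, ht₃⟩
  simp only at hp1 hp2 hr hsn hall ht₃
  simp only [wp_rules, Word.val_zero, Word.val_one, Nat.add_sub_cancel]
  have hcN := Nat.count_le (fun j => μ₃ .seen (T j) ≠ 0) (n := N)
  refine ⟨⟨?_, by omega, by omega, by simp, fun i hi => ?_, fun i hi hmi => ?_⟩, ?_⟩
  · exact ((hF₁.mono (by simp)).trans ((hF₂.mono (by simp)).trans (hF₃.mono (by simp)))).upd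
      (by simp) _ _
  · rw [upd_self, if_neg (by omega)]; exact hr i hi
  · obtain ⟨k, hk, e⟩ := hsn _ hmi (hall i hi hmi)
    exact ⟨k, by omega, by rw [upd_self, if_neg (by omega), e]⟩
  · unfold augmentTime; omega

/-! ## Phase 1: the LCP array -/

/-- `sa` and `isa` are the suffix array and the inverse suffix array of the reference `R`, which
ends with its only `0`. -/
structure RefIndex (R sa isa : ℕ → ℕ) (nR : ℕ) : Prop where
  pos : 0 < nR
  last : R (nR - 1) = 0
  pos_of_lt : ∀ i, i < nR - 1 → 0 < R i
  perm : IsPerm sa nR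
  sorted : ∀ i j, i < j → j < nR → suf R (sa i) < suf R (sa j)
  isa_sa : ∀ j, j < nR → isa (sa j) = j

/-- The final `0` occurs only once: a match that reached it would pair it with a positive entry at
an earlier position. -/
theorem agree_bound {R : ℕ → ℕ} {nR i j l : ℕ} (hlast : R (nR - 1) = 0)
    (hpos : ∀ i, i < nR - 1 → 0 < R i) (hi : i < nR) (hj : j < nR) (hij : i ≠ j)
    (h : Agree R i R j l) : i + l < nR ∧ j + l < nR := by
  by_contra hc
  rcases Nat.lt_or_gt_of_ne hij with h' | h'
  · have e := h (nR - 1 - j) (by omega)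
    rw [show j + (nR - 1 - j) = nR - 1 by omega, hlast] at e
    have := hpos (i + (nR - 1 - j)) (by omega)
    omega
  · have e := h (nR - 1 - i) (by omega)
    rw [show i + (nR - 1 - i) = nR - 1 by omega, hlast] at e
    have := hpos (j + (nR - 1 - i)) (by omega)
    omega

/-- By `agree_bound` any two suffixes differ before the end of the reference, so the padding and the
memory contents beyond the end are irrelevant to the order. -/
theorem IsSuffixArray.refIndex {R sa isa : ℕ → ℕ} {nR : ℕ} (h : IsSuffixArray R sa isa nR)
    (h0 : 0 < nR) (hlast : R (nR - 1) = 0) (hpos : ∀ i, i < nR - 1 → 0 < R i) :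
    RefIndex R sa isa nR := by
  refine ⟨h0, hlast, hpos, h.perm, fun i j hij hj => ?_, h.isa_sa⟩
  obtain ⟨l, hl, hlt⟩ := suf_lt_iff.1 (h.sorted i j hij hj)
  have hi' := h.perm.lt i (by omega)
  have hj' := h.perm.lt j hj
  have hne : sa i ≠ sa j := fun e => hij.ne (h.perm.inj i j (by omega) hj e)
  have hag : ∀ k, k ≤ l → Agree R (sa i) R (sa j) k := by
    intro k hk
    induction k with
    | zero => exact Agree.zero
    | succ k ih =>
      have h1 := ih (by omega)
      obtain ⟨b1, b2⟩ := agree_bound hlast hpos hi' hj' hne h1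
      have := hl k (by omega)
      rw [padded, padded, if_pos b1, if_pos b2] at this
      exact h1.succ (by omega)
  obtain ⟨b1, b2⟩ := agree_bound hlast hpos hi' hj' hne (hag l le_rfl)
  rw [padded, padded, if_pos b1, if_pos b2] at hlt
  exact (hag l le_rfl).lt (by omega)

namespace RefIndex
variable {R sa isa : ℕ → ℕ} {nR : ℕ} (h : RefIndex R sa isa nR)
include h

theorem sa_isa {i : ℕ} (hi : i < nR) : sa (isa i) = i := by
  obtain ⟨j, hj, rfl⟩ := h.perm.surj hi
  rw [h.isa_sa j hj]

theorem isa_lt {i : ℕ} (hi : i < nR) : isa i < nR := by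
  obtain ⟨j, hj, rfl⟩ := h.perm.surj hi
  rwa [h.isa_sa j hj]

theorem sorted_iff {i j : ℕ} (hi : i < nR) (hj : j < nR) :
    suf R (sa i) < suf R (sa j) ↔ i < j := by
  refine ⟨fun hlt => ?_, fun hij => h.sorted i j hij hj⟩
  by_contra hc
  rcases (not_lt.1 hc).lt_or_eq with h' | rfl
  · exact lt_asymm hlt (h.sorted j i h' hi)
  · exact lt_irrefl _ hlt

theorem sorted_le {i j : ℕ} (hij : i ≤ j) (hj : j < nR) : suf R (sa i) ≤ suf R (sa j) := by
  rcases hij.lt_or_eq with h' | rfl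
  · exact (h.sorted i j h' hj).le
  · exact le_rfl

theorem isa_lt_isa_iff {i j : ℕ} (hi : i < nR) (hj : j < nR) :
    isa i < isa j ↔ suf R i < suf R j := by
  rw [← h.sorted_iff (h.isa_lt hi) (h.isa_lt hj), h.sa_isa hi, h.sa_isa hj]

theorem isa_last : isa (nR - 1) = 0 := by
  have hpos := h.pos
  by_contra hc
  have hlt := h.isa_lt (i := nR - 1) (by omega)
  have h1 := h.sorted 0 (isa (nR - 1)) (by omega) hlt
  rw [h.sa_isa (by omega)] at h1
  have h2 : sa 0 ≠ nR - 1 := fun e => hc (by rw [← e, h.isa_sa 0 h.pos])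
  have h3 := h.pos_of_lt (sa 0) (by have := h.perm.lt 0 h.pos; omega)
  have := (Agree.zero (f := R) (i := sa 0) (g := R) (j := nR - 1)).char_le h1.le
  rw [Nat.add_zero, Nat.add_zero, h.last] at this
  omega

theorem sa_zero : sa 0 = nR - 1 := by
  have := h.sa_isa (i := nR - 1) (by have := h.pos; omega)
  rwa [h.isa_last] at this

theorem isa_pos {i : ℕ} (hi : i < nR - 1) : 0 < isa i := by
  by_contra hc
  have e := h.sa_isa (i := i) (by omega)
  rw [show isa i = 0 by omega, h.sa_zero] at e
  omega

end RefIndex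

/-- `lcp j` is the length of the longest common prefix of the suffixes of rank `j - 1` and `j`. -/
structure IsLcp (R sa lcp : ℕ → ℕ) (nR : ℕ) : Prop where
  zero : lcp 0 = 0
  agree : ∀ j, 0 < j → j < nR → Agree R (sa (j - 1)) R (sa j) (lcp j)
  ne : ∀ j, 0 < j → j < nR → R (sa (j - 1) + lcp j) ≠ R (sa j + lcp j)

/-- In text order the permuted LCP value drops by at most one per position: deleting the first
character from a suffix and from its predecessor leaves a smaller suffix that shares `l - 1`
characters with the next one. -/
theorem wp_computeLCP {R sa isa : ℕ → ℕ} {nR : ℕ} (h : RefIndex R sa isa nR) {μ : Mem} {τ : ℕ}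
    (hR : ∀ i, i < nR → μ .ref i = R i) (hsa : μ .saR = sa) :
    wp (computeLCP ⟨nR⟩) μ τ fun _ μ' τ' =>
      (Frame [.phi, .plcp, .lcp] μ μ' ∧ IsLcp R sa (μ' .lcp) nR) ∧ τ' ≤ τ + (nR * 50 + 50) := by
  have hpos := h.pos
  simp only [computeLCP, wp_bind, wp_sub, Word.val_one]
  refine wp_mono (wp_forEach (fun i μ' => Frame [.phi] μ μ' ∧
    ∀ k, k < i → μ' .phi (sa (k + 1)) = sa k) 4 ⟨Frame.refl _ _, fun k h => absurd h (Nat.not_lt_zero _)⟩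
    ?_) ?_
  · rintro i μ' τ' hi ⟨hF, hk⟩
    simp only at hi
    simp only [wp_rules, Word.val_one, hF .saR (by simp), hsa]
    refine ⟨⟨hF.upd (by simp) _ _, fun k hki => ?_⟩, by omega⟩
    rw [upd_self]
    split_ifs with e
    · have := h.perm.inj _ _ (by omega) (by omega) e
      rw [show k = i by omega]
    · refine hk k (lt_of_le_of_ne (Nat.lt_succ_iff.1 hki) ?_)
      rintro rfl; exact e rfl
  rintro _ μ₁ τ₁ ⟨⟨hF₁, hφ₁⟩, ht₁⟩
  simp only at hφ₁ ht₁
  have hφ : ∀ i, i < nR - 1 → μ₁ .phi i = sa (isa i - 1) := fun i hi => by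
    have h1 := h.isa_pos hi
    have h2 := h.isa_lt (i := i) (by omega)
    have := hφ₁ (isa i - 1) (by omega)
    rwa [Nat.sub_add_cancel h1, h.sa_isa (by omega)] at this
  have hprev : ∀ i, i < nR - 1 → sa (isa i - 1) < nR ∧ i ≠ sa (isa i - 1) := fun i hi => by
    have h1 := h.isa_pos hi
    have h2 := h.isa_lt (i := i) (by omega)
    refine ⟨h.perm.lt _ (by omega), fun e => ?_⟩
    have := h.isa_sa (isa i - 1) (by omega)
    rw [← e] at this
    omega
  -- The clock contains `8 * l`: every successful comparison raises `l`, and `l` never exceeds `nR`,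
  -- so all comparisons together are linear in number.
  refine wp_mono (wp_forLoop (fun i l μ' τ' => (Frame [.plcp] μ₁ μ' ∧ l.val ≤ nR ∧
    (i < nR - 1 → Agree R i R (sa (isa i - 1)) l.val) ∧
    (∀ k, k < i → Agree R k R (sa (isa k - 1)) (μ' .plcp k) ∧
      R (k + μ' .plcp k) ≠ R (sa (isa k - 1) + μ' .plcp k))) ∧
    τ' ≤ τ₁ + 1 + i * 30 + l.val * 8) ?_ ?_) ?_
  · exact ⟨⟨Frame.refl _ _, Nat.zero_le _, fun _ => Agree.zero, fun k h => absurd h (Nat.not_lt_zero _)⟩,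
      by simp⟩
  · rintro i ⟨l⟩ μ' τ' hi ⟨⟨hF, hl, hag, hk⟩, ht⟩
    simp only at hi hl hag ht
    simp only [wp_rules, Word.val_one, hF .phi (by simp), hφ i hi]
    obtain ⟨hj, hij⟩ := hprev i hi
    set j := sa (isa i - 1) with hjdef
    refine wp_mono (wp_whileLoop (σ := Word) (Q := fun l' μ'' τ'' => μ'' = μ' ∧
        Agree R i R j l'.val ∧ R (i + l'.val) ≠ R (j + l'.val) ∧
        τ'' + l * 8 ≤ τ' + 2 + l'.val * 8 + 10)
      (fun (l' : Word) μ'' τ'' => μ'' = μ' ∧ Agree R i R j l'.val ∧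
        τ'' + l * 8 ≤ τ' + 2 + l'.val * 8) (fun l' => nR - l'.val)
        ⟨rfl, hag hi, le_rfl⟩ (by simp) ?_ ?_) ?_
    · rintro ⟨l'⟩ μ'' τ'' ⟨hμ'', ha, ht'⟩
      simp only at ha ht'
      obtain ⟨b1, b2⟩ := agree_bound h.last h.pos_of_lt (by omega) hj hij ha
      have e : ∀ k, k < nR → μ' .ref k = R k := fun k hk => by
        rw [hF .ref (by simp), hF₁ .ref (by simp), hR k hk]
      subst hμ''
      simp only [wp_rules, decide_eq_true_eq, Word.val_one, e _ b1, e _ b2]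
      split_ifs with hc
      · exact ⟨by omega, by trivial, ha.succ hc, by omega⟩
      · exact ⟨by trivial, ha, hc, by omega⟩
    · rintro ⟨l'⟩ μ'' τ'' ⟨hμ'', ha, ht'⟩ h0
      simp only at ha ht' h0
      obtain ⟨b1, b2⟩ := agree_bound h.last h.pos_of_lt (by omega) hj hij ha
      omega
    · rintro ⟨l'⟩ μ'' τ'' ⟨hμ'', ha, hne, ht'⟩
      simp only at ha hne ht' ⊢
      subst hμ''
      obtain ⟨b1, b2⟩ := agree_bound h.last h.pos_of_lt (by omega) hj hij ha
      refine ⟨⟨hF.upd (by simp) _ _, by omega, fun hi' => ?_, fun k hki => ?_⟩, by omega⟩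
      · rcases Nat.eq_zero_or_pos l' with rfl | hl'
        · exact Agree.zero
        · have hRi := h.pos_of_lt i hi
          have hj1 : j + 1 < nR := by
            have e := ha 0 hl'
            rw [Nat.add_zero, Nat.add_zero] at e
            by_contra hcon
            rw [show j = nR - 1 by omega, h.last] at e
            omega
          have ha1 : Agree R (i + 1) R (j + 1) (l' - 1) := by
            refine Agree.shift (k := 1) (l := l' - 1) ?_
            rwa [show 1 + (l' - 1) = l' by omega]
          have hlt : suf R j < suf R i := by
            rw [← h.isa_lt_isa_iff hj (by omega), hjdef, h.isa_sa _ (by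
              have := h.isa_lt (i := i) (by omega); omega)]
            have := h.isa_pos hi; omega
          have hlt1 : suf R (j + 1) < suf R (i + 1) :=
            ((ha.symm.mono (show 1 ≤ l' from hl')).lt_iff).1 hlt
          -- The predecessor of suffix `i + 1` lies between suffix `j + 1` and suffix `i + 1`, and
          -- hence inherits their common prefix.
          have hle : suf R (j + 1) ≤ suf R (sa (isa (i + 1) - 1)) := by
            have h1 := (h.isa_lt_isa_iff hj1 (show i + 1 < nR by omega)).2 hlt1
            have h2 := h.isa_lt (i := i + 1) (by omega)
            have h3 := h.sorted_le (i := isa (j + 1)) (j := isa (i + 1) - 1) (by omega) (by omega)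
            rwa [h.sa_isa hj1] at h3
          have hle2 : suf R (sa (isa (i + 1) - 1)) ≤ suf R (i + 1) := by
            have h2 := h.isa_lt (i := i + 1) (by omega)
            have h3 := h.sorted_le (i := isa (i + 1) - 1) (j := isa (i + 1)) (by omega) (by omega)
            rwa [h.sa_isa (i := i + 1) (by omega)] at h3
          exact ha1.trans (Agree.between hle hle2 ha1.symm)
      · by_cases e : k = i
        · rw [e, upd_same]; exact ⟨ha, hne⟩
        · rw [upd_self, if_neg e]; exact hk k (by omega)
  rintro ⟨l⟩ μ₂ τ₂ ⟨⟨hF₂, hl, -, hk₂⟩, ht₂⟩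
  simp only at hl hk₂ ht₂
  rw [wp_write]
  refine wp_mono (wp_forEach (fun i μ' => Frame [.lcp] (upd μ₂ .plcp (nR - 1) 0) μ' ∧
    ∀ k, k < i → μ' .lcp k = upd μ₂ .plcp (nR - 1) 0 .plcp (sa k)) 3 ⟨Frame.refl _ _,
      fun k h => absurd h (Nat.not_lt_zero _)⟩ ?_) ?_
  · rintro i μ' τ' hi ⟨hF, hk⟩
    simp only at hi
    simp only [wp_rules, hF .saR (by simp), hF .plcp (by simp), upd_ne μ₂ (a := .plcp) (b := .saR)
      _ _ (by simp), hF₂ .saR (by simp), hF₁ .saR (by simp), hsa]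
    refine ⟨⟨hF.upd (by simp) _ _, fun k hki => ?_⟩, by omega⟩
    by_cases e : k = i
    · rw [e, upd_same]
    · rw [upd_self, if_neg e]; exact hk k (by omega)
  rintro _ μ₃ τ₃ ⟨⟨hF₃, hk₃⟩, ht₃⟩
  simp only at hk₃ ht₃
  have hl3 : ∀ j, 0 < j → j < nR → μ₃ .lcp j = μ₂ .plcp (sa j) ∧ sa j < nR - 1 := fun j h0 hj => by
    have h1 := h.perm.lt j hj
    have h2 : sa j ≠ nR - 1 := fun e => by
      have := h.isa_sa j hj
      rw [e, h.isa_last] at this; omega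
    rw [hk₃ j hj, upd_self, if_neg h2]
    exact ⟨rfl, by omega⟩
  refine ⟨⟨?_, ⟨?_, fun j h0 hj => ?_, fun j h0 hj => ?_⟩⟩, ?_⟩
  · exact (hF₁.mono (by simp)).trans (((hF₂.mono (by simp)).upd (by simp) _ _).trans
      (hF₃.mono (by simp)))
  · rw [hk₃ 0 hpos, h.sa_zero, upd_same]
  · obtain ⟨e, hlt⟩ := hl3 j h0 hj
    have := (hk₂ _ hlt).1
    rw [h.isa_sa j hj] at this
    rw [e]; exact this.symm
  · obtain ⟨e, hlt⟩ := hl3 j h0 hj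
    have := (hk₂ _ hlt).2
    rw [h.isa_sa j hj] at this
    rw [e]; exact this.symm
  · omega

/-! ## Phase 1: range minima -/

/-- The entry `i` of the row at `base` bounds exactly the values below `lcp[i, i + w)`. -/
def RowSpec (lcp rmq : ℕ → ℕ) (nR base w : ℕ) : Prop :=
  ∀ i, i < nR → ∀ v, v ≤ rmq (base + i) ↔ ∀ x, i ≤ x → x < i + w → x < nR → v ≤ lcp x

/-- The rows `0, …, t` of the range minimum structure are correct, and row `t` is the last one. -/
structure IsRmq (lcp rmq : ℕ → ℕ) (nR t : ℕ) : Prop where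
  row : ∀ k, k ≤ t → RowSpec lcp rmq nR (k * nR) (2 ^ k)
  le_pow : nR ≤ 2 ^ t
  pow_lt : ∀ k, k < t → 2 ^ k < nR

theorem IsRmq.lt_size {lcp rmq : ℕ → ℕ} {nR t : ℕ} (h : IsRmq lcp rmq nR t) : t ≤ Nat.size nR := by
  rcases Nat.eq_zero_or_pos t with rfl | ht
  · exact Nat.zero_le _
  · have := h.pow_lt (t - 1) (by omega)
    have := Nat.lt_size.2 this.le
    omega

/-- The descents through the rows get fuel `nR` and visit `t + 1` rows. -/
theorem IsRmq.succ_le {lcp rmq : ℕ → ℕ} {nR t : ℕ} (h : IsRmq lcp rmq nR t) (hn : 0 < nR) :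
    t + 1 ≤ nR := by
  rcases Nat.eq_zero_or_pos t with rfl | ht
  · exact hn
  · have h1 := h.pow_lt (t - 1) (by omega)
    have h2 := Nat.lt_two_pow_self (n := t - 1)
    omega

/-- Time of `buildRMQ`. -/
def rmqTime (nR : ℕ) : ℕ := Nat.size nR * (nR * 30) + nR * 40 + 40

/-- A window of length `2 ^ (t + 1)` is the union of two windows of length `2 ^ t`; when the second
one starts beyond the end, the first alone covers what is left. -/
theorem wp_buildRMQ {nR : ℕ} (hn : 0 < nR) {μ : Mem} {τ : ℕ} :
    wp (buildRMQ ⟨nR⟩) μ τ fun r μ' τ' =>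
      (Frame [.rmq] μ μ' ∧ ∃ t, r = (⟨t * nR⟩, ⟨2 ^ t⟩) ∧ IsRmq (μ .lcp) (μ' .rmq) nR t) ∧
      τ' ≤ τ + rmqTime nR := by
  simp only [buildRMQ, wp_bind]
  refine wp_mono (wp_forEach (fun i μ' => Frame [.rmq] μ μ' ∧ ∀ k, k < i → μ' .rmq k = μ .lcp k) 2
    ⟨Frame.refl _ _, fun k h => absurd h (Nat.not_lt_zero _)⟩ ?_) ?_
  · rintro i μ' τ' hi ⟨hF, hk⟩
    simp only [wp_rules, hF .lcp (by simp)]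
    refine ⟨⟨hF.upd (by simp) _ _, fun k hki => ?_⟩, by omega⟩
    by_cases e : k = i
    · rw [e, upd_same]
    · rw [upd_self, if_neg e]; exact hk k (by omega)
  rintro _ μ₁ τ₁ ⟨⟨hF₁, hl₁⟩, ht₁⟩
  simp only at hl₁ ht₁
  have hfin : ∀ t, (∀ k, k < t → 2 ^ k < nR) → t * (nR * 30) ≤ Nat.size nR * (nR * 30) :=
    fun t ht => Nat.mul_le_mul_right _ (by
      rcases Nat.eq_zero_or_pos t with rfl | h0
      · exact Nat.zero_le _
      · have := Nat.lt_size.2 (ht (t - 1) (by omega)).le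
        omega)
  refine wp_whileLoop (fun s μ' τ' => ∃ t, s = (⟨t * nR⟩, ⟨2 ^ t⟩) ∧ Frame [.rmq] μ μ' ∧
      (∀ k, k ≤ t → RowSpec (μ .lcp) (μ' .rmq) nR (k * nR) (2 ^ k)) ∧
      (∀ k, k < t → 2 ^ k < nR) ∧ τ' ≤ τ₁ + t * (nR * 30))
    (fun s => nR - s.2.val) ?_ ?_ ?_ ?_
  · refine ⟨0, by simp only [Nat.zero_mul, pow_zero]; rfl, hF₁, fun k hk i hi v => ?_, fun k hk => absurd hk (Nat.not_lt_zero _),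
      by simp⟩
    obtain rfl : k = 0 := by omega
    rw [Nat.zero_mul, Nat.zero_add, hl₁ i hi]
    refine ⟨fun h x h1 h2 _ => ?_, fun h => h i le_rfl (by simp) hi⟩
    rwa [show x = i by simp at h2; omega]
  · simp
  · rintro ⟨⟨b⟩, ⟨w⟩⟩ μ' τ' ⟨t, e, hF, hrow, hpow, ht⟩
    simp only [Prod.mk.injEq, Word.mk.injEq] at e
    obtain ⟨rfl, rfl⟩ := e
    simp only [wp_rules, decide_eq_true_eq]
    split_ifs with hw
    -- The new row lies above all finished ones, so writing it leaves the values it is computed from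
    -- intact.
    · refine wp_mono (wp_forEach (fun i μ'' => Frame [.rmq] μ' μ'' ∧
        (∀ k, k < t * nR + nR → μ'' .rmq k = μ' .rmq k) ∧
        ∀ j, j < i → ∀ v, v ≤ μ'' .rmq (t * nR + nR + j) ↔
          ∀ x, j ≤ x → x < j + 2 ^ (t + 1) → x < nR → v ≤ μ .lcp x) 11 ?_ ?_) ?_
      · exact ⟨Frame.refl _ _, fun _ _ => rfl, fun k h => absurd h (Nat.not_lt_zero _)⟩
      · rintro i μ'' τ'' hi ⟨hF', hk, hj⟩
        simp only at hi
        have hx := hrow t le_rfl i hi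
        simp only [wp_rules, decide_eq_true_eq, minWord]
        have key : ∀ u τ₃, τ₃ ≤ τ'' + 11 → (∀ v, v ≤ u ↔
              ∀ x, i ≤ x → x < i + 2 ^ (t + 1) → x < nR → v ≤ μ .lcp x) →
            (Frame [.rmq] μ' (upd μ'' .rmq (t * nR + nR + i) u) ∧
            (∀ k, k < t * nR + nR → upd μ'' .rmq (t * nR + nR + i) u .rmq k = μ' .rmq k) ∧
            ∀ j, j < i + 1 → ∀ v, v ≤ upd μ'' .rmq (t * nR + nR + i) u .rmq (t * nR + nR + j) ↔
              ∀ x, j ≤ x → x < j + 2 ^ (t + 1) → x < nR → v ≤ μ .lcp x) ∧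
            τ₃ ≤ τ'' + 11 := by
          intro u τ₃ hτ hu
          refine ⟨⟨hF'.upd (by simp) _ _, fun k hk' => ?_, fun j hji v => ?_⟩, hτ⟩
          · rw [upd_self, if_neg (by omega)]; exact hk k hk'
          · by_cases e : j = i
            · subst e; rw [upd_same]; exact hu v
            · rw [upd_self, if_neg (by omega)]; exact hj j (by omega) v
        have e2 : 2 ^ (t + 1) = 2 ^ t + 2 ^ t := by rw [pow_succ]; omega
        rw [hk (t * nR + i) (by omega)]
        have hmin : i + 2 ^ t < nR → ∀ v, (v ≤ μ' .rmq (t * nR + i) ∧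
            v ≤ μ' .rmq (t * nR + (i + 2 ^ t)) ↔
            ∀ x, i ≤ x → x < i + 2 ^ (t + 1) → x < nR → v ≤ μ .lcp x) := by
          intro hlt v
          rw [hx, hrow t le_rfl _ hlt, e2]
          refine ⟨fun ⟨h1, h2⟩ x a b c => ?_, fun h => ⟨fun x a b c => h x a (by omega) c,
            fun x a b c => h x (by omega) (by omega) c⟩⟩
          rcases Nat.lt_or_ge x (i + 2 ^ t) with h' | h'
          · exact h1 x a h' c
          · exact h2 x h' (by omega) c
        have hone : ¬ i + 2 ^ t < nR → ∀ v, (v ≤ μ' .rmq (t * nR + i) ↔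
            ∀ x, i ≤ x → x < i + 2 ^ (t + 1) → x < nR → v ≤ μ .lcp x) := by
          intro hlt v
          rw [hx, e2]
          exact ⟨fun h x a b c => h x a (by omega) c, fun h x a b c => h x a (by omega) c⟩
        split_ifs with h1 h2 h2
        · rw [hk (t * nR + (i + 2 ^ t)) (by omega)] at h2
          refine key _ _ (by omega) fun v => ?_
          rw [← hmin h1 v]
          exact ⟨fun h => ⟨h, h.trans h2⟩, fun h => h.1⟩
        · rw [hk (t * nR + (i + 2 ^ t)) (by omega)] at h2 ⊢
          refine key _ _ (by omega) fun v => ?_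
          rw [← hmin h1 v]
          exact ⟨fun h => ⟨h.trans (not_le.1 h2).le, h⟩, fun h => h.2⟩
        · exact key _ _ (by omega) (hone h1)
        · exact absurd le_rfl h2
      · rintro _ μ'' τ'' ⟨⟨hF', hk, hj⟩, ht'⟩
        simp only at hj ht' ⊢
        have hp : 0 < 2 ^ t := Nat.pow_pos (by omega)
        refine ⟨by omega, t + 1, ?_, hF.trans hF', fun k hkt => ?_, fun k hkt => ?_, ?_⟩
        · rw [Nat.succ_mul, pow_succ, Nat.mul_two]
        · rcases Nat.lt_or_ge k (t + 1) with h' | h'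
          · intro i hi v
            have : k * nR ≤ t * nR := Nat.mul_le_mul_right _ (by omega)
            rw [hk _ (by omega)]
            exact hrow k (by omega) i hi v
          · obtain rfl : k = t + 1 := by omega
            intro i hi v
            rw [Nat.succ_mul]
            exact hj i hi v
        · rcases Nat.lt_or_ge k t with h' | h'
          · exact hpow k h'
          · obtain rfl : k = t := by omega
            exact hw
        · rw [Nat.succ_mul]; omega
    · refine ⟨⟨hF, t, rfl, hrow, not_lt.1 hw, hpow⟩, ?_⟩
      have := hfin t hpow
      unfold rmqTime; omega
  · rintro ⟨⟨b⟩, ⟨w⟩⟩ μ' τ' ⟨t, e, hF, hrow, hpow, ht⟩ h0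
    simp only [Prod.mk.injEq, Word.mk.injEq] at e
    obtain ⟨rfl, rfl⟩ := e
    simp only at h0
    refine ⟨⟨hF, t, rfl, hrow, by omega, hpow⟩, ?_⟩
    have := hfin t hpow
    unfold rmqTime; omega

/-! ### Previous and next smaller values by descent through the rows -/

/-- The row and the offset used when `c` rows remain. -/
def level (nR c : ℕ) : Word × Word := (⟨(c - 1) * nR⟩, ⟨2 ^ c / 2⟩)

theorem level_succ (nR c : ℕ) : level nR (c + 1) = (⟨c * nR⟩, ⟨2 ^ c⟩) := by
  rw [level, pow_succ, Nat.mul_div_cancel _ (by omega), Nat.add_sub_cancel]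

theorem level_pred (nR c : ℕ) : ((⟨c * nR - nR⟩, ⟨2 ^ c / 2⟩) : Word × Word) = level nR c := by
  rw [level, Nat.sub_mul, Nat.one_mul]

theorem exists_prev {p : ℕ → Prop} (x : ℕ) (h0 : p 0) :
    ∃ r, r ≤ x ∧ p r ∧ ∀ y, r < y → y ≤ x → ¬ p y := by
  induction x with
  | zero => exact ⟨0, le_rfl, h0, fun y h h' => by omega⟩
  | succ x ih =>
    by_cases hp : p (x + 1)
    · exact ⟨x + 1, le_rfl, hp, fun y h h' => by omega⟩
    · obtain ⟨r, h1, h2, h3⟩ := ih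
      refine ⟨r, by omega, h2, fun y h h' => ?_⟩
      rcases Nat.lt_or_ge y (x + 1) with hy | hy
      · exact h3 y h (by omega)
      · rwa [show y = x + 1 by omega]

theorem exists_next {p : ℕ → Prop} (n x : ℕ) (hx : x ≤ n) :
    ∃ r, x ≤ r ∧ r ≤ n ∧ (r < n → p r) ∧ ∀ y, x ≤ y → y < r → ¬ p y := by
  induction n with
  | zero => exact ⟨x, le_rfl, hx, fun h => by omega, fun y h h' => by omega⟩
  | succ n ih =>
    rcases Nat.lt_or_ge n x with h | h
    · exact ⟨x, le_rfl, hx, fun h => by omega, fun y h h' => by omega⟩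
    · obtain ⟨r, h1, h2, h3, h4⟩ := ih h
      by_cases hp : r < n
      · exact ⟨r, h1, by omega, fun _ => h3 hp, h4⟩
      · obtain rfl : r = n := by omega
        by_cases hpr : p r
        · exact ⟨r, h1, by omega, fun _ => hpr, h4⟩
        · refine ⟨r + 1, by omega, le_rfl, fun h => by omega, fun y h h' => ?_⟩
          rcases Nat.lt_or_ge y r with hy | hy
          · exact h4 y h hy
          · rwa [show y = r by omega]

/-- Binary descent: while `c` rows remain, the answer lies less than `2 ^ c` below the current
index, and a jump is made exactly if the window jumped over has no entry below `v`. Since `lcp 0 <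
v`, an answer exists and no jump passes it. -/
theorem wp_prevSmaller {lcp : ℕ → ℕ} {nR t v x : ℕ} {μ : Mem} {τ : ℕ} (hn : 0 < nR)
    (h : IsRmq lcp (μ .rmq) nR t) (h0 : lcp 0 < v) (hx : x < nR) :
    wp (prevSmaller ⟨nR⟩ (⟨t * nR⟩, ⟨2 ^ t⟩) ⟨v⟩ ⟨x⟩) μ τ fun r μ' τ' =>
      μ' = μ ∧ (r.val ≤ x ∧ lcp r.val < v ∧ ∀ y, r.val < y → y ≤ x → v ≤ lcp y) ∧
      τ' ≤ τ + (Nat.size nR * 16 + 40) := by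
  obtain ⟨r, hr1, hr2, hr3⟩ := exists_prev (p := fun y => lcp y < v) x h0
  have hr3' : ∀ y, r < y → y ≤ x → v ≤ lcp y := fun y h h' => not_lt.1 (hr3 y h h')
  simp only [prevSmaller, wp_bind, wp_pure]
  have hend : ∀ (x' : ℕ) (μ' : Mem) (τ' : ℕ), μ' = μ → r ≤ x' → x' < r + 2 ^ 0 →
      τ' ≤ τ + (t + 1) * 16 + 2 → μ' = μ ∧
      (x' ≤ x ∧ lcp x' < v ∧ ∀ y, x' < y → y ≤ x → v ≤ lcp y) ∧
      τ' ≤ τ + (Nat.size nR * 16 + 40) := by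
    intro x' μ' τ' hμ ha hb ht
    obtain rfl : x' = r := by simp at hb; omega
    have := h.lt_size
    exact ⟨hμ, ⟨hr1, hr2, hr3'⟩, by omega⟩
  refine wp_whileLoop (fun s μ' τ' => μ' = μ ∧ ∃ c, s.1 = level nR c ∧ c ≤ t + 1 ∧ r ≤ s.2.val ∧
      s.2.val ≤ x ∧ s.2.val < r + 2 ^ c ∧ τ' + c * 16 ≤ τ + (t + 1) * 16)
    (fun s => s.1.2.val.size) ?_ ?_ ?_ ?_
  · refine ⟨rfl, t + 1, (level_succ _ _).symm, le_rfl, hr1, le_rfl, ?_, le_rfl⟩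
    have := h.le_pow
    rw [pow_succ]; simp only; omega
  · simp only [Nat.size_pow]
    exact h.succ_le hn
  · rintro ⟨l, ⟨x'⟩⟩ μ' τ' ⟨hμ', c, rfl, hc, h1, h2, h3, ht⟩
    simp only at h1 h2 h3 ht
    subst hμ'
    simp only [wp_rules, decide_eq_true_eq, Word.val_zero, Word.val_one]
    rcases c with _ | c
    -- When no row remains the offset is `2 ^ 0 / 2 = 0`, which is what the loop test detects.
    · rw [if_neg (by simp [level])]
      obtain ⟨-, h5⟩ := hend x' _ (τ' + 1 + 1) rfl h1 h3 (by omega)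
      exact ⟨by trivial, h5⟩
    · rw [level_succ]
      have hp : 0 < 2 ^ c := Nat.pow_pos (by omega)
      have e2 : 2 ^ (c + 1) = 2 ^ c + 2 ^ c := by rw [pow_succ]; omega
      have hsz : Nat.size (2 ^ c / 2) < Nat.size (2 ^ c) := size_lt_size hp le_rfl
      have hrow := h.row c (by omega)
      simp only [if_pos hp, level_pred]
      rw [e2] at h3
      have hlev : (level nR c).2.val.size < Nat.size (2 ^ c) := hsz
      split_ifs with hw hv
      · rw [hrow _ (by omega)] at hv
        have hry : r ≤ x' - 2 ^ c := by
          by_contra hcon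
          exact absurd hr2 (not_lt.2 (hv r (by omega) (by omega) (by omega)))
        exact ⟨hlev, by trivial, c, rfl, by omega, hry, by omega, by omega, by omega⟩
      · rw [hrow _ (by omega)] at hv
        have hry : x' - 2 ^ c < r := by
          by_contra hcon
          exact hv fun y a b _ => hr3' y (by omega) (by omega)
        exact ⟨hlev, by trivial, c, rfl, by omega, h1, h2, by omega, by omega⟩
      · exact ⟨hlev, by trivial, c, rfl, by omega, h1, h2, by omega, by omega⟩
  · rintro ⟨l, ⟨x'⟩⟩ μ' τ' ⟨hμ', c, rfl, hc, h1, h2, h3, ht⟩ hz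
    simp only at h1 h2 h3 ht hz
    rcases c with _ | c
    · exact hend x' _ _ hμ' h1 h3 (by omega)
    · rw [level_succ] at hz
      simp only [Nat.size_pow] at hz
      omega

/-- The mirror image; a missing answer is represented by `nR`, and jumps are cut off there. -/
theorem wp_nextSmaller {lcp : ℕ → ℕ} {nR t v x : ℕ} {μ : Mem} {τ : ℕ} (hn : 0 < nR)
    (h : IsRmq lcp (μ .rmq) nR t) (hx : x ≤ nR) :
    wp (nextSmaller ⟨nR⟩ (⟨t * nR⟩, ⟨2 ^ t⟩) ⟨v⟩ ⟨x⟩) μ τ fun r μ' τ' =>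
      μ' = μ ∧ (x ≤ r.val ∧ r.val ≤ nR ∧ (r.val < nR → lcp r.val < v) ∧
        ∀ y, x ≤ y → y < r.val → v ≤ lcp y) ∧
      τ' ≤ τ + (Nat.size nR * 16 + 40) := by
  obtain ⟨r, hr1, hr2, hr3, hr4⟩ := exists_next (p := fun y => lcp y < v) nR x hx
  have hr4' : ∀ y, x ≤ y → y < r → v ≤ lcp y := fun y h h' => not_lt.1 (hr4 y h h')
  simp only [nextSmaller, wp_bind, wp_pure]
  have hend : ∀ (x' : ℕ) (μ' : Mem) (τ' : ℕ), μ' = μ → x' ≤ r → r < x' + 2 ^ 0 →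
      τ' ≤ τ + (t + 1) * 16 + 2 → μ' = μ ∧ (x ≤ x' ∧ x' ≤ nR ∧ (x' < nR → lcp x' < v) ∧
        ∀ y, x ≤ y → y < x' → v ≤ lcp y) ∧
      τ' ≤ τ + (Nat.size nR * 16 + 40) := by
    intro x' μ' τ' hμ ha hb ht
    obtain rfl : x' = r := by simp at hb; omega
    have := h.lt_size
    exact ⟨hμ, ⟨hr1, hr2, hr3, hr4'⟩, by omega⟩
  refine wp_whileLoop (fun s μ' τ' => μ' = μ ∧ ∃ c, s.1 = level nR c ∧ c ≤ t + 1 ∧ x ≤ s.2.val ∧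
      s.2.val ≤ r ∧ r < s.2.val + 2 ^ c ∧ τ' + c * 16 ≤ τ + (t + 1) * 16)
    (fun s => s.1.2.val.size) ?_ ?_ ?_ ?_
  · refine ⟨rfl, t + 1, (level_succ _ _).symm, le_rfl, le_rfl, hr1, ?_, le_rfl⟩
    have := h.le_pow
    have hp : 0 < 2 ^ t := Nat.pow_pos (by omega)
    rw [pow_succ]; simp only; omega
  · simp only [Nat.size_pow]
    exact h.succ_le hn
  · rintro ⟨l, ⟨x'⟩⟩ μ' τ' ⟨hμ', c, rfl, hc, h1, h2, h3, ht⟩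
    simp only at h1 h2 h3 ht
    subst hμ'
    simp only [wp_rules, decide_eq_true_eq, Word.val_zero, minWord]
    rcases c with _ | c
    · rw [if_neg (by simp [level])]
      obtain ⟨-, h5⟩ := hend x' _ (τ' + 1 + 1) rfl h2 h3 (by omega)
      exact ⟨by trivial, h5⟩
    · rw [level_succ]
      have hp : 0 < 2 ^ c := Nat.pow_pos (by omega)
      have e2 : 2 ^ (c + 1) = 2 ^ c + 2 ^ c := by rw [pow_succ]; omega
      have hsz : Nat.size (2 ^ c / 2) < Nat.size (2 ^ c) := size_lt_size hp le_rfl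
      have hrow := h.row c (by omega)
      simp only [if_pos hp, level_pred]
      rw [e2] at h3
      have hlev : (level nR c).2.val.size < Nat.size (2 ^ c) := hsz
      split_ifs with hw hv hm
      · rw [hrow _ hw] at hv
        have hry : x' + 2 ^ c ≤ r := by
          by_contra hcon
          exact absurd (hr3 (by omega)) (not_lt.2 (hv r (by omega) (by omega) (by omega)))
        exact ⟨hlev, by trivial, c, rfl, by omega, by omega, hry, by omega, by omega⟩
      · rw [hrow _ hw] at hv
        have hry : nR ≤ r := by
          by_contra hcon
          exact absurd (hr3 (by omega)) (not_lt.2 (hv r (by omega) (by omega) (by omega)))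
        exact ⟨hlev, by trivial, c, rfl, by omega, by omega, by omega, by omega, by omega⟩
      · rw [hrow _ hw] at hv
        have hry : r < x' + 2 ^ c := by
          by_contra hcon
          exact hv fun y a b _ => hr4' y (by omega) (by omega)
        exact ⟨hlev, by trivial, c, rfl, by omega, h1, h2, by omega, by omega⟩
      · exact ⟨hlev, by trivial, c, rfl, by omega, h1, h2, by omega, by omega⟩
  · rintro ⟨l, ⟨x'⟩⟩ μ' τ' ⟨hμ', c, rfl, hc, h1, h2, h3, ht⟩ hz
    simp only at h1 h2 h3 ht hz
    rcases c with _ | c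
    · exact hend x' _ _ hμ' h2 h3 (by omega)
    · rw [level_succ] at hz
      simp only [Nat.size_pow] at hz
      omega

/-! ## Matching statistics -/

/-- The text `T` of a collection (length `N`, terminators `1, …, m`, letters between `m` and `K`,
and `K` after the end) and a reference `R` in which all its letters occur. -/
structure TextRef (T R : ℕ → ℕ) (N nR m K : ℕ) : Prop where
  pos : ∀ i, i < N → 0 < T i
  lt : ∀ i, i < N → T i < K
  of_ge : ∀ i, N ≤ i → T i = K
  term_lt : ∀ i, i < N → T i ≤ m → T i < T (i + 1)
  term_inj : ∀ i j, i < N → j < N → T i ≤ m → T i = T j → i = j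
  last : 0 < N → T (N - 1) ≤ m
  m_lt : m < K
  ref_gt : ∀ i, i < nR - 1 → m < R i
  occurs : ∀ i, i < N → m < T i → ∃ j, j < nR ∧ R j = T i

/-- The enhanced matching statistics of position `i`: the suffix of the reference at the insert
point starts at `q`, the matching factor has length `l`, and `x` tells whether the suffix of the
text is smaller (`0`) or greater (`1`). -/
structure Ems (T R : ℕ → ℕ) (nR i q l x : ℕ) : Prop where
  q_lt : q < nR
  x_le : x ≤ 1
  agree : Agree R q T i l
  maximal : ∀ p, p < nR → ¬ Agree R p T i (l + 1)
  low : x = 0 → l ≠ 0 ∧ suf T i < suf R q ∧ ∀ p, p < nR → Agree R p T i l → suf R q ≤ suf R p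
  high : x = 1 → suf R q < suf T i ∧ ∀ p, p < nR → suf R p < suf T i → suf R p ≤ suf R q
  zero : l = 0 → x = 1 ∧ q = nR - 1

/-- The interval `[lo, hi)` of the suffix array consists of the suffixes that start with
`T[i, i + l)`. -/
structure Interval (T R sa : ℕ → ℕ) (nR i l lo hi : ℕ) : Prop where
  lt : lo < hi
  le : hi ≤ nR
  iff : ∀ j, j < nR → (lo ≤ j ∧ j < hi ↔ Agree R (sa j) T i l)

section math
variable {T R sa isa : ℕ → ℕ} {N nR m K : ℕ}

/-- A match cannot cross either end: the final `0` of the reference is smaller than every text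
character, and the final terminator of the text equals no letter of the reference. Hence values
beyond the ends are never compared. -/
theorem TextRef.bound (ht : TextRef T R N nR m K) (h : RefIndex R sa isa nR) {i p l : ℕ}
    (hi : i < N) (hp : p < nR) (ha : Agree R p T i l) : i + l < N ∧ p + l < nR := by
  induction l with
  | zero => exact ⟨hi, hp⟩
  | succ l ih =>
    obtain ⟨h1, h2⟩ := ih (ha.mono (Nat.le_succ l))
    have e := ha l (Nat.lt_succ_self l)
    have h3 := ht.pos _ h1
    have h4 : p + l ≠ nR - 1 := fun e' => by rw [e', h.last] at e; omega
    have h5 := ht.ref_gt (p + l) (by omega)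
    have h6 : i + l ≠ N - 1 := fun e' => by
      have := ht.last (by omega)
      rw [← e'] at this; omega
    omega

theorem RefIndex.eq_of_suf_eq (h : RefIndex R sa isa nR) {p q : ℕ} (hp : p < nR) (hq : q < nR)
    (e : suf R p = suf R q) : p = q := by
  rw [← h.sa_isa hp, ← h.sa_isa hq]
  congr 1
  have h1 := h.isa_lt_isa_iff hp hq
  have h2 := h.isa_lt_isa_iff hq hp
  rw [e] at h1 h2
  simp only [lt_irrefl, iff_false] at h1 h2
  omega

/-- The comparison is decided within the first `l + 1` characters, which the two suffixes of the
text share. -/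
theorem lt_iff_of_agree {p i i' l : ℕ} (hn : ¬ Agree R p T i (l + 1))
    (ha : Agree T i T i' (l + 1)) : suf R p < suf T i ↔ suf R p < suf T i' := by
  have key : ∀ {a b : ℕ}, ¬ Agree R p T a (l + 1) → Agree T a T b (l + 1) →
      suf R p < suf T a → suf R p < suf T b := by
    intro a b hn ha hlt
    obtain ⟨d, hd, hlt⟩ := suf_lt_iff.1 hlt
    have hdl : d < l + 1 := by
      by_contra hc
      exact hn (hd.mono (by omega))
    exact (hd.trans (ha.mono (by omega))).lt (by rwa [← ha d hdl])
  exact ⟨key hn ha, key (fun h => hn (h.trans ha.symm)) ha.symm⟩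

/-- All defining conditions compare suffixes of the reference with the text, and by maximality these
comparisons see only the matching factor and the mismatch character. With `i = i'` this is ordinary
uniqueness. -/
theorem Ems.unique (h : RefIndex R sa isa nR) {i i' q q' l l' x x' : ℕ} (he : Ems T R nR i q l x)
    (he' : Ems T R nR i' q' l' x') (ha : Agree T i T i' (l + 1)) : q = q' ∧ l = l' ∧ x = x' := by
  obtain rfl : l = l' := by
    rcases lt_trichotomy l l' with hl | hl | hl
    · exact absurd ((he'.agree.mono hl).trans ha.symm) (he.maximal q' he'.q_lt)
    · exact hl
    · exact absurd ((he.agree.trans (ha.mono (Nat.le_succ l))).mono hl) (he'.maximal q he.q_lt)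
  have hlt : ∀ p, p < nR → (suf R p < suf T i ↔ suf R p < suf T i') := fun p hp =>
    lt_iff_of_agree (he.maximal p hp) ha
  have ha' : Agree T i T i' l := ha.mono (Nat.le_succ l)
  have hx := he.x_le
  have hx' := he'.x_le
  rcases Nat.eq_zero_or_pos x with h0 | h0 <;> rcases Nat.eq_zero_or_pos x' with h0' | h0'
  · refine ⟨h.eq_of_suf_eq he.q_lt he'.q_lt (le_antisymm ?_ ?_), rfl, by omega⟩
    · exact (he.low h0).2.2 q' he'.q_lt (he'.agree.trans ha'.symm)
    · exact (he'.low h0').2.2 q he.q_lt (he.agree.trans ha')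
  · have h1 := (he.low h0).2.2 q' he'.q_lt (he'.agree.trans ha'.symm)
    have h2 := (hlt q' he'.q_lt).2 (he'.high (by omega)).1
    exact absurd (h1.trans_lt h2) (not_lt.2 (he.low h0).2.1.le)
  · have h1 := (he'.low h0').2.2 q he.q_lt (he.agree.trans ha')
    have h2 := (hlt q he.q_lt).1 (he.high (by omega)).1
    exact absurd (h1.trans_lt h2) (not_lt.2 (he'.low h0').2.1.le)
  · refine ⟨h.eq_of_suf_eq he.q_lt he'.q_lt (le_antisymm ?_ ?_), rfl, by omega⟩
    · exact (he'.high (by omega)).2 q he.q_lt ((hlt q he.q_lt).1 (he.high (by omega)).1)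
    · exact (he.high (by omega)).2 q' he'.q_lt ((hlt q' he'.q_lt).2 (he'.high (by omega)).1)

/-- Why storing statistics at insert-heads is enough: while `q` advances by one, the match merely
loses its first character. A longer match at `i + 1` would extend the one at `i`, and cancelling a
character preserves the order. -/
theorem Ems.succ {i q l l' x x' : ℕ} (he : Ems T R nR i q l x)
    (he' : Ems T R nR (i + 1) (q + 1) l' x') : l = l' + 1 ∧ x' = x := by
  -- Length `0` forces `q` to be the last position of the reference, which has no successor. In
  -- particular a position after a terminator is always an insert-head.
  have hl : l ≠ 0 := fun h0 => by
    have := (he.zero h0).2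
    have := he'.q_lt
    omega
  have h1 : Agree R q T i 1 := he.agree.mono (by omega)
  have hll : l = l' + 1 := by
    rcases lt_trichotomy l (l' + 1) with h | h | h
    · have : Agree R q T i (1 + l') := h1.append he'.agree
      exact absurd (this.mono (by omega)) (he.maximal q he.q_lt)
    · exact h
    · have : Agree R q T i (1 + (l' + 1)) := he.agree.mono (by omega)
      exact absurd this.shift (he'.maximal _ he'.q_lt)
  refine ⟨hll, ?_⟩
  have hx := he.x_le
  have hx' := he'.x_le
  rcases Nat.eq_zero_or_pos x with h0 | h0 <;> rcases Nat.eq_zero_or_pos x' with h0' | h0'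
  · omega
  · have h2 := (he'.high (by omega)).1
    rw [← h1.lt_iff] at h2
    exact absurd h2 (not_lt.2 (he.low h0).2.1.le)
  · have h2 := (he'.low h0').2.1
    rw [← h1.symm.lt_iff] at h2
    exact absurd h2 (not_lt.2 (he.high (by omega)).1.le)
  · omega

/-! ### Intervals of the suffix array: insert points and contraction -/

theorem Interval.whole (h : 0 < nR) (i : ℕ) : Interval T R sa nR i 0 0 nR :=
  ⟨h, le_rfl, fun _ hj => ⟨fun _ => Agree.zero, fun _ => ⟨Nat.zero_le _, hj⟩⟩⟩

/-- The enhanced matching statistics in terms of the interval of the matching factor. -/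
theorem Interval.ems (ht : TextRef T R N nR m K) (h : RefIndex R sa isa nR) {i l lo hi ins : ℕ}
    (hi' : i < N) (hI : Interval T R sa nR i l lo hi) (hmax : ∀ p, p < nR → ¬ Agree R p T i (l + 1))
    (hins : ∀ j, lo ≤ j → j < hi → (R (sa j + l) < T (i + l) ↔ j < ins))
    (h2 : ins ≤ hi) :
    (l = 0 → Ems T R nR i (sa 0) 0 1) ∧ (l ≠ 0 → lo < ins → Ems T R nR i (sa (ins - 1)) l 1) ∧
      (l ≠ 0 → ¬ lo < ins → Ems T R nR i (sa lo) l 0) := by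
  have hle := hI.le
  have hag : ∀ j, lo ≤ j → j < hi → Agree R (sa j) T i l := fun j a b =>
    (hI.iff j (by omega)).1 ⟨a, b⟩
  refine ⟨?_, fun h0 hlt => ?_, fun h0 hlt => ?_⟩
  · rintro rfl
    -- Here the augmentation enters: a letter would match at least one character.
    have hm : T i ≤ m := by
      by_contra hc
      obtain ⟨j, hj, e⟩ := ht.occurs i hi' (not_le.1 hc)
      exact hmax j hj (Agree.zero.succ (by simpa using e))
    have hlt : suf R (nR - 1) < suf T i := Agree.zero.lt (by
      simpa [h.last] using ht.pos i hi')
    have hpos := h.pos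
    rw [h.sa_zero]
    refine ⟨by omega, le_rfl, Agree.zero, hmax, fun h => by omega, fun _ => ⟨hlt, fun p hp hpT => ?_⟩,
      fun _ => ⟨rfl, rfl⟩⟩
    rcases Nat.lt_or_ge p (nR - 1) with hp' | hp'
    · have h3 := ht.ref_gt p hp'
      have h4 := (Agree.zero (f := R) (i := p) (g := T) (j := i)).char_le hpT.le
      simp only [Nat.add_zero] at h4
      omega
    · rw [show p = nR - 1 by omega]
  · have hin := h.perm.lt (ins - 1) (by omega)
    refine ⟨hin, le_rfl, hag _ (by omega) (by omega), hmax, fun h => by omega, fun _ => ⟨?_, fun p hp hpT => ?_⟩,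
      fun h => absurd h h0⟩
    · exact (hag _ (by omega) (by omega)).lt ((hins (ins - 1) (by omega) (by omega)).2 (by omega))
    · rw [← h.sa_isa hp] at hpT ⊢
      have hpl := h.isa_lt hp
      rcases Nat.lt_or_ge (isa p) ins with hc | hc
      · exact h.sorted_le (by omega) (by omega)
      -- A suffix of the reference from `ins` on but below the text suffix is squeezed between the
      -- left end of the interval and the text suffix, so it starts with the matching factor; its
      -- next character would then have to be smaller than that of the text.
      · exfalso
        have hap : Agree R (sa (isa p)) T i l := by
          have h3 := Agree.between (h.sorted_le (i := lo) (by omega) hpl) hpT.le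
            (hag lo le_rfl hI.lt)
          exact h3.symm.trans (hag lo le_rfl hI.lt)
        obtain ⟨h4, h5⟩ := (hI.iff _ hpl).2 hap
        have h6 := (hins _ h4 h5).not.2 (by omega)
        have h7 : R (sa (isa p) + l) ≠ T (i + l) := fun e =>
          hmax _ (h.perm.lt _ hpl) (hap.succ e)
        exact h6 (hap.lt_of_le_of_ne hpT.le h7)
  · have hlo := hI.lt
    have h3 := (hins lo le_rfl hlo).not.2 hlt
    have h4 : R (sa lo + l) ≠ T (i + l) := fun e =>
      hmax _ (h.perm.lt _ (by omega)) ((hag lo le_rfl hlo).succ e)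
    refine ⟨h.perm.lt _ (by omega), by omega, hag lo le_rfl hlo, hmax, fun _ => ⟨h0, ?_, fun p hp hpa => ?_⟩,
      fun h => by omega, fun h => absurd h h0⟩
    · exact (hag lo le_rfl hlo).symm.lt (by omega)
    · rw [← h.sa_isa hp] at hpa ⊢
      have hpl := h.isa_lt hp
      exact h.sorted_le ((hI.iff _ hpl).2 hpa).1 hpl

/-- Suffixes between two suffixes with a common prefix share it, so the common prefix reaches length
`v` exactly if it does between all neighbours. -/
theorem IsLcp.agree_iff {lcp : ℕ → ℕ} (h : RefIndex R sa isa nR) (hl : IsLcp R sa lcp nR)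
    {j j' v : ℕ} (hjj : j ≤ j') (hj' : j' < nR) :
    Agree R (sa j) R (sa j') v ↔ ∀ z, j < z → z ≤ j' → v ≤ lcp z := by
  constructor
  · intro ha z hz hz'
    by_contra hc
    have h1 : Agree R (sa j) R (sa (z - 1)) v :=
      Agree.between (h.sorted_le (by omega) (by omega)) (h.sorted_le (by omega) hj') ha
    have h2 : Agree R (sa j) R (sa z) v :=
      Agree.between (h.sorted_le (by omega) (by omega)) (h.sorted_le hz' hj') ha
    exact hl.ne z (by omega) (by omega) ((h1.symm.trans h2) _ (by omega))
  · induction j', hjj using Nat.le_induction with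
    | base => exact fun _ => Agree.refl _ _ _
    | succ j' hjj ih =>
      intro hz
      have h1 := ih (by omega) fun z a b => hz z a (by omega)
      have h2 := hl.agree (j' + 1) (by omega) hj'
      exact h1.trans (h2.mono (hz (j' + 1) (by omega) le_rfl))

/-- Left contraction. -/
theorem Interval.contract {lcp : ℕ → ℕ} (ht : TextRef T R N nR m K) (h : RefIndex R sa isa nR)
    (hl : IsLcp R sa lcp nR) {i v lo hi a b : ℕ} (hi' : i < N)
    (hI : Interval T R sa nR i (v + 1) lo hi)
    (ha : a ≤ isa (sa lo + 1) ∧ lcp a < v ∧ ∀ y, a < y → y ≤ isa (sa lo + 1) → v ≤ lcp y)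
    (hb : isa (sa (hi - 1) + 1) + 1 ≤ b ∧ b ≤ nR ∧ (b < nR → lcp b < v) ∧
      ∀ y, isa (sa (hi - 1) + 1) + 1 ≤ y → y < b → v ≤ lcp y) :
    Interval T R sa nR (i + 1) v a b := by
  have hlt := hI.lt
  have hle := hI.le
  have a1 := (hI.iff lo (by omega)).1 ⟨le_rfl, hlt⟩
  have a2 := (hI.iff (hi - 1) (by omega)).1 ⟨by omega, by omega⟩
  have b1 := (ht.bound h hi' (h.perm.lt lo (by omega)) a1).2
  have b2 := (ht.bound h hi' (h.perm.lt (hi - 1) (by omega)) a2).2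
  set s := isa (sa lo + 1) with hs
  set e := isa (sa (hi - 1) + 1) with he
  have hsn : s < nR := h.isa_lt (by omega)
  have hen : e < nR := h.isa_lt (by omega)
  have ss : sa s = sa lo + 1 := h.sa_isa (by omega)
  have se : sa e = sa (hi - 1) + 1 := h.sa_isa (by omega)
  have as : Agree R (sa s) T (i + 1) v := by
    rw [ss]; exact (show Agree R (sa lo) T i (1 + v) by rwa [Nat.add_comm]).shift
  have ae : Agree R (sa e) T (i + 1) v := by
    rw [se]; exact (show Agree R (sa (hi - 1)) T i (1 + v) by rwa [Nat.add_comm]).shift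
  -- Both suffixes lose the same first character, so their order is kept. The interval of the
  -- shorter word contains `[s, e]`, and the smaller-value queries extend it to both sides.
  have hse : s ≤ e := by
    by_contra hc
    have h1 := h.sorted e s (by omega) hsn
    rw [ss, se] at h1
    have h2 : Agree R (sa (hi - 1)) R (sa lo) 1 := (a2.trans a1.symm).mono (by omega)
    rw [← h2.lt_iff] at h1
    exact absurd (h.sorted_le (i := lo) (j := hi - 1) (by omega) (by omega)) (not_le.2 h1)
  refine ⟨by omega, hb.2.1, fun j hj => ⟨fun ⟨hj1, hj2⟩ => ?_, fun hag => ?_⟩⟩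
  · rcases Nat.lt_or_ge s j with hsj | hsj
    · have h1 : Agree R (sa s) R (sa j) v := by
        rw [hl.agree_iff h hsj.le hj]
        intro z hz hz'
        rcases Nat.lt_or_ge e z with hez | hez
        · exact hb.2.2.2 z hez (by omega)
        · exact (hl.agree_iff h hse hen).1 (as.trans ae.symm) z hz hez
      exact h1.symm.trans as
    · have h1 : Agree R (sa j) R (sa s) v := by
        rw [hl.agree_iff h hsj hsn]
        exact fun z hz hz' => ha.2.2 z (by omega) hz'
      exact h1.trans as
  · refine ⟨?_, ?_⟩
    · by_contra hc
      have h1 := (hl.agree_iff h (show j ≤ s by omega) hsn).1 (hag.trans as.symm) a (by omega) ha.1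
      exact absurd ha.2.1 (not_lt.2 h1)
    · by_contra hc
      have h1 := (hl.agree_iff h (show e ≤ j by omega) hj).1 (ae.trans hag.symm) b (by omega)
        (by omega)
      exact absurd (hb.2.2.1 (by omega)) (not_lt.2 h1)

end math

/-! ## Phase 2 -/

/-- The memory holds the text, the reference and the index structures of the reference. -/
structure Loaded (T R sa isa lcp : ℕ → ℕ) (N nR t : ℕ) (μ : Mem) : Prop where
  txt : ∀ i, i < N → μ .txt i = T i
  ref : ∀ i, i < nR → μ .ref i = R i
  saR : μ .saR = sa
  isaR : μ .isaR = isa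
  rmq : IsRmq lcp (μ .rmq) nR t

/-- The insert-heads of the text `T[0, N)` with their enhanced matching statistics. -/
structure Heads (T R : ℕ → ℕ) (nR N heads : ℕ) (μ : Mem) : Prop where
  first : 0 < N → 0 < heads ∧ μ .hPos 0 = 0
  lt : ∀ h, h < heads → μ .hPos h < N
  mono : ∀ h h', h < h' → h' < heads → μ .hPos h < μ .hPos h'
  cover : ∀ h, h < heads → ∀ i, i < N → μ .hPos h ≤ i → (h + 1 < heads → i < μ .hPos (h + 1)) →
    i - μ .hPos h ≤ μ .hLen h ∧
      Ems T R nR i (μ .hQ h + (i - μ .hPos h)) (μ .hLen h - (i - μ .hPos h)) (μ .hX h)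
  char : ∀ h, h < heads → μ .hC h = T (μ .hPos h + μ .hLen h)
  ne : ∀ h, h + 1 < heads → ∀ q l x, Ems T R nR (μ .hPos (h + 1) - 1) q l x →
    μ .hQ (h + 1) ≠ q + 1

section heads
variable {T R sa isa lcp : ℕ → ℕ} {N nR m K t : ℕ} {μ μ' : Mem}

theorem Loaded.frame (hL : Loaded T R sa isa lcp N nR t μ) {S : List Arr} (hF : Frame S μ μ')
    (h1 : Arr.txt ∉ S) (h2 : Arr.ref ∉ S) (h3 : Arr.saR ∉ S) (h4 : Arr.isaR ∉ S)
    (h5 : Arr.rmq ∉ S) : Loaded T R sa isa lcp N nR t μ' :=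
  ⟨by rw [hF _ h1]; exact hL.txt, by rw [hF _ h2]; exact hL.ref, by rw [hF _ h3]; exact hL.saR,
    by rw [hF _ h4]; exact hL.isaR, by rw [hF _ h5]; exact hL.rmq⟩

theorem Heads.frame {heads : ℕ} (hH : Heads T R nR N heads μ) {S : List Arr} (hF : Frame S μ μ')
    (h1 : Arr.hPos ∉ S) (h2 : Arr.hQ ∉ S) (h3 : Arr.hLen ∉ S) (h4 : Arr.hX ∉ S)
    (h5 : Arr.hC ∉ S) : Heads T R nR N heads μ' := by
  obtain ⟨a, b, c, d, e, f⟩ := hH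
  rw [← hF _ h1] at a b c d e f
  rw [← hF _ h2] at d f
  rw [← hF _ h3] at d e
  rw [← hF _ h4] at d
  rw [← hF _ h5] at e
  exact ⟨a, b, c, d, e, f⟩

/-- Uniqueness identifies the statistics computed at the previous position with those recovered from
the insert-head, and `Ems.succ` shifts them by one. -/
theorem Heads.tail (h : RefIndex R sa isa nR) {i heads q l l' x x' : ℕ}
    (hH : Heads T R nR i heads μ) (hi : 0 < i) (he : Ems T R nR (i - 1) q l' x')
    (he' : Ems T R nR i (q + 1) l x) : Heads T R nR (i + 1) heads μ := by
  refine ⟨fun _ => hH.first hi, fun k hk => (hH.lt k hk).trans i.lt_succ_self, hH.mono, ?_,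
    hH.char, hH.ne⟩
  intro k hk j hj hkj hkj'
  rcases Nat.lt_or_ge j i with hji | hji
  · exact hH.cover k hk j hji hkj hkj'
  · obtain rfl : j = i := by omega
    have hlt := hH.lt k hk
    obtain ⟨h1, h2⟩ := hH.cover k hk (j - 1) (by omega) (by omega) (fun hk' => by
      have := hH.lt _ hk'; have := hkj' hk'; omega)
    obtain ⟨e1, e2, e3⟩ := he.unique h h2 (Agree.refl _ _ _)
    obtain ⟨e4, e5⟩ := Ems.succ he (i := j - 1) (by rwa [Nat.sub_add_cancel hi])
    refine ⟨by omega, ?_⟩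
    convert he' using 1 <;> omega

/-- Position `i` starts a new range. That `q` is not the successor of its predecessor is recorded as
well: this is what `Within.next_eq` needs later. -/
theorem Heads.head (h : RefIndex R sa isa nR) {i heads q l x : ℕ}
    (hH : Heads T R nR i heads μ) (he : Ems T R nR i q l x)
    (hne : 0 < i → ∃ q' l' x', Ems T R nR (i - 1) q' l' x' ∧ q ≠ q' + 1)
    (h1 : ∀ k, μ' .hPos k = if k = heads then i else μ .hPos k)
    (h2 : ∀ k, μ' .hQ k = if k = heads then q else μ .hQ k)
    (h3 : ∀ k, μ' .hLen k = if k = heads then l else μ .hLen k)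
    (h4 : ∀ k, μ' .hX k = if k = heads then x else μ .hX k)
    (h5 : ∀ k, μ' .hC k = if k = heads then T (i + l) else μ .hC k) :
    Heads T R nR (i + 1) (heads + 1) μ' := by
  have hlt : ∀ k, k < heads → k ≠ heads := fun k hk => hk.ne
  refine ⟨fun _ => ⟨Nat.succ_pos _, ?_⟩, fun k hk => ?_, fun k k' hkk hk' => ?_, ?_, ?_, ?_⟩
  · rw [h1]
    rcases Nat.eq_zero_or_pos i with rfl | hi
    · split_ifs with e
      · rfl
      · exact absurd (hH.lt 0 (by omega)) (by omega)
    · rw [if_neg (hH.first hi).1.ne, (hH.first hi).2]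
  · rw [h1]
    split_ifs with e
    · omega
    · exact (hH.lt k (by omega)).trans i.lt_succ_self
  · rw [h1, h1, if_neg (hlt k (by omega))]
    split_ifs with e
    · exact hH.lt k (by omega)
    · exact hH.mono k k' hkk (by omega)
  · intro k hk j hj hkj hkj'
    rw [h1] at hkj hkj'
    rw [h1, h2, h3, h4]
    split_ifs at hkj hkj' ⊢ with e1 e2 e2
    · omega
    · obtain rfl : j = i := by omega
      simpa using he
    · exact hH.cover k (by omega) j (hkj' (by omega)) hkj (fun hc => by omega)
    · exact hH.cover k (by omega) j ((hkj' (by omega)).trans (hH.lt _ (by omega))) hkj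
        (fun hc => hkj' (by omega))
  · intro k hk
    rw [h1, h3, h5]
    split_ifs with e
    · rfl
    · exact hH.char k (by omega)
  · intro k hk q' l' x' he'
    rw [h1] at he'
    rw [h2]
    split_ifs at he' ⊢ with e
    · have hi : 0 < i := (Nat.zero_le _).trans_lt (hH.lt k (by omega))
      obtain ⟨q₁, l₁, x₁, he₁, hq⟩ := hne hi
      rw [(he'.unique h he₁ (Agree.refl _ _ _)).1]
      exact hq
    · exact hH.ne k (by omega) q' l' x' he'

/-- Along the interval of `Y` the character after `Y` increases, so the occurrences of `Y c` form a
subinterval found by two binary searches; the first of them yields the insert position in any case.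
-/
theorem wp_rightExtension (ht : TextRef T R N nR m K) (h : RefIndex R sa isa nR)
    (hL : Loaded T R sa isa lcp N nR t μ) {i l lo hi : ℕ} {τ : ℕ} (hi' : i < N)
    (hI : Interval T R sa nR i l lo hi) :
    wp (rightExtension ⟨lo⟩ ⟨hi⟩ ⟨l⟩ ⟨T (i + l)⟩) μ τ fun r μ' τ' =>
      μ' = μ ∧ (r.1.val ≤ hi ∧ r.2.val ≤ hi ∧
        (∀ j, lo ≤ j → j < hi → (R (sa j + l) < T (i + l) ↔ j < r.1.val)) ∧
        ∀ j, j < nR → (r.1.val ≤ j ∧ j < r.2.val ↔ Agree R (sa j) T i (l + 1))) ∧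
      τ' ≤ τ + (Nat.size nR * 20 + 12) := by
  have hlt := hI.lt
  have hle := hI.le
  have hag : ∀ j, lo ≤ j → j < hi → Agree R (sa j) T i l := fun j a b =>
    (hI.iff j (by omega)).1 ⟨a, b⟩
  have hb : ∀ j, lo ≤ j → j < hi → sa j + l < nR := fun j a b =>
    (ht.bound h hi' (h.perm.lt j (by omega)) (hag j a b)).2
  have hmono : ∀ j j', lo ≤ j → j ≤ j' → j' < hi → R (sa j + l) ≤ R (sa j' + l) :=
    fun j j' a b c => ((hag j a (by omega)).trans (hag j' (by omega) c).symm).char_le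
      (h.sorted_le b (by omega))
  simp only [rightExtension, wp_bind]
  refine wp_mono (wp_binarySearch (p := fun j => R (sa j + l) < T (i + l)) (B := 4) ?_
    (fun j j' a b c hp => (hmono j j' a b c).trans_lt hp) hlt.le) ?_
  · intro j a b τ
    simp only [wp_rules, hL.saR, hL.ref _ (hb j a b)]
    exact ⟨trivial, trivial, le_rfl⟩
  rintro ⟨a⟩ _ τ₁ ⟨⟨rfl, ha1, ha2, ha3⟩, ht₁⟩
  simp only at ha1 ha2 ha3
  refine wp_mono (wp_binarySearch (p := fun j => R (sa j + l) ≤ T (i + l)) (B := 4) ?_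
    (fun j j' a' b c hp => (hmono j j' (by omega) b c).trans hp) ha2) ?_
  · intro j a' b τ
    simp only [wp_rules, hL.saR, hL.ref _ (hb j (by omega) b)]
    exact ⟨trivial, trivial, le_rfl⟩
  rintro ⟨b⟩ _ τ₂ ⟨⟨rfl, hb1, hb2, hb3⟩, ht₂⟩
  simp only at hb1 hb2 hb3
  simp only [wp_pure]
  refine ⟨by trivial, ⟨ha2, hb2, ha3, fun j hj => ⟨fun ⟨h1, h2⟩ => ?_, fun ha => ?_⟩⟩, ?_⟩
  · have h3 := (hb3 j h1 (by omega)).2 h2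
    have h4 := (ha3 j (by omega) (by omega)).not.2 (by omega)
    exact (hag j (by omega) (by omega)).succ (by omega)
  · obtain ⟨h1, e⟩ := agree_succ_iff.1 ha
    obtain ⟨h2, h3⟩ := (hI.iff j hj).2 h1
    have h4 := (ha3 j h2 h3).not.1 (by omega)
    exact ⟨by omega, (hb3 j (by omega) h3).1 (by omega)⟩
  · have h1 := searchTime_mono 4 (show hi - lo ≤ nR by omega)
    have h2 := searchTime_mono 4 (show hi - a ≤ nR by omega)
    simp only [searchTime] at *
    omega

/-- The empty word is treated apart: for `v = 0` the value `lcp 0 = 0` would not stop the search for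
a previous smaller value. -/
theorem wp_leftContraction (ht : TextRef T R N nR m K) (h : RefIndex R sa isa nR)
    (hl : IsLcp R sa lcp nR) (hL : Loaded T R sa isa lcp N nR t μ) {z : Sizes}
    (hz : z.nR = ⟨nR⟩) (hz' : z.top = (⟨t * nR⟩, ⟨2 ^ t⟩)) {i v lo hi : ℕ} {τ : ℕ}
    (hI : v ≠ 0 → 0 < i ∧ i - 1 < N ∧ Interval T R sa nR (i - 1) (v + 1) lo hi) :
    wp (leftContraction z ⟨lo⟩ ⟨hi⟩ ⟨v⟩) μ τ fun r μ' τ' =>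
      μ' = μ ∧ Interval T R sa nR i v r.1.val r.2.val ∧ τ' ≤ τ + (Nat.size nR * 32 + 100) := by
  simp only [leftContraction, wp_rules, decide_eq_true_eq, Word.val_zero, Word.val_one, hz, hz']
  by_cases hv : v = 0
  · rw [if_pos hv]
    subst hv
    exact ⟨by trivial, Interval.whole h.pos i, by omega⟩
  · rw [if_neg hv]
    obtain ⟨hi0, hi', hI⟩ := hI hv
    have hlt := hI.lt
    have hle := hI.le
    have a1 := (hI.iff lo (by omega)).1 ⟨le_rfl, hlt⟩
    have a2 := (hI.iff (hi - 1) (by omega)).1 ⟨by omega, by omega⟩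
    have b1 := (ht.bound h hi' (h.perm.lt lo (by omega)) a1).2
    have b2 := (ht.bound h hi' (h.perm.lt (hi - 1) (by omega)) a2).2
    have s1 := h.isa_lt (i := sa lo + 1) (by omega)
    have s2 := h.isa_lt (i := sa (hi - 1) + 1) (by omega)
    simp only [hL.saR, hL.isaR]
    refine wp_mono (wp_prevSmaller h.pos hL.rmq (by rw [hl.zero]; omega) s1) ?_
    rintro ⟨a⟩ _ τ₁ ⟨rfl, ha, ht₁⟩
    refine wp_mono (wp_nextSmaller h.pos hL.rmq s2) ?_
    rintro ⟨b⟩ _ τ₂ ⟨rfl, hb, ht₂⟩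
    simp only at ha hb ⊢
    refine ⟨by trivial, ?_, by omega⟩
    have := Interval.contract ht h hl hi' hI ha hb
    rwa [Nat.sub_add_cancel hi0] at this

/-- Time of an extension of a match by one character. -/
def extendTime (nR : ℕ) : ℕ := Nat.size nR * 20 + 40

/-- The cost is proportional to the number of characters gained, plus one for the failing extension;
this form is what the amortization in `wp_phase2` uses. -/
theorem wp_extendMatch (ht : TextRef T R N nR m K) (h : RefIndex R sa isa nR)
    (hL : Loaded T R sa isa lcp N nR t μ) {z : Sizes} (hz : z.N = ⟨N⟩) {i v lo hi : ℕ} {τ : ℕ}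
    (hi' : i < N) (hI : Interval T R sa nR i v lo hi) :
    wp (extendMatch z ⟨i⟩ ⟨lo⟩ ⟨hi⟩ ⟨v⟩) μ τ fun f μ' τ' =>
      μ' = μ ∧ (v ≤ f.len.val ∧ Interval T R sa nR i f.len.val f.lo.val f.hi.val ∧
        (∀ p, p < nR → ¬ Agree R p T i (f.len.val + 1)) ∧
        (∀ j, f.lo.val ≤ j → j < f.hi.val →
          (R (sa j + f.len.val) < T (i + f.len.val) ↔ j < f.ins.val)) ∧ f.ins.val ≤ f.hi.val) ∧
      τ' ≤ τ + ((f.len.val - v + 1) * extendTime nR + 5) := by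
  simp only [extendMatch, wp_bind, wp_add, Word.val_one, hz]
  have hbound : ∀ l lo hi, Interval T R sa nR i l lo hi → i + l < N := fun l lo hi hI =>
    (ht.bound h hi' (h.perm.lt lo (hI.lt.trans_le hI.le))
      ((hI.iff lo (hI.lt.trans_le hI.le)).1 ⟨le_rfl, hI.lt⟩)).1
  refine wp_whileLoop (σ := Search) (fun s μ' τ' => μ' = μ ∧ (v ≤ s.len.val ∧
      Interval T R sa nR i s.len.val s.lo.val s.hi.val ∧ (s.go = false →
        (∀ p, p < nR → ¬ Agree R p T i (s.len.val + 1)) ∧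
        (∀ j, s.lo.val ≤ j → j < s.hi.val →
          (R (sa j + s.len.val) < T (i + s.len.val) ↔ j < s.ins.val)) ∧ s.ins.val ≤ s.hi.val)) ∧
      τ' ≤ τ + 1 + (s.len.val - v + if s.go then 0 else 1) * extendTime nR)
    (fun s => if s.go then N - s.len.val + 1 else 0) ?_ ?_ ?_ ?_
  · exact ⟨rfl, ⟨le_rfl, hI, fun hc => by simp at hc⟩, by simp⟩
  · simp only [if_true]; omega
  · rintro ⟨⟨lo⟩, ⟨hi⟩, ⟨l⟩, ⟨ins⟩, go⟩ _ τ₁ ⟨rfl, ⟨hv, hI, hgo⟩, ht₁⟩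
    simp only at hv hI hgo ht₁
    simp only [wp_pure]
    cases go with
    | false =>
      simp only [Bool.false_eq_true, if_false] at *
      obtain ⟨h1, h2, h3⟩ := hgo trivial
      exact ⟨by trivial, ⟨hv, hI, h1, h2, h3⟩, by omega⟩
    | true =>
      have hN := hbound l lo hi hI
      simp only [wp_rules, if_true, decide_eq_true_eq, Word.val_one, hL.txt _ hN] at ht₁ ⊢
      refine wp_mono (wp_rightExtension ht h hL hi' hI) ?_
      rintro ⟨⟨a⟩, ⟨b⟩⟩ _ τ₂ ⟨rfl, ⟨ha, hb, hp, hq⟩, ht₂⟩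
      simp only at ha hb hp hq ht₂
      simp only [Nat.add_zero] at ht₁
      have hE : extendTime nR = Nat.size nR * 20 + 40 := rfl
      have hD : l + 1 - v = l - v + 1 := by omega
      by_cases hab : a < b
      · rw [if_pos hab]
        simp only [Bool.true_eq_false, false_imp_iff, and_true, hD, Nat.add_zero]
        refine ⟨by omega, by trivial, ⟨by omega, hab, hb.trans hI.le, hq⟩, ?_⟩
        rw [Nat.succ_mul]
        omega
      · rw [if_neg hab]
        simp only [Bool.false_eq_true, if_false]
        refine ⟨Nat.succ_pos _, by trivial, ⟨hv, hI, fun _ => ⟨fun p hp' ha' => ?_, hp, ha⟩⟩, ?_⟩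
        · rw [← h.sa_isa hp'] at ha'
          have := (hq _ (h.isa_lt hp')).2 ha'
          omega
        · rw [Nat.succ_mul]
          simp only [extendTime] at *
          omega
  · rintro ⟨⟨lo⟩, ⟨hi⟩, ⟨l⟩, ⟨ins⟩, go⟩ _ τ₁ ⟨rfl, ⟨hv, hI, hgo⟩, ht₁⟩ hm
    cases go with
    | true => simp at hm
    | false =>
      simp only [Bool.false_eq_true, if_false] at *
      obtain ⟨h1, h2, h3⟩ := hgo trivial
      exact ⟨by trivial, ⟨hv, hI, h1, h2, h3⟩, by omega⟩

theorem wp_insertPoint (ht : TextRef T R N nR m K) (h : RefIndex R sa isa nR) {i : ℕ} {τ : ℕ}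
    (hi' : i < N) {f : Search} (hI : Interval T R sa nR i f.len.val f.lo.val f.hi.val)
    (hmax : ∀ p, p < nR → ¬ Agree R p T i (f.len.val + 1))
    (hins : ∀ j, f.lo.val ≤ j → j < f.hi.val →
      (R (sa j + f.len.val) < T (i + f.len.val) ↔ j < f.ins.val)) (hle : f.ins.val ≤ f.hi.val) :
    wp (insertPoint f) μ τ fun r μ' τ' =>
      μ' = μ ∧ Ems T R nR i (sa r.1.val) f.len.val r.2.val ∧ τ' ≤ τ + 3 := by
  obtain ⟨h1, h2, h3⟩ := hI.ems ht h hi' hmax hins hle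
  simp only [insertPoint, wp_rules, decide_eq_true_eq, Word.val_zero, Word.val_one]
  split_ifs with e1 e2
  · rw [e1]; exact ⟨by trivial, h1 e1, by omega⟩
  · exact ⟨by trivial, h2 e1 e2, by omega⟩
  · exact ⟨by trivial, h3 e1 e2, by omega⟩

/-- Time of the second phase. -/
def headsTime (N nR : ℕ) : ℕ := N * (extendTime nR * 5 + 200) + 10

/-- The clock contains `len * D` as potential. A contraction costs one unit of length, every
extension regains one, and the length is at most `N` at the end, so there are linearly many
extensions of logarithmic cost. -/
theorem wp_phase2 (ht : TextRef T R N nR m K) (h : RefIndex R sa isa nR)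
    (hl : IsLcp R sa lcp nR) (hL : Loaded T R sa isa lcp N nR t μ) {z : Sizes}
    (hz : z.nR = ⟨nR⟩) (hz' : z.top = (⟨t * nR⟩, ⟨2 ^ t⟩)) (hzN : z.N = ⟨N⟩) {τ : ℕ} :
    wp (phase2 z) μ τ fun r μ' τ' =>
      (Frame [.hPos, .hQ, .hLen, .hX, .hC] μ μ' ∧ Heads T R nR N r.val μ') ∧
      τ' ≤ τ + headsTime N nR := by
  simp only [phase2, wp_bind, wp_pure, hz, hzN]
  set D := extendTime nR with hD
  refine wp_mono (wp_forLoop (σ := Scan) (fun i s μ' τ' =>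
    Frame [.hPos, .hQ, .hLen, .hX, .hC] μ μ' ∧ Heads T R nR i s.heads.val μ' ∧
    (i = 0 → s.len.val = 0 ∧ s.q.val = nR) ∧
    (0 < i → Interval T R sa nR (i - 1) s.len.val s.lo.val s.hi.val ∧
      ∃ x, Ems T R nR (i - 1) s.q.val s.len.val x) ∧
    τ' ≤ τ + 1 + (i * (D * 4 + 200) + s.len.val * D)) ?_ ?_) ?_
  · refine ⟨Frame.refl _ _, ?_, fun _ => ⟨rfl, rfl⟩, fun hc => absurd hc (lt_irrefl 0), by simp⟩
    exact ⟨fun hc => absurd hc (lt_irrefl 0), fun k hk => absurd hk (Nat.not_lt_zero _),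
      fun k k' _ hk => absurd hk (Nat.not_lt_zero _), fun k hk => absurd hk (Nat.not_lt_zero _),
      fun k hk => absurd hk (Nat.not_lt_zero _), fun k hk => absurd hk (Nat.not_lt_zero _)⟩
  · rintro i ⟨⟨lo⟩, ⟨hi⟩, ⟨len⟩, ⟨q⟩, ⟨heads⟩⟩ μ₁ τ₁ hi' ⟨hF, hH, h0, hpos, ht₁⟩
    simp only at hi' hH h0 hpos ht₁
    have hL₁ := hL.frame hF (by simp) (by simp) (by simp) (by simp) (by simp)
    simp only [wp_rules, decide_eq_true_eq, Word.val_one]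
    refine wp_mono (wp_leftContraction ht h hl hL₁ hz hz' (i := i) ?_) ?_
    · intro hv
      have hi0 : 0 < i := by
        rcases Nat.eq_zero_or_pos i with rfl | hi0
        · have := (h0 rfl).1; omega
        · exact hi0
      refine ⟨hi0, by omega, ?_⟩
      rw [Nat.sub_add_cancel (by omega)]
      exact (hpos hi0).1
    rintro ⟨⟨lo'⟩, ⟨hi₁⟩⟩ _ τ₂ ⟨rfl, hI, ht₂⟩
    simp only at hI ⊢
    refine wp_mono (wp_extendMatch ht h hL₁ hzN hi' hI) ?_
    rintro ⟨⟨flo⟩, ⟨fhi⟩, ⟨flen⟩, ⟨ins⟩, go⟩ _ τ₃ ⟨rfl, ⟨hv, hI', hmax, hins, hle⟩, ht₃⟩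
    simp only at hv hI' hmax hins hle ht₃
    refine wp_mono (wp_insertPoint ht h hi' hI' hmax hins hle) ?_
    rintro ⟨⟨ip⟩, ⟨x⟩⟩ μ₂ τ₄ ⟨rfl, he, ht₄⟩
    simp only at he ht₄
    have hb := (ht.bound h hi' he.q_lt he.agree).1
    simp only [hL₁.saR]
    have htime : τ₄ + 30 ≤ τ + 1 + ((i + 1) * (D * 4 + 200) + flen * D) := by
      have e1 : (flen - (len - 1) + 1) * D + len * D ≤ flen * D + D * 2 := by
        have : flen - (len - 1) + 1 + len ≤ flen + 2 := by omega
        calc _ = (flen - (len - 1) + 1 + len) * D := by ring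
          _ ≤ (flen + 2) * D := Nat.mul_le_mul_right _ this
          _ = _ := by ring
      rw [Nat.succ_mul]
      have : Nat.size nR * 32 + 100 ≤ D * 2 + 100 := by rw [hD, extendTime]; omega
      rw [← hD] at ht₃
      omega
    by_cases hq : sa ip = q + 1
    · simp only [if_pos hq]
      -- The initial value `nR` of `q` has no successor in the reference, so position `0` becomes an
      -- insert-head without a special case.
      have hi0 : 0 < i := by
        rcases Nat.eq_zero_or_pos i with rfl | hi0
        · have := (h0 rfl).2; have := he.q_lt; omega
        · exact hi0
      obtain ⟨x', he'⟩ := (hpos hi0).2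
      refine ⟨hF, hH.tail h hi0 he' (hq ▸ he), fun hc => by omega, fun _ => ⟨hI', x, he⟩, ?_⟩
      omega
    · simp only [if_neg hq]
      have hT : ∀ w, upd (upd (upd (upd μ₂ .hPos heads i) .hQ heads (sa ip)) .hLen heads flen)
          .hX heads w .txt (i + flen) = T (i + flen) := fun w => by
        simp [upd_ne, hL₁.txt _ hb]
      rw [hT]
      refine ⟨((((hF.upd (by simp) _ _).upd (by simp) _ _).upd (by simp) _ _).upd (by simp) _ _).upd
        (by simp) _ _, hH.head h he (fun hi0 => ?_) ?_ ?_ ?_ ?_ ?_, fun hc => by omega,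
        fun _ => ⟨hI', x, he⟩, by omega⟩
      · obtain ⟨x', he'⟩ := (hpos hi0).2
        exact ⟨q, len, x', he', hq⟩
      all_goals intro k; simp [upd_ne, upd_self]
  · rintro ⟨⟨lo⟩, ⟨hi⟩, ⟨len⟩, ⟨q⟩, ⟨heads⟩⟩ μ₁ τ₁ ⟨hF, hH, h0, hpos, ht₁⟩
    simp only at hH h0 hpos ht₁ ⊢
    refine ⟨⟨hF, hH⟩, ht₁.trans ?_⟩
    have hlen : len ≤ N := by
      rcases Nat.eq_zero_or_pos N with rfl | hN
      · have := (h0 rfl).1; omega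
      · obtain ⟨x, he⟩ := (hpos hN).2
        have := (ht.bound h (show N - 1 < N by omega) he.q_lt he.agree).1
        omega
    have := Nat.mul_le_mul_right D hlen
    have e : headsTime N nR = N * (D * 4 + 200) + N * D + 10 := by rw [headsTime, ← hD]; ring
    omega

end heads

/-! ## The order of the suffixes in terms of the enhanced matching statistics -/

/-- The sorting key of suffixes with the same insert point. -/
def emsKey (l x c : ℕ) : ℕ ×ₗ ℤ ×ₗ ℕ := toLex (x, toLex (if x = 0 then (l : ℤ) else -l, c))

theorem emsKey_lt_iff {l x c l' x' c' : ℕ} : emsKey l x c < emsKey l' x' c' ↔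
    x < x' ∨ x = x' ∧ ((if x = 0 then (l : ℤ) else -l) < (if x' = 0 then (l' : ℤ) else -l') ∨
      (if x = 0 then (l : ℤ) else -l) = (if x' = 0 then (l' : ℤ) else -l') ∧ c < c') := by
  simp only [emsKey, Prod.Lex.toLex_lt_toLex]

theorem emsKey_eq_iff {l x c l' x' c' : ℕ} :
    emsKey l x c = emsKey l' x' c' ↔ l = l' ∧ x = x' ∧ c = c' := by
  simp only [emsKey, toLex_inj, Prod.mk.injEq]
  constructor
  · rintro ⟨rfl, h, rfl⟩
    split_ifs at h <;> omega
  · rintro ⟨rfl, rfl, rfl⟩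
    simp

/-- The program looks at the lengths first, the key at the type. They agree: if the first suffix is
shorter and of type S, it is smaller whatever the type of the second; if it is shorter and of type
L, it is greater in both cases. -/
theorem computes_compareEms {len x c : Arr} {i j : ℕ} {μ : Mem} (hi : μ x i ≤ 1)
    (hj : μ x j ≤ 1) : Computes (compareEms len x c ⟨i⟩ ⟨j⟩) μ
      (cmp (emsKey (μ len i) (μ x i) (μ c i)) (emsKey (μ len j) (μ x j) (μ c j))) 12 := by
  intro τ
  have hlt : ∀ {a b : ℕ ×ₗ ℤ ×ₗ ℕ}, a < b → Ordering.lt = cmp a b := fun h =>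
    ((cmp_eq_lt_iff _ _).2 h).symm
  have hgt : ∀ {a b : ℕ ×ₗ ℤ ×ₗ ℕ}, b < a → Ordering.gt = cmp a b := fun h =>
    ((cmp_eq_gt_iff _ _).2 h).symm
  simp only [compareEms, wp_rules, decide_eq_true_eq, Word.val_zero]
  split_ifs <;> refine ⟨?_, by trivial, by omega⟩
  · refine hlt (emsKey_lt_iff.2 ?_); split_ifs <;> omega
  · refine hgt (emsKey_lt_iff.2 ?_); split_ifs <;> omega
  · refine hgt (emsKey_lt_iff.2 ?_); split_ifs <;> omega
  · refine hlt (emsKey_lt_iff.2 ?_); split_ifs <;> omega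
  · exact hlt (emsKey_lt_iff.2 (Or.inl ‹_›))
  · exact hgt (emsKey_lt_iff.2 (Or.inl ‹_›))
  · refine hlt (emsKey_lt_iff.2 ?_); split_ifs <;> omega
  · refine hgt (emsKey_lt_iff.2 ?_); split_ifs <;> omega
  · exact ((cmp_eq_eq_iff _ _).2 (emsKey_eq_iff.2 ⟨by omega, by omega, by omega⟩)).symm

section math
variable {T R sa isa : ℕ → ℕ} {N nR m K : ℕ}

/-- Suppose the text suffixes were in the opposite order. If `x' = 1`, then `q'` lies below the
suffix at `i'`, hence below the one at `i`, and `q` would not be its proper insert point. If `x' =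
0`, squeezing shows that `q` starts with the matching factor of `i'`, while `q'` is the least suffix
that does. -/
theorem Ems.lt_of_isa_lt (h : RefIndex R sa isa nR) {i i' q q' l l' x x' : ℕ}
    (he : Ems T R nR i q l x) (he' : Ems T R nR i' q' l' x') (hlt : isa q < isa q') :
    suf T i < suf T i' := by
  rw [h.isa_lt_isa_iff he.q_lt he'.q_lt] at hlt
  have hx := he.x_le
  have hx' := he'.x_le
  by_contra hc
  rw [not_lt] at hc
  rcases Nat.eq_zero_or_pos x' with h0' | h0'
  · obtain ⟨_, h1, h2⟩ := he'.low h0'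
    refine absurd (h2 q he.q_lt ?_) (not_le.2 hlt)
    rcases Nat.eq_zero_or_pos x with h0 | h0
    · have h3 := (he.low h0).2.1
      exact (Agree.between (hc.trans h3.le) hlt.le he'.agree.symm).symm
    · obtain ⟨h3, h4⟩ := he.high (by omega)
      have h5 : suf T i ≤ suf R q' := by
        by_contra h5
        exact absurd (h4 q' he'.q_lt (not_le.1 h5)) (not_le.2 hlt)
      have h6 := Agree.between hc h5 he'.agree.symm
      have h7 : l' ≤ l := by
        by_contra h7
        exact he.maximal q' he'.q_lt ((he'.agree.trans h6).mono (by omega))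
      exact (he.agree.mono h7).trans h6.symm
  · have h1 := (he'.high (by omega)).1
    rcases Nat.eq_zero_or_pos x with h0 | h0
    · exact absurd ((he.low h0).2.1.trans (hlt.trans h1)) (not_lt.2 hc)
    · exact absurd ((he.high (by omega)).2 q' he'.q_lt (h1.trans_le hc)) (not_le.2 hlt)

theorem Ems.ne_char {i q l x : ℕ} (he : Ems T R nR i q l x) : R (q + l) ≠ T (i + l) :=
  fun e => he.maximal q he.q_lt (he.agree.succ e)

/-- Both suffixes follow the same suffix of the reference, one on each side if the types differ.
Among types S, the one that leaves it first drops below the other; among types L, it rises above the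
other. -/
theorem Ems.lt_of_key_lt {i i' q l l' x x' : ℕ} (he : Ems T R nR i q l x)
    (he' : Ems T R nR i' q l' x') (hlt : emsKey l x (T (i + l)) < emsKey l' x' (T (i' + l'))) :
    suf T i < suf T i' := by
  have hx := he.x_le
  have hx' := he'.x_le
  have hag : Agree T i T i' (min l l') :=
    (he.agree.symm.mono (Nat.min_le_left _ _)).trans (he'.agree.mono (Nat.min_le_right _ _))
  rcases emsKey_lt_iff.1 hlt with h | ⟨rfl, h⟩
  · exact (he.low (by omega)).2.1.trans (he'.high (by omega)).1
  · rcases Nat.eq_zero_or_pos x with h0 | h0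
    · rw [if_pos h0, if_pos h0] at h
      rcases h with h | ⟨h, hc⟩
      · refine hag.lt ?_
        rw [min_eq_left (by omega), ← he'.agree l (by omega)]
        exact he.agree.symm.lt_of_le_of_ne (he.low h0).2.1.le he.ne_char.symm
      · obtain rfl : l = l' := by omega
        rw [min_self] at hag
        exact hag.lt hc
    · rw [if_neg (by omega), if_neg (by omega)] at h
      rcases h with h | ⟨h, hc⟩
      · refine hag.lt ?_
        rw [min_eq_right (by omega), ← he.agree l' (by omega)]
        exact he'.agree.lt_of_le_of_ne (he'.high (by omega)).1.le he'.ne_char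
      · obtain rfl : l = l' := by omega
        rw [min_self] at hag
        exact hag.lt hc

/-- Both matching factors are the same prefix of the reference suffix at `q`, and the mismatch
characters coincide. -/
theorem Ems.agree_of_key_eq {i i' q l l' x x' : ℕ} (he : Ems T R nR i q l x)
    (he' : Ems T R nR i' q l' x') (hk : emsKey l x (T (i + l)) = emsKey l' x' (T (i' + l'))) :
    l = l' ∧ x = x' ∧ Agree T i T i' (l + 1) := by
  obtain ⟨rfl, rfl, hc⟩ := emsKey_eq_iff.1 hk
  exact ⟨rfl, rfl, (he.agree.symm.trans he'.agree).succ hc⟩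

/-! ### The distance to the next insert-head -/

variable {heads : ℕ} {μ : Mem}

/-- Position `i` belongs to the insert-head `g`, the last one up to `i`. -/
structure Within (N heads : ℕ) (μ : Mem) (g i : ℕ) : Prop where
  lt : g < heads
  le : μ .hPos g ≤ i
  lt' : i < N
  lt_next : g + 1 < heads → i < μ .hPos (g + 1)

theorem Within.ems {g i : ℕ} (hw : Within N heads μ g i) (hH : Heads T R nR N heads μ) :
    i - μ .hPos g ≤ μ .hLen g ∧
      Ems T R nR i (μ .hQ g + (i - μ .hPos g)) (μ .hLen g - (i - μ .hPos g)) (μ .hX g) :=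
  hH.cover g hw.lt i hw.lt' hw.le hw.lt_next

theorem Heads.within_pos (hH : Heads T R nR N heads μ) {g : ℕ} (hg : g < heads) :
    Within N heads μ g (μ .hPos g) :=
  ⟨hg, le_rfl, hH.lt g hg, fun h => hH.mono g (g + 1) g.lt_succ_self h⟩

theorem Heads.ems_pos (hH : Heads T R nR N heads μ) {g : ℕ} (hg : g < heads) :
    Ems T R nR (μ .hPos g) (μ .hQ g) (μ .hLen g) (μ .hX g) := by
  simpa using ((hH.within_pos hg).ems hH).2

/-- The next insert-head is reached within the matching factor. -/
theorem Within.next_le (ht : TextRef T R N nR m K) (h : RefIndex R sa isa nR)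
    (hH : Heads T R nR N heads μ) {i i' q l x g : ℕ} (hw : Within N heads μ g i)
    (he : Ems T R nR i q l x) (he' : Ems T R nR i' q l x) (hi' : i' < N)
    (ha : Agree T i T i' (l + 1)) (hne : i ≠ i') :
    g + 1 < heads ∧ μ .hPos (g + 1) ≤ i + l := by
  obtain ⟨h1, h2⟩ := hw.ems hH
  obtain ⟨rfl, rfl, rfl⟩ := he.unique h h2 (Agree.refl _ _ _)
  set l := μ .hLen g - (i - μ .hPos g) with hl
  have b := (ht.bound h hw.lt' he.q_lt he.agree).1
  have b' := (ht.bound h hi' he'.q_lt he'.agree).1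
  -- A terminator among the shared characters would occur at two different positions.
  have hterm : ∀ e, e ≤ l → m < T (i + e) := by
    intro e hel
    by_contra hc
    have := ht.term_inj (i + e) (i' + e) (by omega) (by omega) (by omega) (ha e (by omega))
    omega
  by_contra hc
  have hle := hw.le
  have hw' : Within N heads μ g (i + l) := ⟨hw.lt, by omega, b, fun hg => by
    by_contra hc'; exact hc ⟨hg, by omega⟩⟩
  obtain ⟨h3, h4⟩ := hw'.ems hH
  have h5 : μ .hLen g - (i + l - μ .hPos g) = 0 := by omega
  rw [h5] at h4
  -- Without an insert-head up to `i + l`, the recovered matching length there would be `0`, but the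
  -- character is a letter and letters occur in the reference.
  obtain ⟨j, hj, e⟩ := ht.occurs (i + l) b (hterm l le_rfl)
  exact h4.maximal j hj (Agree.zero.succ (by simpa using e))

/-- Positions whose enhanced matching statistics agree have the next insert-head at the same
distance. -/
theorem Within.next_eq (ht : TextRef T R N nR m K) (h : RefIndex R sa isa nR)
    (hH : Heads T R nR N heads μ) {i i' q l x g g' : ℕ} (hw : Within N heads μ g i)
    (hw' : Within N heads μ g' i') (he : Ems T R nR i q l x) (he' : Ems T R nR i' q l x)
    (ha : Agree T i T i' (l + 1)) (hne : i ≠ i') :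
    μ .hPos (g + 1) - i = μ .hPos (g' + 1) - i' := by
  wlog hlt : μ .hPos (g + 1) - i ≤ μ .hPos (g' + 1) - i' generalizing i i' g g'
  · exact (this hw' hw he' he ha.symm hne.symm (by omega)).symm
  obtain ⟨h1, h2⟩ := hw.next_le ht h hH he he' hw'.lt' ha hne
  obtain ⟨h1', h2'⟩ := hw'.next_le ht h hH he' he hw.lt' ha.symm hne.symm
  by_contra hc
  have h3 := hw.lt_next h1
  have h3' := hw'.lt_next h1'
  have hle := hw.le
  have hle' := hw'.le
  have b := hH.lt _ h1
  have b' := hH.lt _ h1'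
  obtain ⟨k, hk⟩ : ∃ k, k + 1 = μ .hPos (g + 1) - i := ⟨μ .hPos (g + 1) - i - 1, by omega⟩
  have hin : Within N heads μ g (i + k) := ⟨hw.lt, by omega, by omega, fun _ => by omega⟩
  -- The first suffix meets an insert-head after `k + 1` places while the second does not, so for
  -- the second one `q` has advanced by `k + 1`.
  have hin' : Within N heads μ g' (i' + (k + 1)) :=
    ⟨hw'.lt, by omega, by omega, fun _ => by omega⟩
  have e := (hw.ems hH).2
  obtain ⟨e1, e2, e3⟩ := he.unique h e (Agree.refl _ _ _)
  obtain ⟨e1', e2', e3'⟩ := he'.unique h (hw'.ems hH).2 (Agree.refl _ _ _)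
  have hp : μ .hPos (g + 1) = i + (k + 1) := by omega
  -- At the insert-head `q` has not advanced this way, although the suffixes still share the
  -- matching factor and the mismatch character, so that `Ems.unique` forces equal values of `q`.
  have hne' := hH.ne g h1 _ _ _ (by
    rw [hp]; exact (hin.ems hH).2)
  have hh := hH.ems_pos h1
  rw [hp] at hh
  refine hne' (((hin'.ems hH).2.unique h hh ?_).1.symm.trans (by omega))
  refine Agree.symm ?_
  refine Agree.shift (k := k + 1) (l := _) (ha.mono ?_)
  omega

end math

/-! ## Phase 3 -/

/-- The suffix at `i` is of type S. -/
def SType (T : ℕ → ℕ) (i : ℕ) : Prop := suf T i < suf T (i + 1)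

/-- The suffix at `i` is an `S*`-suffix. -/
def Star (T : ℕ → ℕ) (m i : ℕ) : Prop := T i ≤ m ∨ SType T i ∧ 0 < i ∧ ¬ SType T (i - 1)

/-- The types of the suffixes are in memory. -/
def Typed (T : ℕ → ℕ) (N : ℕ) (μ : Mem) : Prop :=
  ∀ i, i < N → μ .typ i ≤ 1 ∧ (μ .typ i = 0 ↔ SType T i)

/-- The list of the `S*`-suffixes, with their enhanced matching statistics. -/
structure Stars (T R isa : ℕ → ℕ) (nR m N num : ℕ) (μ : Mem) : Prop where
  star : ∀ t, t < num → μ .sPos t < N ∧ Star T m (μ .sPos t)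
  mono : ∀ t t', t < t' → t' < num → μ .sPos t < μ .sPos t'
  cover : ∀ i, i < N → Star T m i → ∃ t, t < num ∧ μ .sPos t = i
  ems : ∀ t, t < num → ∃ q, μ .sIp t = isa q ∧ Ems T R nR (μ .sPos t) q (μ .sLen t) (μ .sX t)
  char : ∀ t, t < num → μ .sC t = T (μ .sPos t + μ .sLen t)

section phase3
variable {T R sa isa lcp : ℕ → ℕ} {N nR m K t : ℕ} {μ μ' : Mem}

/-- The recursion behind the backward scan: equal first characters are cancelled and the type is
inherited. -/
theorem stype_iff (T : ℕ → ℕ) (i : ℕ) :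
    SType T i ↔ T i < T (i + 1) ∨ T i = T (i + 1) ∧ SType T (i + 1) := by
  have h0 : Agree T i T (i + 1) 0 := Agree.zero
  rw [SType, SType]
  constructor
  · intro h
    rcases (h0.char_le h.le).lt_or_eq with h1 | h1
    · exact Or.inl h1
    · exact Or.inr ⟨h1, ((h0.succ h1).lt_iff).1 h⟩
  · rintro (h | ⟨h1, h⟩)
    · exact h0.lt h
    · exact ((h0.succ h1).lt_iff).2 h

theorem Typed.frame (h : Typed T N μ) {S : List Arr} (hF : Frame S μ μ') (hS : Arr.typ ∉ S) :
    Typed T N μ' := by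
  rw [Typed, hF _ hS]; exact h

theorem Stars.frame {num : ℕ} (h : Stars T R isa nR m N num μ) {S : List Arr} (hF : Frame S μ μ')
    (h1 : Arr.sPos ∉ S) (h2 : Arr.sIp ∉ S) (h3 : Arr.sLen ∉ S) (h4 : Arr.sX ∉ S)
    (h5 : Arr.sC ∉ S) : Stars T R isa nR m N num μ' := by
  obtain ⟨a, b, c, d, e⟩ := h
  rw [← hF _ h1] at a b c d e
  rw [← hF _ h2] at d
  rw [← hF _ h3] at d e
  rw [← hF _ h4] at d
  rw [← hF _ h5] at e
  exact ⟨a, b, c, d, e⟩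

theorem Stars.le {num : ℕ} (h : Stars T R isa nR m N num μ) : num ≤ N := by
  have key : ∀ t, t < num → t ≤ μ .sPos t := by
    intro t
    induction t with
    | zero => exact fun _ => Nat.zero_le _
    | succ t ih =>
      intro ht
      have := ih (by omega)
      have := h.mono t (t + 1) (by omega) ht
      omega
  by_contra hc
  have := key N (by omega)
  have := (h.star N (by omega)).1
  omega

theorem Heads.le {heads : ℕ} (h : Heads T R nR N heads μ) : heads ≤ N := by
  have key : ∀ t, t < heads → t ≤ μ .hPos t := by
    intro t
    induction t with
    | zero => exact fun _ => Nat.zero_le _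
    | succ t ih =>
      intro ht
      have := ih (by omega)
      have := h.mono t (t + 1) (by omega) ht
      omega
  by_contra hc
  have := key N (by omega)
  have := h.lt N (by omega)
  omega

theorem Stars.skip {i num : ℕ} (h : Stars T R isa nR m i num μ) (hi : ¬ Star T m i) :
    Stars T R isa nR m (i + 1) num μ := by
  refine ⟨fun t ht => ⟨(h.star t ht).1.trans i.lt_succ_self, (h.star t ht).2⟩, h.mono,
    fun j hj hs => ?_, h.ems, h.char⟩
  rcases (Nat.lt_succ_iff_lt_or_eq.1 hj) with hj | rfl
  · exact h.cover j hj hs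
  · exact absurd hs hi

theorem Stars.push {i num q l x : ℕ} (h : Stars T R isa nR m i num μ) (hi : Star T m i)
    (he : Ems T R nR i q l x)
    (h1 : ∀ k, μ' .sPos k = if k = num then i else μ .sPos k)
    (h2 : ∀ k, μ' .sIp k = if k = num then isa q else μ .sIp k)
    (h3 : ∀ k, μ' .sLen k = if k = num then l else μ .sLen k)
    (h4 : ∀ k, μ' .sX k = if k = num then x else μ .sX k)
    (h5 : ∀ k, μ' .sC k = if k = num then T (i + l) else μ .sC k) :
    Stars T R isa nR m (i + 1) (num + 1) μ' := by
  refine ⟨fun t ht => ?_, fun t t' htt ht' => ?_, fun j hj hs => ?_, fun t ht => ?_,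
    fun t ht => ?_⟩
  · rw [h1]
    split_ifs with e
    · exact ⟨i.lt_succ_self, hi⟩
    · have := h.star t (by omega)
      exact ⟨by omega, this.2⟩
  · rw [h1, h1, if_neg (show t ≠ num by omega)]
    split_ifs with e
    · exact (h.star t (by omega)).1
    · exact h.mono t t' htt (by omega)
  · rcases (Nat.lt_succ_iff_lt_or_eq.1 hj) with hj | rfl
    · obtain ⟨t, ht, rfl⟩ := h.cover j hj hs
      exact ⟨t, by omega, by rw [h1, if_neg ht.ne]⟩
    · exact ⟨num, num.lt_succ_self, by rw [h1, if_pos rfl]⟩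
  · rw [h1, h2, h3, h4]
    split_ifs with e
    · exact ⟨q, rfl, he⟩
    · exact h.ems t (by omega)
  · rw [h1, h3, h5]
    split_ifs with e
    · rfl
    · exact h.char t (by omega)

theorem wp_computeTypes (ht : TextRef T R N nR m K) (hT : ∀ i, i < N → μ .txt i = T i) {τ : ℕ} :
    wp (computeTypes ⟨N⟩) μ τ fun _ μ' τ' =>
      (Frame [.typ] μ μ' ∧ Typed T N μ') ∧ τ' ≤ τ + (N * 12 + 1) := by
  refine wp_mono (wp_forDown (fun k μ' => Frame [.typ] μ μ' ∧
    ∀ i, k ≤ i → i < N → μ' .typ i ≤ 1 ∧ (μ' .typ i = 0 ↔ SType T i)) 9 ?_ ?_) ?_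
  · exact ⟨Frame.refl _ _, fun i h1 h2 => absurd h2 (not_lt.2 h1)⟩
  · rintro k μ₁ τ₁ hk ⟨hF, hI⟩
    simp only at hk
    have hupd : ∀ v, v ≤ 1 → (v = 0 ↔ SType T k) → Frame [.typ] μ (upd μ₁ .typ k v) ∧
        ∀ i, k ≤ i → i < N → upd μ₁ .typ k v .typ i ≤ 1 ∧
          (upd μ₁ .typ k v .typ i = 0 ↔ SType T i) := by
      intro v hv hv'
      refine ⟨hF.upd (by simp) _ _, fun i h1 h2 => ?_⟩
      rw [upd_self]
      split_ifs with e
      · rw [e]; exact ⟨hv, hv'⟩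
      · exact hI i (by omega) h2
    have hs := stype_iff T k
    simp only [wp_rules, decide_eq_true_eq, Word.val_zero, Word.val_one, hF .txt (by simp)]
    split_ifs with h1 h2 h3
    · rw [hT k hk, hT _ h1] at h2
      exact ⟨hupd 0 (by omega) (by tauto), by omega⟩
    · rw [hT k hk, hT _ h1] at h2 h3
      refine ⟨hupd 1 le_rfl ?_, by omega⟩
      rw [hs]; omega
    · rw [hT k hk, hT _ h1] at h2 h3
      obtain ⟨h4, h5⟩ := hI (k + 1) (by omega) h1
      refine ⟨hupd _ h4 ?_, by omega⟩
      rw [h5, hs]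
      have : T k = T (k + 1) := by omega
      tauto
    -- The text is continued by `K`, which exceeds all characters, so the last suffix has type S as
    -- required.
    · refine ⟨hupd 0 (by omega) ⟨fun _ => ?_, fun _ => rfl⟩, by omega⟩
      rw [hs]
      left
      have h2 := ht.lt k hk
      have h3 := ht.of_ge (k + 1) (by omega)
      omega
  · rintro _ μ₁ τ₁ ⟨⟨hF, hI⟩, ht₁⟩
    exact ⟨⟨hF, fun i hi => hI i (Nat.zero_le _) hi⟩, by simpa using ht₁⟩

theorem wp_isSStar (hT : ∀ i, i < N → μ .txt i = T i) (hty : Typed T N μ) {i : ℕ}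
    (hi : i < N) (τ : ℕ) : wp (isSStar ⟨m⟩ ⟨i⟩) μ τ fun b μ' τ' =>
      (b = true ↔ Star T m i) ∧ μ' = μ ∧ τ' ≤ τ + 8 := by
  have h2 := hty i hi
  have h4 := hty (i - 1) (by omega)
  simp only [isSStar, wp_rules, decide_eq_true_eq, Word.val_zero, Word.val_one, hT i hi]
  rw [Star, ← h2.2, ← h4.2]
  split_ifs with h5 h6 h7 <;> refine ⟨?_, by trivial, by omega⟩
  · simp only [h5, true_or]
  · simp only [false_iff]; omega
  · simp only [false_iff]; omega
  · omega

/-- Time of the third phase. -/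
def starsTime (N nR : ℕ) : ℕ := N * 120 + nR * 10 + 30

theorem wp_phase3 (ht : TextRef T R N nR m K) (h : RefIndex R sa isa nR)
    (hL : Loaded T R sa isa lcp N nR t μ) {heads : ℕ} (hH : Heads T R nR N heads μ) {z : Sizes}
    (hzN : z.N = ⟨N⟩) (hzm : z.m = ⟨m⟩) (hzR : z.nR = ⟨nR⟩) {τ : ℕ} :
    wp (phase3 z ⟨heads⟩) μ τ fun r μ' τ' =>
      (Frame [.typ, .sPos, .sIp, .sLen, .sX, .sC, .sList, .sSorted, .sEnd] μ μ' ∧ Typed T N μ' ∧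
        Stars T R isa nR m N r.val μ' ∧ IsPerm (μ' .sSorted) r.val ∧
        Bucketed (μ' .sSorted) (μ' .sEnd) r.val nR (μ' .sIp)) ∧
      τ' ≤ τ + starsTime N nR := by
  simp only [phase3, wp_bind, hzN, hzm, hzR]
  refine wp_mono (wp_computeTypes ht hL.txt) ?_
  rintro _ μ₁ τ₁ ⟨⟨hF₁, hty⟩, ht₁⟩
  have hL₁ := hL.frame hF₁ (by simp) (by simp) (by simp) (by simp) (by simp)
  have hH₁ := hH.frame hF₁ (by simp) (by simp) (by simp) (by simp) (by simp)
  set S : List Arr := [.sPos, .sIp, .sLen, .sX, .sC] with hS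
  refine wp_mono (wp_forLoop_of_cost (σ := Word × Word) (fun i s μ' => Frame S μ₁ μ' ∧
    Stars T R isa nR m i s.2.val μ' ∧ (i = 0 → s.1.val = 0) ∧
      (0 < i → Within N heads μ' s.1.val (i - 1))) 50 ?_ ?_) ?_
  · refine ⟨Frame.refl _ _, ?_, fun _ => rfl, fun hc => absurd hc (lt_irrefl 0)⟩
    exact ⟨fun t ht => absurd ht (Nat.not_lt_zero _), fun t t' _ ht => absurd ht (Nat.not_lt_zero _),
      fun t ht => absurd ht (Nat.not_lt_zero _), fun t ht => absurd ht (Nat.not_lt_zero _),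
      fun t ht => absurd ht (Nat.not_lt_zero _)⟩
  · rintro i ⟨⟨g⟩, ⟨num⟩⟩ μ₂ τ₂ hi ⟨hF, hst, h0, hw⟩
    simp only at hi hst h0 hw
    have hL₂ := hL₁.frame hF (by simp [hS]) (by simp [hS]) (by simp [hS]) (by simp [hS]) (by simp [hS])
    have hH₂ := hH₁.frame hF (by simp [hS]) (by simp [hS]) (by simp [hS]) (by simp [hS]) (by simp [hS])
    have hty₂ := hty.frame hF (by simp [hS])
    -- The insert-head in charge changes only when `i` is itself the next one; at `i = 0` it is
    -- insert-head `0`, which stands at position `0`.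
    have hw0 : ¬ (g + 1 < heads ∧ μ₂ .hPos (g + 1) = i) → Within N heads μ₂ g i := by
      intro hc
      rcases Nat.eq_zero_or_pos i with rfl | hi0
      · obtain ⟨f1, f2⟩ := hH₂.first hi
        rw [h0 rfl]
        have := hH₂.within_pos f1
        rwa [f2] at this
      · obtain ⟨a, b, c, d⟩ := hw hi0
        exact ⟨a, by omega, hi, fun hg => by have := d hg; omega⟩
    -- The three ways to determine the insert-head share this continuation, which is verified once.
    have hrest : ∀ g' τ₃, Within N heads μ₂ g' i → τ₃ ≤ τ₂ + 10 →
        wp (do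
          let b ← isSStar ⟨m⟩ ⟨i⟩
          if b = true then do
            let k ← sub ⟨i⟩ (← read .hPos ⟨g'⟩)
            write .sPos ⟨num⟩ ⟨i⟩
            write .sIp ⟨num⟩ (← read .isaR (← add (← read .hQ ⟨g'⟩) k))
            write .sLen ⟨num⟩ (← sub (← read .hLen ⟨g'⟩) k)
            write .sX ⟨num⟩ (← read .hX ⟨g'⟩)
            write .sC ⟨num⟩ (← read .hC ⟨g'⟩)
            return ((⟨g'⟩ : Word), ← add ⟨num⟩ 1)
          else
            return (⟨g'⟩, ⟨num⟩)) μ₂ τ₃ fun s μ' τ' =>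
          (Frame S μ₁ μ' ∧ Stars T R isa nR m (i + 1) s.2.val μ' ∧ (i + 1 = 0 → s.1.val = 0) ∧
            (0 < i + 1 → Within N heads μ' s.1.val (i + 1 - 1))) ∧ τ' ≤ τ₂ + 50 := by
      intro g' τ₃ hw' ht₃
      rw [wp_bind]
      refine wp_mono (wp_isSStar hL₂.txt hty₂ hi _) ?_
      rintro b μ₃ τ₄ ⟨hb, rfl, ht₄⟩
      rw [wp_ite]
      split_ifs with hstar <;> rw [hb] at hstar
      · obtain ⟨h1, h2⟩ := hw'.ems hH₂
        have hc := hH₂.char g' hw'.lt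
        have hle := hw'.le
        rw [show μ₃ .hPos g' + μ₃ .hLen g' = i + (μ₃ .hLen g' - (i - μ₃ .hPos g')) by omega] at hc
        simp only [wp_rules, Word.val_one, Nat.add_sub_cancel]
        refine ⟨⟨(((((hF.upd (by simp [hS]) _ _).upd (by simp [hS]) _ _).upd (by simp [hS]) _ _).upd
          (by simp [hS]) _ _).upd (by simp [hS]) _ _), hst.push hstar h2 ?_ ?_ ?_ ?_ ?_,
          fun hc => hc.elim, fun _ => ?_⟩, by omega⟩
        · intro k; simp [upd_ne, upd_self]
        · intro k; simp [upd_ne, upd_self, hL₂.isaR]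
        · intro k; simp [upd_ne, upd_self]
        · intro k; simp [upd_ne, upd_self]
        · intro k; simp [upd_ne, upd_self, hc]
        · obtain ⟨a, b, c, d⟩ := hw'
          exact ⟨a, by simpa [upd_ne] using b, c, by simpa [upd_ne] using d⟩
      · simp only [wp_rules]
        exact ⟨⟨hF, hst.skip hstar, fun hc => hc.elim, fun _ => hw'⟩, by omega⟩
    rw [wp_bind, wp_add, wp_bind, wp_lt, wp_ite]
    by_cases h1 : g + 1 < heads
    · refine Eq.mpr (if_pos (decide_eq_true h1)) ?_
      rw [wp_bind, wp_read, wp_bind, wp_eq, wp_ite]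
      by_cases h2 : μ₂ .hPos (g + 1) = i
      · refine Eq.mpr (if_pos (decide_eq_true h2)) ?_
        rw [wp_bind, wp_pure]
        refine hrest (g + 1) _ ?_ ?_
        · have := hH₂.within_pos h1
          rwa [h2] at this
        · omega
      · refine Eq.mpr (if_neg (fun hc => h2 (of_decide_eq_true hc))) ?_
        rw [wp_bind, wp_pure]
        refine hrest g _ (hw0 fun hc => h2 hc.2) ?_
        omega
    · refine Eq.mpr (if_neg (fun hc => h1 (of_decide_eq_true hc))) ?_
      rw [wp_bind, wp_pure]
      refine hrest g _ (hw0 fun hc => h1 hc.1) ?_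
      omega
  · rintro ⟨⟨g⟩, ⟨num⟩⟩ μ₂ τ₂ ⟨⟨hF, hst, -, -⟩, ht₂⟩
    simp only at hst ht₂
    have hnum := hst.le
    refine wp_mono (wp_forEach (fun k μ' => Frame [.sList] μ₂ μ' ∧ ∀ j, j < k → μ' .sList j = j) 1
      ⟨Frame.refl _ _, fun j hj => absurd hj (Nat.not_lt_zero _)⟩ ?_) ?_
    · rintro k μ' τ' hk ⟨hF', hj⟩
      simp only [wp_rules]
      refine ⟨⟨hF'.upd (by simp) _ _, fun j hj' => ?_⟩, le_rfl⟩
      rw [upd_self]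
      split_ifs with e
      · exact e.symm
      · exact hj j (by omega)
    rintro _ μ₃ τ₃ ⟨⟨hF₃, hls⟩, ht₃⟩
    simp only at hls ht₃
    have hst₃ := hst.frame hF₃ (by simp) (by simp) (by simp) (by simp) (by simp)
    refine wp_mono (wp_bucketSort (kf := μ₃ .sIp) (B := 1) (by simp) (by simp) (by simp) ?_ ?_) ?_
    · intro μ' hF' i hi τ
      simp only [wp_rules, hF' .sIp (by simp)]
      exact ⟨trivial, trivial, le_rfl⟩
    · intro i hi
      rw [hls i hi]
      obtain ⟨q, e, he⟩ := hst₃.ems i hi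
      rw [e]; exact h.isa_lt he.q_lt
    rintro _ μ₄ τ₄ ⟨⟨hF₄, hd, hB⟩, ht₄⟩
    simp only [wp_pure]
    refine ⟨⟨?_, ?_, ?_, isPerm_of_bucketPos ((IsPerm.id num).congr hls) hd, ?_⟩, ?_⟩
    · exact (hF₁.mono (by simp)).trans (((hF.mono (by simp [hS])).trans (hF₃.mono (by simp))).trans
        (hF₄.mono (by simp)))
    · exact ((hty.frame hF (by simp [hS])).frame hF₃ (by simp)).frame hF₄ (by simp)
    · exact hst₃.frame hF₄ (by simp) (by simp) (by simp) (by simp) (by simp)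
    · rw [hF₄ .sIp (by simp)]; exact hB
    · simp only [starsTime] at *
      omega

end phase3

/-! ## Phase 4 -/

/-- The sorting key of the insert-heads. -/
def headKey (isa : ℕ → ℕ) (μ : Mem) (g : ℕ) : ℕ ×ₗ ℕ ×ₗ ℤ ×ₗ ℕ :=
  toLex (isa (μ .hQ g), emsKey (μ .hLen g) (μ .hX g) (μ .hC g))

section phase4
variable {T R sa isa lcp : ℕ → ℕ} {N nR m K t heads : ℕ} {μ μ' : Mem}

theorem headKey_lt_iff {g g' : ℕ} : headKey isa μ g < headKey isa μ g' ↔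
    isa (μ .hQ g) < isa (μ .hQ g') ∨ isa (μ .hQ g) = isa (μ .hQ g') ∧
      emsKey (μ .hLen g) (μ .hX g) (μ .hC g) < emsKey (μ .hLen g') (μ .hX g') (μ .hC g') :=
  Prod.Lex.toLex_lt_toLex

theorem headKey_eq_iff {g g' : ℕ} : headKey isa μ g = headKey isa μ g' ↔
    isa (μ .hQ g) = isa (μ .hQ g') ∧
      emsKey (μ .hLen g) (μ .hX g) (μ .hC g) = emsKey (μ .hLen g') (μ .hX g') (μ .hC g') := by
  simp only [headKey, toLex_inj, Prod.mk.injEq]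

theorem RefIndex.isa_inj (h : RefIndex R sa isa nR) {p q : ℕ} (hp : p < nR) (hq : q < nR)
    (e : isa p = isa q) : p = q := by rw [← h.sa_isa hp, e, h.sa_isa hq]

theorem Heads.lt_of_key_lt (h : RefIndex R sa isa nR) (hH : Heads T R nR N heads μ) {g g' : ℕ}
    (hg : g < heads) (hg' : g' < heads) (hlt : headKey isa μ g < headKey isa μ g') :
    suf T (μ .hPos g) < suf T (μ .hPos g') := by
  have e := hH.ems_pos hg
  have e' := hH.ems_pos hg'
  rcases headKey_lt_iff.1 hlt with h1 | ⟨h1, h2⟩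
  · exact e.lt_of_isa_lt h e' h1
  · rw [hH.char g hg, hH.char g' hg'] at h2
    rw [← h.isa_inj e.q_lt e'.q_lt h1] at e'
    exact e.lt_of_key_lt e' h2

theorem Heads.pos_inj (hH : Heads T R nR N heads μ) {g g' : ℕ}
    (hg : g < heads) (hg' : g' < heads) (e : μ .hPos g = μ .hPos g') : g = g' := by
  rcases lt_trichotomy g g' with h | h | h
  · exact absurd e (hH.mono g g' h hg').ne
  · exact h
  · exact absurd e.symm (hH.mono g' g h hg).ne

/-- Insert-heads with the same metacharacter: the next insert-heads have the same distance. -/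
theorem Heads.next_of_key_eq (ht : TextRef T R N nR m K) (h : RefIndex R sa isa nR)
    (hH : Heads T R nR N heads μ) {g g' : ℕ} (hg : g < heads) (hg' : g' < heads) (hne : g ≠ g')
    (hk : headKey isa μ g = headKey isa μ g') : g + 1 < heads ∧ g' + 1 < heads ∧
      μ .hPos (g + 1) - μ .hPos g = μ .hPos (g' + 1) - μ .hPos g' ∧
      Agree T (μ .hPos g) T (μ .hPos g') (μ .hPos (g + 1) - μ .hPos g) := by
  have e := hH.ems_pos hg
  have e' := hH.ems_pos hg'
  obtain ⟨h1, h2⟩ := headKey_eq_iff.1 hk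
  rw [hH.char g hg, hH.char g' hg'] at h2
  have hq := h.isa_inj e.q_lt e'.q_lt h1
  rw [← hq] at e'
  obtain ⟨hl, hx, ha⟩ := e.agree_of_key_eq e' h2
  rw [← hl, ← hx] at e'
  have hp : μ .hPos g ≠ μ .hPos g' := fun hc => hne (hH.pos_inj hg hg' hc)
  have w := hH.within_pos hg
  have w' := hH.within_pos hg'
  obtain ⟨n1, n2⟩ := w.next_le ht h hH e e' w'.lt' ha hp
  obtain ⟨n1', n2'⟩ := w'.next_le ht h hH e' e w.lt' ha.symm hp.symm
  exact ⟨n1, n1', w.next_eq ht h hH w' e e' ha hp, ha.mono (by omega)⟩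

/-- The suffixes that start at insert-heads are ordered like the suffixes of the string of
metacharacters. -/
theorem Heads.lt_of_padded_lt (ht : TextRef T R N nR m K) (h : RefIndex R sa isa nR)
    (hH : Heads T R nR N heads μ) {code : ℕ → ℕ}
    (hlt : ∀ g g', g < heads → g' < heads → code g < code g' → headKey isa μ g < headKey isa μ g')
    (heq : ∀ g g', g < heads → g' < heads → code g = code g' → headKey isa μ g = headKey isa μ g')
    {g g' : ℕ} (hg : g < heads) (hg' : g' < heads)
    (hs : suf (padded code heads) g < suf (padded code heads) g') :
    suf T (μ .hPos g) < suf T (μ .hPos g') := by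
  have hne : g ≠ g' := by rintro rfl; exact lt_irrefl _ hs
  obtain ⟨d, ha, hd⟩ := suf_lt_iff.1 hs
  -- As long as the metacharacters agree, both sequences of insert-heads advance by equal distances
  -- through equal text. Equal metacharacters at different places guarantee a further insert-head,
  -- so the padding is never reached and the first difference is one of codes.
  have key : ∀ e, e ≤ d → g + e < heads ∧ g' + e < heads ∧ μ .hPos g ≤ μ .hPos (g + e) ∧
      μ .hPos g' ≤ μ .hPos (g' + e) ∧
      μ .hPos (g + e) - μ .hPos g = μ .hPos (g' + e) - μ .hPos g' ∧
      Agree T (μ .hPos g) T (μ .hPos g') (μ .hPos (g + e) - μ .hPos g) := by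
    intro e
    induction e with
    | zero => exact fun _ => ⟨hg, hg', le_rfl, le_rfl, by simp, by simpa using Agree.zero⟩
    | succ e ih =>
      intro hed
      obtain ⟨h1, h2, h3, h4, h5, h6⟩ := ih (by omega)
      have hm := ha e (by omega)
      rw [padded, padded, if_pos h1, if_pos h2] at hm
      obtain ⟨k1, k2, k3, k4⟩ := hH.next_of_key_eq ht h h1 h2 (by omega) (heq _ _ h1 h2 (by omega))
      have m1 := hH.mono _ _ (Nat.lt_succ_self (g + e)) k1
      have m2 := hH.mono _ _ (Nat.lt_succ_self (g' + e)) k2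
      simp only [Nat.succ_eq_add_one] at m1 m2
      refine ⟨k1, k2, by simp only [← Nat.add_assoc]; omega, by simp only [← Nat.add_assoc]; omega,
        by simp only [← Nat.add_assoc]; omega, ?_⟩
      have := h6.append (l := μ .hPos (g + e + 1) - μ .hPos (g + e)) (by
        rw [show μ .hPos g + (μ .hPos (g + e) - μ .hPos g) = μ .hPos (g + e) by omega,
          show μ .hPos g' + (μ .hPos (g + e) - μ .hPos g) = μ .hPos (g' + e) by omega]
        exact k4)
      rw [← Nat.add_assoc]
      exact this.mono (by omega)
  obtain ⟨h1, h2, h3, h4, h5, h6⟩ := key d le_rfl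
  rw [padded, padded, if_pos h1, if_pos h2] at hd
  rw [h6.lt_iff, show μ .hPos g + (μ .hPos (g + d) - μ .hPos g) = μ .hPos (g + d) by omega,
    show μ .hPos g' + (μ .hPos (g + d) - μ .hPos g) = μ .hPos (g' + d) by omega]
  exact hH.lt_of_key_lt h h1 h2 (hlt _ _ h1 h2 (by omega))

theorem ne_gt_cmp {β : Type} [LinearOrder β] (a b : β) : (cmp a b != .gt) = decide (a ≤ b) := by
  rcases lt_trichotomy a b with h | h | h
  · rw [(cmp_eq_lt_iff _ _).2 h, decide_eq_true h.le]; rfl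
  · rw [(cmp_eq_eq_iff _ _).2 h, decide_eq_true h.le]; rfl
  · rw [(cmp_eq_gt_iff _ _).2 h, decide_eq_false (not_le.2 h)]; rfl

theorem eq_eq_cmp {β : Type} [LinearOrder β] (a b : β) : (cmp a b == .eq) = decide (a = b) := by
  rcases lt_trichotomy a b with h | h | h
  · rw [(cmp_eq_lt_iff _ _).2 h, decide_eq_false h.ne]; rfl
  · rw [(cmp_eq_eq_iff _ _).2 h, decide_eq_true h]; rfl
  · rw [(cmp_eq_gt_iff _ _).2 h, decide_eq_false h.ne']; rfl

/-- `hRank` orders the insert-heads like the suffixes of the text that start at them. -/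
structure HeadRanks (T : ℕ → ℕ) (heads : ℕ) (μ : Mem) : Prop where
  lt : ∀ g g', g < heads → g' < heads → μ .hRank g < μ .hRank g' →
    suf T (μ .hPos g) < suf T (μ .hPos g')
  inj : ∀ g g', g < heads → g' < heads → μ .hRank g = μ .hRank g' → g = g'

/-- Time of the fourth phase. -/
def metaTime (N nR : ℕ) : ℕ := Nat.size N * (N * 300) + N * 300 + nR * 20 + 200

/-- The codes are ranks of `headKey` in its sorted order, so comparing codes is comparing keys;
`hRank` is the inverse suffix array of the string of codes, and `Heads.lt_of_padded_lt` turns its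
order into that of the text. -/
theorem wp_phase4 (ht : TextRef T R N nR m K) (h : RefIndex R sa isa nR)
    (hL : Loaded T R sa isa lcp N nR t μ) (hH : Heads T R nR N heads μ) {z : Sizes}
    (hzR : z.nR = ⟨nR⟩) {τ : ℕ} :
    wp (phase4 z ⟨heads⟩) μ τ fun _ μ' τ' =>
      (Frame [.hList, .hIp, .hSorted, .hEnd, .metaStr, .saM, .hRank, .ord, .cnt, .tmp] μ μ' ∧
        HeadRanks T heads μ') ∧ τ' ≤ τ + metaTime N nR := by
  have hN := hH.le
  simp only [phase4, wp_bind, hzR]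
  refine wp_mono (wp_forEach (fun g μ' => Frame [.hList, .hIp] μ μ' ∧
    (∀ k, k < g → μ' .hList k = k) ∧ ∀ k, k < g → μ' .hIp k = isa (μ .hQ k)) 4
    ⟨Frame.refl _ _, fun k hk => absurd hk (Nat.not_lt_zero _),
      fun k hk => absurd hk (Nat.not_lt_zero _)⟩ ?_) ?_
  · rintro g μ₁ τ₁ hg ⟨hF, h1, h2⟩
    simp only [wp_rules]
    refine ⟨⟨(hF.upd (by simp) _ _).upd (by simp) _ _, fun k hk => ?_, fun k hk => ?_⟩, by omega⟩
    · rw [upd_ne _ _ _ (by simp), upd_self]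
      split_ifs with e
      · exact e.symm
      · exact h1 k (by omega)
    · rw [upd_self, upd_ne _ _ _ (by simp), upd_ne _ _ _ (by simp)]
      split_ifs with e
      · rw [e, hF .isaR (by simp), hF .hQ (by simp), hL.isaR]
      · rw [upd_ne _ _ _ (by simp)]
        exact h2 k (by omega)
  rintro _ μ₁ τ₁ ⟨⟨hF₁, hl, hip⟩, ht₁⟩
  simp only at hl hip ht₁
  have hH₁ := hH.frame hF₁ (by simp) (by simp) (by simp) (by simp) (by simp)
  refine wp_mono (wp_bucketSort (kf := μ₁ .hIp) (B := 1) (by simp) (by simp) (by simp) ?_ ?_) ?_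
  · intro μ' hF' i hi τ
    simp only [wp_rules, hF' .hIp (by simp)]
    exact ⟨trivial, trivial, le_rfl⟩
  · intro g hg
    rw [hl g hg, hip g hg]
    exact h.isa_lt (hH.ems_pos hg).q_lt
  rintro _ μ₂ τ₂ ⟨⟨hF₂, hd, hB⟩, ht₂⟩
  have hp₂ := isPerm_of_bucketPos ((IsPerm.id heads).congr hl) hd
  have hF₁₂ : Frame [.hList, .hIp, .hSorted, .hEnd] μ μ₂ :=
    (hF₁.mono (by simp)).trans (hF₂.mono (by simp))
  have hH₂ := hH.frame hF₁₂ (by simp) (by simp) (by simp) (by simp) (by simp)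
  set κ : ℕ → ℕ ×ₗ ℤ ×ₗ ℕ := fun g => emsKey (μ .hLen g) (μ .hX g) (μ .hC g) with hκ
  have hcmp : ∀ μ', Frame [.hList, .hIp, .hSorted, .hEnd, .metaStr, .tmp] μ μ' → ∀ x y, x < heads →
      y < heads → Computes (compareEms .hLen .hX .hC ⟨x⟩ ⟨y⟩) μ' (cmp (κ x) (κ y)) 12 := by
    intro μ' hF' x y hx hy
    have hH' := hH.frame hF' (by simp) (by simp) (by simp) (by simp) (by simp)
    have := computes_compareEms (len := .hLen) (c := .hC) (hH'.ems_pos hx).x_le (hH'.ems_pos hy).x_le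
    simpa only [hF' .hLen (by simp), hF' .hX (by simp), hF' .hC (by simp)] using this
  refine wp_mono (wp_sortBuckets (D := fun g => g < heads) (κ := κ) (kf := μ₁ .hIp) (B := 12)
    (by simp) (by simp) (by simp) ?_ (fun i hi => hp₂.lt i hi) hB) ?_
  · intro μ' hF' x y hx hy τ
    rw [wp_bind]
    refine wp_mono (hcmp μ' ((hF₁₂.mono (by simp)).trans (hF'.mono (by simp))) x y hx hy τ) ?_
    rintro _ _ τ' ⟨rfl, rfl, ht'⟩
    exact ⟨ne_gt_cmp _ _, rfl, ht'⟩
  rintro _ μ₃ τ₃ ⟨⟨hF₃, hperm, hsort⟩, ht₃⟩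
  have hp₃ := hp₂.of_seg hperm
  have hF₁₃ : Frame [.hList, .hIp, .hSorted, .hEnd, .tmp] μ μ₃ :=
    (hF₁₂.mono (by simp)).trans (hF₃.mono (by simp))
  have hip₃ : ∀ g, g < heads → μ₃ .hIp g = isa (μ .hQ g) := fun g hg => by
    rw [hF₃ .hIp (by simp), hF₂ .hIp (by simp), hip g hg]
  refine wp_mono (wp_assignRanks (κ := headKey isa μ) (B := 16) (by simp) ?_ hp₃.inj) ?_
  · intro μ' hF' i j hi hj τ
    have hx := hp₃.lt i hi
    have hy := hp₃.lt j hj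
    simp only [wp_rules, decide_eq_true_eq, hF' .hIp (by simp), hip₃ _ hx, hip₃ _ hy]
    have hkey := headKey_eq_iff (isa := isa) (μ := μ) (g := μ₃ .hSorted i) (g' := μ₃ .hSorted j)
    by_cases e : isa (μ .hQ (μ₃ .hSorted i)) = isa (μ .hQ (μ₃ .hSorted j))
    · rw [if_pos e]
      refine wp_mono (hcmp μ' ((hF₁₃.mono (by simp)).trans (hF'.mono (by simp))) _ _ hx hy _) ?_
      rintro _ _ τ' ⟨rfl, rfl, ht'⟩
      refine ⟨?_, by trivial, by omega⟩
      rw [eq_eq_cmp, decide_eq_decide, hkey]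
      exact ⟨fun h => ⟨e, h⟩, fun h => h.2⟩
    · rw [if_neg e]
      exact ⟨(decide_eq_false fun hc => e (hkey.1 hc).1).symm, by trivial, by omega⟩
  rintro ⟨r⟩ μ₄ τ₄ ⟨⟨hF₄, hrank, -⟩, ht₄⟩
  simp only at hrank
  have hs : ∀ i j, i < j → j < heads →
      headKey isa μ (μ₃ .hSorted i) ≤ headKey isa μ (μ₃ .hSorted j) := by
    intro i j hij hj
    have hx := hp₃.lt i (hij.trans hj)
    have hy := hp₃.lt j hj
    have := hsort i j hij hj
    rw [hip _ hx, hip _ hy] at this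
    rw [headKey, headKey, Prod.Lex.toLex_le_toLex]
    exact this
  have hrnum := hrank.num_le
  refine wp_mono (wp_suffixSort (t := .metaStr) (sa := .saM) (rank := .hRank) (by simp) (by simp)
    (by simp) (numKeys := r) ?_) ?_
  · intro g hg
    obtain ⟨i, hi, rfl⟩ := hp₃.surj hg
    exact hrank.lt_num hi
  rintro _ μ₅ τ₅ ⟨⟨hF₅, hsa, -⟩, ht₅⟩
  have hF : Frame [.hList, .hIp, .hSorted, .hEnd, .metaStr, .saM, .hRank, .ord, .cnt, .tmp] μ μ₅ :=
    (hF₁₃.mono (by simp)).trans ((hF₄.mono (by simp)).trans (hF₅.mono (by simp)))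
  refine ⟨⟨hF, ?_, ?_⟩, ?_⟩
  · intro g g' hg hg' hlt
    rw [hF .hPos (by simp)]
    obtain ⟨i, hi, rfl⟩ := hsa.perm.surj hg
    obtain ⟨j, hj, rfl⟩ := hsa.perm.surj hg'
    rw [hsa.isa_sa i hi, hsa.isa_sa j hj] at hlt
    refine hH.lt_of_padded_lt ht h ?_ ?_ hg hg' (hsa.sorted i j hlt hj)
    · intro g g' hg hg' hlt
      obtain ⟨i, hi, rfl⟩ := hp₃.surj hg
      obtain ⟨j, hj, rfl⟩ := hp₃.surj hg'
      exact (hrank.lt_iff hs hi hj).1 hlt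
    · intro g g' hg hg' e
      obtain ⟨i, hi, rfl⟩ := hp₃.surj hg
      obtain ⟨j, hj, rfl⟩ := hp₃.surj hg'
      have h1 := (hrank.lt_iff hs hi hj).not.1 e.not_lt
      have h2 := (hrank.lt_iff hs hj hi).not.1 e.symm.not_lt
      exact le_antisymm (not_lt.1 h2) (not_lt.1 h1)
  · intro g g' hg hg' e
    obtain ⟨i, hi, rfl⟩ := hsa.perm.surj hg
    obtain ⟨j, hj, rfl⟩ := hsa.perm.surj hg'
    rw [hsa.isa_sa i hi, hsa.isa_sa j hj] at e
    rw [e]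
  · have hsz := Nat.size_le_size hN
    have e1 : Nat.size heads * (heads * (12 + 60)) ≤ Nat.size N * (N * 72) :=
      Nat.mul_le_mul hsz (Nat.mul_le_mul_right _ hN)
    have e2 : Nat.size heads * (heads * 150) ≤ Nat.size N * (N * 150) :=
      Nat.mul_le_mul hsz (Nat.mul_le_mul_right _ hN)
    have e3 : Nat.size N * (N * 300) = Nat.size N * (N * 72) + Nat.size N * (N * 150) +
      Nat.size N * (N * 78) := by ring
    simp only [metaTime, suffixTime] at *
    omega

/-! ## Phase 5 -/

/-- The binary search counts the insert-heads up to `p`; there is at least one, so the result can be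
written as `g + 1`, where `g` is the insert-head in charge of `p`. -/
theorem wp_nextHead (hH : Heads T R nR N heads μ) {p : ℕ} (hp : p < N) (τ : ℕ) :
    wp (nextHead ⟨heads⟩ ⟨p⟩) μ τ fun r μ' τ' =>
      μ' = μ ∧ (∃ g, r = ⟨g + 1⟩ ∧ Within N heads μ g p) ∧ τ' ≤ τ + searchTime 2 heads := by
  obtain ⟨h0, hz⟩ := hH.first ((Nat.zero_le p).trans_lt hp)
  refine wp_mono (wp_binarySearch (lo := 0) (p := fun g => μ .hPos g ≤ p) (B := 2) ?_ ?_
    (Nat.zero_le _)) ?_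
  · intro g _ hg τ
    simp only [wp_rules]
    exact ⟨trivial, trivial, le_rfl⟩
  · intro i j _ hij hj hle
    rcases hij.lt_or_eq with h | h
    · exact (hH.mono i j h hj).le.trans hle
    · rw [h]; exact hle
  · rintro ⟨r⟩ _ τ' ⟨⟨rfl, -, hr, hiff⟩, ht'⟩
    simp only at hr hiff
    have h1 := (hiff 0 (Nat.zero_le _) h0).1 (by omega)
    refine ⟨rfl, ⟨r - 1, by rw [Nat.sub_add_cancel h1], by omega,
      (hiff (r - 1) (Nat.zero_le _) (by omega)).2 (by omega), hp, fun hg => ?_⟩, ht'⟩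
    have := (hiff (r - 1 + 1) (Nat.zero_le _) hg).not.2 (by omega)
    omega

/-- Time of the fifth phase. -/
def sortTime (N nR : ℕ) : ℕ := Nat.size N * (N * 100) + N * 20 + nR * 7 + 10

/-- Buckets and keys decide all cases except equal statistics. There the next insert-heads are
equally far away within shared text, so the prefix up to them cancels and their ranks decide. -/
theorem wp_phase5 (ht : TextRef T R N nR m K) (h : RefIndex R sa isa nR)
    (hH : Heads T R nR N heads μ) (hR : HeadRanks T heads μ) {num : ℕ}
    (hS : Stars T R isa nR m N num μ) (hperm : IsPerm (μ .sSorted) num)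
    (hB : Bucketed (μ .sSorted) (μ .sEnd) num nR (μ .sIp)) {z : Sizes} (hzR : z.nR = ⟨nR⟩) {τ : ℕ} :
    wp (phase5 z ⟨heads⟩ ⟨num⟩) μ τ fun _ μ' τ' =>
      (Frame [.sNext, .sSorted, .tmp] μ μ' ∧ IsPerm (μ' .sSorted) num ∧
        ∀ a b, a < b → b < num →
          suf T (μ .sPos (μ' .sSorted a)) < suf T (μ .sPos (μ' .sSorted b))) ∧
      τ' ≤ τ + sortTime N nR := by
  have hnum := hS.le
  have hheads := hH.le
  simp only [phase5, wp_bind, hzR]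
  -- If there is no later insert-head, this reads the entry of `hRank` at index `heads`, which is no
  -- rank; `Within.next_le` shows that this does not happen in a genuine tie.
  refine wp_mono (wp_forEach (fun k μ' => Frame [.sNext] μ μ' ∧ ∀ t, t < k →
    ∃ g, Within N heads μ g (μ .sPos t) ∧ μ' .sNext t = μ .hRank (g + 1)) (searchTime 2 heads + 3)
    ⟨Frame.refl _ _, fun k hk => absurd hk (Nat.not_lt_zero _)⟩ ?_) ?_
  · rintro k μ₁ τ₁ hk ⟨hF, hn⟩
    simp only at hk
    simp only [wp_bind, wp_read]
    rw [hF .sPos (by simp)]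
    have hH₁ := hH.frame hF (by simp) (by simp) (by simp) (by simp) (by simp)
    refine wp_mono (wp_nextHead hH₁ (hS.star k hk).1 _) ?_
    rintro _ _ τ₂ ⟨rfl, ⟨g, rfl, hw⟩, ht₂⟩
    simp only [wp_rules, hF .hRank (by simp)]
    refine ⟨⟨hF.upd (by simp) _ _, fun t ht => ?_⟩, by omega⟩
    rw [upd_self]
    split_ifs with e
    · obtain ⟨a, b, c, d⟩ := hw
      rw [hF .hPos (by simp)] at b d
      exact ⟨g, ⟨a, by rwa [e], by rwa [e], by rwa [e]⟩, rfl⟩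
    · exact hn t (by omega)
  rintro _ μ₁ τ₁ ⟨⟨hF₁, hn⟩, ht₁⟩
  simp only at hn ht₁
  set κ : ℕ → (ℕ ×ₗ ℤ ×ₗ ℕ) ×ₗ ℕ := fun t =>
    toLex (emsKey (μ .sLen t) (μ .sX t) (μ .sC t), μ₁ .sNext t) with hκ
  refine wp_mono (wp_sortBuckets (D := fun t => t < num) (κ := κ) (kf := μ .sIp) (len := num)
    (B := 16) (by simp) (by simp) (by simp) ?_ ?_ ?_) ?_
  · intro μ' hF' x y hx hy τ
    have hF : Frame [.sNext, .sSorted, .tmp] μ μ' := (hF₁.mono (by simp)).trans (hF'.mono (by simp))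
    have hS' := hS.frame hF (by simp) (by simp) (by simp) (by simp) (by simp)
    obtain ⟨_, _, e1⟩ := hS'.ems x hx
    obtain ⟨_, _, e2⟩ := hS'.ems y hy
    rw [wp_bind]
    refine wp_mono (computes_compareEms (len := .sLen) (c := .sC) e1.x_le e2.x_le τ) ?_
    rintro _ _ τ' ⟨rfl, rfl, ht'⟩
    simp only [hF .sLen (by simp), hF .sX (by simp), hF .sC (by simp), hκ,
      Prod.Lex.toLex_le_toLex]
    rcases lt_trichotomy (emsKey (μ .sLen x) (μ .sX x) (μ .sC x))
      (emsKey (μ .sLen y) (μ .sX y) (μ .sC y)) with hlt | heq | hgt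
    · rw [(cmp_eq_lt_iff _ _).2 hlt]
      exact ⟨(decide_eq_true (Or.inl hlt)).symm, by trivial, ht'.trans (by omega)⟩
    · rw [(cmp_eq_eq_iff _ _).2 heq]
      simp only [wp_rules, hF' .sNext (by simp)]
      refine ⟨decide_eq_decide.2 ⟨fun h => Or.inr ⟨heq, h⟩, ?_⟩, by trivial, by omega⟩
      rintro (h | h)
      · exact absurd heq h.ne
      · exact h.2
    · rw [(cmp_eq_gt_iff _ _).2 hgt]
      refine ⟨(decide_eq_false ?_).symm, by trivial, ht'.trans (by omega)⟩
      rintro (h | h)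
      · exact absurd hgt h.not_gt
      · exact absurd h.1 hgt.ne'
  · rw [hF₁ .sSorted (by simp)]
    exact fun i hi => hperm.lt i hi
  · rw [hF₁ .sSorted (by simp), hF₁ .sEnd (by simp)]
    exact hB
  rintro _ μ₂ τ₂ ⟨⟨hF₂, hp, hsort⟩, ht₂⟩
  rw [hF₁ .sSorted (by simp)] at hp
  have hperm₂ := hperm.of_seg hp
  refine ⟨⟨(hF₁.mono (by simp)).trans (hF₂.mono (by simp)), hperm₂, fun a b hab hb => ?_⟩, ?_⟩
  · have hx := hperm₂.lt a (hab.trans hb)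
    have hy := hperm₂.lt b hb
    have hxy : μ₂ .sSorted a ≠ μ₂ .sSorted b := fun e =>
      hab.ne (hperm₂.inj a b (hab.trans hb) hb e)
    have hs := hsort a b hab hb
    generalize μ₂ .sSorted a = x at *
    generalize μ₂ .sSorted b = y at *
    obtain ⟨q, e1, he⟩ := hS.ems x hx
    obtain ⟨q', e2, he'⟩ := hS.ems y hy
    rw [e1, e2] at hs
    rcases hs with hs | ⟨hs, hs'⟩
    · exact he.lt_of_isa_lt h he' hs
    · obtain rfl := h.isa_inj he.q_lt he'.q_lt hs
      simp only [hκ, Prod.Lex.toLex_le_toLex, hS.char x hx, hS.char y hy] at hs'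
      rcases hs' with hs' | ⟨hs', hs''⟩
      · exact he.lt_of_key_lt he' hs'
      · have hpos : μ .sPos x ≠ μ .sPos y := by
          rcases Nat.lt_or_gt_of_ne hxy with hc | hc
          · exact (hS.mono x y hc hy).ne
          · exact (hS.mono y x hc hx).ne'
        obtain ⟨hl, hx', ha⟩ := he.agree_of_key_eq he' hs'
        rw [← hl, ← hx'] at he'
        obtain ⟨g, hw, en⟩ := hn x hx
        obtain ⟨g', hw', en'⟩ := hn y hy
        rw [en, en'] at hs''
        obtain ⟨n1, n2⟩ := hw.next_le ht h hH he he' hw'.lt' ha hpos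
        obtain ⟨n1', n2'⟩ := hw'.next_le ht h hH he' he hw.lt' ha.symm hpos.symm
        have hd := hw.next_eq ht h hH hw' he he' ha hpos
        have hb1 := hw.lt_next n1
        have hb2 := hw'.lt_next n1'
        rw [(ha.mono (show μ .hPos (g + 1) - μ .sPos x ≤ _ by omega)).lt_iff,
          show μ .sPos x + (μ .hPos (g + 1) - μ .sPos x) = μ .hPos (g + 1) by omega,
          show μ .sPos y + (μ .hPos (g + 1) - μ .sPos x) = μ .hPos (g' + 1) by omega]
        -- Equal ranks would mean the same next insert-head at the same distance, hence the same
        -- position.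
        refine hR.lt _ _ n1 n1' (lt_of_le_of_ne hs'' fun e => hpos ?_)
        have := hR.inj _ _ n1 n1' e
        rw [this] at hd hb1
        omega
  · have hsz := Nat.size_le_size hnum
    have hsz' := Nat.size_le_size hheads
    have e1 : Nat.size num * (num * (16 + 60)) ≤ Nat.size N * (N * 76) :=
      Nat.mul_le_mul hsz (Nat.mul_le_mul_right _ hnum)
    have e2 : num * (searchTime 2 heads + 3 + 1) ≤ Nat.size N * (N * 8) + N * 10 := by
      have : searchTime 2 heads + 3 + 1 ≤ Nat.size N * 8 + 10 := by rw [searchTime]; omega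
      calc _ ≤ N * (Nat.size N * 8 + 10) := Nat.mul_le_mul hnum this
        _ = _ := by ring
    have e3 : Nat.size N * (N * 100) = Nat.size N * (N * 76) + Nat.size N * (N * 8) +
      Nat.size N * (N * 16) := by ring
    simp only [sortTime] at *
    omega

end phase4

/-! ## The positions of the suffixes in the suffix array -/

/-- The number of `p < N` with property `P`. -/
noncomputable def tally (N : ℕ) (P : ℕ → Prop) : ℕ := @Nat.count P (Classical.decPred P) N

section tally
variable {N : ℕ} {P Q R : ℕ → Prop}

theorem tally_eq_card (N : ℕ) (P : ℕ → Prop) [DecidablePred P] :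
    tally N P = ((Finset.range N).filter P).card := by
  rw [tally, Nat.count_eq_card_filter_range]
  congr!

theorem tally_succ (N : ℕ) (P : ℕ → Prop) [Decidable (P N)] :
    tally (N + 1) P = tally N P + if P N then 1 else 0 := by
  rw [tally, tally, Nat.count_succ]
  congr

theorem tally_congr (h : ∀ p, p < N → (P p ↔ Q p)) : tally N P = tally N Q := by
  classical
  rw [tally_eq_card, tally_eq_card]
  congr 1
  exact Finset.filter_congr fun p hp => h p (Finset.mem_range.1 hp)

theorem tally_add (h : ∀ p, p < N → (P p ↔ Q p ∨ R p)) (hd : ∀ p, p < N → Q p → ¬ R p) :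
    tally N P = tally N Q + tally N R := by
  induction N with
  | zero => rfl
  | succ N ih =>
    classical
    rw [tally_succ, tally_succ, tally_succ, ih (fun p hp => h p (by omega))
      fun p hp => hd p (by omega)]
    have h1 := h N (by omega)
    have h2 := hd N (by omega)
    split_ifs <;> first | omega | (exfalso; tauto)

theorem tally_mono (h : ∀ p, p < N → P p → Q p) : tally N P ≤ tally N Q := by
  rw [tally_add (P := Q) (Q := P) (R := fun p => Q p ∧ ¬ P p) (fun p hp => by
    have := h p hp; tauto) fun p hp => by tauto]
  exact Nat.le_add_right _ _

theorem tally_eq_zero (h : ∀ p, p < N → ¬ P p) : tally N P = 0 := by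
  induction N with
  | zero => rfl
  | succ N ih =>
    classical
    rw [tally_succ, ih fun p hp => h p (by omega), if_neg (h N (by omega))]

theorem tally_true (h : ∀ p, p < N → P p) : tally N P = N := by
  induction N with
  | zero => rfl
  | succ N ih =>
    classical
    rw [tally_succ, ih fun p hp => h p (by omega), if_pos (h N (by omega))]

theorem tally_single {a : ℕ} (ha : a < N) : tally N (fun p => p = a) = 1 := by
  rw [tally_eq_card, Finset.filter_eq' (Finset.range N) a, if_pos (Finset.mem_range.2 ha)]
  rfl

theorem tally_insert {a : ℕ} (ha : a < N) (h : ∀ p, p < N → (P p ↔ Q p ∨ p = a)) (hn : ¬ Q a) :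
    tally N P = tally N Q + 1 := by
  rw [tally_add h fun p _ hq e => hn (e ▸ hq), tally_single ha]

theorem tally_lt {a : ℕ} (ha : a < N) (h : ∀ p, p < N → P p → Q p) (hq : Q a) (hp : ¬ P a) :
    tally N P < tally N Q := by
  have h1 : tally N (fun p => P p ∨ p = a) = tally N P + 1 :=
    tally_insert ha (fun _ _ => Iff.rfl) hp
  have h2 : tally N (fun p => P p ∨ p = a) ≤ tally N Q := tally_mono fun p hp h' =>
    h'.elim (h p hp) fun e => e ▸ hq
  omega

end tally

/-- The number of suffixes of `T[0, N)` smaller than the one at `p`. -/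
noncomputable def rk (T : ℕ → ℕ) (N p : ℕ) : ℕ := tally N fun p' => suf T p' < suf T p

/-- The left end of the bucket of the character `c`. -/
noncomputable def bucketStart (T : ℕ → ℕ) (N c : ℕ) : ℕ := tally N fun p => T p < c

/-- The slot of an `S*`-suffix before the S-suffixes are induced. -/
noncomputable def starSlot (T : ℕ → ℕ) (N m p : ℕ) : ℕ :=
  bucketStart T N (T p + 1) - 1 - tally N fun p' => Star T m p' ∧ T p' = T p ∧ suf T p < suf T p'

open Classical in
/-- The slot of an L-suffix or an `S*`-suffix while the L-suffixes are induced. -/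
noncomputable def slot (T : ℕ → ℕ) (N m p : ℕ) : ℕ :=
  if SType T p then starSlot T N m p else rk T N p

section order
variable {T R : ℕ → ℕ} {N nR m K : ℕ}

theorem suf_le_char {T : ℕ → ℕ} {p p' : ℕ} (h : suf T p ≤ suf T p') : T p ≤ T p' :=
  (Agree.zero (f := T) (i := p) (g := T) (j := p')).char_le h

theorem suf_lt_of_char {T : ℕ → ℕ} {p p' : ℕ} (h : T p < T p') : suf T p < suf T p' :=
  (Agree.zero (f := T) (i := p) (g := T) (j := p')).lt h

theorem suf_lt_succ_iff {T : ℕ → ℕ} {p p' : ℕ} (h : T p = T p') :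
    suf T p < suf T p' ↔ suf T (p + 1) < suf T (p' + 1) :=
  ((Agree.zero (f := T) (i := p) (g := T) (j := p')).succ h).lt_iff

theorem bucketStart_succ (T : ℕ → ℕ) (N c : ℕ) : bucketStart T N (c + 1) = bucketStart T N c +
    (tally N (fun p => ¬ SType T p ∧ T p = c) + tally N fun p => SType T p ∧ T p = c) := by
  have h1 : tally N (fun p => T p = c) =
      tally N (fun p => ¬ SType T p ∧ T p = c) + tally N fun p => SType T p ∧ T p = c :=
    tally_add (fun p _ => by tauto) fun p _ => by tauto
  rw [← h1]
  exact tally_add (fun p _ => by omega) fun p _ => by omega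

theorem bucketStart_mono (T : ℕ → ℕ) (N : ℕ) {c c' : ℕ} (h : c ≤ c') :
    bucketStart T N c ≤ bucketStart T N c' := tally_mono fun _ _ hp => hp.trans_le h

/-- The successor of an L-suffix is an L-suffix or an `S*`-suffix. -/
theorem star_succ {p : ℕ} (hs : ¬ SType T p) : SType T (p + 1) → Star T m (p + 1) :=
  fun h => Or.inr ⟨h, Nat.succ_pos _, hs⟩

variable (ht : TextRef T R N nR m K)
include ht

/-- Shifted to the last terminator of the text, the suffix that starts later shows the filler `K`,
which is no terminator. -/
theorem TextRef.suf_inj {p p' : ℕ} (hp : p < N) (hp' : p' < N) (e : suf T p = suf T p') :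
    p = p' := by
  wlog h : p ≤ p' generalizing p p'
  · exact (this hp' hp e.symm (by omega)).symm
  by_contra hc
  have e1 : T (p + (N - 1 - p)) = T (p' + (N - 1 - p)) := congrFun e (N - 1 - p)
  rw [show p + (N - 1 - p) = N - 1 by omega, ht.of_ge (p' + (N - 1 - p)) (by omega)] at e1
  have := ht.last (by omega)
  have := ht.m_lt
  omega

theorem TextRef.succ_lt_of_gt {p : ℕ} (hp : p < N) (hm : m < T p) : p + 1 < N := by
  by_contra hc
  have := ht.last (by omega)
  rw [show N - 1 = p by omega] at this
  omega

theorem TextRef.stype_of_le {p : ℕ} (hp : p < N) (hm : T p ≤ m) : SType T p :=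
  (stype_iff T p).2 (Or.inl (ht.term_lt p hp hm))

theorem TextRef.gt_of_not_stype {p : ℕ} (hp : p < N) (hs : ¬ SType T p) : m < T p := by
  by_contra hc
  exact hs (ht.stype_of_le hp (not_lt.1 hc))

theorem TextRef.star_stype {p : ℕ} (hp : p < N) (hs : Star T m p) : SType T p :=
  hs.elim (ht.stype_of_le hp) fun h => h.1

theorem TextRef.succ_lt {p : ℕ} (hp : p < N) (hs : ¬ SType T p) :
    p + 1 < N ∧ suf T (p + 1) < suf T p := by
  have h1 := ht.succ_lt_of_gt hp (ht.gt_of_not_stype hp hs)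
  refine ⟨h1, lt_of_le_of_ne (not_lt.1 hs) fun e => ?_⟩
  have := ht.suf_inj h1 hp e
  omega

/-- L-suffixes precede the S-suffixes with the same first character. -/
theorem TextRef.lt_of_type {p p' : ℕ} (hp : p < N) (hp' : p' < N) (hc : T p = T p')
    (hs : ¬ SType T p) (hs' : SType T p') : suf T p < suf T p' := by
  by_contra hle
  rw [not_lt] at hle
  -- Induction on the length of the L-suffix. In the wrong order, the two second characters are
  -- forced to equal the common first one, so the types pass on and the same situation recurs one
  -- position later.
  obtain ⟨n, hn⟩ : ∃ n, n = N - p := ⟨_, rfl⟩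
  induction n using Nat.strong_induction_on generalizing p p' with
  | _ n ih =>
    obtain ⟨h1, h2⟩ := ht.succ_lt hp hs
    have h3 : suf T (p' + 1) ≤ suf T (p + 1) := by
      rw [← not_lt, ← suf_lt_succ_iff hc, not_lt]; exact hle
    have c1 := suf_le_char h3
    have c2 := suf_le_char h2.le
    have c3 := suf_le_char (show suf T p' ≤ suf T (p' + 1) from le_of_lt hs')
    have hK := ht.lt p' hp'
    have hp1 : p' + 1 < N := by
      by_contra h
      have := ht.of_ge (p' + 1) (by omega)
      omega
    have s1 : ¬ SType T (p + 1) := fun h => hs ((stype_iff T p).2 (Or.inr ⟨by omega, h⟩))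
    have s2 : SType T (p' + 1) := ((stype_iff T p').1 hs').elim (fun h => by omega) fun h => h.2
    exact ih (N - (p + 1)) (by omega) h1 hp1 (by omega) s1 s2 h3 rfl

theorem TextRef.rk_lt_iff {p p' : ℕ} (hp : p < N) (hp' : p' < N) :
    rk T N p < rk T N p' ↔ suf T p < suf T p' := by
  have key : ∀ {a b : ℕ}, a < N → suf T a < suf T b → rk T N a < rk T N b := fun ha hab =>
    tally_lt ha (fun x _ hx => hx.trans hab) hab (lt_irrefl _)
  refine ⟨fun h => ?_, key hp⟩
  by_contra hc
  rcases (not_lt.1 hc).lt_or_eq with h' | h'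
  · exact lt_asymm h (key hp' h')
  · rw [ht.suf_inj hp' hp h'] at h
    exact lt_irrefl _ h

theorem TextRef.isPerm_rk : IsPerm (rk T N) N := by
  refine ⟨fun p hp => ?_, fun p p' hp hp' e => ?_⟩
  · conv_rhs => rw [← tally_true (N := N) (P := fun _ => True) fun _ _ => trivial]
    exact tally_lt hp (fun _ _ _ => trivial) trivial (lt_irrefl _)
  · have h1 := (ht.rk_lt_iff hp hp').not.1 e.not_lt
    have h2 := (ht.rk_lt_iff hp' hp).not.1 e.symm.not_lt
    exact ht.suf_inj hp hp' (le_antisymm (not_lt.1 h2) (not_lt.1 h1))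

/-- L-suffixes fill their bucket from the left: since no S-suffix of the bucket precedes them, only
smaller L-suffixes need be counted. -/
theorem TextRef.rk_of_not_stype {p : ℕ} (hp : p < N) (hs : ¬ SType T p) :
    rk T N p = bucketStart T N (T p) +
      tally N fun p' => ¬ SType T p' ∧ T p' = T p ∧ suf T p' < suf T p := by
  refine tally_add (fun p' hp' => ⟨fun h => ?_, ?_⟩) fun p' _ h h' => by omega
  · rcases (suf_le_char h.le).lt_or_eq with h1 | h1
    · exact Or.inl h1
    · refine Or.inr ⟨fun hs' => ?_, h1, h⟩
      exact lt_asymm h (ht.lt_of_type hp hp' h1.symm hs hs')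
  · rintro (h | h)
    · exact suf_lt_of_char h
    · exact h.2.2

/-- The mirror image: counted from the right end, S-suffixes are preceded by greater S-suffixes of
the bucket only. -/
theorem TextRef.rk_of_stype {p : ℕ} (hp : p < N) (hs : SType T p) :
    rk T N p + 1 + (tally N fun p' => SType T p' ∧ T p' = T p ∧ suf T p < suf T p') =
      bucketStart T N (T p + 1) := by
  have h1 : tally N (fun p' => suf T p' < suf T p ∨ p' = p) = rk T N p + 1 :=
    tally_insert hp (fun _ _ => Iff.rfl) (lt_irrefl _)
  rw [← h1]
  refine (tally_add (fun p' hp' => ⟨fun h => ?_, ?_⟩) ?_).symm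
  · rcases lt_trichotomy (suf T p') (suf T p) with h2 | h2 | h2
    · exact Or.inl (Or.inl h2)
    · exact Or.inl (Or.inr (ht.suf_inj hp' hp h2))
    · have h3 := suf_le_char h2.le
      have h4 : T p' = T p := by omega
      refine Or.inr ⟨?_, h4, h2⟩
      by_contra hs'
      exact lt_asymm h2 (ht.lt_of_type hp' hp h4 hs' hs)
  · rintro ((h | rfl) | h)
    · have := suf_le_char h.le; omega
    · omega
    · omega
  · rintro p' _ (h | rfl) h'
    · exact lt_asymm h h'.2.2
    · exact lt_irrefl _ h'.2.2

/-- The `S*`-suffixes are among the S-suffixes, so packed at the right end they do not reach into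
the L-part. The first conjunct also makes the truncated subtractions in `starSlot` exact. -/
theorem TextRef.starSlot_add {p : ℕ} (hp : p < N) (hs : Star T m p) :
    starSlot T N m p + 1 + (tally N fun p' => Star T m p' ∧ T p' = T p ∧ suf T p < suf T p') =
        bucketStart T N (T p + 1) ∧
      bucketStart T N (T p) + (tally N fun p' => ¬ SType T p' ∧ T p' = T p) ≤
        starSlot T N m p := by
  have h1 := bucketStart_succ T N (T p)
  have h2 : (tally N fun p' => Star T m p' ∧ T p' = T p ∧ suf T p < suf T p') <
      tally N fun p' => SType T p' ∧ T p' = T p :=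
    tally_lt hp (fun p' hp' h => ⟨ht.star_stype hp' h.1, h.2.1⟩) ⟨ht.star_stype hp hs, rfl⟩
      fun h => lt_irrefl _ h.2.2
  rw [starSlot]
  omega

theorem TextRef.slot_bounds {p : ℕ} (hp : p < N) (h : SType T p → Star T m p) :
    bucketStart T N (T p) ≤ slot T N m p ∧ slot T N m p < bucketStart T N (T p + 1) := by
  rw [slot]
  split_ifs with hs
  · have := ht.starSlot_add hp (h hs)
    omega
  · have h1 := bucketStart_succ T N (T p)
    have h2 := ht.rk_of_not_stype hp hs
    have h3 : (tally N fun p' => ¬ SType T p' ∧ T p' = T p ∧ suf T p' < suf T p) <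
        tally N fun p' => ¬ SType T p' ∧ T p' = T p :=
      tally_lt hp (fun p' _ h => ⟨h.1, h.2.1⟩) ⟨hs, rfl⟩ fun h => lt_irrefl _ h.2.2
    omega

/-- Although provisional slots of `S*`-suffixes differ from ranks, they are in the right order
relative to each other and to the L-suffixes. This is all that the left-to-right scan relies on. -/
theorem TextRef.slot_lt_slot {p p' : ℕ} (hp : p < N) (hp' : p' < N) (h : SType T p → Star T m p)
    (h' : SType T p' → Star T m p') (hlt : suf T p < suf T p') : slot T N m p < slot T N m p' := by
  have b := ht.slot_bounds hp h
  have b' := ht.slot_bounds hp' h'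
  rcases (suf_le_char hlt.le).lt_or_eq with hc | hc
  · have := bucketStart_mono T N (show T p + 1 ≤ T p' from hc)
    omega
  · by_cases hs : SType T p <;> by_cases hs' : SType T p'
    · rw [slot, slot, if_pos hs, if_pos hs']
      have h1 := (ht.starSlot_add hp (h hs)).1
      have h2 := (ht.starSlot_add hp' (h' hs')).1
      rw [← hc] at h2
      have h3 : (tally N fun q => Star T m q ∧ T q = T p ∧ suf T p' < suf T q) <
          tally N fun q => Star T m q ∧ T q = T p ∧ suf T p < suf T q :=
        tally_lt hp' (fun q _ hq => ⟨hq.1, hq.2.1, hlt.trans hq.2.2⟩) ⟨h' hs', hc.symm, hlt⟩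
          fun hq => lt_irrefl _ hq.2.2
      omega
    · exact absurd hlt (ht.lt_of_type hp' hp hc.symm hs' hs).not_gt
    · rw [slot, slot, if_neg hs, if_pos hs']
      have h1 := (ht.starSlot_add hp' (h' hs')).2
      have h2 := ht.rk_of_not_stype hp hs
      have h3 : (tally N fun p' => ¬ SType T p' ∧ T p' = T p ∧ suf T p' < suf T p) <
          tally N fun p' => ¬ SType T p' ∧ T p' = T p :=
        tally_lt hp (fun p' _ h => ⟨h.1, h.2.1⟩) ⟨hs, rfl⟩ fun h => lt_irrefl _ h.2.2
      rw [← hc] at h1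
      omega
    · rw [slot, slot, if_neg hs, if_neg hs']
      exact (ht.rk_lt_iff hp hp').2 hlt

theorem TextRef.slot_lt_iff {p p' : ℕ} (hp : p < N) (hp' : p' < N) (h : SType T p → Star T m p)
    (h' : SType T p' → Star T m p') : slot T N m p < slot T N m p' ↔ suf T p < suf T p' := by
  refine ⟨fun hlt => ?_, ht.slot_lt_slot hp hp' h h'⟩
  by_contra hc
  rcases (not_lt.1 hc).lt_or_eq with e | e
  · exact lt_asymm hlt (ht.slot_lt_slot hp' hp h' h e)
  · rw [ht.suf_inj hp' hp e] at hlt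
    exact lt_irrefl _ hlt

theorem TextRef.slot_inj {p p' : ℕ} (hp : p < N) (hp' : p' < N) (h : SType T p → Star T m p)
    (h' : SType T p' → Star T m p') (e : slot T N m p = slot T N m p') : p = p' := by
  have h1 := (ht.slot_lt_iff hp hp' h h').not.1 e.not_lt
  have h2 := (ht.slot_lt_iff hp' hp h' h).not.1 e.symm.not_lt
  exact ht.suf_inj hp hp' (le_antisymm (not_lt.1 h2) (not_lt.1 h1))

theorem TextRef.slot_lt {p : ℕ} (hp : p < N) (h : SType T p → Star T m p) : slot T N m p < N := by
  have h1 := (ht.slot_bounds hp h).2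
  have h2 : bucketStart T N (T p + 1) ≤ tally N fun _ => True := tally_mono fun _ _ _ => trivial
  rw [tally_true fun _ _ => trivial] at h2
  omega

/-- A terminator is alone in its bucket, so its provisional slot is already final. -/
theorem TextRef.slot_term {p : ℕ} (hp : p < N) (hm : T p ≤ m) : slot T N m p = rk T N p := by
  have hs := ht.stype_of_le hp hm
  rw [slot, if_pos hs]
  have h1 := (ht.starSlot_add hp (Or.inl hm)).1
  have h2 := ht.rk_of_stype hp hs
  have h3 : ∀ q, q < N → T q = T p → ¬ suf T p < suf T q := fun q hq e h => by
    rw [ht.term_inj p q hp hq hm e.symm] at h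
    exact lt_irrefl _ h
  rw [tally_eq_zero fun q hq h => h3 q hq h.2.1 h.2.2] at h1 h2
  omega

end order

/-! ## Phase 6 -/

theorem Word.val_two : (2 : Word).val = 2 := rfl

section phase6
variable {T R : ℕ → ℕ} {N nR m K : ℕ} {μ μ' : Mem}

theorem wp_charBuckets (hT : ∀ i, i < N → μ .txt i = T i) (hK : ∀ i, i < N → T i < K)
    {z : Sizes} (hzN : z.N = ⟨N⟩) (hzK : z.numKeys = ⟨K⟩) {τ : ℕ} :
    wp (charBuckets z) μ τ fun _ μ' τ' =>
      (Frame [.bStart] μ μ' ∧ ∀ c, c ≤ K → μ' .bStart c = bucketStart T N c) ∧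
      τ' ≤ τ + (N * 7 + K * 10 + 10) := by
  classical
  simp only [charBuckets, wp_rules, hzN, hzK, Word.val_one]
  refine wp_mono (wp_forEach (fun c μ' => Frame [.bStart] μ μ' ∧ ∀ k, k < c → μ' .bStart k = 0) 1
    ⟨Frame.refl _ _, fun k hk => absurd hk (Nat.not_lt_zero _)⟩ ?_) ?_
  · rintro c μ₁ τ₁ hc ⟨hF, hk⟩
    simp only [wp_rules, Word.val_zero]
    refine ⟨⟨hF.upd (by simp) _ _, fun k hkc => ?_⟩, le_rfl⟩
    rw [upd_self]
    split_ifs with e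
    · rfl
    · exact hk k (by omega)
  rintro _ μ₁ τ₁ ⟨⟨hF₁, h0⟩, ht₁⟩
  simp only at h0 ht₁
  refine wp_mono (wp_forEach (fun i μ' => Frame [.bStart] μ μ' ∧ ∀ c, c ≤ K →
    μ' .bStart c = tally i fun p => T p + 1 = c) 5 ⟨hF₁, fun c hc => ?_⟩ ?_) ?_
  · rw [h0 c (by omega)]; rfl
  · rintro i μ₂ τ₂ hi ⟨hF, hk⟩
    simp only at hi
    simp only [wp_rules, Word.val_one, hF .txt (by simp), hT i hi]
    refine ⟨⟨hF.upd (by simp) _ _, fun c hc => ?_⟩, by omega⟩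
    rw [upd_self, tally_succ, hk _ (hK i hi), hk c hc]
    split_ifs <;> first | omega | (subst c; rfl)
  rintro _ μ₂ τ₂ ⟨⟨hF₂, h2⟩, ht₂⟩
  simp only at h2 ht₂
  refine wp_mono (wp_forEach (fun k μ' => Frame [.bStart] μ μ' ∧ ∀ c, c ≤ K →
    μ' .bStart c = if c ≤ k then bucketStart T N c else tally N fun p => T p + 1 = c) 5
    ⟨hF₂, fun c hc => ?_⟩ ?_) ?_
  · rw [h2 c hc]
    split_ifs with e
    · rw [bucketStart, tally_eq_zero (fun p _ => by omega), tally_eq_zero (fun p _ => by omega)]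
    · rfl
  · rintro k μ₃ τ₃ hk ⟨hF, h3⟩
    simp only at hk
    simp only [wp_rules, Word.val_one]
    refine ⟨⟨hF.upd (by simp) _ _, fun c hc => ?_⟩, by omega⟩
    rw [upd_self]
    split_ifs with e1 e2 e2
    · rw [h3 (k + 1) (by omega), h3 k hk.le, if_neg (by omega), if_pos le_rfl, e1, bucketStart,
        bucketStart, Nat.add_comm]
      exact (tally_add (fun p _ => by omega) fun p _ => by omega).symm
    · omega
    · rw [h3 c hc, if_pos (by omega)]
    · rw [h3 c hc, if_neg (by omega)]
  rintro _ μ₃ τ₃ ⟨⟨hF₃, h3⟩, ht₃⟩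
  simp only at h3 ht₃
  exact ⟨⟨hF₃, fun c hc => by rw [h3 c hc, if_pos hc]⟩, by omega⟩

theorem wp_pointToEnds {b : ℕ → ℕ} (hb : ∀ c, c ≤ K → μ .bStart c = b c) {z : Sizes}
    (hzK : z.numKeys = ⟨K⟩) {τ : ℕ} :
    wp (pointToEnds z) μ τ fun _ μ' τ' =>
      (Frame [.bPtr] μ μ' ∧ ∀ c, c < K → μ' .bPtr c = b (c + 1)) ∧ τ' ≤ τ + (K * 4 + 1) := by
  simp only [pointToEnds, hzK]
  refine wp_mono (wp_forEach (fun k μ' => Frame [.bPtr] μ μ' ∧ ∀ c, c < k → μ' .bPtr c = b (c + 1))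
    3 ⟨Frame.refl _ _, fun k hk => absurd hk (Nat.not_lt_zero _)⟩ ?_) fun _ _ _ h => h
  rintro k μ₁ τ₁ hk ⟨hF, h⟩
  simp only at hk
  simp only [wp_rules, Word.val_one, hF .bStart (by simp), hb (k + 1) hk]
  refine ⟨⟨hF.upd (by simp) _ _, fun c hc => ?_⟩, by omega⟩
  rw [upd_self]
  split_ifs with e
  · rw [e]
  · exact h c (by omega)

/-- While the L-suffixes are induced, `gsa` holds exactly the suffixes with property `P`. -/
structure Placed (T : ℕ → ℕ) (N m : ℕ) (P : ℕ → Prop) (μ : Mem) : Prop where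
  type : ∀ p, p < N → P p → SType T p → Star T m p
  full : ∀ p, p < N → P p → μ .gsa (slot T N m p) = p + 1
  empty : ∀ j, j < N → (∀ p, p < N → P p → slot T N m p ≠ j) → μ .gsa j = 0

/-- Injectivity of slots ensures that the new entry destroys no other. -/
theorem Placed.insert (ht : TextRef T R N nR m K) {P Q : ℕ → Prop} {a : ℕ}
    (hP : Placed T N m P μ) (ha : a < N) (has : SType T a → Star T m a)
    (hQ : ∀ p, p < N → (Q p ↔ P p ∨ p = a))
    (hg : ∀ j, μ' .gsa j = if j = slot T N m a then a + 1 else μ .gsa j) :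
    Placed T N m Q μ' := by
  refine ⟨fun p hp hq => ?_, fun p hp hq => ?_, fun j hj h => ?_⟩
  · rcases (hQ p hp).1 hq with h | rfl
    · exact hP.type p hp h
    · exact has
  · rw [hg]
    rcases (hQ p hp).1 hq with h | rfl
    · split_ifs with e
      · rw [ht.slot_inj hp ha (hP.type p hp h) has e]
      · exact hP.full p hp h
    · rw [if_pos rfl]
  · rw [hg, if_neg (h a ha ((hQ a ha).2 (Or.inr rfl))).symm]
    exact hP.empty j hj fun p hp h' => h p hp ((hQ p hp).2 (Or.inl h'))

theorem Placed.congr {P Q : ℕ → Prop} (hP : Placed T N m P μ) (hQ : ∀ p, p < N → (Q p ↔ P p)) :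
    Placed T N m Q μ :=
  ⟨fun p hp h => hP.type p hp ((hQ p hp).1 h), fun p hp h => hP.full p hp ((hQ p hp).1 h),
    fun j hj h => hP.empty j hj fun p hp h' => h p hp ((hQ p hp).2 h')⟩

/-- Placing the sorted `S*`-suffixes. -/
theorem wp_placeStars (ht : TextRef T R N nR m K) {num : ℕ} {pos : ℕ → ℕ}
    (hT : ∀ i, i < N → μ .txt i = T i) (hpos : ∀ t, t < num → μ .sPos (μ .sSorted t) = pos t)
    (hstar : ∀ t, t < num → pos t < N ∧ Star T m (pos t))
    (hcover : ∀ p, p < N → Star T m p → ∃ t, t < num ∧ pos t = p)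
    (hsort : ∀ t u, t < u → u < num → suf T (pos t) < suf T (pos u))
    (hptr : ∀ c, c < K → μ .bPtr c = bucketStart T N (c + 1)) (hz : ∀ j, j < N → μ .gsa j = 0)
    {τ : ℕ} :
    wp (forDown ⟨num⟩ fun t => do putRight (← read .sPos (← read .sSorted t))) μ τ
      fun _ μ' τ' => (Frame [.bPtr, .gsa] μ μ' ∧ Placed T N m (Star T m) μ') ∧
        τ' ≤ τ + (num * 11 + 1) := by
  -- The `S*`-suffixes with sorted index at least `t`, described without the index so that they can
  -- be counted per bucket.
  set P : ℕ → ℕ → Prop := fun t p => Star T m p ∧ ∀ u, u < t → suf T (pos u) < suf T p with hPdef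
  refine wp_mono (wp_forDown (fun t μ' => Frame [.bPtr, .gsa] μ μ' ∧ Placed T N m (P t) μ' ∧
    ∀ c, c < K → μ' .bPtr c + (tally N fun p => P t p ∧ T p = c) = bucketStart T N (c + 1)) 8
    ?_ ?_) ?_
  · have hn : ∀ p, p < N → ¬ P num p := fun p hp h => by
      obtain ⟨u, hu, rfl⟩ := hcover p hp h.1
      exact lt_irrefl _ (h.2 u hu)
    refine ⟨Frame.refl _ _, ⟨fun p hp h => absurd h (hn p hp), fun p hp h => absurd h (hn p hp),
      fun j hj _ => hz j hj⟩, fun c hc => ?_⟩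
    rw [tally_eq_zero fun p hp h => hn p hp h.1, hptr c hc]; rfl
  · rintro t μ₁ τ₁ htn ⟨hF, hP, hp⟩
    simp only at htn
    obtain ⟨ha, has⟩ := hstar t htn
    set a := pos t with hadef
    have hiff : ∀ p, p < N → (P t p ↔ P (t + 1) p ∨ p = a) := by
      intro p hp
      constructor
      · rintro ⟨h1, h2⟩
        obtain ⟨u, hu, rfl⟩ := hcover p hp h1
        rcases lt_trichotomy u t with h | h | h
        · exact absurd (h2 u h) (lt_irrefl _)
        · right; rw [h]
        · exact Or.inl ⟨h1, fun v hv => hsort v u (by omega) hu⟩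
      · rintro (⟨h1, h2⟩ | rfl)
        · exact ⟨h1, fun u hu => h2 u (by omega)⟩
        · exact ⟨has, fun u hu => hsort u t hu htn⟩
    have hnot : ¬ P (t + 1) a := fun h => lt_irrefl _ (h.2 t (Nat.lt_succ_self t))
    have hab : ∀ p, p < N → (P (t + 1) p ↔ Star T m p ∧ suf T a < suf T p) := by
      intro p hp
      refine ⟨fun h => ⟨h.1, h.2 t (Nat.lt_succ_self t)⟩, fun h => ⟨h.1, fun u hu => ?_⟩⟩
      rcases Nat.lt_succ_iff_lt_or_eq.1 hu with hu | rfl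
      · exact (hsort u t hu htn).trans h.2
      · exact h.2
    have hcK := ht.lt a ha
    have h1 := hp (T a) hcK
    have h2 := (ht.starSlot_add ha has).1
    rw [tally_congr (Q := fun p' => Star T m p' ∧ T p' = T a ∧ suf T a < suf T p')
      (fun p hp => by rw [hab p hp]; tauto)] at h1
    have hsl : slot T N m a = starSlot T N m a := by rw [slot, if_pos (ht.star_stype ha has)]
    have hk : μ₁ .bPtr (T a) - 1 = slot T N m a := by omega
    simp only [putRight, wp_rules, Word.val_one, hF .sPos (by simp), hF .sSorted (by simp),
      hpos t htn, hF .txt (by simp)]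
    rw [← hadef, hT a ha, hk]
    refine ⟨⟨(hF.upd (by simp) _ _).upd (by simp) _ _, hP.insert ht ha (fun _ => has) hiff ?_,
      fun c hc => ?_⟩, by omega⟩
    · intro j; simp [upd_self, upd_ne]
    · rw [upd_ne _ _ _ (by simp), upd_self]
      split_ifs with e
      · subst c
        rw [tally_insert ha (Q := fun p' => Star T m p' ∧ T p' = T a ∧ suf T a < suf T p')
          (fun p hp => by
            rw [hiff p hp, hab p hp]
            constructor
            · rintro ⟨h1 | h1, h2⟩
              · exact Or.inl ⟨h1.1, h2, h1.2⟩
              · exact Or.inr h1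
            · rintro (h1 | rfl)
              · exact ⟨Or.inl ⟨h1.1, h1.2.2⟩, h1.2.1⟩
              · exact ⟨Or.inr rfl, rfl⟩) fun h => lt_irrefl _ h.2.2]
        omega
      · rw [← hp c hc]
        congr 1
        refine tally_congr fun p hp => ?_
        rw [hiff p hp]
        constructor
        · rintro ⟨h1 | rfl, h2⟩
          · exact ⟨h1, h2⟩
          · exact absurd h2.symm e
        · exact fun h => ⟨Or.inl h.1, h.2⟩
  · rintro _ μ₁ τ₁ ⟨⟨hF, hP, -⟩, ht₁⟩
    refine ⟨⟨hF, hP.congr fun p hp => ⟨fun h => ⟨h, fun u hu => absurd hu (Nat.not_lt_zero _)⟩,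
      fun h => h.1⟩⟩, by simpa using ht₁⟩

/-- Inducing the L-suffixes. -/
theorem wp_induceL (ht : TextRef T R N nR m K) (hT : ∀ i, i < N → μ .txt i = T i)
    (hty : Typed T N μ) (hptr : ∀ c, c < K → μ .bPtr c = bucketStart T N c)
    (hP : Placed T N m (Star T m) μ) {τ : ℕ} :
    wp (forEach ⟨N⟩ fun k => do
      let v ← read .gsa k
      if (← le 2 v) then
        let p ← sub v 2
        if (← eq (← read .typ p) 1) then putLeft p) μ τ fun _ μ' τ' =>
      (Frame [.bPtr, .gsa] μ μ' ∧ ∀ p, p < N → ¬ SType T p ∨ T p ≤ m →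
        μ' .gsa (rk T N p) = p + 1) ∧ τ' ≤ τ + (N * 13 + 1) := by
  -- Besides the `S*`-suffixes, exactly those L-suffixes are present whose successor occupies a slot
  -- already scanned.
  set F : ℕ → ℕ → Prop := fun k p => Star T m p ∨ ¬ SType T p ∧ slot T N m (p + 1) < k with hFdef
  refine wp_mono (wp_forEach (fun k μ' => Frame [.bPtr, .gsa] μ μ' ∧ Placed T N m (F k) μ' ∧
    ∀ c, c < K → μ' .bPtr c = bucketStart T N c +
      tally N fun p => ¬ SType T p ∧ T p = c ∧ slot T N m (p + 1) < k) 12 ?_ ?_) ?_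
  · refine ⟨Frame.refl _ _, hP.congr fun p hp => ?_, fun c hc => ?_⟩
    · exact ⟨fun h => h.elim id fun h => absurd h.2 (Nat.not_lt_zero _), Or.inl⟩
    · rw [hptr c hc, tally_eq_zero fun p _ h => absurd h.2.2 (Nat.not_lt_zero _), Nat.add_zero]
  · rintro k μ₁ τ₁ hk ⟨hF, hP, hp⟩
    simp only at hk
    have hT₁ : ∀ i, i < N → μ₁ .txt i = T i := by rw [hF .txt (by simp)]; exact hT
    have hty₁ := hty.frame hF (by simp)
    have hstay : (∀ p, p < N → ¬ SType T p → slot T N m (p + 1) ≠ k) → ∀ τ', τ' ≤ τ₁ + 12 →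
        (Frame [.bPtr, .gsa] μ μ₁ ∧ Placed T N m (F (k + 1)) μ₁ ∧
          ∀ c, c < K → μ₁ .bPtr c = bucketStart T N c +
            tally N fun p => ¬ SType T p ∧ T p = c ∧ slot T N m (p + 1) < k + 1) ∧
          τ' ≤ τ₁ + 12 := by
      intro hno τ' hτ
      refine ⟨⟨hF, hP.congr fun p hp => ?_, fun c hc => ?_⟩, hτ⟩
      · simp only [hFdef]
        constructor
        · rintro (h | ⟨h1, h2⟩)
          · exact Or.inl h
          · have := hno p hp h1; exact Or.inr ⟨h1, by omega⟩
        · rintro (h | ⟨h1, h2⟩)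
          · exact Or.inl h
          · exact Or.inr ⟨h1, by omega⟩
      · rw [hp c hc]
        congr 1
        refine tally_congr fun p hp => ?_
        constructor
        · rintro ⟨h1, h2, h3⟩; exact ⟨h1, h2, by omega⟩
        · rintro ⟨h1, h2, h3⟩; have := hno p hp h1; exact ⟨h1, h2, by omega⟩
    by_cases hex : ∃ p, p < N ∧ (SType T p → Star T m p) ∧ slot T N m p = k
    · obtain ⟨p, hpN, hps, hpk⟩ := hex
      -- The entry is there in time: the successor of an L-suffix is smaller, so its slot has been
      -- scanned before.
      have hFk : F k p := by
        by_cases hs : SType T p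
        · exact Or.inl (hps hs)
        · obtain ⟨h1, h2⟩ := ht.succ_lt hpN hs
          exact Or.inr ⟨hs, hpk ▸ ht.slot_lt_slot h1 hpN (star_succ hs) hps h2⟩
      have hg := hP.full p hpN hFk
      rw [hpk] at hg
      have huniq : ∀ q, q < N → ¬ SType T q → slot T N m (q + 1) = k → q + 1 = p :=
        fun q hq hs e => ht.slot_inj (ht.succ_lt hq hs).1 hpN (star_succ hs) hps (e.trans hpk.symm)
      simp only [putLeft, wp_rules, hg, decide_eq_true_eq, Word.val_one, Word.val_two]
      by_cases h2 : 2 ≤ p + 1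
      swap
      · rw [if_neg h2]
        exact hstay (fun q hq hs e => by have := huniq q hq hs e; omega) _ (by omega)
      rw [if_pos h2]
      obtain ⟨a, rfl⟩ : ∃ a, p = a + 1 := ⟨p - 1, by omega⟩
      simp only [show a + 1 + 1 - 2 = a by omega]
      have haN : a < N := by omega
      obtain ⟨hy1, hy2⟩ := hty₁ a haN
      by_cases hs : SType T a
      · rw [if_neg (by have := hy2.2 hs; omega)]
        refine hstay (fun q hq hs' e => ?_) _ (by omega)
        have := huniq q hq hs' e
        rw [show q = a by omega] at hs'
        exact hs' hs
      · rw [if_pos (by have := mt hy2.1 hs; omega)]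
        have hcK := ht.lt a haN
        have hslot : slot T N m a = rk T N a := by rw [slot, if_neg hs]
        have hcmp : ∀ q, q < N → ¬ SType T q → T q = T a →
            (slot T N m (q + 1) < k ↔ suf T q < suf T a) := fun q hq hs' hc => by
          rw [suf_lt_succ_iff hc, ← hpk]
          exact ht.slot_lt_iff (ht.succ_lt hq hs').1 hpN (star_succ hs') hps
        -- The L-suffixes inserted so far into this bucket are those with a smaller successor, i.e.
        -- the smaller L-suffixes with this first character, so the pointer equals the rank.
        have hptr' : μ₁ .bPtr (T a) = slot T N m a := by
          rw [hslot, ht.rk_of_not_stype haN hs, hp _ hcK]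
          congr 1
          refine tally_congr fun q hq => ?_
          constructor
          · rintro ⟨h1, h2, h3⟩; exact ⟨h1, h2, (hcmp q hq h1 h2).1 h3⟩
          · rintro ⟨h1, h2, h3⟩; exact ⟨h1, h2, (hcmp q hq h1 h2).2 h3⟩
        rw [hT₁ a haN]
        refine ⟨⟨(hF.upd (by simp) _ _).upd (by simp) _ _, hP.insert ht haN
          (fun h => absurd h hs) (fun q hq => ?_) ?_, fun c hc => ?_⟩, by omega⟩
        · simp only [hFdef]
          constructor
          · rintro (h | ⟨h1, h2⟩)
            · exact Or.inl (Or.inl h)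
            · rcases Nat.lt_succ_iff_lt_or_eq.1 h2 with h3 | h3
              · exact Or.inl (Or.inr ⟨h1, h3⟩)
              · have := huniq q hq h1 h3; exact Or.inr (by omega)
          · rintro ((h | ⟨h1, h2⟩) | rfl)
            · exact Or.inl h
            · exact Or.inr ⟨h1, by omega⟩
            · exact Or.inr ⟨hs, by omega⟩
        · intro j; simp [upd_self, upd_ne, hptr']
        · rw [upd_self, upd_ne _ _ _ (by simp)]
          split_ifs with e
          · subst c
            rw [hp _ hcK, Nat.add_assoc]
            congr 1
            refine (tally_insert haN (fun q hq => ?_) fun h => ?_).symm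
            · constructor
              · rintro ⟨h1, h2, h3⟩
                rcases Nat.lt_succ_iff_lt_or_eq.1 h3 with h3 | h3
                · exact Or.inl ⟨h1, h2, h3⟩
                · have := huniq q hq h1 h3; exact Or.inr (by omega)
              · rintro (⟨h1, h2, h3⟩ | rfl)
                · exact ⟨h1, h2, by omega⟩
                · exact ⟨hs, rfl, by omega⟩
            · exact absurd h.2.2 (by omega)
          · rw [hp c hc]
            congr 1
            refine tally_congr fun q hq => ?_
            constructor
            · rintro ⟨h1, h2, h3⟩; exact ⟨h1, h2, by omega⟩
            · rintro ⟨h1, h2, h3⟩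
              rcases Nat.lt_succ_iff_lt_or_eq.1 h3 with h3 | h3
              · exact ⟨h1, h2, h3⟩
              · have := huniq q hq h1 h3
                rw [show q = a by omega] at h2
                exact absurd h2.symm e
    · have hg : μ₁ .gsa k = 0 := hP.empty k hk fun p hp h e => hex ⟨p, hp, hP.type p hp h, e⟩
      simp only [putLeft, wp_rules, hg, decide_eq_true_eq, Word.val_one, Word.val_two]
      rw [if_neg (by omega)]
      exact hstay (fun p hp hs e => hex ⟨p + 1, (ht.succ_lt hp hs).1, star_succ hs, e⟩) _ (by omega)
  · rintro _ μ₁ τ₁ ⟨⟨hF, hP, -⟩, ht₁⟩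
    refine ⟨⟨hF, fun p hp h => ?_⟩, by simpa using ht₁⟩
    by_cases hs : SType T p
    · have hm : T p ≤ m := h.resolve_left fun h => h hs
      rw [← ht.slot_term hp hm]
      exact hP.full p hp (Or.inl (Or.inl hm))
    · have : slot T N m p = rk T N p := by rw [slot, if_neg hs]
      rw [← this]
      exact hP.full p hp (Or.inr ⟨hs, ht.slot_lt (ht.succ_lt hp hs).1 (star_succ hs)⟩)

/-- Inducing the S-suffixes. -/
theorem wp_induceS (ht : TextRef T R N nR m K) (hT : ∀ i, i < N → μ .txt i = T i)
    (hty : Typed T N μ) (hptr : ∀ c, c < K → μ .bPtr c = bucketStart T N (c + 1))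
    (hL : ∀ p, p < N → ¬ SType T p ∨ T p ≤ m → μ .gsa (rk T N p) = p + 1) {τ : ℕ} :
    wp (forDown ⟨N⟩ fun k => do
      let v ← read .gsa k
      if (← le 2 v) then
        let p ← sub v 2
        if (← eq (← read .typ p) 0) then
          if (← lt ⟨m⟩ (← read .txt p)) then putRight p) μ τ fun _ μ' τ' =>
      (Frame [.bPtr, .gsa] μ μ' ∧ ∀ p, p < N → μ' .gsa (rk T N p) = p + 1) ∧
        τ' ≤ τ + (N * 18 + 1) := by
  -- The induced S-suffixes. Terminators are excluded: they are already in place, and their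
  -- successors belong to the next string.
  set A : ℕ → ℕ → Prop := fun k p => SType T p ∧ m < T p ∧ k ≤ rk T N (p + 1) with hA
  refine wp_mono (wp_forDown (fun k μ' => Frame [.bPtr, .gsa] μ μ' ∧
    (∀ p, p < N → ¬ SType T p ∨ T p ≤ m ∨ k ≤ rk T N (p + 1) → μ' .gsa (rk T N p) = p + 1) ∧
    ∀ c, c < K → μ' .bPtr c + (tally N fun p => A k p ∧ T p = c) = bucketStart T N (c + 1)) 15
    ?_ ?_) ?_
  · have hno : ∀ p, p < N → m < T p → rk T N (p + 1) < N := fun p hp hm =>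
      ht.isPerm_rk.lt _ (ht.succ_lt_of_gt hp hm)
    refine ⟨Frame.refl _ _, fun p hp h => hL p hp ?_, fun c hc => ?_⟩
    · by_contra hc
      rw [not_or, not_le] at hc
      have := hno p hp hc.2
      simp only at h
      rcases h with h | h | h
      · exact hc.1 h
      · omega
      · omega
    · rw [tally_eq_zero fun p hp h => by
        have := hno p hp h.1.2.1; have := h.1.2.2; simp only at this; omega, hptr c hc]
      rfl
  · rintro k μ₁ τ₁ hk ⟨hF, hG, hp⟩
    simp only at hk
    have hT₁ : ∀ i, i < N → μ₁ .txt i = T i := by rw [hF .txt (by simp)]; exact hT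
    have hty₁ := hty.frame hF (by simp)
    obtain ⟨p, hpN, hpk⟩ := ht.isPerm_rk.surj hk
    -- The provisional `S*`-entries may be out of place, but no stale one is read: the successor of
    -- an S-suffix other than a terminator has greater rank, so slot `k` has been overwritten before
    -- the scan arrives.
    have hg : μ₁ .gsa k = p + 1 := by
      rw [← hpk]
      refine hG p hpN ?_
      by_contra hc
      simp only [not_or, not_not, not_le] at hc
      have h1 := ht.succ_lt_of_gt hpN hc.2.1
      have h2 := (ht.rk_lt_iff hpN h1).2 hc.1
      omega
    have huniq : ∀ q, q + 1 < N → rk T N (q + 1) = k → q + 1 = p := fun q hq e =>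
      ht.isPerm_rk.inj _ _ hq hpN (e.trans hpk.symm)
    have hstay : (∀ q, q < N → SType T q → m < T q → q + 1 ≠ p) → ∀ τ', τ' ≤ τ₁ + 15 →
        (Frame [.bPtr, .gsa] μ μ₁ ∧
          (∀ p, p < N → ¬ SType T p ∨ T p ≤ m ∨ k ≤ rk T N (p + 1) →
            μ₁ .gsa (rk T N p) = p + 1) ∧
          ∀ c, c < K → μ₁ .bPtr c + (tally N fun p => A k p ∧ T p = c) =
            bucketStart T N (c + 1)) ∧ τ' ≤ τ₁ + 15 := by
      intro hno τ' hτ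
      refine ⟨⟨hF, fun q hq h => ?_, fun c hc => ?_⟩, hτ⟩
      · by_cases h1 : ¬ SType T q ∨ T q ≤ m
        · exact hG q hq (by tauto)
        · rw [not_or, not_not, not_le] at h1
          refine hG q hq (Or.inr (Or.inr ?_))
          have h2 : k ≤ rk T N (q + 1) := by
            rcases h with h | h | h
            · exact absurd h1.1 h
            · omega
            · exact h
          have h3 := hno q hq h1.1 h1.2
          have h4 := mt (huniq q (ht.succ_lt_of_gt hq h1.2)) h3
          omega
      · rw [← hp c hc]
        congr 1
        refine tally_congr fun q hq => and_congr_left fun _ => ?_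
        constructor
        · rintro ⟨h1, h2, h3⟩
          have h4 := mt (huniq q (ht.succ_lt_of_gt hq h2)) (hno q hq h1 h2)
          exact ⟨h1, h2, by omega⟩
        · rintro ⟨h1, h2, h3⟩
          exact ⟨h1, h2, by omega⟩
    simp only [putRight, wp_rules, hg, decide_eq_true_eq, Word.val_zero, Word.val_one,
      Word.val_two]
    by_cases h2 : 2 ≤ p + 1
    swap
    · rw [if_neg h2]
      exact hstay (fun q hq _ _ e => by omega) _ (by omega)
    rw [if_pos h2]
    obtain ⟨a, rfl⟩ : ∃ a, p = a + 1 := ⟨p - 1, by omega⟩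
    simp only [show a + 1 + 1 - 2 = a by omega]
    have haN : a < N := by omega
    obtain ⟨hy1, hy2⟩ := hty₁ a haN
    rw [hT₁ a haN]
    by_cases hs : SType T a
    swap
    · rw [if_neg (mt hy2.1 hs)]
      refine hstay (fun q hq hs' _ e => ?_) _ (by omega)
      rw [show q = a by omega] at hs'
      exact hs hs'
    rw [if_pos (hy2.2 hs)]
    by_cases hm : m < T a
    swap
    · rw [if_neg hm]
      refine hstay (fun q hq _ hm' e => ?_) _ (by omega)
      rw [show q = a by omega] at hm'
      exact hm hm'
    rw [if_pos hm]
    have hcK := ht.lt a haN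
    have hcmp : ∀ q, q < N → m < T q → T q = T a →
        (k + 1 ≤ rk T N (q + 1) ↔ suf T a < suf T q) := fun q hq hm' hc => by
      rw [suf_lt_succ_iff hc.symm, ← hpk]
      exact ht.rk_lt_iff hpN (ht.succ_lt_of_gt hq hm')
    have hcount : (tally N fun q => A (k + 1) q ∧ T q = T a) =
        tally N fun q => SType T q ∧ T q = T a ∧ suf T a < suf T q := by
      refine tally_congr fun q hq => ?_
      constructor
      · rintro ⟨⟨h1, h2, h3⟩, h4⟩; exact ⟨h1, h4, (hcmp q hq h2 h4).1 h3⟩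
      · rintro ⟨h1, h2, h3⟩
        exact ⟨⟨h1, by omega, (hcmp q hq (by omega) h2).2 h3⟩, h2⟩
    have hpa := hp (T a) hcK
    rw [hcount] at hpa
    have hrk := ht.rk_of_stype haN hs
    -- The suffixes induced so far into this bucket are exactly the greater S-suffixes, which
    -- `TextRef.rk_of_stype` counts from the right end.
    have hslot : μ₁ .bPtr (T a) - 1 = rk T N a := by omega
    have hiff : ∀ q, q < N → (A k q ↔ A (k + 1) q ∨ q = a) := by
      intro q hq
      constructor
      · rintro ⟨h1, h2, h3⟩
        rcases Nat.lt_or_eq_of_le h3 with h3 | h3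
        · exact Or.inl ⟨h1, h2, h3⟩
        · have := huniq q (ht.succ_lt_of_gt hq h2) h3.symm
          exact Or.inr (by omega)
      · rintro (⟨h1, h2, h3⟩ | rfl)
        · exact ⟨h1, h2, by omega⟩
        · exact ⟨hs, hm, hpk.ge⟩
    have hnot : ¬ A (k + 1) a := fun h => by have := h.2.2; have h3 : k + 1 ≤ rk T N (a + 1) := this; omega
    rw [hslot]
    refine ⟨⟨(hF.upd (by simp) _ _).upd (by simp) _ _, fun q hq h => ?_, fun c hc => ?_⟩, by omega⟩
    · rw [upd_self]
      split_ifs with e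
      · rw [ht.isPerm_rk.inj q a hq haN e]
      · rw [upd_ne _ _ _ (by simp)]
        refine hG q hq ?_
        rcases h with h | h | h
        · exact Or.inl h
        · exact Or.inr (Or.inl h)
        · by_contra hc
          simp only [not_or, not_not, not_le] at hc
          have := huniq q (ht.succ_lt_of_gt hq hc.2.1) (by omega)
          exact e (by rw [show q = a by omega])
    · rw [upd_ne _ _ _ (by simp), upd_self]
      split_ifs with e
      · subst c
        rw [tally_insert haN (Q := fun q => A (k + 1) q ∧ T q = T a) (fun q hq => ?_)
          fun h => hnot h.1, hcount]
        · omega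
        · rw [hiff q hq]
          constructor
          · rintro ⟨h1 | h1, h2⟩
            · exact Or.inl ⟨h1, h2⟩
            · exact Or.inr h1
          · rintro (h1 | rfl)
            · exact ⟨Or.inl h1.1, h1.2⟩
            · exact ⟨Or.inr rfl, rfl⟩
      · rw [← hp c hc]
        congr 1
        refine tally_congr fun q hq => ?_
        rw [hiff q hq]
        constructor
        · rintro ⟨h1 | rfl, h5⟩
          · exact ⟨h1, h5⟩
          · exact absurd h5.symm e
        · exact fun h => ⟨Or.inl h.1, h.2⟩
  · rintro _ μ₁ τ₁ ⟨⟨hF, hG, -⟩, ht₁⟩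
    exact ⟨⟨hF, fun p hp => hG p hp (Or.inr (Or.inr (Nat.zero_le _)))⟩, by simpa using ht₁⟩

/-- Time of the sixth phase. -/
def induceTime (N K : ℕ) : ℕ := N * 70 + K * 30 + 30

theorem wp_phase6 (ht : TextRef T R N nR m K) (hT : ∀ i, i < N → μ .txt i = T i)
    (hty : Typed T N μ) {isa : ℕ → ℕ} {num : ℕ} (hS : Stars T R isa nR m N num μ)
    (hperm : IsPerm (μ .sSorted) num)
    (hsort : ∀ a b, a < b → b < num →
      suf T (μ .sPos (μ .sSorted a)) < suf T (μ .sPos (μ .sSorted b)))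
    {z : Sizes} (hzN : z.N = ⟨N⟩) (hzm : z.m = ⟨m⟩) (hzK : z.numKeys = ⟨K⟩) {τ : ℕ} :
    wp (phase6 z ⟨num⟩) μ τ fun _ μ' τ' =>
      (∀ p, p < N → μ' .outDoc (rk T N p) = μ .docNo p ∧ μ' .outPos (rk T N p) = μ .docPos p) ∧
      τ' ≤ τ + induceTime N K := by
  have hnum := hS.le
  simp only [phase6, wp_bind]
  refine wp_mono (wp_charBuckets hT ht.lt hzN hzK) ?_
  rintro _ μ₁ τ₁ ⟨⟨hF₁, hb⟩, ht₁⟩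
  simp only [hzN, hzm, hzK]
  refine wp_mono (wp_forEach (fun k μ' => Frame [.gsa] μ₁ μ' ∧ ∀ j, j < k → μ' .gsa j = 0) 1
    ⟨Frame.refl _ _, fun k hk => absurd hk (Nat.not_lt_zero _)⟩ ?_) ?_
  · rintro c μ₁ τ₁ hc ⟨hF, hk⟩
    simp only [wp_rules, Word.val_zero]
    refine ⟨⟨hF.upd (by simp) _ _, fun k hkc => ?_⟩, le_rfl⟩
    rw [upd_self]
    split_ifs with e
    · rfl
    · exact hk k (by omega)
  rintro _ μ₂ τ₂ ⟨⟨hF₂, hz⟩, ht₂⟩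
  simp only at hz ht₂
  refine wp_mono (wp_pointToEnds (b := bucketStart T N) (by rw [hF₂ .bStart (by simp)]; exact hb)
    hzK) ?_
  rintro _ μ₃ τ₃ ⟨⟨hF₃, hptr₃⟩, ht₃⟩
  have hF₀₃ : Frame [.bStart, .gsa, .bPtr] μ μ₃ :=
    (hF₁.mono (by simp)).trans ((hF₂.mono (by simp)).trans (hF₃.mono (by simp)))
  have hpos : ∀ t, t < num → μ₃ .sPos (μ₃ .sSorted t) = μ .sPos (μ .sSorted t) := fun t _ => by
    rw [hF₀₃ .sPos (by simp), hF₀₃ .sSorted (by simp)]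
  refine wp_mono (wp_placeStars ht (pos := fun t => μ .sPos (μ .sSorted t))
    (by rw [hF₀₃ .txt (by simp)]; exact hT) hpos (fun t h => hS.star _ (hperm.lt t h)) ?_ hsort hptr₃
    (by rw [hF₃ .gsa (by simp)]; exact hz)) ?_
  · intro p hp hs
    obtain ⟨t, ht, e⟩ := hS.cover p hp hs
    obtain ⟨u, hu, rfl⟩ := hperm.surj ht
    exact ⟨u, hu, e⟩
  rintro _ μ₄ τ₄ ⟨⟨hF₄, hP⟩, ht₄⟩
  have hF₀₄ : Frame [.bStart, .gsa, .bPtr] μ μ₄ := hF₀₃.trans (hF₄.mono (by simp))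
  have hb₄ : ∀ c, c ≤ K → μ₄ .bStart c = bucketStart T N c := by
    rw [hF₄ .bStart (by simp), hF₃ .bStart (by simp), hF₂ .bStart (by simp)]; exact hb
  refine wp_mono (wp_forEach (fun k μ' => Frame [.bPtr] μ₄ μ' ∧ ∀ c, c < k →
    μ' .bPtr c = bucketStart T N c) 2
    ⟨Frame.refl _ _, fun k hk => absurd hk (Nat.not_lt_zero _)⟩ ?_) ?_
  · rintro k μ₅ τ₅ hk ⟨hF, h⟩
    simp only at hk
    simp only [wp_rules, hF .bStart (by simp), hb₄ k hk.le]
    refine ⟨⟨hF.upd (by simp) _ _, fun c hc => ?_⟩, by omega⟩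
    rw [upd_self]
    split_ifs with e
    · rw [e]
    · exact h c (by omega)
  rintro _ μ₅ τ₅ ⟨⟨hF₅, hptr₅⟩, ht₅⟩
  simp only at hptr₅ ht₅
  have hF₀₅ : Frame [.bStart, .gsa, .bPtr] μ μ₅ := hF₀₄.trans (hF₅.mono (by simp))
  have hP₅ : Placed T N m (Star T m) μ₅ :=
    ⟨hP.type, by rw [hF₅ .gsa (by simp)]; exact hP.full, by rw [hF₅ .gsa (by simp)]; exact hP.empty⟩
  refine wp_mono (wp_induceL ht (by rw [hF₀₅ .txt (by simp)]; exact hT) (hty.frame hF₀₅ (by simp))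
    hptr₅ hP₅) ?_
  rintro _ μ₆ τ₆ ⟨⟨hF₆, hL⟩, ht₆⟩
  have hF₀₆ : Frame [.bStart, .gsa, .bPtr] μ μ₆ := hF₀₅.trans (hF₆.mono (by simp))
  refine wp_mono (wp_pointToEnds (b := bucketStart T N) (by
    rw [hF₆ .bStart (by simp), hF₅ .bStart (by simp)]; exact hb₄) hzK) ?_
  rintro _ μ₇ τ₇ ⟨⟨hF₇, hptr₇⟩, ht₇⟩
  have hF₀₇ : Frame [.bStart, .gsa, .bPtr] μ μ₇ := hF₀₆.trans (hF₇.mono (by simp))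
  refine wp_mono (wp_induceS ht (by rw [hF₀₇ .txt (by simp)]; exact hT) (hty.frame hF₀₇ (by simp))
    hptr₇ (by rw [hF₇ .gsa (by simp)]; exact hL)) ?_
  rintro _ μ₈ τ₈ ⟨⟨hF₈, hG⟩, ht₈⟩
  have hF₀₈ : Frame [.bStart, .gsa, .bPtr] μ μ₈ := hF₀₇.trans (hF₈.mono (by simp))
  refine wp_mono (wp_forEach (fun k μ' => Frame [.outDoc, .outPos] μ₈ μ' ∧ ∀ j, j < k →
    μ' .outDoc j = μ .docNo (μ₈ .gsa j - 1) ∧ μ' .outPos j = μ .docPos (μ₈ .gsa j - 1)) 6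
    ⟨Frame.refl _ _, fun k hk => absurd hk (Nat.not_lt_zero _)⟩ ?_) ?_
  · rintro k μ₉ τ₉ hk ⟨hF, h⟩
    simp only [wp_rules, Word.val_one, hF .gsa (by simp), hF .docNo (by simp), hF₀₈ .docNo (by simp),
      upd_ne _ _ _ (show Arr.docPos ≠ .outDoc by simp), hF .docPos (by simp), hF₀₈ .docPos (by simp)]
    refine ⟨⟨(hF.upd (by simp) _ _).upd (by simp) _ _, fun j hj => ?_⟩, by omega⟩
    rw [upd_ne _ _ _ (by simp), upd_self, upd_self, upd_ne _ _ _ (by simp)]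
    split_ifs with e
    · rw [e]; exact ⟨rfl, rfl⟩
    · exact h j (by omega)
  rintro _ μ₉ τ₉ ⟨⟨-, h⟩, ht₉⟩
  simp only at h ht₉
  refine ⟨fun p hp => ?_, ?_⟩
  · have := h _ (ht.isPerm_rk.lt p hp)
    rwa [hG p hp, Nat.add_sub_cancel] at this
  · simp only [induceTime] at *
    omega

end phase6

/-! ## The whole algorithm -/

/-- `T[0, N)` is the renaming by rank of the input `E[0, N)`: the terminators, which are `0` in
the input, are numbered, and the letters follow in their order. -/
structure Renamed (E T : ℕ → ℕ) (N : ℕ) : Prop where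
  term : ∀ i, i < N → E i = 0 → T i = zerosBefore E i + 1
  letter : ∀ i, i < N → E i ≠ 0 → zerosBefore E N < T i
  lt_iff : ∀ i j, i < N → j < N → E i ≠ 0 → E j ≠ 0 → (T i < T j ↔ E i < E j)

theorem zerosBefore_succ {E : ℕ → ℕ} {i : ℕ} (h : E i = 0) :
    zerosBefore E (i + 1) = zerosBefore E i + 1 := by
  rw [zerosBefore, Nat.count_succ, if_pos h]

theorem zerosBefore_lt {E : ℕ → ℕ} {i j : ℕ} (hij : i < j) (h : E i = 0) :
    zerosBefore E i < zerosBefore E j := by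
  have h1 := zerosBefore_succ h
  have h2 : zerosBefore E (i + 1) ≤ zerosBefore E j := Nat.count_monotone _ hij
  omega

namespace Renamed
variable {E T : ℕ → ℕ} {N : ℕ}

theorem le_iff (h : Renamed E T N) {i : ℕ} (hi : i < N) : T i ≤ zerosBefore E N ↔ E i = 0 := by
  constructor
  · intro hle
    by_contra hc
    have := h.letter i hi hc
    omega
  · intro e
    rw [h.term i hi e]
    exact zerosBefore_lt hi e

theorem pos (h : Renamed E T N) {i : ℕ} (hi : i < N) : 0 < T i := by
  by_cases e : E i = 0
  · rw [h.term i hi e]; omega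
  · have := h.letter i hi e; omega

theorem textRef (h : Renamed E T N) {R : ℕ → ℕ} {nR K : ℕ} (hE : 0 < N → E (N - 1) = 0)
    (hlt : ∀ i, i < N → T i < K) (hge : ∀ i, N ≤ i → T i = K) (hK : zerosBefore E N < K)
    (hR : ∀ i, i < nR - 1 → zerosBefore E N < R i)
    (hocc : ∀ i, i < N → zerosBefore E N < T i → ∃ j, j < nR ∧ R j = T i) :
    TextRef T R N nR (zerosBefore E N) K where
  pos _ hi := h.pos hi
  lt := hlt
  of_ge := hge
  term_lt i hi hle := by
    have e := (h.le_iff hi).1 hle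
    rcases Nat.lt_or_ge (i + 1) N with h1 | h1
    · by_cases e' : E (i + 1) = 0
      · rw [h.term i hi e, h.term _ h1 e', zerosBefore_succ e]; omega
      · have := h.letter _ h1 e'; omega
    · rw [hge _ h1]; exact hlt i hi
  term_inj i j hi hj hle e := by
    have e1 := (h.le_iff hi).1 hle
    have e2 := (h.le_iff hj).1 (e ▸ hle)
    rw [h.term i hi e1, h.term j hj e2] at e
    rcases lt_trichotomy i j with hij | hij | hij
    · have := zerosBefore_lt hij e1; omega
    · exact hij
    · have := zerosBefore_lt hij e2; omega
  last h0 := (h.le_iff (by omega)).2 (hE h0)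
  m_lt := hK
  ref_gt := hR
  occurs := hocc

end Renamed

section main
variable {E F : ℕ → ℕ} {N n : ℕ} {μ : Mem} {τ : ℕ}

theorem wp_phase1 (hE : ∀ i, i < N → μ .inColl i = E i) (hF : ∀ i, i < n → μ .inRef i = F i)
    (hN : μ .inSize 0 = N) (hn : μ .inSize 1 = n) (hElast : 0 < N → E (N - 1) = 0) (hn0 : 0 < n)
    (hFlast : F (n - 1) = 0) (hF0 : ∀ i, i < n - 1 → F i ≠ 0) (hseen : ∀ c, μ .seen c = 0)
    (hrun : ∀ c, μ .runLen c = 0) :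
    wp phase1 μ τ fun r μ' τ' => ∃ T R sa isa lcp nR K t,
      r = ⟨⟨N⟩, ⟨zerosBefore E N⟩, ⟨K⟩, ⟨nR⟩, (⟨t * nR⟩, ⟨2 ^ t⟩)⟩ ∧
      Renamed E T N ∧ TextRef T R N nR (zerosBefore E N) K ∧ RefIndex R sa isa nR ∧
      IsLcp R sa lcp nR ∧ Loaded T R sa isa lcp N nR t μ' ∧
      (∀ i, i < N → μ' .docNo i = zerosBefore E i + 1 ∧ μ' .docPos i = sinceZero E i + 1) ∧
      nR ≤ n + N ∧ K ≤ n + N ∧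
      τ' ≤ τ + (prepareTime N n + augmentTime N n + suffixTime nR K + (nR * 50 + 50) +
        rmqTime nR + 2) := by
  have e0 : (0 : Word).val = 0 := rfl
  simp only [phase1, wp_bind, wp_read, Word.val_one, e0, hN, hn]
  refine wp_mono (wp_prepare hE hF hn0 hFlast hF0) ?_
  rintro ⟨⟨m'⟩, ⟨K⟩⟩ μ₁ τ₁ ⟨⟨hF₁, hm, hdoc, hterm, hletter, hK, hiff, hlast, hR, hmK, hKn⟩, ht₁⟩
  simp only at hm hK hR hmK hKn
  subst hm
  simp only
  refine wp_mono (wp_augment (T := μ₁ .txt) (m := zerosBefore E N) (K := K) (fun _ _ => rfl) hK hn0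
    hlast hR (by rw [hF₁ .seen (by simp)]; exact hseen)
    (by rw [hF₁ .runLen (by simp)]; exact hrun)) ?_
  rintro ⟨nR⟩ μ₂ τ₂ ⟨⟨hF₂, hn₂, hnN, hlast₂, hR₂, hocc⟩, ht₂⟩
  simp only at hn₂ hnN hlast₂ hR₂ hocc
  refine wp_mono (wp_suffixSort (t := .ref) (sa := .saR) (rank := .isaR) (by simp) (by simp)
    (by simp) (len := nR) (numKeys := K) fun i hi => ?_) ?_
  · rcases Nat.lt_or_ge i (nR - 1) with h | h
    · exact (hR₂ i h).2
    · rw [show i = nR - 1 by omega, hlast₂]; omega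
  rintro _ μ₃ τ₃ ⟨⟨hF₃, hsa, -⟩, ht₃⟩
  have hidx := hsa.refIndex (by omega) hlast₂ fun i hi => by have := (hR₂ i hi).1; omega
  refine wp_mono (wp_computeLCP hidx (fun i _ => by rw [hF₃ .ref (by simp)]) rfl) ?_
  rintro _ μ₄ τ₄ ⟨⟨hF₄, hlcp⟩, ht₄⟩
  refine wp_mono (wp_buildRMQ (by omega)) ?_
  rintro _ μ₅ τ₅ ⟨⟨hF₅, t, rfl, hrmq⟩, ht₅⟩
  simp only [wp_pure]
  -- Beyond the end the memory is replaced by a character above the alphabet, which makes the last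
  -- terminator an S-suffix and all suffixes distinct.
  set T : ℕ → ℕ := fun i => if i < N then μ₁ .txt i else K with hT
  have hTi : ∀ i, i < N → T i = μ₁ .txt i := fun i hi => if_pos hi
  have hren : Renamed E T N := by
    refine ⟨fun i hi => ?_, fun i hi => ?_, fun i j hi hj => ?_⟩
    · rw [hTi i hi]; exact hterm i hi
    · rw [hTi i hi]; exact hletter i hi
    · rw [hTi i hi, hTi j hj]; exact hiff i j hi hj
  have hne : ∀ a ∉ ([.seen, .runLen, .ref, .saR, .isaR, .ord, .cnt, .tmp, .phi, .plcp, .lcp, .rmq] : List Arr),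
      μ₅ a = μ₁ a := by
    intro a ha
    simp only [List.mem_cons, List.not_mem_nil, or_false, not_or] at ha
    rw [hF₅ a (by simp [ha]), hF₄ a (by simp [ha]), hF₃ a (by simp [ha]), hF₂ a (by simp [ha])]
  refine ⟨T, μ₂ .ref, μ₃ .saR, μ₃ .isaR, μ₄ .lcp, nR, K, t, rfl, hren,
    hren.textRef hElast (fun i hi => by rw [hTi i hi]; exact hK i hi)
      (fun i hi => if_neg (by omega)) hmK (fun i hi => (hR₂ i hi).1) (fun i hi => by
        rw [hTi i hi]; exact hocc i hi), hidx, hlcp, ⟨fun i hi => ?_, fun i _ => ?_, ?_, ?_, hrmq⟩,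
    ?_, hnN, hKn, by omega⟩
  · rw [hTi i hi, hne .txt (by simp)]
  · rw [hF₅ .ref (by simp), hF₄ .ref (by simp), hF₃ .ref (by simp)]
  · rw [hF₅ .saR (by simp), hF₄ .saR (by simp)]
  · rw [hF₅ .isaR (by simp), hF₄ .isaR (by simp)]
  · rw [hne .docNo (by simp), hne .docPos (by simp)]
    exact hdoc

/-- Time of the algorithm for inputs of total length `L`. -/
def algorithmTime (L : ℕ) : ℕ := Nat.size L * L * 800 + L * 1300 + 600

/-- Every superlinear term is a bit length times a length, both belonging to numbers at most `n +
N`. All are bounded by the same product, which then serves as an atom for linear arithmetic. -/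
theorem time_le {nR K : ℕ} (hR : nR ≤ n + N) (hK : K ≤ n + N) :
    prepareTime N n + augmentTime N n + suffixTime nR K + (nR * 50 + 50) + rmqTime nR + 2 +
      headsTime N nR + starsTime N nR + metaTime N nR + sortTime N nR + induceTime N K ≤
    algorithmTime (n + N) := by
  have hN : N ≤ n + N := Nat.le_add_left _ _
  have key : ∀ a b, a ≤ n + N → b ≤ n + N → Nat.size a * b ≤ Nat.size (n + N) * (n + N) :=
    fun a b ha hb => Nat.mul_le_mul (Nat.size_le_size ha) hb
  simp only [prepareTime, mergeTime, augmentTime, suffixTime, rmqTime, headsTime, extendTime,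
    starsTime, metaTime, sortTime, induceTime, algorithmTime]
  have h1 := key nR nR hR hR
  have h2 := key nR N hR hN
  have h3 := key N N hN hN
  generalize hS : Nat.size (n + N) * (n + N) = S at *
  have e1 : Nat.size (n + N) * ((n + N) * (3 + 60)) = S * 63 := by rw [← hS]; ring
  have e2 : Nat.size nR * (nR * 150) = Nat.size nR * nR * 150 := by ring
  have e3 : Nat.size nR * (nR * 30) = Nat.size nR * nR * 30 := by ring
  have e4 : Nat.size N * (N * 300) = Nat.size N * N * 300 := by ring
  have e5 : Nat.size N * (N * 100) = Nat.size N * N * 100 := by ring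
  have e6 : N * ((Nat.size nR * 20 + 40) * 5 + 200) = Nat.size nR * N * 100 + N * 400 := by ring
  rw [e1, e2, e3, e4, e5, e6]
  omega

theorem wp_algorithm1 (hE : ∀ i, i < N → μ .inColl i = E i) (hF : ∀ i, i < n → μ .inRef i = F i)
    (hN : μ .inSize 0 = N) (hn : μ .inSize 1 = n) (hElast : 0 < N → E (N - 1) = 0) (hn0 : 0 < n)
    (hFlast : F (n - 1) = 0) (hF0 : ∀ i, i < n - 1 → F i ≠ 0) (hseen : ∀ c, μ .seen c = 0)
    (hrun : ∀ c, μ .runLen c = 0) :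
    wp algorithm1 μ τ fun _ μ' τ' =>
      (∃ T R nR K, Renamed E T N ∧ TextRef T R N nR (zerosBefore E N) K ∧
        ∀ p, p < N → μ' .outDoc (rk T N p) = zerosBefore E p + 1 ∧
          μ' .outPos (rk T N p) = sinceZero E p + 1) ∧
      τ' ≤ τ + algorithmTime (n + N) := by
  simp only [algorithm1, wp_bind]
  refine wp_mono (wp_phase1 hE hF hN hn hElast hn0 hFlast hF0 hseen hrun) ?_
  rintro _ μ₁ τ₁ ⟨T, R, sa, isa, lcp, nR, K, t, rfl, hren, ht, hidx, hlcp, hL, hdoc, hnR, hK, ht₁⟩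
  refine wp_mono (wp_phase2 ht hidx hlcp hL rfl rfl rfl) ?_
  rintro ⟨heads⟩ μ₂ τ₂ ⟨⟨hF₂, hH⟩, ht₂⟩
  simp only at hH
  have hL₂ := hL.frame hF₂ (by simp) (by simp) (by simp) (by simp) (by simp)
  refine wp_mono (wp_phase3 ht hidx hL₂ hH rfl rfl rfl) ?_
  rintro ⟨num⟩ μ₃ τ₃ ⟨⟨hF₃, hty, hS, hperm, hB⟩, ht₃⟩
  simp only at hS hperm hB
  have hL₃ := hL₂.frame hF₃ (by simp) (by simp) (by simp) (by simp) (by simp)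
  have hH₃ := hH.frame hF₃ (by simp) (by simp) (by simp) (by simp) (by simp)
  refine wp_mono (wp_phase4 ht hidx hL₃ hH₃ rfl) ?_
  rintro _ μ₄ τ₄ ⟨⟨hF₄, hR⟩, ht₄⟩
  have hH₄ := hH₃.frame hF₄ (by simp) (by simp) (by simp) (by simp) (by simp)
  have hS₄ := hS.frame hF₄ (by simp) (by simp) (by simp) (by simp) (by simp)
  refine wp_mono (wp_phase5 ht hidx hH₄ hR hS₄ (by rw [hF₄ .sSorted (by simp)]; exact hperm)
    (by rw [hF₄ .sSorted (by simp), hF₄ .sEnd (by simp), hF₄ .sIp (by simp)]; exact hB) rfl) ?_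
  rintro _ μ₅ τ₅ ⟨⟨hF₅, hperm₅, hsort⟩, ht₅⟩
  have hS₅ := hS₄.frame hF₅ (by simp) (by simp) (by simp) (by simp) (by simp)
  have hty₅ := (hty.frame hF₄ (by simp)).frame hF₅ (by simp)
  have hL₅ := (hL₃.frame hF₄ (by simp) (by simp) (by simp) (by simp) (by simp)).frame hF₅ (by simp)
    (by simp) (by simp) (by simp) (by simp)
  refine wp_mono (wp_phase6 ht hL₅.txt hty₅ hS₅ hperm₅ (by rw [hF₅ .sPos (by simp)]; exact hsort)
    rfl rfl rfl) ?_
  rintro _ μ₆ τ₆ ⟨hout, ht₆⟩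
  have h := time_le hnR hK
  refine ⟨⟨T, R, nR, K, hren, ht, fun p hp => ?_⟩, by omega⟩
  obtain ⟨h1, h2⟩ := hout p hp
  rw [h1, h2, hF₅ .docNo (by simp), hF₄ .docNo (by simp), hF₃ .docNo (by simp),
    hF₂ .docNo (by simp), hF₅ .docPos (by simp), hF₄ .docPos (by simp), hF₃ .docPos (by simp),
    hF₂ .docPos (by simp)]
  exact hdoc p hp

end main

/-! ## The text of a collection -/

/-- The input array that represents the collection. -/
def text (C : List (List ℕ)) (i : ℕ) : ℕ := (C.map encode).flatten.getD i 0

section text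
variable {C : List (List ℕ)} {s : List ℕ} {p j k : ℕ}

theorem length_encode (s : List ℕ) : (encode s).length = s.length + 1 := by simp [encode]

theorem terminated_eq (s : List ℕ) : terminated s = s.map WithBot.some ++ [⊥] := by
  simp [terminated, List.map_eq_flatMap]
  rfl

theorem terminated_cons (a : ℕ) (s : List ℕ) : terminated (a :: s) = ↑a :: terminated s := by
  simp [terminated_eq]
  rfl

theorem length_terminated (s : List ℕ) : (terminated s).length = s.length + 1 := by
  simp [terminated_eq]

theorem totalLength_cons (s : List ℕ) (C : List (List ℕ)) :
    totalLength (s :: C) = s.length + 1 + totalLength C := by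
  simp [totalLength, length_terminated]

theorem encode_lt (h : k < s.length) : (encode s).getD k 0 = s.getD k 0 + 1 := by
  simp [encode, h, List.getElem?_append]

theorem encode_length : (encode s).getD s.length 0 = 0 := by
  simp [encode]

theorem text_cons_le (h : k ≤ s.length) : text (s :: C) k = (encode s).getD k 0 := by
  rw [text, List.map_cons, List.flatten_cons, List.getD_append _ _ _ _ (by rw [length_encode]; omega)]

theorem text_cons_add (s : List ℕ) (C : List (List ℕ)) (q : ℕ) :
    text (s :: C) (s.length + 1 + q) = text C q := by
  rw [text, List.map_cons, List.flatten_cons, List.getD_append_right _ _ _ _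
    (by rw [length_encode]; omega), length_encode, text]
  congr 1
  omega

theorem text_last (h : 0 < totalLength C) : text C (totalLength C - 1) = 0 := by
  induction C with
  | nil => simp [totalLength] at h
  | cons s C ih =>
    rw [totalLength_cons]
    rcases Nat.eq_zero_or_pos (totalLength C) with h0 | h0
    · rw [h0, show s.length + 1 + 0 - 1 = s.length by omega, text_cons_le le_rfl, encode_length]
    · rw [show s.length + 1 + totalLength C - 1 = s.length + 1 + (totalLength C - 1) by omega,
        text_cons_add, ih h0]

theorem zerosBefore_cons_le (h : p ≤ s.length) : zerosBefore (text (s :: C)) p = 0 := by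
  rw [zerosBefore, Nat.count_iff_forall_not]
  intro k hk
  rw [text_cons_le (by omega), encode_lt (by omega)]
  omega

theorem sinceZero_cons_le (h : p ≤ s.length) : sinceZero (text (s :: C)) p = p := by
  induction p with
  | zero => rfl
  | succ p ih =>
    rw [sinceZero, if_neg, ih (by omega)]
    rw [text_cons_le (by omega), encode_lt (by omega)]
    omega

theorem zerosBefore_cons_add (s : List ℕ) (C : List (List ℕ)) (q : ℕ) :
    zerosBefore (text (s :: C)) (s.length + 1 + q) = zerosBefore (text C) q + 1 := by
  have h0 : text (s :: C) s.length = 0 := by rw [text_cons_le le_rfl, encode_length]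
  rw [zerosBefore, Nat.count_add]
  have h1 : zerosBefore (text (s :: C)) (s.length + 1) = 1 := by
    rw [zerosBefore_succ h0, zerosBefore_cons_le le_rfl]
  rw [show Nat.count (fun k => text (s :: C) k = 0) (s.length + 1) = 1 from h1, Nat.add_comm]
  simp only [text_cons_add]

theorem sinceZero_cons_add (s : List ℕ) (C : List (List ℕ)) (q : ℕ) :
    sinceZero (text (s :: C)) (s.length + 1 + q) = sinceZero (text C) q := by
  induction q with
  | zero =>
    change sinceZero (text (s :: C)) (s.length + 1) = 0
    rw [sinceZero, if_pos]
    rw [text_cons_le le_rfl, encode_length]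
  | succ q ih => rw [← Nat.add_assoc, sinceZero, sinceZero, text_cons_add, ih]

/-- The position `p` of the text belongs to the document after `zerosBefore` others. -/
theorem text_at (hp : p < totalLength C) : ∃ s j, zerosBefore (text C) p < C.length ∧
    C.getD (zerosBefore (text C) p) [] = s ∧ sinceZero (text C) p = j ∧ j ≤ s.length ∧
    p + (s.length - j) < totalLength C ∧
    ∀ k, k ≤ s.length - j → text C (p + k) = (encode s).getD (j + k) 0 := by
  induction C generalizing p with
  | nil => simp [totalLength] at hp
  | cons s C ih =>
    rw [totalLength_cons] at hp ⊢
    rcases Nat.lt_or_ge s.length p with h | h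
    · obtain ⟨q, rfl⟩ : ∃ q, p = s.length + 1 + q := ⟨p - (s.length + 1), by omega⟩
      obtain ⟨s', j, h1, h2, h3, h4, h5, h6⟩ := ih (p := q) (by omega)
      rw [zerosBefore_cons_add, sinceZero_cons_add]
      refine ⟨s', j, by simpa using h1, by simpa using h2, h3, h4, by omega, fun k hk => ?_⟩
      rw [Nat.add_assoc, text_cons_add, h6 k hk]
    · rw [zerosBefore_cons_le h, sinceZero_cons_le h]
      refine ⟨s, p, by simp, by simp, rfl, h, by omega, fun k hk => text_cons_le (by omega)⟩

theorem exists_text_at {d : ℕ} (hd : d < C.length) (hj : j ≤ (C.getD d []).length) :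
    ∃ p, p < totalLength C ∧ zerosBefore (text C) p = d ∧ sinceZero (text C) p = j := by
  induction C generalizing d with
  | nil => simp at hd
  | cons s C ih =>
    rw [totalLength_cons]
    cases d with
    | zero =>
      rw [List.getD_cons_zero] at hj
      exact ⟨j, by omega, zerosBefore_cons_le hj, sinceZero_cons_le hj⟩
    | succ d =>
      rw [List.getD_cons_succ] at hj
      obtain ⟨q, h1, h2, h3⟩ := ih (by simpa using hd) hj
      exact ⟨s.length + 1 + q, by omega, by rw [zerosBefore_cons_add, h2],
        by rw [sinceZero_cons_add, h3]⟩

end text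

/-! ## Correctness -/

/-- The character that is represented by a number. -/
def decode : ℕ → WithBot ℕ
  | 0 => ⊥
  | a + 1 => (a : WithBot ℕ)

theorem decode_lt_decode {a b : ℕ} : decode a < decode b ↔ a < b := by
  cases a <;> cases b <;> simp [decode]

/-- The string `u`, ending with its terminator, stands at position `p` of `E[0, N)`. -/
def StandsAt (E : ℕ → ℕ) (N : ℕ) : ℕ → List (WithBot ℕ) → Prop
  | _, [] => False
  | p, x :: u => p < N ∧ x = decode (E p) ∧ (E p = 0 → u = []) ∧ (E p ≠ 0 → StandsAt E N (p + 1) u)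

theorem standsAt_terminated {E : ℕ → ℕ} {N p : ℕ} {s : List ℕ} (hp : p + s.length < N)
    (h : ∀ k, k ≤ s.length → E (p + k) = (encode s).getD k 0) : StandsAt E N p (terminated s) := by
  induction s generalizing p with
  | nil =>
    have h0 := h 0 le_rfl
    rw [Nat.add_zero] at h0
    exact ⟨by simpa using hp, by rw [h0]; rfl, fun _ => rfl, fun hne => absurd h0 hne⟩
  | cons a s ih =>
    have h0 := h 0 (Nat.zero_le _)
    rw [Nat.add_zero] at h0
    have e0 : (encode (a :: s)).getD 0 0 = a + 1 := by simp [encode]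
    rw [e0] at h0
    rw [List.length_cons] at hp
    rw [terminated_cons]
    refine ⟨by omega, by rw [h0]; rfl, fun h => by omega, fun _ => ih (by omega) fun k hk => ?_⟩
    have := h (k + 1) (by rw [List.length_cons]; omega)
    rw [show p + 1 + k = p + (k + 1) by omega, this]
    simp [encode]

theorem drop_terminated {s : List ℕ} {j : ℕ} (h : j ≤ s.length) :
    (terminated s).drop j = terminated (s.drop j) := by
  rw [terminated_eq, terminated_eq, List.drop_append_of_le_length (by simpa using h), List.map_drop]

theorem standsAt_suffix {C : List (List ℕ)} {p : ℕ} (hp : p < totalLength C) :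
    IsSuffixIndex C (zerosBefore (text C) p + 1, sinceZero (text C) p + 1) ∧
      StandsAt (text C) (totalLength C) p
        (suffix C (zerosBefore (text C) p + 1, sinceZero (text C) p + 1)) := by
  obtain ⟨s, j, h1, h2, h3, h4, h5, h6⟩ := text_at hp
  have hd : doc C (zerosBefore (text C) p + 1) = terminated s := by
    rw [doc, Nat.add_sub_cancel, h2]
  refine ⟨⟨by simp, h1, by simp, ?_⟩, ?_⟩
  · simp only [hd, h3, length_terminated]
    omega
  · simp only [suffix, hd, h3, Nat.add_sub_cancel]
    rw [drop_terminated h4]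
    refine standsAt_terminated (by rwa [List.length_drop]) fun k hk => ?_
    rw [List.length_drop] at hk
    rw [h6 k hk]
    simp [encode, List.getD_eq_getElem?_getD, List.getElem?_append, List.getElem?_drop]
    by_cases hlt : j + k < s.length
    · simp [hlt, show k < s.length - j by omega]
    · simp [hlt, show ¬ k < s.length - j by omega]

/-- Induction along the string. Letters keep their order under the renaming and terminators stay
below letters. When both strings reach their terminators together they are equal, and the numbers of
the terminators compare the documents. -/
theorem Renamed.suffix_lt {E T : ℕ → ℕ} {N : ℕ} (h : Renamed E T N) {p p' l : ℕ}
    {u u' : List (WithBot ℕ)} (hu : StandsAt E N p u) (hu' : StandsAt E N p' u')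
    (ha : Agree T p T p' l) (hlt : T (p + l) < T (p' + l)) :
    u < u' ∨ u = u' ∧ zerosBefore E p < zerosBefore E p' := by
  induction u generalizing p p' l u' with
  | nil => exact hu.elim
  | cons x u ih =>
    cases u' with
    | nil => exact hu'.elim
    | cons x' u' =>
      obtain ⟨hp, rfl, h0, h1⟩ := hu
      obtain ⟨hp', rfl, h0', h1'⟩ := hu'
      have hle : T p ≤ T p' := by
        rcases Nat.eq_zero_or_pos l with rfl | hl
        · exact hlt.le
        · exact (ha 0 hl).le
      by_cases e : E p = 0 <;> by_cases e' : E p' = 0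
      · rw [h0 e, h0' e', e, e']
        refine Or.inr ⟨rfl, ?_⟩
        rw [h.term p hp e, h.term p' hp' e'] at hle
        rcases lt_trichotomy p p' with hpp | rfl | hpp
        · exact zerosBefore_lt hpp e
        · exact absurd hlt (lt_irrefl _)
        · have := zerosBefore_lt hpp e'; omega
      · exact Or.inl (List.cons_lt_cons_iff.2 (Or.inl (decode_lt_decode.2 (by omega))))
      · have h2 := (h.le_iff hp').2 e'
        have h3 := h.letter p hp e
        omega
      · rcases Nat.eq_zero_or_pos l with rfl | hl
        · exact Or.inl (List.cons_lt_cons_iff.2 (Or.inl (decode_lt_decode.2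
            ((h.lt_iff p p' hp hp' e e').1 hlt))))
        · have e1 : T p = T p' := ha 0 hl
          have h2 := h.lt_iff p p' hp hp' e e'
          have h3 := h.lt_iff p' p hp' hp e' e
          have e2 : E p = E p' := by omega
          have hs : ∀ {q}, E q ≠ 0 → zerosBefore E (q + 1) = zerosBefore E q := fun hq => by
            rw [zerosBefore, Nat.count_succ, if_neg hq, Nat.add_zero]
          obtain ⟨l, rfl⟩ : ∃ l', l = 1 + l' := ⟨l - 1, by omega⟩
          rw [← Nat.add_assoc, ← Nat.add_assoc] at hlt
          have := ih (h1 e) (h1' e') ha.shift hlt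
          rw [hs e, hs e'] at this
          rw [e2, List.cons_lt_cons_iff, List.cons.injEq]
          tauto

theorem wp_view {α : Type} (c : RAM α) (M : Machine) (Q : α → Mem → ℕ → Prop) :
    wp c M.view M.time Q ↔ Q (c.run M).1 (c.run M).2.view (c.run M).2.time := by
  rw [wp, Machine.of_view]

theorem finalState_spec (C : List (List ℕ)) (R : List ℕ) :
    (∃ T R' nR K, Renamed (text C) T (totalLength C) ∧
      TextRef T R' (totalLength C) nR (zerosBefore (text C) (totalLength C)) K ∧
      ∀ p, p < totalLength C →
        (finalState C R).view .outDoc (rk T (totalLength C) p) = zerosBefore (text C) p + 1 ∧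
        (finalState C R).view .outPos (rk T (totalLength C) p) = sinceZero (text C) p + 1) ∧
      runningTime C R ≤ algorithmTime ((terminated R).length + totalLength C) := by
  have hlen := length_terminated R
  have h := wp_algorithm1 (E := text C) (F := fun i => (encode R).getD i 0)
    (N := totalLength C) (n := (terminated R).length) (μ := (initial C R).view)
    (τ := (initial C R).time) (fun _ _ => rfl) (fun _ _ => rfl) rfl rfl text_last (by omega)
    (by rw [hlen, Nat.add_sub_cancel, encode_length])
    (fun i hi => by rw [encode_lt (by omega)]; omega) (fun _ => rfl) fun _ => rfl
  rw [wp_view, show (initial C R).time = 0 from rfl, Nat.zero_add] at h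
  rw [runningTime, finalState]
  exact h

/-- Positions of the text correspond bijectively to suffix indices by counting terminators and the
distance to the last one. The entry of rank `k` comes from the unique position of that rank, so the
order of ranks becomes the order of the output. -/
theorem isGSA_output (C : List (List ℕ)) (R : List ℕ) : IsGSA C (output C R) := by
  obtain ⟨⟨T, R', nR, K, hren, ht, hout⟩, -⟩ := finalState_spec C R
  rw [output]
  generalize finalState C R = M at hout ⊢
  have hrk : ∀ k, k < totalLength C → ∃ p, p < totalLength C ∧ rk T (totalLength C) p = k :=
    fun k hk => ht.isPerm_rk.surj hk
  have hval : ∀ p, p < totalLength C →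
      ((M.mem .outDoc (rk T (totalLength C) p)).val,
        (M.mem .outPos (rk T (totalLength C) p)).val) =
      (zerosBefore (text C) p + 1, sinceZero (text C) p + 1) :=
    fun p hp => Prod.ext (hout p hp).1 (hout p hp).2
  constructor
  · rintro ⟨d, j⟩
    simp only [List.mem_map, List.mem_range]
    constructor
    · rintro ⟨k, hk, e⟩
      obtain ⟨p, hp, rfl⟩ := hrk k hk
      rw [← e, hval p hp]
      exact (standsAt_suffix hp).1
    · rintro ⟨h1, h2, h3, h4⟩
      simp only at h1 h2 h3 h4
      rw [doc, length_terminated] at h4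
      obtain ⟨p, hp, e1, e2⟩ := exists_text_at (C := C) (d := d - 1) (j := j - 1) (by omega)
        (by omega)
      refine ⟨rk T (totalLength C) p, ht.isPerm_rk.lt p hp, ?_⟩
      rw [hval p hp, e1, e2, Nat.sub_add_cancel h1, Nat.sub_add_cancel h3]
  · rw [List.pairwise_map]
    refine List.Pairwise.imp_of_mem (fun {k k'} hk hk' hlt => ?_) List.pairwise_lt_range
    obtain ⟨p, hp, rfl⟩ := hrk k (List.mem_range.1 hk)
    obtain ⟨p', hp', rfl⟩ := hrk k' (List.mem_range.1 hk')
    obtain ⟨l, ha, hl⟩ := suf_lt_iff.1 ((ht.rk_lt_iff hp hp').1 hlt)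
    rw [hval p hp, hval p' hp']
    have := hren.suffix_lt (standsAt_suffix hp).2 (standsAt_suffix hp').2 ha hl
    simp only [Nat.add_lt_add_iff_right]
    exact this

/-! ## Running time -/

/-- A factor `K + 1 < 2 ^ (K + 1)` adds at most `K + 1` bits, absorbed into a factor because `N` has
at least one bit. -/
theorem size_mul_le (K : ℕ) {N : ℕ} (hN : 1 ≤ N) : Nat.size ((K + 1) * N) ≤ (K + 2) * Nat.size N := by
  have h1 : Nat.size ((K + 1) * N) ≤ K + 1 + Nat.size N := by
    rw [Nat.size_le, pow_add]
    exact Nat.mul_lt_mul_of_lt_of_lt Nat.lt_two_pow_self (Nat.lt_size_self N)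
  have h2 : 1 ≤ Nat.size N := Nat.size_pos.2 hN
  nlinarith [Nat.mul_le_mul_left (K + 1) h2]

/-- For `N ≥ 2` the bit length `s` is at least `2`, so `s ≤ 2 * (s - 1)`, while `2 ^ (s - 1) ≤ N`;
the factor `4` leaves room, since `log 2 > 1 / 2`. -/
theorem size_le_log {N : ℕ} (hN : 2 ≤ N) : (Nat.size N : ℝ) ≤ 4 * Real.log N := by
  have h1 : 1 < Nat.size N := Nat.lt_size.2 (by simpa using hN)
  have h2 : 2 ^ (Nat.size N - 1) ≤ N := Nat.lt_size.1 (by omega)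
  have h3 : ((2 : ℝ) ^ (Nat.size N - 1)) ≤ N := by exact_mod_cast h2
  have h4 := Real.log_le_log (by positivity) h3
  rw [Real.log_pow] at h4
  have h5 : (Nat.size N : ℝ) ≤ 2 * ((Nat.size N - 1 : ℕ) : ℝ) := by
    exact_mod_cast (show Nat.size N ≤ 2 * (Nat.size N - 1) by omega)
  have h6 := Real.log_two_gt_d9
  nlinarith

theorem algorithmTime_le {K L N : ℕ} (hN : 2 ≤ N) (hL : L ≤ (K + 1) * N) :
    (algorithmTime L : ℝ) ≤
      4 * ((K + 2) * (K + 1) * 800 + (K + 1) * 1300 + 600) * (N * Real.log N) := by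
  have h1 := size_le_log hN
  have h2 : Nat.size L ≤ (K + 2) * Nat.size N := (Nat.size_le_size hL).trans (size_mul_le K (by omega))
  have h3 : 1 ≤ Nat.size N := Nat.size_pos.2 (by omega)
  have h4 : algorithmTime L ≤
      ((K + 2) * (K + 1) * 800 + (K + 1) * 1300 + 600) * (N * Nat.size N) := by
    have a1 := Nat.mul_le_mul h2 hL
    have a2 : L ≤ (K + 1) * (N * Nat.size N) :=
      hL.trans (Nat.mul_le_mul_left _ (Nat.le_mul_of_pos_right N h3))
    have a3 : 1 ≤ N * Nat.size N := Nat.mul_pos (by omega) h3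
    calc algorithmTime L = Nat.size L * L * 800 + L * 1300 + 600 * 1 := rfl
      _ ≤ (K + 2) * Nat.size N * ((K + 1) * N) * 800 + (K + 1) * (N * Nat.size N) * 1300 +
          600 * (N * Nat.size N) := by gcongr
      _ = _ := by ring
  calc (algorithmTime L : ℝ) ≤
      ((K + 2) * (K + 1) * 800 + (K + 1) * 1300 + 600) * (N * Nat.size N) := by exact_mod_cast h4
    _ ≤ ((K + 2) * (K + 1) * 800 + (K + 1) * 1300 + 600) * (N * (4 * Real.log N)) := by gcongr
    _ = _ := by ring

end SuffixSorting

theorem mainTheorem1 :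
    (∀ (C : List (List ℕ)) (R : List ℕ),
      SuffixSorting.IsGSA C (SuffixSorting.output C R)) ∧
    (∀ K : ℕ, ∃ c : ℝ, ∀ (C : List (List ℕ)) (R : List ℕ),
      2 ≤ SuffixSorting.totalLength C →
      (SuffixSorting.terminated R).length ≤ K * SuffixSorting.totalLength C →
      (SuffixSorting.runningTime C R : ℝ) ≤
        c * ((SuffixSorting.totalLength C : ℝ) *
          Real.log (SuffixSorting.totalLength C : ℝ))) := by
  -- The constant is that of `algorithmTime` at `L ≤ (K + 1) * N`, with `4` from replacing the bit
  -- length by the logarithm.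
  refine ⟨SuffixSorting.isGSA_output,
    fun K => ⟨4 * ((K + 2) * (K + 1) * 800 + (K + 1) * 1300 + 600), fun C R hN hR => ?_⟩⟩
  have h := (SuffixSorting.finalState_spec C R).2
  refine le_trans (Nat.cast_le.2 h) (SuffixSorting.algorithmTime_le hN ?_)
  rw [Nat.add_mul, Nat.one_mul]
  omega
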